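/- **Setting.** Let $d\in\mathbb N$, $T\in(0,\infty)$, let $\Omega\subset\mathbb R^d$ be a bounded Lipschitz domain, $\Omega_T:=[0,T]\times\overline\Omega$, and let $s_1,s_2\in(0,\infty)$, $r_1,r_2\in\mathbb N_{\ge2}$. *Initial partition.* $\mathcal P_0=\{I\times S: I\in\mathcal I_0,\ S\in\mathcal T_0\}$, where $\mathcal I_0=\{[t_0,t_1),\dots,[t_{N-2},t_{N-1}),[t_{N-1},t_N]\}$ with $0=t_0<\dots<t_N=T$, and $\mathcal T_0$ is a finite conforming triangulation of $\overline\Omega$ into closed non-overlapping tagged $d$-simplices $(x_0,\dots,x_d)_\gamma$, $0\le\gamma\le d-1$, all of the same type $\gamma$. Bisection $\mathrm{BISECT}(d,\cdot)$ produces the children $(x_0,\frac{x_0+x_d}2,x_1,\dots,x_{d-1})_{\gamma+1\bmod d}$ and $(x_d,\frac{x_0+x_d}2,x_1,\dots,x_\gamma,x_{d-1},\dots,x_{\gamma+1})_{\gamma+1\bmod d}$; the segment from $x_0$ to $x_d$ is the refinement edge $\mathrm{RE}$. Two tagged simplices are reflected neighbours if the vertex sequence of the one, or of its reflection $(x_d,x_1,\dots,x_\gamma,x_{d-1},\dots,x_{\gamma+1},x_0)_\gamma$,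 agrees with that of the other in all but one position. $\mathcal T_0$ is well-labelled: whenever $S\ne S'$ in $\mathcal T_0$ share a $(d-1)$-dimensional face, then $S,S'$ are reflected neighbours if that face contains $\mathrm{RE}(S)$ or $\mathrm{RE}(S')$, and otherwise the children of $S$ and $S'$ that share a $(d-1)$-dimensional face are reflected neighbours. *Refinement.* Prisms in $\mathcal P_0$ have level $\ell=0$. $\mathrm{ATOMIC\_SPLIT}(I\times S)$ consists of all prisms $I'\times S'$ of level $n:=\ell(I\times S)+1$, where $S'$ is one of the two children of $S$ and $I'$ is one of the $2^m$ intervals obtained by bisecting $I$ successively $m=\lceil\frac{ns_2}{s_1d}\rceil-\lceil\frac{(n-1)s_2}{s_1d}\rceil$ times (half-open intervals are split into half-open ones, closed ones into a half-open and a closed one). For $E=I\times S$ in a partition $\mathcal P$ let $\mathcal N(E,\mathcal P)=\mathcal N_t\cup\mathcal N_x$, where $\mathcal N_t$ is the set of $I'\times S'\in\mathcal P\setminus\{E\}$ of level $\ell(E)-1$ with $\#(\overline I\cap\overline{I'})=1$ and $\dim(S\cap S')=d$; for $d\ge2$, $\mathcal N_x$ is the set of $I'\times S'\in\mathcal P\setminus\{E\}$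 with $|I\cap I'|>0$, $1\le\dim(S\cap S')\le d-1$ and $\mathrm{RE}(S)\subset S'$; for $d=1$, the set of those of level $\ell(E)-1$ with $|I\cap I'|>0$ and $\#(S\cap S')=1$. $\mathrm{PATCH\_REFINE}(\mathcal P,E)$ is computed as follows. Start with $K=\emptyset$, $F=\{E\}$. While $F\ne\emptyset$: let $G=\emptyset$; as long as possible, take $E'\in F$ and $E''\in\mathcal N(E',\mathcal P)\setminus(K\cup F\cup G)$ (for the current $\mathcal P$, in any order); if $\ell(E'')=\ell(E')$, add $E''$ to $G$; otherwise replace $\mathcal P$ by $\mathrm{PATCH\_REFINE}(\mathcal P,E'')$ and, if $E''$ was in $\mathcal N_x(E',\cdot)$ before this call, add to $G$ those elements of $\mathrm{ATOMIC\_SPLIT}(E'')$ of level $\ell(E')$ that lie in $\mathcal N(E',\mathcal P)$ for the new $\mathcal P$; then replace $K$ by $K\cup F$ and $F$ by $G$. In the end, replace every prism of $K$ in $\mathcal P$ by its atomic split. Let $\mathcal P$ be a partition obtained from $\mathcal P_0$ by finitely many (possibly zero) patch refinements of elements. *Neighbourhoods.* $\omega^0_{\mathcal P}(I\times S)=\{I\times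 S\}$, and $\omega^j_{\mathcal P}(I\times S)$ is the set of elements of $\mathcal P$ whose closure meets the closure of an element of $\omega^{j-1}_{\mathcal P}(I\times S)$; $\omega^j_{\mathcal P}(I\times S)$ also denotes the union of its elements. Put $j(1)=2$ and $j(d)=3$ for $d\ge2$. *Finite elements.* $\Pi=\Pi^{r_1,r_2}_{t,x}$ is the span of the monomials $t^ix^\alpha$, $i<r_1$, $|\alpha|<r_2$; $\mathbb V_{\mathcal P}$ is the space of continuous functions on $\Omega_T$ whose restriction to each $I\times S\in\mathcal P$ is in $\Pi$; and $E(f,\Pi,D)_p:=\inf_{q\in\Pi}\|f-q\|_{L_p(D)}\in[0,\infty]$. The nodes $\mathcal L(I\times S)$ are the products of the $r_1$ equidistant points of $\overline I$ (end points included) and the points of $S$ with barycentric coordinates in $\frac1{r_2-1}\mathbb N_0$. A node of an element is free if it is a node of every element of $\mathcal P$ whose closure contains it; $\mathcal F(\mathcal P)$ is the set of free nodes. For $\nu\in\mathcal F(\mathcal P)$, $\phi_\nu\in\mathbb V_{\mathcal P}$ is determined by $\phi_\nu(\nu')=\delta_{\nu\nu'}$, $\nu'\in\mathcal F(\mathcal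 P)$. For $E\in\mathcal P$, let $b^E_\nu\in\Pi$ with $b^E_\nu(\nu')=\delta_{\nu\nu'}$ $(\nu,\nu'\in\mathcal L(E))$ be the Lagrange basis and $\zeta^E_\nu\in\Pi$ with $\int_E b^E_{\nu'}\zeta^E_\nu=\delta_{\nu\nu'}$ its dual basis. Choose for each $\nu\in\mathcal F(\mathcal P)$ an element $J(\nu)\in\mathcal P$ with $\nu\in\overline{J(\nu)}$ and set $\mathcal Q_{\mathcal P}(f)=\sum_{\nu\in\mathcal F(\mathcal P)}\big(\int_{J(\nu)}f\,\zeta^{J(\nu)}_\nu\big)\phi_\nu$. For $\rho\in(0,\infty]$ and $f\in L_\rho(\Omega_T)$ choose for each $E\in\mathcal P$ a best approximation $\mathcal B_{\rho,E}(f)\in\Pi$ of $f$ in $L_\rho(E)$, and set $\pi_{\rho,\mathcal P}(f):=\mathcal Q_{\mathcal P}\big(\sum_{E\in\mathcal P}\mathbf 1_E\,\mathcal B_{\rho,E}(f)\big)$. **Theorem.** Let $p\in(0,\infty]$ and $\rho\in(0,p]$. Then $\pi_{\rho,\mathcal P}(f)\in\mathbb V_{\mathcal P}$ is well defined (up to the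 choices above) for every $f\in L_\rho(\Omega_T)$, and there is a constant $C$ depending only on $d,\rho,p,s_1,s_2,r_1,r_2$, on the shape-regularity constant $\kappa_{\mathcal P_0}=\max_{S\in\mathcal T_0}\operatorname{diam}(S)/\sup\{r>0: S\text{ contains a ball of radius }r\}$ and on $\max_{I\in\mathcal I_0}|I|$, $\min_{I\in\mathcal I_0}|I|$, $\max_{S\in\mathcal T_0}|S|$, $\min_{S\in\mathcal T_0}|S|$, such that for all such $\Omega_T$, $\mathcal P_0$, $\mathcal P$, all $f\in L_\rho(\Omega_T)$, every $I\times S\in\mathcal P$ and all choices of $J(\nu)$ and $\mathcal B_{\rho,E}(f)$, $$\|f-\pi_{\rho,\mathcal P}(f)\|_{L_p(I\times S)}\le C\,E\big(f,\Pi^{r_1,r_2}_{t,x},\omega^{j(d)}_{\mathcal P}(I\times S)\big)_p .$$ -/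

import Mathlib

open MeasureTheory Set
open scoped ENNReal NNReal

noncomputable section

namespace PrismMesh

/-- Space `ℝᵈ` with its Euclidean norm. -/
abbrev Sp (d : ℕ) : Type := EuclideanSpace ℝ (Fin d)

/-- Space-time points `(t, x)`. -/
abbrev Pt (d : ℕ) : Type := ℝ × Sp d

/-! ### Lipschitz domains -/

/-- A bounded Lipschitz domain: a non-empty connected bounded open set which, near each of its
boundary points, is the strict epigraph of a Lipschitz function in suitable rotated coordinates
(`e` is the vertical direction, and `φ` depends only on the coordinates orthogonal to `e`). -/
def IsLipschitzDomain {d : ℕ} (Ω : Set (Sp d)) : Prop :=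
  IsOpen Ω ∧ IsConnected Ω ∧ Bornology.IsBounded Ω ∧
    ∀ z ∈ frontier Ω, ∃ (e : Sp d) (φ : Sp d → ℝ) (K : ℝ≥0) (r : ℝ),
      ‖e‖ = 1 ∧ 0 < r ∧ LipschitzWith K φ ∧ (∀ (x : Sp d) (s : ℝ), φ (x + s • e) = φ x) ∧
      Metric.ball z r ∩ Ω = Metric.ball z r ∩ {x | φ x < inner ℝ e x}

/-! ### Time intervals and their bisection -/

/-- A bounded time interval `[left, right)`, or `[left, right]` if `closed` is set. -/
structure TimeInterval where
  left : ℝ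
  right : ℝ
  closed : Bool

/-- The points of a time interval. -/
def TimeInterval.carrier (I : TimeInterval) : Set ℝ :=
  if I.closed then Icc I.left I.right else Ico I.left I.right

/-- The two halves of an interval. A half-open interval is split into two half-open ones, a closed
one into a half-open and a closed one. -/
def TimeInterval.bisect (I : TimeInterval) : Set TimeInterval :=
  {⟨I.left, (I.left + I.right) / 2, false⟩, ⟨(I.left + I.right) / 2, I.right, I.closed⟩}

/-- The `2 ^ m` intervals obtained by `m` successive bisections. -/
def TimeInterval.bisectIter (I : TimeInterval) : ℕ → Set TimeInterval
  | 0 => {I}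
  | m + 1 => ⋃ J ∈ I.bisectIter m, J.bisect

/-! ### Tagged simplices and their bisection (Maubach, Traxler, Stevenson) -/

/-- A tagged simplex `(x₀, …, x_d)_γ`: ordered vertices and a type `γ ∈ {0, …, d - 1}`. -/
structure TaggedSimplex (d : ℕ) where
  vert : Fin (d + 1) → Sp d
  type : ℕ

namespace TaggedSimplex

variable {d : ℕ}

/-- The closed simplex spanned by the vertices. -/
def carrier (S : TaggedSimplex d) : Set (Sp d) := convexHull ℝ (range S.vert)

/-- The refinement edge, from `x₀` to `x_d`. -/
def refEdge (S : TaggedSimplex d) : Set (Sp d) := segment ℝ (S.vert 0) (S.vert (Fin.last d))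

/-- The child `(x₀, (x₀ + x_d)/2, x₁, …, x_{d-1})` of type `γ + 1 mod d`. -/
def child₁ (S : TaggedSimplex d) : TaggedSimplex d where
  vert k :=
    if k.val = 0 then S.vert 0
    else if k.val = 1 then midpoint ℝ (S.vert 0) (S.vert (Fin.last d))
    else S.vert (Fin.ofNat (d + 1) (k.val - 1))
  type := (S.type + 1) % d

/-- The child `(x_d, (x₀ + x_d)/2, x₁, …, x_γ, x_{d-1}, …, x_{γ+1})` of type `γ + 1 mod d`. -/
def child₂ (S : TaggedSimplex d) : TaggedSimplex d where
  vert k :=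
    if k.val = 0 then S.vert (Fin.last d)
    else if k.val = 1 then midpoint ℝ (S.vert 0) (S.vert (Fin.last d))
    else if k.val ≤ S.type + 1 then S.vert (Fin.ofNat (d + 1) (k.val - 1))
    else S.vert (Fin.ofNat (d + 1) (d + S.type + 1 - k.val))
  type := (S.type + 1) % d

/-- `BISECT(d, S)`. -/
def bisect (S : TaggedSimplex d) : Set (TaggedSimplex d) := {S.child₁, S.child₂}

/-- The reflection `(x_d, x₁, …, x_γ, x_{d-1}, …, x_{γ+1}, x₀)_γ`, the other tagging of the same
simplex that has the same children. -/
def reflect (S : TaggedSimplex d) : TaggedSimplex d where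
  vert k :=
    if k.val = 0 then S.vert (Fin.last d)
    else if k.val = d then S.vert 0
    else if k.val ≤ S.type then S.vert k
    else S.vert (Fin.ofNat (d + 1) (d + S.type - k.val))
  type := S.type

/-- The dimension of (the affine hull of) a set. -/
def dimension (A : Set (Sp d)) : ℕ := Module.finrank ℝ (vectorSpan ℝ A)

/-- The two simplices share a `(d - 1)`-dimensional face (in a conforming situation). -/
def ShareFacet (S S' : TaggedSimplex d) : Prop :=
  (S.carrier ∩ S'.carrier).Nonempty ∧ dimension (S.carrier ∩ S'.carrier) + 1 = d

/-- The vertex sequence of `S` or of its reflection agrees with that of `S'` in all but one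
position. -/
def ReflectedNeighbours (S S' : TaggedSimplex d) : Prop :=
  ∃ i, (∀ k, k ≠ i → S.vert k = S'.vert k) ∨ (∀ k, k ≠ i → S.reflect.vert k = S'.vert k)

/-- The matching condition for two neighbouring tagged simplices. -/
def Match (S S' : TaggedSimplex d) : Prop :=
  ((S.refEdge ⊆ S.carrier ∩ S'.carrier ∨ S'.refEdge ⊆ S.carrier ∩ S'.carrier) →
    ReflectedNeighbours S S') ∧
  (¬ (S.refEdge ⊆ S.carrier ∩ S'.carrier ∨ S'.refEdge ⊆ S.carrier ∩ S'.carrier) →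
    ∀ c ∈ S.bisect, ∀ c' ∈ S'.bisect, ShareFacet c c' → ReflectedNeighbours c c')

/-- The intersection of the two simplices is a proper common face (the empty face included). -/
def MeetInCommonFace (S S' : TaggedSimplex d) : Prop :=
  ∃ A B : Set (Fin (d + 1)), A ≠ univ ∧ B ≠ univ ∧
    S.carrier ∩ S'.carrier = convexHull ℝ (S.vert '' A) ∧
    S.carrier ∩ S'.carrier = convexHull ℝ (S'.vert '' B)

/-- `sup {r > 0 : S contains a ball of radius r}`. -/
def inradius (S : TaggedSimplex d) : ℝ :=
  sSup {r : ℝ | 0 < r ∧ ∃ x, Metric.ball x r ⊆ S.carrier}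

end TaggedSimplex

open TaggedSimplex

/-! ### Prisms and the atomic split -/

/-- A prism `I × S` together with its level, the number of bisections that produced `S`. -/
structure Prism (d : ℕ) where
  time : TimeInterval
  space : TaggedSimplex d
  level : ℕ

variable {d : ℕ}

/-- The points of the prism. -/
def Prism.carrier (E : Prism d) : Set (Pt d) := E.time.carrier ×ˢ E.space.carrier

/-- `ATOMIC_SPLIT`: one spatial bisection and
`m = ⌈n s₂ / (s₁ d)⌉ - ⌈(n - 1) s₂ / (s₁ d)⌉` temporal bisections, `n` being the new level. -/
def Prism.atomicSplit (s₁ s₂ : ℝ) (E : Prism d) : Set (Prism d) :=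
  {E' | E'.level = E.level + 1 ∧ E'.space ∈ E.space.bisect ∧
    E'.time ∈ E.time.bisectIter
      (⌈((E.level + 1 : ℕ) : ℝ) * s₂ / (s₁ * d)⌉₊ - ⌈(E.level : ℝ) * s₂ / (s₁ * d)⌉₊)}

/-! ### Initial partitions -/

/-- A tensor product partition of `[0, T] × closure Ω`: a partition `0 = t₀ < ⋯ < t_N = T` of the
time interval, and a conforming, well-labelled (matching, of uniform type) triangulation of
`closure Ω` into closed tagged simplices. -/
structure InitialMesh (d : ℕ) (T : ℝ) (Ω : Set (Sp d)) where
  N : ℕ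
  t : Fin (N + 1) → ℝ
  strictMono_t : StrictMono t
  t_zero : t 0 = 0
  t_last : t (Fin.last N) = T
  simplices : Set (TaggedSimplex d)
  finite_simplices : simplices.Finite
  affineIndependent : ∀ S ∈ simplices, AffineIndependent ℝ S.vert
  iUnion_carrier : ⋃ S ∈ simplices, S.carrier = closure Ω
  nonoverlapping : ∀ S ∈ simplices, ∀ S' ∈ simplices, S ≠ S' →
    Disjoint (interior S.carrier) (interior S'.carrier)
  conforming : ∀ S ∈ simplices, ∀ S' ∈ simplices, S ≠ S' → MeetInCommonFace S S'
  uniform_type : ∃ γ < d, ∀ S ∈ simplices, S.type = γ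
  matching : ∀ S ∈ simplices, ∀ S' ∈ simplices, S ≠ S' → ShareFacet S S' → Match S S'

namespace InitialMesh

variable {T : ℝ} {Ω : Set (Sp d)} (M : InitialMesh d T Ω)

/-- The intervals `[t₀, t₁), …, [t_{N-2}, t_{N-1}), [t_{N-1}, t_N]`. -/
def intervals : Set TimeInterval :=
  range fun i : Fin M.N => ⟨M.t i.castSucc, M.t i.succ, decide (i.val + 1 = M.N)⟩

/-- The initial space-time partition; all its prisms have level `0`. -/
def prisms : Set (Prism d) :=
  {E | E.time ∈ M.intervals ∧ E.space ∈ M.simplices ∧ E.level = 0}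

end InitialMesh

/-- The shape-regularity constant `κ`, the largest ratio of diameter and inradius. -/
def shapeConst (P : Set (Prism d)) : ℝ :=
  sSup ((fun E => Metric.diam E.space.carrier / E.space.inradius) '' P)

/-- The largest length of a time interval. -/
def maxTime (P : Set (Prism d)) : ℝ := sSup ((fun E => volume.real E.time.carrier) '' P)

/-- The smallest length of a time interval. -/
def minTime (P : Set (Prism d)) : ℝ := sInf ((fun E => volume.real E.time.carrier) '' P)

/-- The largest volume of a simplex. -/
def maxSpace (P : Set (Prism d)) : ℝ := sSup ((fun E => volume.real E.space.carrier) '' P)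

/-- The smallest volume of a simplex. -/
def minSpace (P : Set (Prism d)) : ℝ := sInf ((fun E => volume.real E.space.carrier) '' P)

/-! ### Patch refinement -/

/-- The prisms `I' × S'` of one level less, with `#(closure I ∩ closure I') = 1` and
`dim (S ∩ S') = d`. -/
def necRefTime (E : Prism d) (P : Set (Prism d)) : Set (Prism d) :=
  {E' | E' ∈ P ∧ E' ≠ E ∧ (closure E.time.carrier ∩ closure E'.time.carrier).ncard = 1 ∧
    dimension (E.space.carrier ∩ E'.space.carrier) = d ∧ E'.level + 1 = E.level}

/-- For `d ≥ 2`, the prisms overlapping in time whose simplices contain the refinement edge; for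
`d = 1`, the prisms overlapping in time that touch in space and have one level less. -/
def necRefSpace (E : Prism d) (P : Set (Prism d)) : Set (Prism d) :=
  {E' | E' ∈ P ∧ E' ≠ E ∧ 0 < volume (E.time.carrier ∩ E'.time.carrier) ∧
    ((2 ≤ d ∧ 1 ≤ dimension (E.space.carrier ∩ E'.space.carrier) ∧
        dimension (E.space.carrier ∩ E'.space.carrier) ≤ d - 1 ∧
        E.space.refEdge ⊆ E'.space.carrier) ∨
      (d = 1 ∧ (E.space.carrier ∩ E'.space.carrier).ncard = 1 ∧ E'.level + 1 = E.level))}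

/-- The necessary refinements of neighbours. -/
def necRef (E : Prism d) (P : Set (Prism d)) : Set (Prism d) :=
  necRefTime E P ∪ necRefSpace E P

/-- Replace the prisms in `K` by their atomic splits. -/
def splitAll (s₁ s₂ : ℝ) (P K : Set (Prism d)) : Set (Prism d) :=
  (P \ K) ∪ ⋃ E ∈ K, E.atomicSplit s₁ s₂

/-- `PatchRun s₁ s₂ P K F G P' K'`: the while-loop of the patch refinement, entered with the
partition `P`, the set `K` of prisms to be split in the end, the set `F` of prisms under
consideration and the set `G` of prisms to be considered next, may terminate with the partition
`P'` and the set `K'`. The prisms `E''` are taken from `necRef E' P \ (K ∪ F)` for the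
current `P`, in any order.
* `done`: no prism is left for consideration;
* `next`: the for-loops are exhausted, and the next pass of the while-loop starts;
* `equal`: a neighbour of equal level is put on the list;
* `coarser`: a neighbour of another level is refined by a recursive call, and (if it was a
  spatial neighbour) those of its children which have to be refined as well and have the level of
  `E'` are put on the list (any other child is taken up again as a neighbour of another level). -/
inductive PatchRun (s₁ s₂ : ℝ) :
    Set (Prism d) → Set (Prism d) → Set (Prism d) → Set (Prism d) →
      Set (Prism d) → Set (Prism d) → Prop
  | done (P K : Set (Prism d)) : PatchRun s₁ s₂ P K ∅ ∅ P K
  | next (P K F G P' K' : Set (Prism d)) (hF : F.Nonempty)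
      (hG : ∀ E' ∈ F, ∀ E'' ∈ necRef E' P \ (K ∪ F), E'' ∈ G)
      (h : PatchRun s₁ s₂ P (K ∪ F) G ∅ P' K') :
      PatchRun s₁ s₂ P K F G P' K'
  | equal (P K F G P' K' : Set (Prism d)) (E' E'' : Prism d) (hE' : E' ∈ F)
      (hE'' : E'' ∈ necRef E' P \ (K ∪ F)) (hlevel : E'.level = E''.level)
      (h : PatchRun s₁ s₂ P K F (insert E'' G) P' K') :
      PatchRun s₁ s₂ P K F G P' K'
  | coarser (P K F G P' K' Q L : Set (Prism d)) (E' E'' : Prism d) (hE' : E' ∈ F)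
      (hE'' : E'' ∈ necRef E' P \ (K ∪ F)) (hlevel : E'.level ≠ E''.level)
      (hrec : PatchRun s₁ s₂ P ∅ {E''} ∅ Q L)
      (h : PatchRun s₁ s₂ (splitAll s₁ s₂ Q L) K F
        (G ∪ {c | E'' ∈ necRefSpace E' P ∧ c ∈ E''.atomicSplit s₁ s₂ ∧
          c ∈ necRef E' (splitAll s₁ s₂ Q L) ∧ c.level = E'.level}) P' K') :
      PatchRun s₁ s₂ P K F G P' K'

/-- `P'` is the result of `PATCH_REFINE` applied to `P` and its element `E`. -/
def PatchRefine (s₁ s₂ : ℝ) (P : Set (Prism d)) (E : Prism d) (P' : Set (Prism d)) : Prop :=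
  ∃ Q K : Set (Prism d), PatchRun s₁ s₂ P ∅ {E} ∅ Q K ∧ P' = splitAll s₁ s₂ Q K

/-- The partitions obtained from `P₀` by finitely many patch refinements. -/
inductive Reachable (s₁ s₂ : ℝ) (P₀ : Set (Prism d)) : Set (Prism d) → Prop
  | refl : Reachable s₁ s₂ P₀ P₀
  | step (P P' : Set (Prism d)) (E : Prism d) (hP : Reachable s₁ s₂ P₀ P) (hE : E ∈ P)
      (h : PatchRefine s₁ s₂ P E P') : Reachable s₁ s₂ P₀ P'

/-! ### Neighbourhoods -/

/-- The extended neighbourhood of degree `j` (degree `0` being the prism itself): prisms whose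
closures meet the closure of a prism of the extended neighbourhood of degree `j - 1`. -/
def nbhd (P : Set (Prism d)) (E : Prism d) : ℕ → Set (Prism d)
  | 0 => {E}
  | j + 1 => {E' | E' ∈ P ∧ ∃ E'' ∈ nbhd P E j, (closure E''.carrier ∩ closure E'.carrier).Nonempty}

/-- The region covered by the extended neighbourhood. -/
def nbhdRegion (P : Set (Prism d)) (E : Prism d) (j : ℕ) : Set (Pt d) :=
  ⋃ E' ∈ nbhd P E j, E'.carrier

/-- The degree `j(1) = 2`, `j(d) = 3` for `d ≥ 2`. -/
def nbhdDegree (d : ℕ) : ℕ := if d = 1 then 2 else 3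

/-! ### Anisotropic polynomials and finite elements -/

/-- The anisotropic polynomials of temporal order `r₁` and spatial order `r₂`, spanned by
`tⁱ x^α` with `i < r₁` and `|α| < r₂`. -/
def anisoPoly (d r₁ r₂ : ℕ) : Submodule ℝ (Pt d → ℝ) :=
  Submodule.span ℝ {m | ∃ (i : ℕ) (α : Fin d → ℕ), i < r₁ ∧ ∑ k, α k < r₂ ∧
    m = fun z => z.1 ^ i * ∏ k, z.2 k ^ α k}

/-- The space-time cylinder; it contains its boundary. -/
def spaceTimeCyl (T : ℝ) (Ω : Set (Sp d)) : Set (Pt d) := Icc 0 T ×ˢ closure Ω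

/-- Continuous anisotropic finite elements on the cylinder `D` partitioned by `P` (only the values
on `D` matter). -/
def feSpace (D : Set (Pt d)) (P : Set (Prism d)) (r₁ r₂ : ℕ) : Set (Pt d → ℝ) :=
  {F | ContinuousOn F D ∧ ∀ E ∈ P, ∃ q ∈ anisoPoly d r₁ r₂, EqOn F q E.carrier}

/-- `E(f, Π, D)_p`, the infimum of `‖f - q‖_{L_p(D)}` over anisotropic polynomials `q`. -/
def bestError (r₁ r₂ : ℕ) (p : ℝ≥0∞) (D : Set (Pt d)) (f : Pt d → ℝ) : ℝ≥0∞ :=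
  ⨅ q ∈ anisoPoly d r₁ r₂, eLpNorm (fun z => f z - q z) p (volume.restrict D)

/-- `q` is a best approximation of `f` in `L_p(D)` by anisotropic polynomials. -/
def IsBestApprox (r₁ r₂ : ℕ) (p : ℝ≥0∞) (D : Set (Pt d)) (f q : Pt d → ℝ) : Prop :=
  q ∈ anisoPoly d r₁ r₂ ∧
    eLpNorm (fun z => f z - q z) p (volume.restrict D) = bestError r₁ r₂ p D f

/-! ### Nodes -/

/-- Equidistant Lagrange nodes of order `r` in an interval. -/
def timeNodes (r : ℕ) (I : TimeInterval) : Set ℝ :=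
  {x | ∃ n : ℕ, n ≤ r - 1 ∧ x = I.left + (n : ℝ) / ((r - 1 : ℕ) : ℝ) * (I.right - I.left)}

/-- Lagrange nodes of order `r` in a simplex: barycentric coordinates in `ℕ / (r - 1)`. -/
def spaceNodes (r : ℕ) (S : TaggedSimplex d) : Set (Sp d) :=
  {x | ∃ α : Fin (d + 1) → ℕ, ∑ k, α k = r - 1 ∧
    x = ∑ k, ((α k : ℝ) / ((r - 1 : ℕ) : ℝ)) • S.vert k}

/-- Anisotropic Lagrange nodes of a prism. -/
def nodes (r₁ r₂ : ℕ) (E : Prism d) : Set (Pt d) := timeNodes r₁ E.time ×ˢ spaceNodes r₂ E.space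

/-- Free nodes: the nodes of the prisms of `P` that do not hang, i.e. that are nodes of every prism
whose closure contains them. -/
def freeNodes (r₁ r₂ : ℕ) (P : Set (Prism d)) : Set (Pt d) :=
  (⋃ E ∈ P, nodes r₁ r₂ E) \
    {ν | ∃ E ∈ P, ν ∈ closure E.carrier ∧ ν ∉ nodes r₁ r₂ E}

open Classical in
/-- The finite element `φ_ν` with `φ_ν(ν') = δ_{ν ν'}` at all free nodes `ν'`. -/
def nodalBasis (D : Set (Pt d)) (P : Set (Prism d)) (r₁ r₂ : ℕ) (ν : Pt d) : Pt d → ℝ :=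
  Classical.epsilon fun φ =>
    φ ∈ feSpace D P r₁ r₂ ∧ ∀ ν' ∈ freeNodes r₁ r₂ P, φ ν' = if ν' = ν then 1 else 0

open Classical in
/-- The local Lagrange polynomial with value `δ_{ν ν'}` at all nodes `ν'` of the prism. -/
def lagrangePoly (r₁ r₂ : ℕ) (E : Prism d) (ν : Pt d) : Pt d → ℝ :=
  Classical.epsilon fun b =>
    b ∈ anisoPoly d r₁ r₂ ∧ ∀ ν' ∈ nodes r₁ r₂ E, b ν' = if ν' = ν then 1 else 0

open Classical in
/-- The polynomial `ζ_ν` dual to the local Lagrange polynomials in `L₂` of the prism. -/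
def dualPoly (r₁ r₂ : ℕ) (E : Prism d) (ν : Pt d) : Pt d → ℝ :=
  Classical.epsilon fun ζ =>
    ζ ∈ anisoPoly d r₁ r₂ ∧ ∀ ν' ∈ nodes r₁ r₂ E,
      ∫ z in E.carrier, lagrangePoly r₁ r₂ E ν' z * ζ z = if ν' = ν then 1 else 0

/-! ### The quasi-interpolation operator -/

/-- The projection `Q(f) = ∑_ν (∫_{J(ν)} f ζ_ν) φ_ν` onto the continuous finite elements, with
`J` assigning a prism to each free node. -/
def projQ (D : Set (Pt d)) (P : Set (Prism d)) (r₁ r₂ : ℕ) (J : Pt d → Prism d)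
    (f : Pt d → ℝ) : Pt d → ℝ := fun z =>
  ∑ᶠ ν ∈ freeNodes r₁ r₂ P,
    (∫ w in (J ν).carrier, f w * dualPoly r₁ r₂ (J ν) ν w) * nodalBasis D P r₁ r₂ ν z

/-- `g` is a value `π_{ρ,P}(f) = Q(∑_E 1_E B_{ρ,E}(f))` of the quasi-interpolation operator, for
some choice of the prisms `J(ν)` and of the best approximations `B_{ρ,E}(f)`. -/
def IsQuasiInterpolant (D : Set (Pt d)) (P : Set (Prism d)) (r₁ r₂ : ℕ) (ρ : ℝ≥0∞)
    (f g : Pt d → ℝ) : Prop :=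
  ∃ (J : Pt d → Prism d) (b : Prism d → Pt d → ℝ),
    (∀ ν ∈ freeNodes r₁ r₂ P, J ν ∈ P ∧ ν ∈ closure (J ν).carrier) ∧
    (∀ E ∈ P, IsBestApprox r₁ r₂ ρ E.carrier f (b E)) ∧
    g = projQ D P r₁ r₂ J fun z => ∑ᶠ E ∈ P, E.carrier.indicator (b E) z

end PrismMesh

end

open PrismMesh

/-!
The estimate is local. The function `g = π_ρ f` has the value of the best approximation on `J ν` at
each free node `ν`, since the dual basis evaluates polynomials (`Good.projQ_spec`). For a fixed
polynomial `q`, which every such best approximation is compared with, `g - q` is a finite element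
whose value at a free node near a prism `E` is at most a constant times the local error of `q`,
divided by a power of the volume (`Good.enorm_sub_mul_le_of_isBestApprox`). If finite elements are
controlled on `E` by the free nodes close to it, and touching prisms have comparable volumes, then
`g - q`, and hence `f - g`, is bounded on `E` by the error of `q` on the neighbourhood
(`Good.eLpNorm_sub_le_of_isQuasiInterpolant`). The infimum over `q` gives the theorem.

*Partitions.* All partitions that arise are graded (`Good`): they are conforming in every time
slice, and levels differ by at most one between temporal neighbours, and for `d = 1` between spatial
neighbours. Splitting a set of prisms of one level preserves this if the set contains the necessary
refinements of its elements (`Good.splitAll`), and patch refinement produces only such sets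
(`Good.patchRun`, `Good.of_reachable`). The geometric input is that uniform refinements of a
well-labelled conforming triangulation are conforming (`Triang.conf_unif`). Across a facet,
refinement edges are compatible, because reflected neighbours correspond under an affine map that
fixes the facet and is compatible with bisection (`Matched.edgeOK`). Compatibility propagates to all
simplices around an edge, as the star of a point is connected through facets (`facetChain`): generic
segments cross only facets, and near a boundary point a Lipschitz domain is connected.

*Sizes.* Levels of facet neighbours in a time slice differ by at most one
(`Good.level_le_of_facet`). So all levels between those of two simplices at a common point occur at
that point, and shape regularity, inherited by descendants (`TaggedSimplex.Spread`,
`TaggedSimplex.Adm.diam_unif`), bounds the number of simplices there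
(`TaggedSimplex.card_le_of_shape`, `Good.level_le_of_slice`). Hence touching prisms have comparable
volumes (`exists_volume_const`).

*Finite elements.* The values at the free nodes can be prescribed, by recursion on the level:
hanging nodes inherit their values from coarser prisms (`Good.exists_pieces`,
`Good.exists_feSpace`). A node of `E` that is not free lies in a coarser prism touching `E`, whose
nodes in the time slice or the fibre of the node are free, possibly after a second such step for `d
≥ 2` (`Good.exists_free_slice`, `Good.exists_free_fibre`). Interpolation from there gives the bound
by free nodes (`Good.abs_le_of_freeNodes`), which explains the degrees `2` and `3` of the
neighbourhoods: the last step leads from the free node `ν` to `J ν`.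

*Polynomials.* The `L_ρ` norm and the uniform norm are equivalent on polynomials, uniformly in the
prism after scaling by the volume (`exists_norm_bound`), for all `ρ > 0`. This also gives the dual
basis and, by compactness, the existence of best approximations
(`Prism.Proper.exists_isBestApprox`).
-/

noncomputable section

namespace PrismMesh

section
/-! ### Barycentric weights and their bisection -/

section Bary
variable {E : Type*} [AddCommGroup E] [Module ℝ E]

/-- Total mass of a finitely supported weight. -/
def massOf : (E →₀ ℝ) →ₗ[ℝ] ℝ := Finsupp.linearCombination ℝ (fun _ => (1 : ℝ))

/-- The linear combination of points described by a finitely supported weight. -/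
def combOf : (E →₀ ℝ) →ₗ[ℝ] E := Finsupp.linearCombination ℝ id

/-- `w` is a representation of `x` as a convex combination of points of `V`. -/
structure IsBary (V : Set E) (x : E) (w : E →₀ ℝ) : Prop where
  supp : ∀ v, w v ≠ 0 → v ∈ V
  nonneg : ∀ v, 0 ≤ w v
  mass : massOf w = 1
  comb : combOf w = x

lemma massOf_eq_sum {E : Type*} (w : E →₀ ℝ) (s : Finset E) (h : ∀ v, w v ≠ 0 → v ∈ s) :
    massOf w = ∑ v ∈ s, w v := by
  rw [massOf, Finsupp.linearCombination_apply, Finsupp.sum_of_support_subset (s := s)]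
  · simp
  · intro v hv; exact h v (Finsupp.mem_support_iff.1 hv)
  · simp

lemma combOf_eq_sum (w : E →₀ ℝ) (s : Finset E) (h : ∀ v, w v ≠ 0 → v ∈ s) :
    combOf w = ∑ v ∈ s, w v • v := by
  rw [combOf, Finsupp.linearCombination_apply, Finsupp.sum_of_support_subset (s := s)]
  · simp
  · intro v hv; exact h v (Finsupp.mem_support_iff.1 hv)
  · simp

@[simp] lemma massOf_single {E : Type*} (v : E) (a : ℝ) : massOf (Finsupp.single v a) = a := by
  simp [massOf]

@[simp] lemma combOf_single (v : E) (a : ℝ) : combOf (Finsupp.single v a) = a • v := by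
  simp [combOf]

lemma IsBary.mono {V W : Set E} {x : E} {w : E →₀ ℝ} (h : IsBary V x w)
    (hW : ∀ v, w v ≠ 0 → v ∈ W) : IsBary W x w := ⟨hW, h.nonneg, h.mass, h.comb⟩

lemma IsBary.mem_convexHull {V : Set E} {x : E} {w : E →₀ ℝ} (h : IsBary V x w) :
    x ∈ convexHull ℝ V := by
  have h1 := massOf_eq_sum w w.support (fun v hv => Finsupp.mem_support_iff.2 hv)
  have h2 := combOf_eq_sum w w.support (fun v hv => Finsupp.mem_support_iff.2 hv)
  rw [← h.comb, h2]
  refine (convex_convexHull ℝ V).sum_mem (fun v _ => h.nonneg v) (by rw [← h1, h.mass]) ?_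
  intro v hv
  exact subset_convexHull ℝ V (h.supp v (Finsupp.mem_support_iff.1 hv))

lemma mem_convexHull_iff_isBary {V : Set E} {x : E} :
    x ∈ convexHull ℝ V ↔ ∃ w, IsBary V x w := by
  refine ⟨fun hx => ?_, fun ⟨w, hw⟩ => hw.mem_convexHull⟩
  have hc : Convex ℝ {x | ∃ w, IsBary V x w} := by
    rintro x ⟨w, hw⟩ y ⟨u, hu⟩ a b ha hb hab
    refine ⟨a • w + b • u, ?_, ?_, ?_, ?_⟩
    · intro v hv
      by_contra hV
      have h1 : w v = 0 := by by_contra h; exact hV (hw.supp v h)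
      have h2 : u v = 0 := by by_contra h; exact hV (hu.supp v h)
      simp [h1, h2] at hv
    · intro v
      have := hw.nonneg v; have := hu.nonneg v
      simp only [Finsupp.add_apply, Finsupp.smul_apply, smul_eq_mul]; positivity
    · simp [hw.mass, hu.mass, hab]
    · simp [hw.comb, hu.comb]
  refine convexHull_min ?_ hc hx
  intro v hv
  refine ⟨Finsupp.single v 1, ?_, ?_, by simp, by simp⟩
  · intro u hu
    have : v = u := by by_contra h; simp [h] at hu
    exact this ▸ hv
  · intro u; classical
    rw [Finsupp.single_apply]; split_ifs <;> norm_num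

lemma IsBary.single {V : Set E} {v : E} (hv : v ∈ V) : IsBary V v (Finsupp.single v 1) := by
  classical
  refine ⟨?_, ?_, by simp, by simp⟩
  · intro u hu
    have : v = u := by by_contra h; simp [h] at hu
    exact this ▸ hv
  · intro u; rw [Finsupp.single_apply]; split_ifs <;> norm_num

/-- Affine independence of a set of points, in terms of weights. -/
def WIndep (V : Set E) : Prop :=
  ∀ w : E →₀ ℝ, (∀ v, w v ≠ 0 → v ∈ V) → massOf w = 0 → combOf w = 0 → w = 0

lemma WIndep.eq {V : Set E} (h : WIndep V) {w u : E →₀ ℝ} (hw : ∀ v, w v ≠ 0 → v ∈ V)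
    (hu : ∀ v, u v ≠ 0 → v ∈ V) (hm : massOf w = massOf u) (hc : combOf w = combOf u) :
    w = u := by
  rw [← sub_eq_zero]
  refine h _ ?_ (by rw [map_sub, hm, sub_self]) (by rw [map_sub, hc, sub_self])
  intro v hv
  by_contra hV
  have h1 : w v = 0 := by by_contra h; exact hV (hw v h)
  have h2 : u v = 0 := by by_contra h; exact hV (hu v h)
  simp [h1, h2] at hv

lemma WIndep.isBary_unique {V : Set E} (h : WIndep V) {x : E} {w u : E →₀ ℝ}
    (hw : IsBary V x w) (hu : IsBary V x u) : w = u :=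
  h.eq hw.supp hu.supp (by rw [hw.mass, hu.mass]) (by rw [hw.comb, hu.comb])

lemma WIndep.of_affineIndependent {ι : Type*} [Fintype ι] {p : ι → E}
    (h : AffineIndependent ℝ p) : WIndep (range p) := by
  classical
  intro w hw hm hc
  have h' := (affineIndependent_iff.1 h) Finset.univ (fun i => w (p i))
  have hs : ∀ v, w v ≠ 0 → v ∈ Finset.univ.image p := by
    intro v hv; obtain ⟨i, hi⟩ := hw v hv; simp only [Finset.mem_image]; exact ⟨i, by simp, hi⟩
  have hinj := h.injective
  rw [massOf_eq_sum w _ hs, Finset.sum_image (fun a _ b _ hab => hinj hab)] at hm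
  rw [combOf_eq_sum w _ hs, Finset.sum_image (fun a _ b _ hab => hinj hab)] at hc
  have h2 := h' hm hc
  ext v
  by_contra hv
  obtain ⟨i, rfl⟩ := hw v hv
  exact hv (h2 i (Finset.mem_univ i))

/-- The weight transfer of a bisection: the mass which `a` and `b` have in common moves to the
midpoint of `a` and `b`. -/
def splitVec (a b : E) : E →₀ ℝ :=
  Finsupp.single (midpoint ℝ a b) 2 - Finsupp.single a 1 - Finsupp.single b 1

@[simp] lemma massOf_splitVec (a b : E) : massOf (splitVec a b) = 0 := by
  simp [splitVec]; norm_num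

@[simp] lemma combOf_splitVec (a b : E) : combOf (splitVec a b) = 0 := by
  simp only [splitVec, map_sub, combOf_single, one_smul, midpoint_eq_smul_add, smul_smul]
  norm_num

/-- Barycentric weights with respect to the children of a bisected simplex. -/
def splitWeights (a b : E) (w : E →₀ ℝ) : E →₀ ℝ := w + min (w a) (w b) • splitVec a b

lemma splitVec_comm (a b : E) : splitVec a b = splitVec b a := by
  rw [splitVec, splitVec, midpoint_comm, sub_right_comm]

lemma splitWeights_comm (a b : E) (w : E →₀ ℝ) : splitWeights a b w = splitWeights b a w := by
  rw [splitWeights, splitWeights, splitVec_comm, min_comm]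

lemma midpoint_ne_left' {a b : E} (h : a ≠ b) : midpoint ℝ a b ≠ a := by
  intro h1; rw [midpoint_eq_left_iff] at h1; exact h h1

lemma midpoint_ne_right' {a b : E} (h : a ≠ b) : midpoint ℝ a b ≠ b := by
  intro h1; rw [midpoint_eq_right_iff] at h1; exact h h1

lemma splitVec_left {a b : E} (h : a ≠ b) : splitVec a b a = -1 := by
  simp [splitVec, h.symm, midpoint_ne_left' h]

lemma splitVec_right {a b : E} (h : a ≠ b) : splitVec a b b = -1 := by
  simp [splitVec, h]

lemma splitVec_mid {a b : E} (h : a ≠ b) : splitVec a b (midpoint ℝ a b) = 2 := by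
  simp [splitVec, (midpoint_ne_right' h).symm, (midpoint_ne_left' h).symm]

lemma splitVec_other {a b v : E} (ha : v ≠ a) (hb : v ≠ b) (hm : v ≠ midpoint ℝ a b) :
    splitVec a b v = 0 := by
  simp [splitVec, ha.symm, hb.symm, hm.symm]

/-- The part of a simplex in which the weight of `b` is at most that of `a` belongs to the child
that keeps `a`. -/
lemma IsBary.split {V : Set E} {x a b : E} {w : E →₀ ℝ} (hw : IsBary V x w) (hab : a ≠ b)
    (h : w b ≤ w a) : IsBary (insert (midpoint ℝ a b) (V \ {b})) x (splitWeights a b w) := by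
  have hmin : min (w a) (w b) = w b := min_eq_right h
  have hb0 := hw.nonneg b
  refine ⟨?_, ?_, ?_, ?_⟩
  · intro v hv
    by_contra hV
    simp only [mem_insert_iff, mem_sdiff, mem_singleton_iff, not_or, not_and, not_not] at hV
    by_cases hvb : v = b
    · subst hvb
      simp [splitWeights, hmin, splitVec_right hab] at hv
    · have hvV : v ∉ V := fun h => hvb (hV.2 h)
      have hw0 : w v = 0 := by by_contra h; exact hvV (hw.supp v h)
      by_cases hva : v = a
      · subst hva
        have : w b = 0 := le_antisymm (by rw [← hw0]; exact h) hb0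
        simp [splitWeights, hw0, this] at hv
      · simp [splitWeights, hw0, splitVec_other hva hvb hV.1] at hv
  · intro v
    simp only [splitWeights, hmin, Finsupp.add_apply, Finsupp.smul_apply, smul_eq_mul]
    have := hw.nonneg v
    by_cases hvb : v = b
    · subst hvb; rw [splitVec_right hab]; linarith
    by_cases hva : v = a
    · subst hva; rw [splitVec_left hab]; linarith
    by_cases hvm : v = midpoint ℝ a b
    · rw [hvm, splitVec_mid hab]; rw [hvm] at this; linarith
    · rw [splitVec_other hva hvb hvm]; linarith
  · simp [splitWeights, hw.mass]
  · simp [splitWeights, hw.comb]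

/-- Weights with respect to the child that keeps `a` come from weights with respect to the
simplex. -/
lemma IsBary.exists_of_split {V : Set E} {x a b : E} {u : E →₀ ℝ} (hab : a ≠ b) (ha : a ∈ V)
    (hb : b ∈ V) (hu : IsBary (insert (midpoint ℝ a b) (V \ {b})) x u) (hm : midpoint ℝ a b ∉ V) :
    ∃ w, IsBary V x w ∧ w b ≤ w a ∧ u = splitWeights a b w := by
  set m := midpoint ℝ a b with hmdef
  have hub : u b = 0 := by
    by_contra h
    rcases hu.supp b h with h1 | h1
    · exact midpoint_ne_right' hab h1.symm
    · exact h1.2 rfl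
  have hma := midpoint_ne_left' hab
  have hmb := midpoint_ne_right' hab
  refine ⟨u - (u m / 2) • splitVec a b, ⟨?_, ?_, ?_, ?_⟩, ?_, ?_⟩
  · intro v hv
    by_contra hV
    have hva : v ≠ a := fun h => hV (h ▸ ha)
    have hvb : v ≠ b := fun h => hV (h ▸ hb)
    by_cases hvm : v = m
    · rw [hvm] at hv; simp [hmdef, splitVec_mid hab] at hv
    · have : u v = 0 := by
        by_contra h
        rcases hu.supp v h with h1 | h1
        · exact hvm h1
        · exact hV h1.1
      simp [this, splitVec_other hva hvb hvm] at hv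
  · intro v
    have h0 := hu.nonneg v
    have h1 := hu.nonneg m
    simp only [Finsupp.sub_apply, Finsupp.smul_apply, smul_eq_mul]
    by_cases hvb : v = b
    · subst hvb; rw [splitVec_right hab]; linarith
    by_cases hva : v = a
    · subst hva; rw [splitVec_left hab]; linarith
    by_cases hvm : v = m
    · rw [hvm, splitVec_mid hab]; linarith
    · rw [splitVec_other hva hvb hvm]; linarith
  · simp [hu.mass]
  · simp [hu.comb]
  · have := hu.nonneg a
    simp only [Finsupp.sub_apply, Finsupp.smul_apply, smul_eq_mul, splitVec_left hab,
      splitVec_right hab, hub]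
    linarith
  · have h0 := hu.nonneg a
    rw [splitWeights, min_eq_right]
    · simp only [Finsupp.sub_apply, Finsupp.smul_apply, smul_eq_mul, splitVec_right hab, hub]
      ext v
      simp
    · simp only [Finsupp.sub_apply, Finsupp.smul_apply, smul_eq_mul, splitVec_left hab,
        splitVec_right hab, hub]
      linarith

lemma WIndep.midpoint_notMem {V : Set E} (h : WIndep V) {a b : E} (ha : a ∈ V) (hb : b ∈ V)
    (hab : a ≠ b) : midpoint ℝ a b ∉ V := by
  intro hm
  have := h (splitVec a b) ?_ (by simp) (by simp)
  · have h2 := splitVec_left hab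
    rw [this] at h2; norm_num at h2
  · intro v hv
    by_contra hV
    exact hv (splitVec_other (fun h => hV (h ▸ ha)) (fun h => hV (h ▸ hb)) (fun h => hV (h ▸ hm)))

lemma isBary_midpoint {V : Set E} {a b : E} (ha : a ∈ V) (hb : b ∈ V) :
    IsBary V (midpoint ℝ a b) (Finsupp.single a (1/2) + Finsupp.single b (1/2)) := by
  classical
  refine ⟨?_, ?_, by simp; norm_num, ?_⟩
  · intro v hv
    by_contra hV
    apply hv
    have h1 : a ≠ v := fun h => hV (h ▸ ha)
    have h2 : b ≠ v := fun h => hV (h ▸ hb)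
    simp [h1, h2]
  · intro v
    simp only [Finsupp.add_apply, Finsupp.single_apply]
    split_ifs <;> norm_num
  · simp [midpoint_eq_smul_add]

lemma isBary_midpoint_pos {V : Set E} (hV : WIndep V) {a b : E} (ha : a ∈ V) (hb : b ∈ V) {w : E →₀ ℝ}
    (hw : IsBary V (midpoint ℝ a b) w) : w a ≠ 0 ∧ w b ≠ 0 := by
  classical
  rw [hV.isBary_unique hw (isBary_midpoint ha hb)]
  simp only [Finsupp.add_apply, Finsupp.single_apply]
  constructor <;> split_ifs <;> norm_num

end Bary

end

section
variable {d : ℕ}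

/-! ### Bisection of tagged simplices and conformity -/

namespace TaggedSimplex

/-- The set of vertices. -/
def verts (S : TaggedSimplex d) : Set (Sp d) := range S.vert

/-- A simplex with affinely independent vertices. -/
def Nondeg (S : TaggedSimplex d) : Prop := AffineIndependent ℝ S.vert

/-- The set of the two end points of the refinement edge. -/
def ends (S : TaggedSimplex d) : Set (Sp d) := {S.vert 0, S.vert (Fin.last d)}

/-- The midpoint of the refinement edge. -/
def mid (S : TaggedSimplex d) : Sp d := midpoint ℝ (S.vert 0) (S.vert (Fin.last d))

/-- Barycentric weights of a point with respect to the children of a simplex, in terms of the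
weights with respect to the simplex. -/
def split (S : TaggedSimplex d) (w : Sp d →₀ ℝ) : Sp d →₀ ℝ :=
  splitWeights (S.vert 0) (S.vert (Fin.last d)) w

lemma vert_mem (S : TaggedSimplex d) (k) : S.vert k ∈ S.verts := ⟨k, rfl⟩

lemma finite_verts (S : TaggedSimplex d) : S.verts.Finite := finite_range _

lemma Nondeg.wIndep {S : TaggedSimplex d} (h : S.Nondeg) : WIndep S.verts :=
  WIndep.of_affineIndependent h

lemma mem_carrier_iff {S : TaggedSimplex d} {x : Sp d} :
    x ∈ S.carrier ↔ ∃ w, IsBary S.verts x w := mem_convexHull_iff_isBary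

lemma zero_ne_last (hd : 1 ≤ d) : (0 : Fin (d + 1)) ≠ Fin.last d := by
  intro h; have := congrArg Fin.val h; simp at this; omega

lemma Nondeg.ends_ne {S : TaggedSimplex d} (h : S.Nondeg) (hd : 1 ≤ d) :
    S.vert 0 ≠ S.vert (Fin.last d) := fun h1 => zero_ne_last hd (h.injective h1)

lemma Nondeg.mid_notMem {S : TaggedSimplex d} (h : S.Nondeg) (hd : 1 ≤ d) :
    S.mid ∉ S.verts :=
  h.wIndep.midpoint_notMem (S.vert_mem _) (S.vert_mem _) (h.ends_ne hd)

lemma ofNat_val {k : ℕ} (h : k ≤ d) : (Fin.ofNat (d + 1) k).val = k := by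
  simp [Fin.ofNat, Nat.mod_eq_of_lt (Nat.lt_succ_of_le h)]

lemma verts_child₁ {S : TaggedSimplex d} (h : S.Nondeg) (hd : 1 ≤ d) :
    S.child₁.verts = insert S.mid (S.verts \ {S.vert (Fin.last d)}) := by
  ext v
  simp only [verts, mem_range, mem_insert_iff, mem_sdiff, mem_singleton_iff]
  constructor
  · rintro ⟨k, rfl⟩
    simp only [child₁]
    split_ifs with h0 h1
    · exact Or.inr ⟨⟨0, rfl⟩, h.ends_ne hd⟩
    · exact Or.inl rfl
    · refine Or.inr ⟨⟨_, rfl⟩, fun h2 => ?_⟩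
      have := congrArg Fin.val (h.injective h2)
      rw [ofNat_val (by omega)] at this
      simp at this; omega
  · rintro (rfl | ⟨⟨k, rfl⟩, hk⟩)
    · refine ⟨⟨1, by omega⟩, ?_⟩
      simp [child₁, mid]
    · have hkd : k.val ≠ d := fun h => hk (congrArg _ (Fin.ext h))
      by_cases h0 : k.val = 0
      · refine ⟨0, ?_⟩
        have : k = 0 := Fin.ext h0
        simp [child₁, this]
      · refine ⟨⟨k.val + 1, by omega⟩, ?_⟩
        simp only [child₁]
        rw [if_neg (by simp), if_neg (by simpa using h0)]
        congr 1
        apply Fin.ext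
        rw [ofNat_val (by simp; omega)]; simp

lemma verts_child₂ {S : TaggedSimplex d} (h : S.Nondeg) (hd : 1 ≤ d) (ht : S.type < d) :
    S.child₂.verts = insert S.mid (S.verts \ {S.vert 0}) := by
  ext v
  simp only [verts, mem_range, mem_insert_iff, mem_sdiff, mem_singleton_iff]
  constructor
  · rintro ⟨k, rfl⟩
    simp only [child₂]
    split_ifs with h0 h1 h2
    · exact Or.inr ⟨⟨_, rfl⟩, (h.ends_ne hd).symm⟩
    · exact Or.inl rfl
    · refine Or.inr ⟨⟨_, rfl⟩, fun h2 => ?_⟩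
      have := congrArg Fin.val (h.injective h2)
      rw [ofNat_val (by omega)] at this
      simp at this; omega
    · refine Or.inr ⟨⟨_, rfl⟩, fun h2 => ?_⟩
      have := congrArg Fin.val (h.injective h2)
      rw [ofNat_val (by omega)] at this
      simp at this; omega
  · rintro (rfl | ⟨⟨k, rfl⟩, hk⟩)
    · refine ⟨⟨1, by omega⟩, ?_⟩
      simp [child₂, mid]
    · have hk0 : k.val ≠ 0 := fun h => hk (congrArg _ (Fin.ext h))
      by_cases hkd : k.val = d
      · refine ⟨0, ?_⟩
        have : k = Fin.last d := Fin.ext hkd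
        simp [child₂, this]
      · by_cases hkt : k.val ≤ S.type
        · refine ⟨⟨k.val + 1, by omega⟩, ?_⟩
          simp only [child₂]
          rw [if_neg (by simp), if_neg (by simpa using hk0), if_pos (by simpa using hkt)]
          congr 1
          apply Fin.ext
          rw [ofNat_val (by simp; omega)]; simp
        · refine ⟨⟨d + S.type + 1 - k.val, by omega⟩, ?_⟩
          simp only [child₂]
          rw [if_neg (by omega), if_neg (by omega), if_neg (by omega)]
          congr 1
          apply Fin.ext
          rw [ofNat_val (by omega)]; omega

lemma carrier_eq_of_verts {S S' : TaggedSimplex d} (h : S.verts = S'.verts) :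
    S.carrier = S'.carrier := by
  simp only [carrier]; exact congrArg _ h

lemma nondeg_of_affineSpan {S : TaggedSimplex d} (h : affineSpan ℝ S.verts = ⊤) : S.Nondeg := by
  rw [Nondeg, affineIndependent_iff_le_finrank_vectorSpan ℝ S.vert (n := d) (by simp)]
  have : vectorSpan ℝ (range S.vert) = ⊤ := by
    rw [← direction_affineSpan]
    change (affineSpan ℝ S.verts).direction = ⊤
    rw [h, AffineSubspace.direction_top]
  rw [this]; simp

lemma Nondeg.affineSpan_eq {S : TaggedSimplex d} (h : S.Nondeg) : affineSpan ℝ S.verts = ⊤ := by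
  apply (AffineIndependent.affineSpan_eq_top_iff_card_eq_finrank_add_one h).2
  simp

lemma affineSpan_top_of_split {V : Set (Sp d)} (hV : affineSpan ℝ V = ⊤) {a b : Sp d} (ha : a ∈ V)
    (hab : a ≠ b) : affineSpan ℝ (insert (midpoint ℝ a b) (V \ {b})) = ⊤ := by
  rw [eq_top_iff, ← hV, affineSpan_le]
  intro v hv
  by_cases hvb : v = b
  · subst hvb
    have hm : midpoint ℝ a v ∈ affineSpan ℝ (insert (midpoint ℝ a v) (V \ {v})) :=
      subset_affineSpan ℝ _ (mem_insert _ _)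
    have ha' : a ∈ affineSpan ℝ (insert (midpoint ℝ a v) (V \ {v})) :=
      subset_affineSpan ℝ _ (Or.inr ⟨ha, hab⟩)
    have := AffineMap.lineMap_mem (2 : ℝ) ha' hm
    convert! this using 1
    rw [AffineMap.lineMap_apply_module', midpoint_eq_smul_add, invOf_eq_inv]
    module
  · exact subset_affineSpan ℝ _ (Or.inr ⟨hv, hvb⟩)

lemma Nondeg.child₁ {S : TaggedSimplex d} (h : S.Nondeg) (hd : 1 ≤ d) : S.child₁.Nondeg := by
  apply nondeg_of_affineSpan
  rw [verts_child₁ h hd]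
  exact affineSpan_top_of_split h.affineSpan_eq (S.vert_mem _) (h.ends_ne hd)

lemma Nondeg.child₂ {S : TaggedSimplex d} (h : S.Nondeg) (hd : 1 ≤ d) (ht : S.type < d) :
    S.child₂.Nondeg := by
  apply nondeg_of_affineSpan
  rw [verts_child₂ h hd ht, mid, midpoint_comm]
  exact affineSpan_top_of_split h.affineSpan_eq (S.vert_mem _) (h.ends_ne hd).symm

/-- A nondegenerate tagged simplex of admissible type. -/
structure Adm (S : TaggedSimplex d) : Prop where
  pos : 1 ≤ d
  nondeg : S.Nondeg
  type_lt : S.type < d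

lemma Adm.ends_ne {S : TaggedSimplex d} (h : S.Adm) : S.vert 0 ≠ S.vert (Fin.last d) :=
  h.nondeg.ends_ne h.pos

lemma Adm.child {S c : TaggedSimplex d} (h : S.Adm) (hc : c ∈ S.bisect) : c.Adm := by
  rcases hc with rfl | rfl
  · exact ⟨h.pos, h.nondeg.child₁ h.pos, Nat.mod_lt _ h.pos⟩
  · exact ⟨h.pos, h.nondeg.child₂ h.pos h.type_lt, Nat.mod_lt _ h.pos⟩

lemma type_bisect {S c : TaggedSimplex d} (hc : c ∈ S.bisect) : c.type = (S.type + 1) % d := by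
  rcases hc with rfl | rfl <;> rfl

/-- Weights with respect to the first child. -/
lemma Adm.isBary_child₁ {S : TaggedSimplex d} (h : S.Adm) {x u} :
    IsBary S.child₁.verts x u ↔
      ∃ w, IsBary S.verts x w ∧ w (S.vert (Fin.last d)) ≤ w (S.vert 0) ∧ u = S.split w := by
  rw [verts_child₁ h.nondeg h.pos]
  constructor
  · intro hu
    exact hu.exists_of_split h.ends_ne (S.vert_mem _) (S.vert_mem _) (h.nondeg.mid_notMem h.pos)
  · rintro ⟨w, hw, hle, rfl⟩
    exact hw.split h.ends_ne hle

/-- Weights with respect to the second child. -/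
lemma Adm.isBary_child₂ {S : TaggedSimplex d} (h : S.Adm) {x u} :
    IsBary S.child₂.verts x u ↔
      ∃ w, IsBary S.verts x w ∧ w (S.vert 0) ≤ w (S.vert (Fin.last d)) ∧ u = S.split w := by
  rw [verts_child₂ h.nondeg h.pos h.type_lt]
  have hm := h.nondeg.mid_notMem h.pos
  rw [mid, midpoint_comm] at hm ⊢
  constructor
  · intro hu
    obtain ⟨w, hw, hle, rfl⟩ := hu.exists_of_split h.ends_ne.symm (S.vert_mem _) (S.vert_mem _) hm
    exact ⟨w, hw, hle, splitWeights_comm _ _ _⟩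
  · rintro ⟨w, hw, hle, rfl⟩
    rw [split, splitWeights_comm]
    exact hw.split h.ends_ne.symm hle

lemma Adm.exists_of_child {S c : TaggedSimplex d} (h : S.Adm) (hc : c ∈ S.bisect) {x u}
    (hu : IsBary c.verts x u) : ∃ w, IsBary S.verts x w ∧ u = S.split w := by
  rcases hc with rfl | rfl
  · obtain ⟨w, hw, -, rfl⟩ := h.isBary_child₁.1 hu; exact ⟨w, hw, rfl⟩
  · obtain ⟨w, hw, -, rfl⟩ := h.isBary_child₂.1 hu; exact ⟨w, hw, rfl⟩

lemma Adm.exists_child {S : TaggedSimplex d} (h : S.Adm) {x w} (hw : IsBary S.verts x w) :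
    ∃ c ∈ S.bisect, IsBary c.verts x (S.split w) := by
  rcases le_total (w (S.vert (Fin.last d))) (w (S.vert 0)) with hle | hle
  · exact ⟨_, Or.inl rfl, h.isBary_child₁.2 ⟨w, hw, hle, rfl⟩⟩
  · exact ⟨_, Or.inr rfl, h.isBary_child₂.2 ⟨w, hw, hle, rfl⟩⟩

lemma Adm.child_subset {S c : TaggedSimplex d} (h : S.Adm) (hc : c ∈ S.bisect) :
    c.carrier ⊆ S.carrier := by
  intro x hx
  obtain ⟨u, hu⟩ := mem_carrier_iff.1 hx
  obtain ⟨w, hw, -⟩ := h.exists_of_child hc hu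
  exact mem_carrier_iff.2 ⟨w, hw⟩

lemma Adm.mem_child {S : TaggedSimplex d} (h : S.Adm) {x} (hx : x ∈ S.carrier) :
    ∃ c ∈ S.bisect, x ∈ c.carrier := by
  obtain ⟨w, hw⟩ := mem_carrier_iff.1 hx
  obtain ⟨c, hc, hu⟩ := h.exists_child hw
  exact ⟨c, hc, mem_carrier_iff.2 ⟨_, hu⟩⟩

lemma split_of_min_zero {S : TaggedSimplex d} {w : Sp d →₀ ℝ}
    (h : min (w (S.vert 0)) (w (S.vert (Fin.last d))) = 0) : S.split w = w := by
  simp [split, splitWeights, h]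

/-- No child contains both ends of the refinement edge. -/
lemma Adm.not_ends_subset_child {S c : TaggedSimplex d} (h : S.Adm) (hc : c ∈ S.bisect) :
    ¬ (S.vert 0 ∈ c.carrier ∧ S.vert (Fin.last d) ∈ c.carrier) := by
  rintro ⟨h0, h1⟩
  have huniq := fun (k) w (hw : IsBary S.verts (S.vert k) w) =>
    h.nondeg.wIndep.isBary_unique hw (IsBary.single (S.vert_mem k))
  have hne := h.ends_ne
  rcases hc with rfl | rfl
  · obtain ⟨u, hu⟩ := mem_carrier_iff.1 h1
    obtain ⟨w, hw, hle, -⟩ := h.isBary_child₁.1 hu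
    rw [huniq _ w hw] at hle
    simp [hne] at hle
    linarith
  · obtain ⟨u, hu⟩ := mem_carrier_iff.1 h0
    obtain ⟨w, hw, hle, -⟩ := h.isBary_child₂.1 hu
    rw [huniq _ w hw] at hle
    simp [hne.symm] at hle
    linarith

/-- Two simplices meet conformingly: a common point has the same barycentric weights with respect
to both. In particular it lies in the convex hull of the common vertices. -/
def Conf (S S' : TaggedSimplex d) : Prop :=
  ∀ x w w', IsBary S.verts x w → IsBary S'.verts x w' → w = w'

lemma Conf.symm {S S' : TaggedSimplex d} (h : Conf S S') : Conf S' S :=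
  fun x w w' hw hw' => (h x w' w hw' hw).symm

lemma Nondeg.conf_self {S : TaggedSimplex d} (h : S.Nondeg) : Conf S S :=
  fun _ _ _ hw hw' => h.wIndep.isBary_unique hw hw'

lemma Conf.isBary_right {S S' : TaggedSimplex d} (h : Conf S S') {x w} (hw : IsBary S.verts x w)
    (hx : x ∈ S'.carrier) : IsBary S'.verts x w := by
  obtain ⟨w', hw'⟩ := mem_carrier_iff.1 hx
  rwa [h x w w' hw hw']

lemma Conf.vert_mem {S S' : TaggedSimplex d} (h : Conf S S') {v} (hv : v ∈ S.verts)
    (hx : v ∈ S'.carrier) : v ∈ S'.verts := by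
  have := (h.isBary_right (IsBary.single hv) hx).supp v
  simpa using this

lemma Adm.min_nonneg {S : TaggedSimplex d} {x w} (hw : IsBary S.verts x w) :
    0 ≤ min (w (S.vert 0)) (w (S.vert (Fin.last d))) := le_min (hw.nonneg _) (hw.nonneg _)

/-- Bisection of one of two conforming simplices whose refinement edge is not in the other. -/
lemma Conf.bisect_left {S S' c : TaggedSimplex d} (h : Conf S S') (hS : S.Adm)
    (hc : c ∈ S.bisect) (hR : ¬ (S.ends ⊆ S'.verts)) : Conf c S' := by
  intro x u w' hu hw'
  obtain ⟨w, hw, rfl⟩ := hS.exists_of_child hc hu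
  obtain rfl := h x w w' hw hw'
  apply split_of_min_zero
  by_contra hmin
  have hpos := lt_of_le_of_ne (Adm.min_nonneg hw) (Ne.symm hmin)
  apply hR
  rintro v (rfl | rfl)
  · exact hw'.supp _ (ne_of_gt (lt_of_lt_of_le hpos (min_le_left _ _)))
  · exact hw'.supp _ (ne_of_gt (lt_of_lt_of_le hpos (min_le_right _ _)))

lemma split_eq_of_ends {S S' : TaggedSimplex d} (h : S.ends = S'.ends) (w : Sp d →₀ ℝ) :
    S.split w = S'.split w := by
  simp only [ends, pair_eq_pair_iff] at h
  rcases h with ⟨h1, h2⟩ | ⟨h1, h2⟩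
  · simp [split, h1, h2]
  · rw [split, split, h1, h2, splitWeights_comm]

/-- Bisection of two conforming simplices with consistent refinement edges. -/
lemma Conf.bisect {S S' c c' : TaggedSimplex d} (h : Conf S S') (hS : S.Adm) (hS' : S'.Adm)
    (hc : c ∈ S.bisect) (hc' : c' ∈ S'.bisect)
    (hR : S.ends ⊆ S'.verts → S.ends = S'.ends) (hR' : S'.ends ⊆ S.verts → S'.ends = S.ends) :
    Conf c c' := by
  intro x u u' hu hu'
  obtain ⟨w, hw, rfl⟩ := hS.exists_of_child hc hu
  obtain ⟨w', hw', rfl⟩ := hS'.exists_of_child hc' hu'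
  obtain rfl := h x w w' hw hw'
  by_cases hE : S.ends = S'.ends
  · exact split_eq_of_ends hE w
  rw [split_of_min_zero, split_of_min_zero]
  · by_contra hmin
    have hpos := lt_of_le_of_ne (Adm.min_nonneg hw') (Ne.symm hmin)
    apply hE; symm; apply hR'
    rintro v (rfl | rfl)
    · exact hw.supp _ (ne_of_gt (lt_of_lt_of_le hpos (min_le_left _ _)))
    · exact hw.supp _ (ne_of_gt (lt_of_lt_of_le hpos (min_le_right _ _)))
  · by_contra hmin
    have hpos := lt_of_le_of_ne (Adm.min_nonneg hw) (Ne.symm hmin)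
    apply hE; apply hR
    rintro v (rfl | rfl)
    · exact hw'.supp _ (ne_of_gt (lt_of_lt_of_le hpos (min_le_left _ _)))
    · exact hw'.supp _ (ne_of_gt (lt_of_lt_of_le hpos (min_le_right _ _)))

/-! ### Nodes and weights -/

lemma Nondeg.sum_weights {S : TaggedSimplex d} (h : S.Nondeg) {w : Sp d →₀ ℝ}
    (hw : ∀ v, w v ≠ 0 → v ∈ S.verts) : massOf w = ∑ k, w (S.vert k) := by
  classical
  rw [massOf_eq_sum w (Finset.univ.image S.vert), Finset.sum_image]
  · exact fun a _ b _ hab => h.injective hab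
  · intro v hv; obtain ⟨k, hk⟩ := hw v hv; simp only [Finset.mem_image]; exact ⟨k, by simp, hk⟩

lemma Nondeg.sum_weights_smul {S : TaggedSimplex d} (h : S.Nondeg) {w : Sp d →₀ ℝ}
    (hw : ∀ v, w v ≠ 0 → v ∈ S.verts) : combOf w = ∑ k, w (S.vert k) • S.vert k := by
  classical
  rw [combOf_eq_sum w (Finset.univ.image S.vert), Finset.sum_image]
  · exact fun a _ b _ hab => h.injective hab
  · intro v hv; obtain ⟨k, hk⟩ := hw v hv; simp only [Finset.mem_image]; exact ⟨k, by simp, hk⟩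

/-- The weight with prescribed values at the vertices. -/
def weight (S : TaggedSimplex d) (l : Fin (d + 1) → ℝ) : Sp d →₀ ℝ :=
  ∑ k, Finsupp.single (S.vert k) (l k)

lemma Nondeg.weight_apply {S : TaggedSimplex d} (h : S.Nondeg) (l) (k) :
    S.weight l (S.vert k) = l k := by
  classical
  rw [weight, Finsupp.finsetSum_apply, Finset.sum_eq_single k]
  · simp
  · intro b _ hb; rw [Finsupp.single_apply, if_neg]; exact fun h' => hb (h.injective h')
  · simp

lemma weight_supp {S : TaggedSimplex d} (l) : ∀ v, S.weight l v ≠ 0 → v ∈ S.verts := by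
  classical
  intro v hv
  by_contra hV
  apply hv
  rw [weight, Finsupp.finsetSum_apply]
  apply Finset.sum_eq_zero
  intro k _
  rw [Finsupp.single_apply, if_neg]
  rintro rfl; exact hV (S.vert_mem k)

lemma Nondeg.isBary_weight {S : TaggedSimplex d} (h : S.Nondeg) {l : Fin (d + 1) → ℝ}
    (h0 : ∀ k, 0 ≤ l k) (h1 : ∑ k, l k = 1) : IsBary S.verts (∑ k, l k • S.vert k) (S.weight l) := by
  refine ⟨weight_supp l, ?_, ?_, ?_⟩
  · intro v
    by_contra hv
    obtain ⟨k, rfl⟩ := weight_supp l v (fun h => hv (by rw [h]))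
    rw [h.weight_apply] at hv; exact hv (h0 k)
  · rw [h.sum_weights (weight_supp l)]; simpa [h.weight_apply] using h1
  · rw [h.sum_weights_smul (weight_supp l)]; simp [h.weight_apply]

lemma IsBary.sum_eq {S : TaggedSimplex d} (h : S.Nondeg) {x w} (hw : IsBary S.verts x w) :
    ∑ k, w (S.vert k) = 1 := by rw [← h.sum_weights hw.supp, hw.mass]

lemma IsBary.sum_smul_eq {S : TaggedSimplex d} (h : S.Nondeg) {x w} (hw : IsBary S.verts x w) :
    ∑ k, w (S.vert k) • S.vert k = x := by rw [← h.sum_weights_smul hw.supp, hw.comb]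

/-- The weights of nodes are the multiples of `1 / (r - 1)`. -/
def NodeWeight (r : ℕ) (w : Sp d →₀ ℝ) : Prop := ∀ v, ∃ n : ℕ, w v = (n : ℝ) / ((r - 1 : ℕ) : ℝ)

lemma Nondeg.mem_spaceNodes_iff {S : TaggedSimplex d} (h : S.Nondeg) {r : ℕ} (hr : 2 ≤ r)
    {x : Sp d} : x ∈ spaceNodes r S ↔ ∃ w, IsBary S.verts x w ∧ NodeWeight r w := by
  have hk : ((r - 1 : ℕ) : ℝ) ≠ 0 := by
    rw [Nat.cast_ne_zero]; omega
  constructor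
  · rintro ⟨α, hα, rfl⟩
    refine ⟨S.weight fun k => (α k : ℝ) / ((r - 1 : ℕ) : ℝ),
      h.isBary_weight (fun k => by positivity) ?_, ?_⟩
    · rw [← Finset.sum_div, ← Nat.cast_sum, hα, div_self hk]
    · intro v
      by_cases hv : v ∈ S.verts
      · obtain ⟨k, rfl⟩ := hv
        exact ⟨α k, by rw [h.weight_apply]⟩
      · refine ⟨0, ?_⟩
        by_contra h'; exact hv (weight_supp _ v (by simpa using h'))
  · rintro ⟨w, hw, hn⟩
    choose n hn using hn
    refine ⟨fun k => n (S.vert k), ?_, ?_⟩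
    · have := IsBary.sum_eq h hw
      simp only [hn] at this
      rw [← Finset.sum_div, ← Nat.cast_sum, div_eq_one_iff_eq hk] at this
      exact_mod_cast this
    · simp only [← hn]; exact (IsBary.sum_smul_eq h hw).symm

lemma spaceNodes_subset {S : TaggedSimplex d} (h : S.Nondeg) {r : ℕ} (hr : 2 ≤ r) :
    spaceNodes r S ⊆ S.carrier := by
  intro x hx
  obtain ⟨w, hw, -⟩ := (h.mem_spaceNodes_iff hr).1 hx
  exact mem_carrier_iff.2 ⟨w, hw⟩

lemma NodeWeight.split {S : TaggedSimplex d} (hS : S.Adm) {r : ℕ} {w : Sp d →₀ ℝ}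
    (hw : NodeWeight r w) : NodeWeight r (S.split w) := by
  have hab := hS.ends_ne
  obtain ⟨n0, h0⟩ := hw (S.vert 0)
  obtain ⟨n1, h1⟩ := hw (S.vert (Fin.last d))
  have hmin : min (w (S.vert 0)) (w (S.vert (Fin.last d))) =
      ((min n0 n1 : ℕ) : ℝ) / ((r - 1 : ℕ) : ℝ) := by
    rw [h0, h1, Nat.cast_min, min_div_div_right (by positivity)]
  intro v
  obtain ⟨n, hn⟩ := hw v
  simp only [TaggedSimplex.split, splitWeights, hmin, Finsupp.add_apply, Finsupp.smul_apply, smul_eq_mul]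
  by_cases hva : v = S.vert 0
  · subst hva
    refine ⟨n0 - min n0 n1, ?_⟩
    rw [splitVec_left hab, h0, Nat.cast_sub (min_le_left _ _)]; ring
  by_cases hvb : v = S.vert (Fin.last d)
  · subst hvb
    refine ⟨n1 - min n0 n1, ?_⟩
    rw [splitVec_right hab, h1, Nat.cast_sub (min_le_right _ _)]; ring
  by_cases hvm : v = midpoint ℝ (S.vert 0) (S.vert (Fin.last d))
  · refine ⟨n + 2 * min n0 n1, ?_⟩
    rw [hvm, splitVec_mid hab, ← hvm, hn]; push_cast; ring
  · refine ⟨n, ?_⟩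
    rw [splitVec_other hva hvb hvm, hn]; ring

/-- Nodes of a simplex in a child are nodes of the child. -/
lemma Adm.node_child {S c : TaggedSimplex d} (hS : S.Adm) (hc : c ∈ S.bisect) {r : ℕ} (hr : 2 ≤ r)
    {x} (hx : x ∈ spaceNodes r S) (hxc : x ∈ c.carrier) : x ∈ spaceNodes r c := by
  obtain ⟨w, hw, hn⟩ := (hS.nondeg.mem_spaceNodes_iff hr).1 hx
  obtain ⟨u, hu⟩ := mem_carrier_iff.1 hxc
  obtain ⟨w', hw', rfl⟩ := hS.exists_of_child hc hu
  obtain rfl := hS.nondeg.wIndep.isBary_unique hw hw'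
  exact ((hS.child hc).nondeg.mem_spaceNodes_iff hr).2 ⟨_, hu, hn.split hS⟩

/-- A new node of a child lies on faces containing the refinement edge only. -/
lemma Adm.ends_pos_of_new_node {S c : TaggedSimplex d} (hS : S.Adm) (hc : c ∈ S.bisect) {r : ℕ}
    (hr : 2 ≤ r) {x w} (hx : x ∈ spaceNodes r c) (hxS : x ∉ spaceNodes r S)
    (hw : IsBary S.verts x w) : w (S.vert 0) ≠ 0 ∧ w (S.vert (Fin.last d)) ≠ 0 := by
  obtain ⟨u, hu, hn⟩ := ((hS.child hc).nondeg.mem_spaceNodes_iff hr).1 hx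
  obtain ⟨w', hw', rfl⟩ := hS.exists_of_child hc hu
  obtain rfl := hS.nondeg.wIndep.isBary_unique hw hw'
  have hmin : min (w (S.vert 0)) (w (S.vert (Fin.last d))) ≠ 0 := by
    intro h0
    rw [split_of_min_zero h0] at hn
    exact hxS ((hS.nondeg.mem_spaceNodes_iff hr).2 ⟨w, hw, hn⟩)
  have hpos := lt_of_le_of_ne (Adm.min_nonneg hw) (Ne.symm hmin)
  exact ⟨ne_of_gt (lt_of_lt_of_le hpos (min_le_left _ _)),
    ne_of_gt (lt_of_lt_of_le hpos (min_le_right _ _))⟩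

lemma Conf.node {S S' : TaggedSimplex d} (h : Conf S S') (hS : S.Nondeg) (hS' : S'.Nondeg)
    {r : ℕ} (hr : 2 ≤ r) {x} (hx : x ∈ spaceNodes r S) (hx' : x ∈ S'.carrier) :
    x ∈ spaceNodes r S' := by
  obtain ⟨w, hw, hn⟩ := (hS.mem_spaceNodes_iff hr).1 hx
  exact (hS'.mem_spaceNodes_iff hr).2 ⟨w, h.isBary_right hw hx', hn⟩

end TaggedSimplex

end

section
variable {d : ℕ}

namespace TaggedSimplex

/-! ### Barycentric coordinates and overlapping simplices -/

/-- The vertices of a nondegenerate simplex as an affine basis. -/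
def Nondeg.basis {S : TaggedSimplex d} (h : S.Nondeg) : AffineBasis (Fin (d + 1)) ℝ (Sp d) :=
  ⟨S.vert, h, h.affineSpan_eq⟩

/-- Barycentric coordinates. -/
def Nondeg.coord {S : TaggedSimplex d} (h : S.Nondeg) (k : Fin (d + 1)) : Sp d →ᵃ[ℝ] ℝ :=
  h.basis.coord k

lemma Nondeg.coord_vert {S : TaggedSimplex d} (h : S.Nondeg) (k l : Fin (d + 1)) :
    h.coord k (S.vert l) = if k = l then 1 else 0 := h.basis.coord_apply k l

lemma Nondeg.sum_coord {S : TaggedSimplex d} (h : S.Nondeg) (x : Sp d) :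
    ∑ k, h.coord k x = 1 := h.basis.sum_coord_apply_eq_one x

lemma Nondeg.sum_coord_smul {S : TaggedSimplex d} (h : S.Nondeg) (x : Sp d) :
    ∑ k, h.coord k x • S.vert k = x := h.basis.linear_combination_coord_eq_self x

lemma Nondeg.affine_apply {S : TaggedSimplex d} (h : S.Nondeg) (g : Sp d →ᵃ[ℝ] ℝ) (x : Sp d) :
    g x = ∑ k, h.coord k x * g (S.vert k) := by
  have h1 : (∑ k, h.coord k x • S.vert k) = x := h.sum_coord_smul x
  have h2 := Finset.univ.map_affineCombination S.vert (fun k => h.coord k x) (h.sum_coord x) g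
  rw [Finset.affineCombination_eq_linear_combination _ _ _ (h.sum_coord x),
    Finset.affineCombination_eq_linear_combination _ _ _ (h.sum_coord x), h1] at h2
  simpa using h2

lemma Nondeg.mem_carrier_iff_coord {S : TaggedSimplex d} (h : S.Nondeg) {x : Sp d} :
    x ∈ S.carrier ↔ ∀ k, 0 ≤ h.coord k x := by
  have := h.basis.convexHull_eq_nonneg_coord
  rw [carrier]
  change x ∈ convexHull ℝ (range h.basis) ↔ _
  rw [this]; rfl

lemma Nondeg.mem_interior_iff {S : TaggedSimplex d} (h : S.Nondeg) {x : Sp d} :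
    x ∈ interior S.carrier ↔ ∀ k, 0 < h.coord k x := by
  have := h.basis.interior_convexHull
  rw [carrier]
  change x ∈ interior (convexHull ℝ (range h.basis)) ↔ _
  rw [this]; rfl

lemma Nondeg.isBary_coord {S : TaggedSimplex d} (h : S.Nondeg) {x : Sp d} (hx : x ∈ S.carrier) :
    IsBary S.verts x (S.weight fun k => h.coord k x) := by
  have := h.isBary_weight (h.mem_carrier_iff_coord.1 hx) (h.sum_coord x)
  rwa [h.sum_coord_smul] at this

lemma Nondeg.weight_eq_coord {S : TaggedSimplex d} (h : S.Nondeg) {x : Sp d} {w}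
    (hw : IsBary S.verts x w) (k : Fin (d + 1)) : w (S.vert k) = h.coord k x := by
  rw [h.wIndep.isBary_unique hw (h.isBary_coord (mem_carrier_iff.2 ⟨w, hw⟩)), h.weight_apply]

lemma isCompact_carrier (S : TaggedSimplex d) : IsCompact S.carrier :=
  S.finite_verts.isCompact_convexHull (𝕜 := ℝ)

lemma isClosed_carrier (S : TaggedSimplex d) : IsClosed S.carrier := S.isCompact_carrier.isClosed

lemma convex_carrier (S : TaggedSimplex d) : Convex ℝ S.carrier := convex_convexHull ℝ _

lemma vert_mem_carrier (S : TaggedSimplex d) (k) : S.vert k ∈ S.carrier :=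
  subset_convexHull ℝ _ (S.vert_mem k)

lemma verts_subset_carrier (S : TaggedSimplex d) : S.verts ⊆ S.carrier := subset_convexHull ℝ _

lemma Nondeg.interior_nonempty {S : TaggedSimplex d} (h : S.Nondeg) :
    (interior S.carrier).Nonempty := by
  rw [carrier]
  exact interior_convexHull_nonempty_iff_affineSpan_eq_top.2 h.affineSpan_eq

lemma Nondeg.closure_interior {S : TaggedSimplex d} (h : S.Nondeg) :
    closure (interior S.carrier) = S.carrier := by
  rw [S.convex_carrier.closure_interior_eq_closure_of_nonempty_interior h.interior_nonempty,
    S.isClosed_carrier.closure_eq]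

/-- An open set which meets a simplex meets its interior. -/
lemma Nondeg.inter_interior_nonempty {S : TaggedSimplex d} (h : S.Nondeg) {O : Set (Sp d)}
    (hO : IsOpen O) {x} (hx : x ∈ O) (hxS : x ∈ S.carrier) : (O ∩ interior S.carrier).Nonempty := by
  rw [← h.closure_interior] at hxS
  exact mem_closure_iff.1 hxS O hO hx

lemma Nondeg.ncard_verts {S : TaggedSimplex d} (h : S.Nondeg) : S.verts.ncard = d + 1 := by
  rw [verts, ← image_univ, ncard_image_of_injective _ h.injective, ncard_univ]; simp

/-- `d` of the vertices: all but one. -/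
lemma Nondeg.exists_facet {S : TaggedSimplex d} (h : S.Nondeg) {W : Set (Sp d)}
    (hW : W ⊆ S.verts) (hc : d ≤ W.ncard) : ∃ i, ∀ k, k ≠ i → S.vert k ∈ W := by
  have h1 := ncard_sdiff_add_ncard_of_subset hW S.finite_verts
  rw [h.ncard_verts] at h1
  have h2 : (S.verts \ W).ncard ≤ 1 := by omega
  rw [ncard_le_one (S.finite_verts.subset sdiff_subset)] at h2
  by_cases hne : (S.verts \ W).Nonempty
  · obtain ⟨v, ⟨i, rfl⟩, hv⟩ := hne
    refine ⟨i, fun k hk => ?_⟩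
    by_contra hkW
    exact hk (h.injective (h2 _ ⟨S.vert_mem k, hkW⟩ _ ⟨S.vert_mem i, hv⟩))
  · rw [not_nonempty_iff_eq_empty, sdiff_eq_empty] at hne
    exact ⟨0, fun k _ => hne (S.vert_mem k)⟩

/-- An affine function that vanishes on a facet is a multiple of a barycentric coordinate. -/
lemma Nondeg.affine_eq_of_facet {S : TaggedSimplex d} (h : S.Nondeg) {i : Fin (d + 1)}
    {g : Sp d →ᵃ[ℝ] ℝ} (hg : ∀ k, k ≠ i → g (S.vert k) = 0) (x : Sp d) :
    g x = h.coord i x * g (S.vert i) := by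
  rw [h.affine_apply g, Finset.sum_eq_single i]
  · intro k _ hk; rw [hg k hk, mul_zero]
  · simp

/-- Two affine functions vanishing at `d` vertices of a simplex are linearly dependent. -/
lemma Nondeg.affine_dependent {S : TaggedSimplex d} (h : S.Nondeg) {W : Set (Sp d)}
    (hW : W ⊆ S.verts) (hc : d ≤ W.ncard) {f g : Sp d →ᵃ[ℝ] ℝ} (hf : ∀ v ∈ W, f v = 0)
    (hg : ∀ v ∈ W, g v = 0) {p : Sp d} (hfp : f p ≠ 0) (hgp : g p = 0) (q : Sp d) : g q = 0 := by
  obtain ⟨i, hi⟩ := h.exists_facet hW hc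
  have h1 := h.affine_eq_of_facet (g := f) (i := i) (fun k hk => hf _ (hi k hk))
  have h2 := h.affine_eq_of_facet (g := g) (i := i) (fun k hk => hg _ (hi k hk))
  rw [h1 p] at hfp
  rw [h2 p] at hgp
  have : g (S.vert i) = 0 := by
    rcases mul_eq_zero.1 hgp with h | h
    · exact absurd (by rw [h, zero_mul]) hfp
    · exact h
  rw [h2 q, this, mul_zero]

/-- Two simplices with `d` common vertices on the same side of the common facet overlap. -/
lemma Nondeg.overlap {S S' : TaggedSimplex d} (hd : 1 ≤ d) (h : S.Nondeg) (h' : S'.Nondeg) {W : Set (Sp d)}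
    (hW : W ⊆ S.verts) (hW' : W ⊆ S'.verts) (hc : d ≤ W.ncard) {g : Sp d →ᵃ[ℝ] ℝ}
    (hg : ∀ v ∈ W, g v = 0) {p p' : Sp d} (hp : p ∈ S.carrier) (hp' : p' ∈ S'.carrier)
    (hgp : 0 < g p) (hgp' : 0 < g p') : (interior S.carrier ∩ interior S'.carrier).Nonempty := by
  obtain ⟨i, hi⟩ := h.exists_facet hW hc
  obtain ⟨j, hj⟩ := h'.exists_facet hW' hc
  have h1 := h.affine_eq_of_facet (g := g) (i := i) (fun k hk => hg _ (hi k hk))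
  have h2 := h'.affine_eq_of_facet (g := g) (i := j) (fun k hk => hg _ (hj k hk))
  have e1 : 0 < g (S.vert i) := by
    have := h.mem_carrier_iff_coord.1 hp i
    rw [h1] at hgp; exact pos_of_mul_pos_right hgp this
  have e2 : 0 < g (S'.vert j) := by
    have := h'.mem_carrier_iff_coord.1 hp' j
    rw [h2] at hgp'; exact pos_of_mul_pos_right hgp' this
  have e3 : 0 < h'.coord j (S.vert i) := by
    have := h2 (S.vert i)
    rw [this] at e1
    exact pos_of_mul_pos_left e1 e2.le
  -- the centroid `z` of the common facet has vanishing coordinate only at the opposite vertex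
  set z : Sp d := ∑ k, (if k = i then (0 : ℝ) else 1 / d) • S.vert k with hz
  have hsum : ∑ k : Fin (d + 1), (if k = i then (0 : ℝ) else 1 / d) = 1 := by
    have hd' : (d : ℝ) ≠ 0 := by positivity
    rw [Finset.sum_ite]
    simp [Finset.filter_ne', hd']
  have hzg (f : Sp d →ᵃ[ℝ] ℝ) : f z = ∑ k, (if k = i then (0 : ℝ) else 1 / d) * f (S.vert k) := by
    have h2 := Finset.univ.map_affineCombination S.vert _ hsum f
    rw [Finset.affineCombination_eq_linear_combination _ _ _ hsum,
      Finset.affineCombination_eq_linear_combination _ _ _ hsum, ← hz] at h2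
    simpa only [Function.comp, smul_eq_mul] using h2
  have hzi (k) (hk : k ≠ i) : h.coord k z = 1 / d := by
    rw [hzg, Finset.sum_eq_single k]
    · simp [hk, h.coord_vert]
    · intro l _ hl; simp [h.coord_vert, hl.symm]
    · simp
  have hzii : h.coord i z = 0 := by
    rw [hzg]; apply Finset.sum_eq_zero
    intro l _
    by_cases hl : l = i
    · simp [hl]
    · simp [h.coord_vert, Ne.symm hl]
  have hzj (k) (hk : k ≠ j) : 0 < h'.coord k z := by
    rw [hzg]
    -- `S'.vert k` is one of the common vertices
    obtain ⟨l, hl⟩ := hW (hj k hk)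
    have hli : l ≠ i := by
      rintro rfl
      have := hg _ (hj k hk)
      rw [← hl] at this; linarith
    have hpos : 0 < (if l = i then (0 : ℝ) else 1 / d) * h'.coord k (S.vert l) := by
      rw [if_neg hli, hl, h'.coord_vert, if_pos rfl]; positivity
    refine lt_of_lt_of_le hpos (Finset.single_le_sum (f := fun l => (if l = i then (0 : ℝ) else 1 / d) *
      h'.coord k (S.vert l)) (fun m _ => ?_) (Finset.mem_univ l))
    by_cases hm : m = i
    · simp [hm]
    · have := h'.mem_carrier_iff_coord.1 (S'.verts_subset_carrier (hW' (hi m hm))) k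
      simp only [hm, if_false]; positivity
  have hzjj : 0 ≤ h'.coord j z := by
    rw [hzg]
    apply Finset.sum_nonneg
    intro m _
    by_cases hm : m = i
    · simp [hm]
    · have := h'.mem_carrier_iff_coord.1 (S'.verts_subset_carrier (hW' (hi m hm))) j
      simp only [hm, if_false]; positivity
  -- move from `z` towards the opposite vertex of `S`
  have hline (f : Sp d →ᵃ[ℝ] ℝ) (t : ℝ) :
      f (AffineMap.lineMap z (S.vert i) t) = (1 - t) * f z + t * f (S.vert i) := by
    rw [AffineMap.apply_lineMap, AffineMap.lineMap_apply_ring]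
  have hev : ∀ᶠ t : ℝ in nhdsWithin 0 (Ioi 0), ∀ k,
      0 < h'.coord k (AffineMap.lineMap z (S.vert i) t) := by
    rw [Filter.eventually_all]
    intro k
    by_cases hk : k = j
    · subst hk
      filter_upwards [self_mem_nhdsWithin, nhdsWithin_le_nhds (Iio_mem_nhds one_pos)] with t ht ht1
      rw [hline]
      have : (0 : ℝ) < t := ht
      have : t < 1 := ht1
      have : 0 ≤ (1 - t) * h'.coord k z := mul_nonneg (by linarith) hzjj
      have : 0 < t * h'.coord k (S.vert i) := by positivity
      linarith
    · have hcont : Filter.Tendsto (fun t : ℝ => (1 - t) * h'.coord k z + t * h'.coord k (S.vert i))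
          (nhds 0) (nhds ((1 - 0) * h'.coord k z + 0 * h'.coord k (S.vert i))) :=
        (Continuous.tendsto (by fun_prop) 0)
      have := (hcont.eventually (lt_mem_nhds (by simpa using hzj k hk)))
      filter_upwards [nhdsWithin_le_nhds this] with t ht
      rw [hline]; exact ht
  have hev2 : ∀ᶠ t : ℝ in nhdsWithin 0 (Ioi 0), t < 1 ∧ 0 < t := by
    filter_upwards [self_mem_nhdsWithin, nhdsWithin_le_nhds (Iio_mem_nhds one_pos)] with t ht ht1
    exact ⟨ht1, ht⟩
  obtain ⟨t, ht, ht1, ht0⟩ := (hev.and hev2).exists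
  refine ⟨AffineMap.lineMap z (S.vert i) t, h.mem_interior_iff.2 fun k => ?_, h'.mem_interior_iff.2 ht⟩
  rw [hline, h.coord_vert]
  by_cases hk : k = i
  · subst hk; rw [hzii]; simp [ht0]
  · rw [hzi k hk, if_neg hk]
    have : (0 : ℝ) < 1 - t := by linarith
    have : (0 : ℝ) < d := by exact_mod_cast hd
    simp only [mul_zero, add_zero]; positivity

/-! ### Dimensions of intersections -/

lemma dimension_eq_iff {A : Set (Sp d)} (hd : 1 ≤ d) (hA : Convex ℝ A) :
    dimension A = d ↔ (interior A).Nonempty := by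
  rw [hA.interior_nonempty_iff_affineSpan_eq_top]
  constructor
  · intro h
    have hne : A.Nonempty := by
      by_contra h'
      rw [not_nonempty_iff_eq_empty] at h'
      rw [h', dimension, vectorSpan_empty, finrank_bot] at h; omega
    rw [← AffineSubspace.direction_eq_top_iff_of_nonempty (hne.mono (subset_affineSpan ℝ A)),
      direction_affineSpan]
    exact Submodule.eq_top_of_finrank_eq (by simpa [dimension] using h)
  · intro h
    rw [dimension, ← direction_affineSpan, h, AffineSubspace.direction_top]; simp

lemma dimension_inter_eq_iff {S S' : TaggedSimplex d} (hd : 1 ≤ d) :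
    dimension (S.carrier ∩ S'.carrier) = d ↔
      (interior S.carrier ∩ interior S'.carrier).Nonempty := by
  rw [dimension_eq_iff hd (S.convex_carrier.inter S'.convex_carrier), interior_inter]

lemma dimension_mono {A B : Set (Sp d)} (h : A ⊆ B) : dimension A ≤ dimension B :=
  Submodule.finrank_mono (vectorSpan_mono ℝ h)

lemma dimension_le (A : Set (Sp d)) : dimension A ≤ d := by
  have := Submodule.finrank_le (vectorSpan ℝ A)
  simpa [dimension] using this

lemma Nondeg.le_dimension_of_facet {S : TaggedSimplex d} (hd : 1 ≤ d) (h : S.Nondeg) {W A : Set (Sp d)}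
    (hW : W ⊆ S.verts) (hc : d ≤ W.ncard) (hA : W ⊆ A) : d ≤ dimension A + 1 := by
  obtain ⟨i, hi⟩ := h.exists_facet hW hc
  have h1 : AffineIndependent ℝ (fun k : {k // k ≠ i} => S.vert k) := h.subtype {k | k ≠ i}
  have h2 := h1.finrank_vectorSpan (n := d - 1) (by simp; omega)
  have h3 : dimension (range fun k : {k // k ≠ i} => S.vert k) ≤ dimension A := by
    apply dimension_mono
    rintro _ ⟨⟨k, hk⟩, rfl⟩
    exact hA (hi k hk)
  rw [dimension, h2] at h3; omega

lemma shareFacet_of_common {S S' c : TaggedSimplex d} (hd : 1 ≤ d) (hc : c.Nondeg)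
    {W : Set (Sp d)} (hW : W ⊆ c.verts) (hcard : d ≤ W.ncard) (hS : W ⊆ S.carrier)
    (hS' : W ⊆ S'.carrier) (hdis : Disjoint (interior S.carrier) (interior S'.carrier)) :
    ShareFacet S S' := by
  have hne : W.Nonempty := nonempty_of_ncard_ne_zero (by omega)
  refine ⟨hne.mono (subset_inter hS hS'), ?_⟩
  have h1 := hc.le_dimension_of_facet hd hW hcard (subset_inter hS hS')
  have h2 := dimension_le (S.carrier ∩ S'.carrier)
  have h3 : dimension (S.carrier ∩ S'.carrier) ≠ d := by
    rw [Ne, dimension_inter_eq_iff hd, not_nonempty_iff_eq_empty]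
    exact disjoint_iff_inter_eq_empty.1 hdis
  omega

/-! ### Uniform refinements -/

/-- All children of the simplices of a set. -/
def refineAll (𝒯 : Set (TaggedSimplex d)) : Set (TaggedSimplex d) := ⋃ S ∈ 𝒯, S.bisect

/-- The `n`-fold uniform bisection. -/
def unif (𝒯 : Set (TaggedSimplex d)) (n : ℕ) : Set (TaggedSimplex d) := refineAll^[n] 𝒯

lemma mem_refineAll {𝒯 : Set (TaggedSimplex d)} {c} : c ∈ refineAll 𝒯 ↔ ∃ S ∈ 𝒯, c ∈ S.bisect := by
  simp [refineAll]

@[simp] lemma unif_zero (𝒯 : Set (TaggedSimplex d)) : unif 𝒯 0 = 𝒯 := rfl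

lemma unif_succ (𝒯 : Set (TaggedSimplex d)) (n) : unif 𝒯 (n + 1) = refineAll (unif 𝒯 n) :=
  Function.iterate_succ_apply' _ _ _

lemma unif_succ' (𝒯 : Set (TaggedSimplex d)) (n) : unif 𝒯 (n + 1) = unif (refineAll 𝒯) n :=
  Function.iterate_succ_apply _ _ _

lemma mem_unif_iff {𝒯 : Set (TaggedSimplex d)} {n c} :
    c ∈ unif 𝒯 n ↔ ∃ S ∈ 𝒯, c ∈ unif {S} n := by
  induction n generalizing c with
  | zero => simp
  | succ n ih =>
    rw [unif_succ, mem_refineAll]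
    constructor
    · rintro ⟨A, hA, hc⟩
      obtain ⟨S, hS, hAS⟩ := ih.1 hA
      exact ⟨S, hS, by rw [unif_succ, mem_refineAll]; exact ⟨A, hAS, hc⟩⟩
    · rintro ⟨S, hS, hc⟩
      rw [unif_succ, mem_refineAll] at hc
      obtain ⟨A, hA, hc⟩ := hc
      exact ⟨A, ih.2 ⟨S, hS, hA⟩, hc⟩

lemma unif_add (𝒯 : Set (TaggedSimplex d)) (m n) : unif 𝒯 (m + n) = unif (unif 𝒯 m) n := by
  rw [unif, add_comm, Function.iterate_add_apply]; rfl

lemma mem_unif_add {𝒯 : Set (TaggedSimplex d)} {m n c} :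
    c ∈ unif 𝒯 (m + n) ↔ ∃ A ∈ unif 𝒯 m, c ∈ unif {A} n := by
  rw [unif_add, mem_unif_iff]

lemma refineAll_singleton (S : TaggedSimplex d) : refineAll {S} = S.bisect := by simp [refineAll]

lemma mem_unif_succ_of_bisect {S c : TaggedSimplex d} {n} :
    c ∈ unif {S} (n + 1) ↔ ∃ C ∈ S.bisect, c ∈ unif {C} n := by
  rw [unif_succ', refineAll_singleton, mem_unif_iff]

lemma Adm.unif {S c : TaggedSimplex d} (h : S.Adm) {n} (hc : c ∈ unif {S} n) : c.Adm := by
  induction n generalizing S with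
  | zero => rw [unif_zero, mem_singleton_iff] at hc; rwa [hc]
  | succ n ih =>
    obtain ⟨C, hC, hc⟩ := mem_unif_succ_of_bisect.1 hc
    exact ih (h.child hC) hc

lemma Adm.unif_subset {S c : TaggedSimplex d} (h : S.Adm) {n} (hc : c ∈ TaggedSimplex.unif {S} n) :
    c.carrier ⊆ S.carrier := by
  induction n generalizing S with
  | zero => rw [unif_zero, mem_singleton_iff] at hc; rw [hc]
  | succ n ih =>
    obtain ⟨C, hC, hc⟩ := mem_unif_succ_of_bisect.1 hc
    exact (ih (h.child hC) hc).trans (h.child_subset hC)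

lemma type_unif {S c : TaggedSimplex d} (h : S.type < d) {n} (hc : c ∈ unif {S} n) :
    c.type = (S.type + n) % d := by
  induction n generalizing c with
  | zero => rw [unif_zero, mem_singleton_iff] at hc; rw [hc, add_zero, Nat.mod_eq_of_lt h]
  | succ n ih =>
    rw [unif_succ, mem_refineAll] at hc
    obtain ⟨A, hA, hc⟩ := hc
    rw [type_bisect hc, ih hA, Nat.mod_add_mod, add_assoc]

/-- Distinct simplices have disjoint interiors. -/
def NonOverlap (𝒯 : Set (TaggedSimplex d)) : Prop :=
  ∀ S ∈ 𝒯, ∀ S' ∈ 𝒯, S ≠ S' → Disjoint (interior S.carrier) (interior S'.carrier)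

lemma Adm.coord_le_of_child₁ {S : TaggedSimplex d} (h : S.Adm) {x} (hx : x ∈ S.child₁.carrier) :
    h.nondeg.coord (Fin.last d) x ≤ h.nondeg.coord 0 x := by
  obtain ⟨u, hu⟩ := mem_carrier_iff.1 hx
  obtain ⟨w, hw, hle, -⟩ := h.isBary_child₁.1 hu
  rwa [h.nondeg.weight_eq_coord hw, h.nondeg.weight_eq_coord hw] at hle

lemma Adm.coord_le_of_child₂ {S : TaggedSimplex d} (h : S.Adm) {x} (hx : x ∈ S.child₂.carrier) :
    h.nondeg.coord 0 x ≤ h.nondeg.coord (Fin.last d) x := by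
  obtain ⟨u, hu⟩ := mem_carrier_iff.1 hx
  obtain ⟨w, hw, hle, -⟩ := h.isBary_child₂.1 hu
  rwa [h.nondeg.weight_eq_coord hw, h.nondeg.weight_eq_coord hw] at hle

lemma Adm.disjoint_children {S : TaggedSimplex d} (h : S.Adm) :
    Disjoint (interior S.child₁.carrier) (interior S.child₂.carrier) := by
  rw [Set.disjoint_iff_inter_eq_empty, ← interior_inter, ← not_nonempty_iff_eq_empty]
  rintro ⟨x, hx⟩
  -- on the intersection the affine function `coord 0 - coord d` vanishes
  obtain ⟨O, hO, hOo, hxO⟩ := mem_interior.1 hx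
  set g : Sp d →ᵃ[ℝ] ℝ := h.nondeg.coord 0 - h.nondeg.coord (Fin.last d) with hg
  have hg0 : ∀ y ∈ O, g y = 0 := fun y hy => by
    have h1 := h.coord_le_of_child₁ (hO hy).1
    have h2 := h.coord_le_of_child₂ (hO hy).2
    simp [hg]; linarith
  have hv : g (S.vert 0) = 1 := by
    simp [hg, h.nondeg.coord_vert, (zero_ne_last h.pos).symm]
  have hcont : Filter.Tendsto (fun t : ℝ => AffineMap.lineMap x (S.vert 0) t) (nhds 0) (nhds x) := by
    have : Continuous (fun t : ℝ => AffineMap.lineMap x (S.vert 0) t) := AffineMap.lineMap_continuous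
    simpa using this.tendsto 0
  have hev : ∀ᶠ t : ℝ in nhdsWithin 0 (Ioi 0), AffineMap.lineMap x (S.vert 0) t ∈ O :=
    nhdsWithin_le_nhds (hcont.eventually (hOo.mem_nhds hxO))
  obtain ⟨t, ht, ht0⟩ := (hev.and self_mem_nhdsWithin).exists
  have := hg0 _ ht
  rw [AffineMap.apply_lineMap, AffineMap.lineMap_apply_ring, hg0 x hxO, hv] at this
  have h0 : (0 : ℝ) < t := ht0
  simp at this; linarith

lemma NonOverlap.refineAll {𝒯 : Set (TaggedSimplex d)} (h : NonOverlap 𝒯) (ha : ∀ S ∈ 𝒯, S.Adm) :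
    NonOverlap (refineAll 𝒯) := by
  intro c hc c' hc' hne
  obtain ⟨S, hS, hcS⟩ := mem_refineAll.1 hc
  obtain ⟨S', hS', hcS'⟩ := mem_refineAll.1 hc'
  by_cases hSS : S = S'
  · subst hSS
    have := (ha S hS).disjoint_children
    rcases hcS with rfl | rfl <;> rcases hcS' with rfl | rfl
    · exact absurd rfl hne
    · exact this
    · exact this.symm
    · exact absurd rfl hne
  · exact (h S hS S' hS' hSS).mono (interior_mono ((ha S hS).child_subset hcS))
      (interior_mono ((ha S' hS').child_subset hcS'))

lemma adm_unif {𝒯 : Set (TaggedSimplex d)} (ha : ∀ S ∈ 𝒯, S.Adm) {n c} (hc : c ∈ unif 𝒯 n) :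
    c.Adm := by
  obtain ⟨S, hS, hc⟩ := mem_unif_iff.1 hc
  exact (ha S hS).unif hc

lemma NonOverlap.unif {𝒯 : Set (TaggedSimplex d)} (h : NonOverlap 𝒯) (ha : ∀ S ∈ 𝒯, S.Adm) (n) :
    NonOverlap (unif 𝒯 n) := by
  induction n with
  | zero => exact h
  | succ n ih => rw [unif_succ]; exact ih.refineAll fun S hS => adm_unif ha hS

lemma nonOverlap_singleton (S : TaggedSimplex d) : NonOverlap {S} := by
  rintro A rfl B rfl h; exact absurd rfl h

lemma finite_unif {𝒯 : Set (TaggedSimplex d)} (h : 𝒯.Finite) (n) : (unif 𝒯 n).Finite := by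
  induction n with
  | zero => exact h
  | succ n ih =>
    rw [unif_succ]
    exact ih.biUnion fun S _ => (finite_singleton _).insert _

lemma exists_mem_unif {𝒯 : Set (TaggedSimplex d)} (ha : ∀ S ∈ 𝒯, S.Adm) {S} (hS : S ∈ 𝒯) {x}
    (hx : x ∈ S.carrier) (n) : ∃ c ∈ unif 𝒯 n, x ∈ c.carrier := by
  induction n with
  | zero => exact ⟨S, hS, hx⟩
  | succ n ih =>
    obtain ⟨A, hA, hxA⟩ := ih
    obtain ⟨c, hc, hxc⟩ := (adm_unif ha hA).mem_child hxA
    exact ⟨c, by rw [unif_succ]; exact mem_refineAll.2 ⟨A, hA, hc⟩, hxc⟩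

/-- The image of a tagged simplex. -/
def map (f : Sp d →ᵃ[ℝ] Sp d) (S : TaggedSimplex d) : TaggedSimplex d := ⟨f ∘ S.vert, S.type⟩

lemma child₁_map (f : Sp d →ᵃ[ℝ] Sp d) (S : TaggedSimplex d) :
    (S.map f).child₁ = S.child₁.map f := by
  simp only [child₁, map, mk.injEq, and_true]
  funext k
  simp only [Function.comp]
  split_ifs <;> simp [AffineMap.map_midpoint]

lemma child₂_map (f : Sp d →ᵃ[ℝ] Sp d) (S : TaggedSimplex d) :
    (S.map f).child₂ = S.child₂.map f := by
  simp only [child₂, map, mk.injEq, and_true]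
  funext k
  simp only [Function.comp]
  split_ifs <;> simp [AffineMap.map_midpoint, *]

lemma unif_map (f : Sp d →ᵃ[ℝ] Sp d) {S c : TaggedSimplex d} {n} (hc : c ∈ unif {S} n) :
    c.map f ∈ unif {S.map f} n := by
  induction n generalizing S with
  | zero => rw [unif_zero, mem_singleton_iff] at hc ⊢; rw [hc]
  | succ n ih =>
    obtain ⟨C, hC, hc⟩ := mem_unif_succ_of_bisect.1 hc
    refine mem_unif_succ_of_bisect.2 ⟨C.map f, ?_, ih hc⟩
    rcases hC with rfl | rfl
    · exact Or.inl (child₁_map f S).symm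
    · exact Or.inr (child₂_map f S).symm

end TaggedSimplex

end

section
variable {d : ℕ}

namespace TaggedSimplex

/-! ### Compatibility of refinement edges across facets -/

/-- If the two simplices share a facet which contains the refinement edge of the first one, this
is the refinement edge of the second one, too. -/
def EdgeOK (c c' : TaggedSimplex d) : Prop :=
  d ≤ (c.verts ∩ c'.verts).ncard → c.ends ⊆ c'.verts → c'.ends = c.ends

lemma ends_subset (S : TaggedSimplex d) : S.ends ⊆ S.verts := by
  rintro v (rfl | rfl) <;> exact S.vert_mem _

lemma ends_map (f : Sp d →ᵃ[ℝ] Sp d) (S : TaggedSimplex d) : (S.map f).ends = f '' S.ends := by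
  simp [ends, map, image_pair]

lemma verts_map (f : Sp d →ᵃ[ℝ] Sp d) (S : TaggedSimplex d) : (S.map f).verts = f '' S.verts := by
  simp [verts, map, range_comp]

/-- Simplices which agree in all vertices but one are refined in the same way: the affine map that
takes the one to the other fixes the common facet and takes descendants to descendants. -/
lemma edgeOK_of_eq_off {S S' : TaggedSimplex d} (hS : S.Adm) (hS' : S'.Adm)
    (ht : S.type = S'.type) (hdis : Disjoint (interior S.carrier) (interior S'.carrier))
    {i : Fin (d + 1)} (hi : ∀ k, k ≠ i → S.vert k = S'.vert k) {n : ℕ} {c c' : TaggedSimplex d}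
    (hc : c ∈ unif {S} n) (hc' : c' ∈ unif {S'} n) : EdgeOK c c' := by
  intro hcard hends
  have h := hS.nondeg
  have h' := hS'.nondeg
  set W := c.verts ∩ c'.verts with hW
  have hcc := hS.unif hc
  have hcc' := hS'.unif hc'
  have hWS : W ⊆ S.carrier := fun v hv => hS.unif_subset hc (c.verts_subset_carrier hv.1)
  have hWS' : W ⊆ S'.carrier := fun v hv => hS'.unif_subset hc' (c'.verts_subset_carrier hv.2)
  -- the coordinate of `S'` at the exceptional vertex is a multiple of the one of `S`
  have hprop := h.affine_eq_of_facet (g := h'.coord i) (i := i) (fun k hk => by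
    rw [hi k hk, h'.coord_vert, if_neg hk.symm])
  have hle : h'.coord i (S.vert i) ≤ 0 := by
    by_contra hpos
    rw [not_le] at hpos
    have hV : S.verts \ {S.vert i} ⊆ S'.verts := by
      rintro _ ⟨⟨k, rfl⟩, hk⟩
      have hk : k ≠ i := fun h => hk (by rw [h]; rfl)
      rw [hi k hk]; exact S'.vert_mem k
    have hn : d ≤ (S.verts \ {S.vert i}).ncard := by
      rw [ncard_sdiff_singleton_of_mem (S.vert_mem i), h.ncard_verts]; simp
    have := h.overlap hS.pos h' sdiff_subset hV hn (g := h'.coord i) (p := S.vert i)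
      (p' := S'.vert i) ?_ (S.vert_mem_carrier i) (S'.vert_mem_carrier i) hpos
      (by rw [h'.coord_vert, if_pos rfl]; norm_num)
    · obtain ⟨x, hx1, hx2⟩ := this
      exact Set.disjoint_left.1 hdis hx1 hx2
    · rintro _ ⟨⟨k, rfl⟩, hk⟩
      have hk : k ≠ i := fun h => hk (by rw [h]; rfl)
      rw [hi k hk, h'.coord_vert, if_neg hk.symm]
  have hlt : h'.coord i (S.vert i) < 0 := by
    refine lt_of_le_of_ne hle fun h0 => ?_
    have := hprop (S'.vert i)
    rw [h0, mul_zero, h'.coord_vert, if_pos rfl] at this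
    exact one_ne_zero this
  have hzero : ∀ v ∈ W, h.coord i v = 0 := fun v hv => by
    have h1 := h.mem_carrier_iff_coord.1 (hWS hv) i
    have h2 := h'.mem_carrier_iff_coord.1 (hWS' hv) i
    rw [hprop] at h2
    nlinarith
  have hzero' : ∀ v ∈ W, h'.coord i v = 0 := fun v hv => by
    rw [hprop, hzero v hv, zero_mul]
  -- the affine map
  set A : Sp d →ᵃ[ℝ] Sp d := AffineMap.id ℝ (Sp d) +
    (LinearMap.toSpanSingleton ℝ (Sp d) (S'.vert i - S.vert i)).toAffineMap.comp (h.coord i) with hA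
  have hAx (x) : A x = x + h.coord i x • (S'.vert i - S.vert i) := by simp [hA]
  have hAS : S.map A = S' := by
    rcases S' with ⟨v', t'⟩
    simp only [map, mk.injEq]
    refine ⟨?_, ht⟩
    funext k
    simp only [Function.comp]
    rw [hAx, h.coord_vert]
    by_cases hk : k = i
    · subst hk; simp
    · rw [if_neg (Ne.symm hk), zero_smul, add_zero]; exact hi k hk
  have hAW : ∀ v ∈ W, A v = v := fun v hv => by rw [hAx, hzero v hv, zero_smul, add_zero]
  have hĉ : c.map A ∈ unif {S'} n := by rw [← hAS]; exact unif_map A hc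
  have hĉA := hS'.unif hĉ
  have hWĉ : W ⊆ (c.map A).verts := fun v hv => by
    rw [verts_map]; exact ⟨v, hv.1, hAW v hv⟩
  have hpos (T : TaggedSimplex d) (hT : T ∈ unif {S'} n) (hWT : W ⊆ T.verts) :
      ∃ p ∈ T.carrier, 0 < h'.coord i p := by
    by_contra hcon
    push Not at hcon
    have hT0 : ∀ v ∈ T.verts, h'.coord i v = 0 := fun v hv =>
      le_antisymm (hcon v (T.verts_subset_carrier hv))
        (h'.mem_carrier_iff_coord.1 (hS'.unif_subset hT (T.verts_subset_carrier hv)) i)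
    have := (hS'.unif hT).nondeg.affine_apply (h'.coord i) (S'.vert i)
    rw [h'.coord_vert, if_pos rfl, Finset.sum_eq_zero] at this
    · exact one_ne_zero this
    · intro k _; rw [hT0 _ (T.vert_mem k), mul_zero]
  obtain ⟨p, hp, hp0⟩ := hpos _ hĉ hWĉ
  obtain ⟨p', hp', hp0'⟩ := hpos _ hc' inter_subset_right
  have hov := hĉA.nondeg.overlap hS.pos hcc'.nondeg hWĉ inter_subset_right hcard hzero' hp hp' hp0 hp0'
  have heq : c.map A = c' := by
    by_contra hne
    obtain ⟨x, hx1, hx2⟩ := hov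
    exact Set.disjoint_left.1 ((nonOverlap_singleton S').unif (by rintro _ rfl; exact hS') n _ hĉ _ hc' hne)
      hx1 hx2
  rw [← heq, ends_map]
  ext v
  constructor
  · rintro ⟨u, hu, rfl⟩
    rw [hAW u ⟨c.ends_subset hu, hends hu⟩]; exact hu
  · intro hv
    exact ⟨v, hv, hAW v ⟨c.ends_subset hv, hends hv⟩⟩

lemma reflect_vert_of {S : TaggedSimplex d} {k : ℕ} (h0 : k ≠ 0) (hd : k < d) :
    S.reflect.vert (Fin.ofNat (d + 1) k) = if k ≤ S.type then S.vert (Fin.ofNat (d + 1) k) else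
      S.vert (Fin.ofNat (d + 1) (d + S.type - k)) := by
  simp only [reflect]
  rw [ofNat_val (by omega), if_neg h0, if_neg (by omega)]

lemma reflect_zero (S : TaggedSimplex d) : S.reflect.vert 0 = S.vert (Fin.last d) := by
  simp [reflect]

lemma reflect_last (S : TaggedSimplex d) : S.reflect.vert (Fin.last d) = S.vert 0 := by
  simp only [reflect]
  by_cases h : d = 0
  · subst h; simp
  · simp [h]

lemma child₁_reflect {S : TaggedSimplex d} : S.reflect.child₁ = S.child₂ := by
  simp only [child₁, child₂, mk.injEq]
  refine ⟨?_, rfl⟩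
  funext k
  rw [reflect_zero, reflect_last, midpoint_comm]
  split_ifs with h0 h1 h2
  · rfl
  · rfl
  · rw [reflect_vert_of (by omega) (by omega), if_pos (by omega)]
  · rw [reflect_vert_of (by omega) (by omega), if_neg (by omega)]
    congr 2; omega

lemma child₂_reflect {S : TaggedSimplex d} (hS : S.type < d) : S.reflect.child₂ = S.child₁ := by
  simp only [child₁, child₂, mk.injEq]
  refine ⟨?_, rfl⟩
  funext k
  have htype : S.reflect.type = S.type := rfl
  rw [reflect_zero, reflect_last, midpoint_comm, htype]
  split_ifs with h0 h1 h2
  · rfl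
  · rfl
  · rw [reflect_vert_of (by omega) (by omega), if_pos (by omega)]
  · rw [reflect_vert_of (by omega) (by omega), if_neg (by omega)]
    congr 2; omega

lemma bisect_reflect {S : TaggedSimplex d} (hS : S.type < d) : S.reflect.bisect = S.bisect := by
  rw [bisect, bisect, child₁_reflect, child₂_reflect hS, pair_comm]

lemma ends_reflect (S : TaggedSimplex d) : S.reflect.ends = S.ends := by
  rw [ends, ends, reflect_zero, reflect_last, pair_comm]

lemma verts_reflect {S : TaggedSimplex d} (hS : S.type < d) : S.reflect.verts = S.verts := by
  apply Subset.antisymm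
  · rintro _ ⟨k, rfl⟩
    simp only [reflect]
    split_ifs <;> exact S.vert_mem _
  · rintro _ ⟨k, rfl⟩
    have hk : k = Fin.ofNat (d + 1) k.val := by simp
    by_cases h0 : k.val = 0
    · have : k = 0 := Fin.ext h0
      rw [this, ← reflect_last]; exact vert_mem _ _
    by_cases h1 : k.val = d
    · have : k = Fin.last d := Fin.ext h1
      rw [this, ← reflect_zero]; exact vert_mem _ _
    by_cases h2 : k.val ≤ S.type
    · have := reflect_vert_of (S := S) (k := k.val) h0 (by omega)
      rw [if_pos h2, ← hk] at this
      rw [← this]; exact vert_mem _ _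
    · have := reflect_vert_of (S := S) (k := d + S.type - k.val) (by omega) (by omega)
      rw [if_neg (by omega), show d + S.type - (d + S.type - k.val) = k.val by omega, ← hk] at this
      rw [← this]; exact vert_mem _ _

lemma Adm.reflect {S : TaggedSimplex d} (hS : S.Adm) : S.reflect.Adm := by
  refine ⟨hS.pos, nondeg_of_affineSpan ?_, hS.type_lt⟩
  rw [verts_reflect hS.type_lt, hS.nondeg.affineSpan_eq]

lemma edgeOK_of_reflectedNeighbours {S S' : TaggedSimplex d} (hS : S.Adm) (hS' : S'.Adm)
    (ht : S.type = S'.type) (hdis : Disjoint (interior S.carrier) (interior S'.carrier))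
    (hR : ReflectedNeighbours S S') {n : ℕ} {c c' : TaggedSimplex d}
    (hc : c ∈ unif {S} n) (hc' : c' ∈ unif {S'} n) : EdgeOK c c' := by
  obtain ⟨i, hi | hi⟩ := hR
  · exact edgeOK_of_eq_off hS hS' ht hdis hi hc hc'
  · have hv := verts_reflect hS.type_lt
    have hdis' : Disjoint (interior S.reflect.carrier) (interior S'.carrier) := by
      rwa [carrier_eq_of_verts hv]
    have key := fun {c} => edgeOK_of_eq_off hS.reflect hS' ht hdis' hi (n := n) (c := c) (c' := c')
    cases n with
    | zero =>
      rw [unif_zero, mem_singleton_iff] at hc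
      have := key (c := S.reflect) rfl hc'
      rw [EdgeOK, hv, ends_reflect] at this
      rw [hc]; exact this
    | succ n =>
      refine key ?_ hc'
      rw [unif_succ', refineAll_singleton] at hc ⊢
      rwa [bisect_reflect hS.type_lt]

lemma mid_notMem_child (S : TaggedSimplex d) (hS : S.Adm) : S.vert 0 ∉ S.child₂.verts := by
  rw [verts_child₂ hS.nondeg hS.pos hS.type_lt]
  rintro (h | h)
  · exact hS.nondeg.mid_notMem hS.pos (h ▸ S.vert_mem 0)
  · exact h.2 rfl

lemma child₁_vert_zero (S : TaggedSimplex d) : S.child₁.vert 0 = S.vert 0 := by simp [child₁]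
lemma child₂_vert_zero (S : TaggedSimplex d) : S.child₂.vert 0 = S.vert (Fin.last d) := by
  simp [child₂]

lemma child₂_vert_of_two_le (S : TaggedSimplex d) {k : Fin (d + 1)} (hk : 2 ≤ k.val) :
    S.child₂.vert k = if k.val ≤ S.type + 1 then S.vert (Fin.ofNat (d + 1) (k.val - 1)) else
      S.vert (Fin.ofNat (d + 1) (d + S.type + 1 - k.val)) := by
  simp only [child₂]
  rw [if_neg (by omega), if_neg (by omega)]

/-- Grandchildren at the common facet of the two children of a simplex are reflected neighbours. -/
lemma reflectedNeighbours_grandchildren {S : TaggedSimplex d} (hd : 2 ≤ d) (hS : S.Adm) :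
    ReflectedNeighbours S.child₁.child₂ S.child₂.child₂ := by
  have ht := hS.type_lt
  have hlast : (Fin.last d).val = d := rfl
  have h1 (k : ℕ) (hk1 : 2 ≤ k) (hk : k ≤ d) : S.child₁.vert (Fin.ofNat (d + 1) k) =
      S.vert (Fin.ofNat (d + 1) (k - 1)) := by
    simp only [child₁]
    rw [ofNat_val hk, if_neg (by omega), if_neg (by omega)]
  have h1' (k : ℕ) (hk1 : k = 1) : S.child₁.vert (Fin.ofNat (d + 1) k) = S.mid := by
    subst hk1
    simp only [child₁]
    rw [ofNat_val (by omega), if_neg (by omega), if_pos rfl]; rfl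
  have h2 (k : ℕ) (hk1 : 2 ≤ k) (hk : k ≤ d) : S.child₂.vert (Fin.ofNat (d + 1) k) =
      if k ≤ S.type + 1 then S.vert (Fin.ofNat (d + 1) (k - 1)) else
        S.vert (Fin.ofNat (d + 1) (d + S.type + 1 - k)) := by
    simp only [child₂]
    rw [ofNat_val hk, if_neg (by omega), if_neg (by omega)]
  have h2' (k : ℕ) (hk1 : k = 1) : S.child₂.vert (Fin.ofNat (d + 1) k) = S.mid := by
    subst hk1
    simp only [child₂]
    rw [ofNat_val (by omega), if_neg (by omega), if_pos rfl]; rfl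
  have hl1 : S.child₁.vert (Fin.last d) = S.vert (Fin.ofNat (d + 1) (d - 1)) := by
    have := h1 d hd le_rfl
    rwa [show Fin.ofNat (d + 1) d = Fin.last d from Fin.ext (ofNat_val le_rfl)] at this
  have hl2 : S.child₂.vert (Fin.last d) =
      if d ≤ S.type + 1 then S.vert (Fin.ofNat (d + 1) (d - 1)) else
        S.vert (Fin.ofNat (d + 1) (S.type + 1)) := by
    have := h2 d hd le_rfl
    rw [show Fin.ofNat (d + 1) d = Fin.last d from Fin.ext (ofNat_val le_rfl)] at this
    rw [this]; congr 3; omega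
  have htype1 : S.child₁.type = (S.type + 1) % d := rfl
  have htype2 : S.child₂.type = (S.type + 1) % d := rfl
  have htype3 : S.child₁.child₂.type = ((S.type + 1) % d + 1) % d := rfl
  have e1 : (Fin.ofNat (d + 1) 1).val = 1 := ofNat_val (by omega)
  -- the vertices at position `1`, the midpoints of the refinement edges of the children, may differ
  refine ⟨Fin.ofNat (d + 1) 1, ?_⟩
  have hg0 : S.child₁.child₂.vert 0 = S.vert (Fin.ofNat (d + 1) (d - 1)) := by
    rw [child₂_vert_zero, hl1]
  have hg0' : S.child₂.child₂.vert 0 = if d ≤ S.type + 1 then S.vert (Fin.ofNat (d + 1) (d - 1)) else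
        S.vert (Fin.ofNat (d + 1) (S.type + 1)) := by
    rw [child₂_vert_zero, hl2]
  by_cases hw : S.type + 1 = d
  · -- the type of the children is `0`
    left
    intro k hk
    have hk1 : k.val ≠ 1 := fun h => hk (Fin.ext (by rw [e1]; exact h))
    by_cases h0 : k.val = 0
    · have : k = 0 := Fin.ext h0
      rw [this, hg0, hg0', if_pos (by omega)]
    have ht0 : (S.type + 1) % d = 0 := by rw [hw, Nat.mod_self]
    simp only [child₂, htype1, ht0] at *
    rw [if_neg h0, if_neg hk1, if_neg (by omega), if_neg h0, if_neg hk1, if_neg (by omega)]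
    by_cases hkd : k.val = d
    · rw [h1' _ (by omega), h2' _ (by omega)]
    · rw [h1 _ (by omega) (by omega), h2 _ (by omega) (by omega), if_pos (by omega)]
  · have ht1 : (S.type + 1) % d = S.type + 1 := Nat.mod_eq_of_lt (by omega)
    by_cases hw2 : S.type + 2 = d
    · -- the type of the grandchildren is `0`
      left
      intro k hk
      have hk1 : k.val ≠ 1 := fun h => hk (Fin.ext (by rw [e1]; exact h))
      by_cases h0 : k.val = 0
      · have : k = 0 := Fin.ext h0
        rw [this, hg0, hg0', if_neg (by omega)]
        congr 2; omega
      simp only [child₂, htype1, ht1] at *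
      rw [if_neg h0, if_neg hk1, if_pos (by omega), if_neg h0, if_neg hk1, if_pos (by omega)]
      by_cases hk2 : k.val = 2
      · rw [h1' _ (by omega), h2' _ (by omega)]
      · rw [h1 _ (by omega) (by omega), h2 _ (by omega) (by omega), if_pos (by omega)]
    · -- otherwise types never wrap around, and the second grandchild agrees with the reflection of
      -- the first one
      right
      have ht2 : ((S.type + 1) % d + 1) % d = S.type + 2 := by
        rw [ht1]; exact Nat.mod_eq_of_lt (by omega)
      -- vertices of the first grandchild
      have hg (k : ℕ) (hk2 : 3 ≤ k) (hk : k ≤ d) :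
          S.child₁.child₂.vert (Fin.ofNat (d + 1) k) =
          if k ≤ S.type + 2 then S.vert (Fin.ofNat (d + 1) (k - 2)) else
            S.vert (Fin.ofNat (d + 1) (d + S.type + 1 - k)) := by
        simp only [child₂, htype1, ht1]
        rw [ofNat_val hk, if_neg (by omega), if_neg (by omega)]
        split_ifs with h
        · rw [h1 _ (by omega) (by omega)]; congr 2
        · rw [h1 _ (by omega) (by omega)]; congr 2; omega
      have hg2 (k : ℕ) (hk : k = 2) : S.child₁.child₂.vert (Fin.ofNat (d + 1) k) = S.mid := by
        subst hk
        simp only [child₂, htype1, ht1]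
        rw [ofNat_val hd, if_neg (by omega), if_neg (by omega), if_pos (by omega), h1' _ (by omega)]
      have hg' (k : Fin (d + 1)) (hk2 : 3 ≤ k.val) :
          S.child₂.child₂.vert k =
          if k ≤ S.type + 2 then S.vert (Fin.ofNat (d + 1) (k - 2)) else
            S.vert (Fin.ofNat (d + 1) (k - 1)) := by
        rw [child₂_vert_of_two_le _ (by omega), htype2, ht1]
        split_ifs with h
        · rw [h2 _ (by omega) (by omega), if_pos (by omega)]; congr 2
        · rw [h2 _ (by omega) (by omega), if_neg (by omega)]; congr 2; omega
      have hg2' (k : Fin (d + 1)) (hk : k.val = 2) : S.child₂.child₂.vert k = S.mid := by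
        rw [child₂_vert_of_two_le _ (by omega), htype2, ht1, if_pos (by omega), hk]
        exact h2' 1 rfl
      intro k hk
      have hk1 : k.val ≠ 1 := fun h => hk (Fin.ext (by rw [e1]; exact h))
      by_cases h0 : k.val = 0
      · have : k = 0 := Fin.ext h0
        rw [this, reflect_zero, hg0', if_neg (by omega)]
        have := hg d (by omega) le_rfl
        rw [show Fin.ofNat (d + 1) d = Fin.last d from Fin.ext (ofNat_val le_rfl)] at this
        rw [this, if_neg (by omega)]; congr 2; omega
      by_cases hkd : k.val = d
      · have : k = Fin.last d := Fin.ext hkd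
        rw [this, reflect_last, hg0, hg' _ (by simp; omega), if_neg (by simp; omega)]
        rfl
      have hkk : k = Fin.ofNat (d + 1) k.val := by simp
      rw [hkk, reflect_vert_of h0 (by omega), htype3, ht2, ← hkk]
      by_cases hk2 : k.val = 2
      · rw [if_pos (by omega), hg2' k hk2]
        have := hg2 k.val hk2
        rwa [← hkk] at this
      · rw [hg' k (by omega)]
        split_ifs with h
        · have := hg k.val (by omega) (by omega)
          rwa [← hkk, if_pos h] at this
        · rw [hg _ (by omega) (by omega), if_neg (by omega)]; congr 2; omega

lemma Nondeg.weight_single_other {S : TaggedSimplex d} (h : S.Nondeg) {k l} (hkl : k ≠ l) :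
    h.coord k (S.vert l) = 0 := by rw [h.coord_vert, if_neg hkl]

/-- A facet of a descendant of the first child of `C` is not contained in a hyperplane where the
coordinate at the vertex `C.vert 0` vanishes. -/
lemma not_facet_child₁ {C c : TaggedSimplex d} (hC : C.Adm) (hc : c.Nondeg) {W : Set (Sp d)}
    (hW : W ⊆ c.verts) (hcard : d ≤ W.ncard) (hWC : W ⊆ C.child₁.carrier)
    (h0 : ∀ v ∈ W, hC.nondeg.coord 0 v = 0) : False := by
  have hl : ∀ v ∈ W, hC.nondeg.coord (Fin.last d) v = 0 := fun v hv => by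
    have h1 := hC.coord_le_of_child₁ (hWC hv)
    have h2 := hC.nondeg.mem_carrier_iff_coord.1
      (hC.child_subset (Or.inl rfl) (hWC hv)) (Fin.last d)
    rw [h0 v hv] at h1; exact le_antisymm h1 h2
  have := hc.affine_dependent hW hcard h0 hl (p := C.vert 0)
    (by rw [hC.nondeg.coord_vert, if_pos rfl]; norm_num)
    (hC.nondeg.weight_single_other (zero_ne_last hC.pos).symm) (C.vert (Fin.last d))
  rw [hC.nondeg.coord_vert, if_pos rfl] at this
  exact one_ne_zero this

/-- Facet neighbours among the descendants of the two different children of a simplex. -/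
lemma edgeOK_siblings {S : TaggedSimplex d} (hd : 2 ≤ d) (hS : S.Adm) {n : ℕ}
    {c c' : TaggedSimplex d} (hc : c ∈ unif {S.child₁} n) (hc' : c' ∈ unif {S.child₂} n) :
    EdgeOK c c' := by
  have hC := hS.child (c := S.child₁) (Or.inl rfl)
  have hC' := hS.child (c := S.child₂) (Or.inr rfl)
  have hdis := hS.disjoint_children
  cases n with
  | zero =>
    rw [unif_zero, mem_singleton_iff] at hc hc'
    subst hc; subst hc'
    intro _ hends
    exfalso
    have : S.vert 0 ∈ S.child₂.verts := hends (Or.inl (child₁_vert_zero S).symm)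
    exact mid_notMem_child S hS this
  | succ n =>
    intro hcard hends
    obtain ⟨g, hg, hcg⟩ := mem_unif_succ_of_bisect.1 hc
    obtain ⟨g', hg', hcg'⟩ := mem_unif_succ_of_bisect.1 hc'
    have hgA := hC.child hg
    have hgA' := hC'.child hg'
    set W := c.verts ∩ c'.verts with hWdef
    have hW1 : W ⊆ g.carrier := fun v hv => hgA.unif_subset hcg (c.verts_subset_carrier hv.1)
    have hW2 : W ⊆ g'.carrier := fun v hv => hgA'.unif_subset hcg' (c'.verts_subset_carrier hv.2)
    have hW1' := hW1.trans (hC.child_subset hg)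
    have hW2' := hW2.trans (hC'.child_subset hg')
    have hcN := (hC.unif hc).nondeg
    have hcN' := (hC'.unif hc').nondeg
    -- on the intersection of the two children the coordinates at `x₀` and `x_d` vanish
    have hb (v) (hv : v ∈ W) : ∃ w, IsBary S.verts v w ∧
        IsBary S.child₁.verts v (S.split w) ∧ IsBary S.child₂.verts v (S.split w) ∧
        w (S.vert 0) = w (S.vert (Fin.last d)) := by
      obtain ⟨u, hu⟩ := mem_carrier_iff.1 (hW1' hv)
      obtain ⟨u', hu'⟩ := mem_carrier_iff.1 (hW2' hv)
      obtain ⟨w, hw, hle, rfl⟩ := hS.isBary_child₁.1 hu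
      obtain ⟨w', hw', hle', rfl⟩ := hS.isBary_child₂.1 hu'
      obtain rfl := hS.nondeg.wIndep.isBary_unique hw hw'
      exact ⟨w, hw, hu, hu', le_antisymm hle' hle⟩
    have hz1 : ∀ v ∈ W, hC.nondeg.coord 0 v = 0 := fun v hv => by
      obtain ⟨w, hw, h1, h2, he⟩ := hb v hv
      rw [← hC.nondeg.weight_eq_coord h1, child₁_vert_zero, split, splitWeights, he, min_self]
      simp [splitVec_left hS.ends_ne, he]
    have hz2 : ∀ v ∈ W, hC'.nondeg.coord 0 v = 0 := fun v hv => by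
      obtain ⟨w, hw, h1, h2, he⟩ := hb v hv
      rw [← hC'.nondeg.weight_eq_coord h2, child₂_vert_zero, split, splitWeights, he, min_self]
      simp [splitVec_right hS.ends_ne]
    rcases hg with rfl | rfl
    · exact (not_facet_child₁ hC hcN inter_subset_left hcard hW1 hz1).elim
    rcases hg' with rfl | rfl
    · exact (not_facet_child₁ hC' hcN' inter_subset_right hcard hW2 hz2).elim
    refine edgeOK_of_reflectedNeighbours hgA hgA' rfl ?_ (reflectedNeighbours_grandchildren hd hS)
      hcg hcg' hcard hends
    exact hdis.mono (interior_mono (hC.child_subset (Or.inr rfl)))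
      (interior_mono (hC'.child_subset (Or.inr rfl)))

/-- Facet neighbours among the descendants of one simplex. -/
lemma edgeOK_same_root {S : TaggedSimplex d} (hd : 2 ≤ d) (hS : S.Adm) {n : ℕ}
    {c c' : TaggedSimplex d} (hc : c ∈ unif {S} n) (hc' : c' ∈ unif {S} n) : EdgeOK c c' := by
  induction n generalizing S with
  | zero =>
    rw [unif_zero, mem_singleton_iff] at hc hc'
    subst hc; subst hc'
    exact fun _ _ => rfl
  | succ n ih =>
    obtain ⟨C, hC, hcC⟩ := mem_unif_succ_of_bisect.1 hc
    obtain ⟨C', hC', hcC'⟩ := mem_unif_succ_of_bisect.1 hc'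
    have hrefl : ∀ c c', c ∈ unif {S.child₁} n → c' ∈ unif {S.child₂} n → EdgeOK c' c := by
      -- apply the result for siblings to the reflected simplex
      intro c c' h h'
      have h1 := child₁_reflect (S := S)
      have h2 := child₂_reflect hS.type_lt
      rw [← h2] at h; rw [← h1] at h'
      exact edgeOK_siblings hd hS.reflect h' h
    rcases hC with rfl | rfl <;> rcases hC' with rfl | rfl
    · exact ih (hS.child (Or.inl rfl)) hcC hcC'
    · exact edgeOK_siblings hd hS hcC hcC'
    · exact hrefl _ _ hcC' hcC
    · exact ih (hS.child (Or.inr rfl)) hcC hcC'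

/-- The set of simplices satisfies the matching condition. -/
structure Matched (𝒯 : Set (TaggedSimplex d)) : Prop where
  adm : ∀ S ∈ 𝒯, S.Adm
  type : ∀ S ∈ 𝒯, ∀ S' ∈ 𝒯, S.type = S'.type
  nonOverlap : NonOverlap 𝒯
  matching : ∀ S ∈ 𝒯, ∀ S' ∈ 𝒯, S ≠ S' → ShareFacet S S' → Match S S'

lemma refEdge_subset_of_ends {S : TaggedSimplex d} {A : Set (Sp d)} (hA : Convex ℝ A)
    (h : S.ends ⊆ A) : S.refEdge ⊆ A :=
  hA.segment_subset (h (Or.inl rfl)) (h (Or.inr rfl))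

/-- In uniform refinements of a well-labelled triangulation, refinement edges are compatible across
facets. -/
lemma Matched.edgeOK {𝒯 : Set (TaggedSimplex d)} (h𝒯 : Matched 𝒯) (hd : 2 ≤ d) {n : ℕ}
    {c c' : TaggedSimplex d} (hc : c ∈ unif 𝒯 n) (hc' : c' ∈ unif 𝒯 n) : EdgeOK c c' := by
  obtain ⟨S, hS, hcS⟩ := mem_unif_iff.1 hc
  obtain ⟨S', hS', hcS'⟩ := mem_unif_iff.1 hc'
  have hA := h𝒯.adm S hS
  have hA' := h𝒯.adm S' hS'
  by_cases hSS : S = S'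
  · subst hSS; exact edgeOK_same_root hd hA hcS hcS'
  intro hcard hends
  have hdis := h𝒯.nonOverlap S hS S' hS' hSS
  set W := c.verts ∩ c'.verts with hWdef
  have hW1 : W ⊆ S.carrier := fun v hv => hA.unif_subset hcS (c.verts_subset_carrier hv.1)
  have hW2 : W ⊆ S'.carrier := fun v hv => hA'.unif_subset hcS' (c'.verts_subset_carrier hv.2)
  have hcN := (hA.unif hcS).nondeg
  have hfac := shareFacet_of_common hA.pos hcN inter_subset_left hcard hW1 hW2 hdis
  obtain ⟨hm1, hm2⟩ := h𝒯.matching S hS S' hS' hSS hfac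
  -- `S` and `S'` are reflected neighbours if the facet contains a refinement edge; otherwise their
  -- children at the facet are
  by_cases hRE : S.refEdge ⊆ S.carrier ∩ S'.carrier ∨ S'.refEdge ⊆ S.carrier ∩ S'.carrier
  · exact edgeOK_of_reflectedNeighbours hA hA' (h𝒯.type S hS S' hS') hdis (hm1 hRE) hcS hcS' hcard hends
  cases n with
  | zero =>
    exfalso
    rw [unif_zero, mem_singleton_iff] at hcS hcS'
    subst hcS; subst hcS'
    apply hRE; left
    exact refEdge_subset_of_ends (c.convex_carrier.inter c'.convex_carrier) fun v hv =>
      ⟨c.verts_subset_carrier (c.ends_subset hv), c'.verts_subset_carrier (hends hv)⟩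
  | succ n =>
    obtain ⟨C, hC, hcC⟩ := mem_unif_succ_of_bisect.1 hcS
    obtain ⟨C', hC', hcC'⟩ := mem_unif_succ_of_bisect.1 hcS'
    have hCA := hA.child hC
    have hCA' := hA'.child hC'
    have hW3 : W ⊆ C.carrier := fun v hv => hCA.unif_subset hcC (c.verts_subset_carrier hv.1)
    have hW4 : W ⊆ C'.carrier := fun v hv => hCA'.unif_subset hcC' (c'.verts_subset_carrier hv.2)
    have hdis' := hdis.mono (interior_mono (hA.child_subset hC)) (interior_mono (hA'.child_subset hC'))
    have hfac' := shareFacet_of_common hA.pos hcN inter_subset_left hcard hW3 hW4 hdis'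
    exact edgeOK_of_reflectedNeighbours hCA hCA'
      (by rw [type_bisect hC, type_bisect hC', h𝒯.type S hS S' hS']) hdis'
      (hm2 hRE C hC C' hC' hfac') hcC hcC' hcard hends

/-- For `d = 1` a refinement edge is not contained in a facet. -/
lemma Matched.edgeOK_of_ne {𝒯 : Set (TaggedSimplex d)} (h𝒯 : Matched 𝒯) (hd : 1 ≤ d) {n : ℕ}
    {c c' : TaggedSimplex d} (hc : c ∈ unif 𝒯 n) (hc' : c' ∈ unif 𝒯 n) (hne : c ≠ c') :
    EdgeOK c c' := by
  rcases Nat.lt_or_ge 1 d with h2 | h1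
  · exact h𝒯.edgeOK h2 hc hc'
  intro hcard hends
  exfalso
  have h1 : d = 1 := by omega
  have hcA := adm_unif h𝒯.adm hc
  have hcA' := adm_unif h𝒯.adm hc'
  have hsub : c.verts ⊆ c'.carrier := by
    rintro _ ⟨k, rfl⟩
    have : c.vert k ∈ c.ends := by
      rcases Nat.lt_or_ge k.val 1 with h | h
      · left; congr 1; exact Fin.ext (by rw [Fin.val_zero]; omega)
      · right; rw [mem_singleton_iff]; congr 1
        exact Fin.ext (by have := k.isLt; rw [Fin.val_last]; omega)
    exact c'.verts_subset_carrier (hends this)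
  have hss : c.carrier ⊆ c'.carrier := convexHull_min hsub c'.convex_carrier
  obtain ⟨x, hx⟩ := hcA.nondeg.interior_nonempty
  exact Set.disjoint_left.1 (h𝒯.nonOverlap.unif h𝒯.adm n c hc c' hc' hne) hx (interior_mono hss hx)

end TaggedSimplex

end

section
variable {d : ℕ}

/-! ### Chains of facet neighbours in conforming triangulations of Lipschitz domains -/

lemma affineSpan_insert_ne_top {U : Set (Sp d)} (hU : U.Finite) (hc : U.ncard < d) (y : Sp d) :
    affineSpan ℝ (insert y U) ≠ ⊤ := by
  intro htop
  have hfin : (insert y U).Finite := hU.insert y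
  have hcard : (insert y U).ncard ≤ d := (ncard_insert_le y U).trans (by omega)
  have hpos : 0 < (insert y U).ncard := (ncard_pos hfin).2 (insert_nonempty _ _)
  have := hfin.fintype
  have h1 : Fintype.card (insert y U : Set (Sp d)) = ((insert y U).ncard - 1) + 1 := by
    rw [← Nat.card_eq_fintype_card, Nat.card_coe_set_eq]; omega
  have h2 := finrank_vectorSpan_range_le ℝ (fun v : (insert y U : Set (Sp d)) => (v : Sp d)) h1
  have h3 : vectorSpan ℝ (range (fun v : (insert y U : Set (Sp d)) => (v : Sp d))) = ⊤ := by
    rw [Subtype.range_coe, ← direction_affineSpan, htop, AffineSubspace.direction_top]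
  rw [h3, finrank_top, finrank_euclideanSpace_fin] at h2
  omega

/-- The affine hulls of a point and the faces of codimension at least two. -/
def coneSkeleton (𝒯 : Set (TaggedSimplex d)) (y : Sp d) : Set (Sp d) :=
  ⋃ S ∈ 𝒯, ⋃ U ∈ {U : Set (Sp d) | U ⊆ S.verts ∧ U.ncard < d}, (affineSpan ℝ (insert y U) : Set (Sp d))

lemma volume_coneSkeleton {𝒯 : Set (TaggedSimplex d)} (h : 𝒯.Finite) (y : Sp d) :
    volume (coneSkeleton 𝒯 y) = 0 := by
  rw [coneSkeleton, measure_biUnion_null_iff h.countable]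
  intro S _
  have hf : {U : Set (Sp d) | U ⊆ S.verts ∧ U.ncard < d}.Finite :=
    S.finite_verts.finite_subsets.subset fun U hU => hU.1
  rw [measure_biUnion_null_iff hf.countable]
  intro U hU
  exact Measure.addHaar_affineSubspace _ _
    (affineSpan_insert_ne_top (S.finite_verts.subset hU.1) hU.2 y)

lemma exists_mem_diff_null {O N : Set (Sp d)} (hO : IsOpen O) (hne : O.Nonempty)
    (hN : volume N = 0) : ∃ y ∈ O, y ∉ N := by
  by_contra hcon
  push Not at hcon
  have := hO.measure_pos volume hne
  rw [measure_mono_null hcon hN] at this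
  exact lt_irrefl _ this

/-- `A` and `B` share a facet, and `B` contains `z`. -/
def FacetStep (𝒯 : Set (TaggedSimplex d)) (z : Sp d) (A B : TaggedSimplex d) : Prop :=
  B ∈ 𝒯 ∧ z ∈ B.carrier ∧ d ≤ (A.verts ∩ B.verts).ncard

/-- Two simplices met by a segment in the interior of the domain, close to `z`, are connected by
a chain of facet neighbours: a generic segment avoids all faces of codimension at least two. -/
lemma facetChain_of_segment {𝒯 : Set (TaggedSimplex d)} (hfin : 𝒯.Finite)
    (hN : ∀ S ∈ 𝒯, S.Nondeg) (hconf : ∀ S ∈ 𝒯, ∀ S' ∈ 𝒯, S.Conf S') {z : Sp d} {U : Set (Sp d)}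
    (hU : IsOpen U) (hcov : U ⊆ ⋃ S ∈ 𝒯, S.carrier)
    (hz : ∀ S ∈ 𝒯, (U ∩ S.carrier).Nonempty → z ∈ S.carrier) {y y' : Sp d}
    (hseg : segment ℝ y y' ⊆ U) {S S' : TaggedSimplex d} (hS : S ∈ 𝒯) (hS' : S' ∈ 𝒯)
    (hy : y ∈ S.carrier) (hy' : y' ∈ S'.carrier) :
    Relation.ReflTransGen (FacetStep 𝒯 z) S S' := by
  have hcomp : IsCompact (segment ℝ y y') := by
    rw [segment_eq_image_lineMap]
    exact isCompact_Icc.image AffineMap.lineMap_continuous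
  obtain ⟨ε, hε, hthick⟩ := hcomp.exists_thickening_subset_open hU hseg
  -- generic end points: the line through them avoids the faces of codimension at least two
  obtain ⟨y₁, ⟨hy₁b, hy₁S⟩, hy₁N⟩ := exists_mem_diff_null
    (Metric.isOpen_ball.inter isOpen_interior)
    ((hN S hS).inter_interior_nonempty Metric.isOpen_ball (Metric.mem_ball_self hε) hy)
    (volume_coneSkeleton hfin y)
  obtain ⟨y₂, ⟨hy₂b, hy₂S⟩, hy₂N⟩ := exists_mem_diff_null
    (Metric.isOpen_ball.inter isOpen_interior)
    ((hN S' hS').inter_interior_nonempty Metric.isOpen_ball (Metric.mem_ball_self hε) hy')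
    (volume_coneSkeleton hfin y₁)
  have hγU (t : ℝ) (ht : t ∈ Icc (0 : ℝ) 1) : AffineMap.lineMap y₁ y₂ t ∈ U := by
    apply hthick
    rw [Metric.mem_thickening_iff]
    refine ⟨AffineMap.lineMap y y' t, ?_, ?_⟩
    · rw [segment_eq_image_lineMap]; exact ⟨t, ht, rfl⟩
    · rw [dist_eq_norm, AffineMap.lineMap_apply_module, AffineMap.lineMap_apply_module]
      rw [Metric.mem_ball, dist_eq_norm] at hy₁b hy₂b
      have : (1 - t) • y₁ + t • y₂ - ((1 - t) • y + t • y') =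
          (1 - t) • (y₁ - y) + t • (y₂ - y') := by module
      rw [this]
      refine (norm_add_le _ _).trans_lt ?_
      rw [norm_smul, norm_smul, Real.norm_of_nonneg ht.1, Real.norm_of_nonneg (by linarith [ht.2])]
      rcases eq_or_lt_of_le ht.1 with h0 | h0
      · rw [← h0]; simpa using hy₁b
      · have h1 : (1 - t) * ‖y₁ - y‖ ≤ (1 - t) * ε :=
          mul_le_mul_of_nonneg_left hy₁b.le (by linarith [ht.2])
        have h2 : t * ‖y₂ - y'‖ < t * ε := mul_lt_mul_of_pos_left hy₂b h0
        linarith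
  -- the times spent in simplices that can be reached from `S`, and in those that cannot, form
  -- closed sets covering the unit interval, hence have a common element
  by_contra hcon
  set TA : Set ℝ := ⋃ B ∈ {B ∈ 𝒯 | Relation.ReflTransGen (FacetStep 𝒯 z) S B},
    (fun t : ℝ => AffineMap.lineMap y₁ y₂ t) ⁻¹' B.carrier with hTA
  set TB : Set ℝ := ⋃ B ∈ {B ∈ 𝒯 | ¬ Relation.ReflTransGen (FacetStep 𝒯 z) S B},
    (fun t : ℝ => AffineMap.lineMap y₁ y₂ t) ⁻¹' B.carrier with hTB
  have hcontγ : Continuous (fun t : ℝ => AffineMap.lineMap y₁ y₂ t) := AffineMap.lineMap_continuous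
  have hclA : IsClosed TA := (hfin.subset (sep_subset _ _)).isClosed_biUnion fun B _ =>
    B.isClosed_carrier.preimage hcontγ
  have hclB : IsClosed TB := (hfin.subset (sep_subset _ _)).isClosed_biUnion fun B _ =>
    B.isClosed_carrier.preimage hcontγ
  have hmem : Icc (0 : ℝ) 1 ⊆ TA ∪ TB := by
    intro t ht
    obtain ⟨B, hB, htB⟩ := mem_iUnion₂.1 (hcov (hγU t ht))
    by_cases hr : Relation.ReflTransGen (FacetStep 𝒯 z) S B
    · exact Or.inl (mem_iUnion₂.2 ⟨B, ⟨hB, hr⟩, htB⟩)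
    · exact Or.inr (mem_iUnion₂.2 ⟨B, ⟨hB, hr⟩, htB⟩)
  have h0A : (0 : ℝ) ∈ TA := mem_iUnion₂.2 ⟨S, ⟨hS, .refl⟩, by
    simpa using interior_subset hy₁S⟩
  have h1B : (1 : ℝ) ∈ TB := mem_iUnion₂.2 ⟨S', ⟨hS', hcon⟩, by
    simpa using interior_subset hy₂S⟩
  obtain ⟨t, ht, htA, htB⟩ := isPreconnected_closed_iff.1 isPreconnected_Icc TA TB hclA hclB hmem
    ⟨0, by simp, h0A⟩ ⟨1, by simp, h1B⟩
  obtain ⟨B, ⟨hB, hrB⟩, htB1⟩ := mem_iUnion₂.1 htA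
  obtain ⟨B', ⟨hB', hrB'⟩, htB2⟩ := mem_iUnion₂.1 htB
  simp only [mem_preimage] at htB1 htB2
  have hcard : (B.verts ∩ B'.verts).ncard < d := by
    by_contra hge
    exact hrB' (hrB.tail ⟨hB', hz B' hB' ⟨_, hγU t ht, htB2⟩, not_lt.1 hge⟩)
  -- at this time the segment is in a face of codimension at least two
  obtain ⟨w, hw⟩ := TaggedSimplex.mem_carrier_iff.1 htB1
  have hw' := (hconf B hB B' hB').isBary_right hw htB2
  have hspan : AffineMap.lineMap y₁ y₂ t ∈ affineSpan ℝ (B.verts ∩ B'.verts) :=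
    convexHull_subset_affineSpan _
      (hw.mono (W := B.verts ∩ B'.verts) fun v hv => ⟨hw.supp v hv, hw'.supp v hv⟩).mem_convexHull
  have hmemU : B.verts ∩ B'.verts ∈ {U : Set (Sp d) | U ⊆ B.verts ∧ U.ncard < d} :=
    ⟨inter_subset_left, hcard⟩
  rcases eq_or_lt_of_le ht.1 with h0 | h0
  · apply hy₁N
    refine mem_iUnion₂.2 ⟨B, hB, mem_iUnion₂.2 ⟨_, hmemU, ?_⟩⟩
    rw [← h0, AffineMap.lineMap_apply_zero] at hspan
    exact affineSpan_mono ℝ (subset_insert _ _) hspan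
  · apply hy₂N
    refine mem_iUnion₂.2 ⟨B, hB, mem_iUnion₂.2 ⟨_, hmemU, ?_⟩⟩
    have h1 : y₁ ∈ affineSpan ℝ (insert y₁ (B.verts ∩ B'.verts)) :=
      subset_affineSpan ℝ _ (mem_insert _ _)
    have h2 := affineSpan_mono ℝ (subset_insert y₁ (B.verts ∩ B'.verts)) hspan
    have := AffineMap.lineMap_mem (1 / t) h1 h2
    convert! this using 1
    rw [AffineMap.lineMap_apply_module, AffineMap.lineMap_apply_module, smul_add, smul_smul,
      smul_smul, one_div_mul_cancel h0.ne', ← add_assoc, ← add_smul]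
    field_simp
    simp

/-- The star of a point in a conforming triangulation of a Lipschitz domain is connected via
facets. -/
lemma facetChain {Ω : Set (Sp d)} (hΩ : IsLipschitzDomain Ω) {𝒯 : Set (TaggedSimplex d)}
    (hfin : 𝒯.Finite) (hN : ∀ S ∈ 𝒯, S.Nondeg) (hconf : ∀ S ∈ 𝒯, ∀ S' ∈ 𝒯, S.Conf S')
    (hcov : ⋃ S ∈ 𝒯, S.carrier = closure Ω) {z : Sp d} {S S' : TaggedSimplex d} (hS : S ∈ 𝒯)
    (hS' : S' ∈ 𝒯) (hz : z ∈ S.carrier) (hz' : z ∈ S'.carrier) :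
    Relation.ReflTransGen (FacetStep 𝒯 z) S S' := by
  obtain ⟨hO, -, -, hch⟩ := hΩ
  -- a ball around `z` which meets no simplices but those containing `z`
  have hcl : IsClosed (⋃ B ∈ {B ∈ 𝒯 | z ∉ B.carrier}, B.carrier) :=
    (hfin.subset (sep_subset _ _)).isClosed_biUnion fun B _ => B.isClosed_carrier
  have hznot : z ∈ (⋃ B ∈ {B ∈ 𝒯 | z ∉ B.carrier}, B.carrier)ᶜ := by
    intro h
    obtain ⟨B, hB, hzB⟩ := mem_iUnion₂.1 h
    exact hB.2 hzB
  obtain ⟨δ₀, hδ₀, hball⟩ := Metric.isOpen_iff.1 hcl.isOpen_compl z hznot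
  have hstar (U : Set (Sp d)) (hU : U ⊆ Metric.ball z δ₀) : ∀ B ∈ 𝒯, (U ∩ B.carrier).Nonempty →
      z ∈ B.carrier := by
    rintro B hB ⟨y, hyU, hyB⟩
    by_contra h
    exact hball (hU hyU) (mem_iUnion₂.2 ⟨B, ⟨hB, h⟩, hyB⟩)
  have hzcl : z ∈ closure Ω := by rw [← hcov]; exact mem_iUnion₂.2 ⟨S, hS, hz⟩
  by_cases hzΩ : z ∈ Ω
  · refine facetChain_of_segment hfin hN hconf (hO.inter Metric.isOpen_ball)
      (U := Ω ∩ Metric.ball z δ₀) ?_ (hstar _ inter_subset_right) ?_ hS hS' hz hz'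
    · rw [hcov]; exact inter_subset_left.trans subset_closure
    · rw [segment_same, singleton_subset_iff]; exact ⟨hzΩ, Metric.mem_ball_self hδ₀⟩
  have hzf : z ∈ frontier Ω := by rw [frontier, hO.interior_eq]; exact ⟨hzcl, hzΩ⟩
  -- at a boundary point, move up in the direction `e` by `s`, then across, and down again; the
  -- height `s` outweighs the variation of `φ` and of the height on a ball of radius `δ`
  obtain ⟨e, φ, K, r, he, hr, hφ, hφe, hΩr⟩ := hch z hzf
  have hin (x : Sp d) (hx : x ∈ Metric.ball z r) : x ∈ Ω ↔ φ x < inner ℝ e x := by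
    have := Set.ext_iff.1 hΩr x
    simp only [mem_inter_iff, hx, true_and] at this
    exact this
  set r' := min r δ₀ with hr'
  have hr'0 : 0 < r' := lt_min hr hδ₀
  set δ := r' / (2 * (3 + 2 * K)) with hδ
  have hK : (0 : ℝ) ≤ K := K.2
  have hδ0 : 0 < δ := by positivity
  have hδr : δ * (3 + 2 * K) < r' := by
    rw [hδ, div_mul_eq_mul_div, div_lt_iff₀ (by positivity)]
    nlinarith
  set s := (2 * K + 2) * δ with hs
  have hs0 : 0 < s := by positivity
  have hstart (B : TaggedSimplex d) (hB : B ∈ 𝒯) (hzB : z ∈ B.carrier) :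
      ∃ y ∈ B.carrier, y ∈ Ω ∧ dist y z < δ := by
    have hne := (hN B hB).inter_interior_nonempty Metric.isOpen_ball (Metric.mem_ball_self hδ0) hzB
    obtain ⟨p, hpb, hpB⟩ := hne
    have hpcl : p ∈ closure Ω := by
      rw [← hcov]; exact mem_iUnion₂.2 ⟨B, hB, interior_subset hpB⟩
    obtain ⟨y, ⟨hyb, hyB⟩, hyΩ⟩ := mem_closure_iff.1 hpcl _
      (Metric.isOpen_ball.inter isOpen_interior) ⟨hpb, hpB⟩
    exact ⟨y, interior_subset hyB, hyΩ, hyb⟩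
  obtain ⟨y, hyS, hyΩ, hyz⟩ := hstart S hS hz
  obtain ⟨y', hyS', hyΩ', hyz'⟩ := hstart S' hS' hz'
  set U := Ω ∩ Metric.ball z r' with hUdef
  have hUo : IsOpen U := hO.inter Metric.isOpen_ball
  have hUcov : U ⊆ ⋃ B ∈ 𝒯, B.carrier := by
    rw [hcov]; exact inter_subset_left.trans subset_closure
  have hUstar := hstar U (inter_subset_right.trans (Metric.ball_subset_ball (min_le_right _ _)))
  have hinner (x : Sp d) (t : ℝ) : inner ℝ e (x + t • e) = inner ℝ e x + t := by
    rw [inner_add_right, inner_smul_right, real_inner_self_eq_norm_sq, he]; ring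
  have hUin (x : Sp d) (hx : dist x z < r') (hlt : φ x < inner ℝ e x) : x ∈ U := by
    refine ⟨(hin x ?_).2 hlt, hx⟩
    exact Metric.mem_ball.2 (hx.trans_le (min_le_left _ _))
  have hφlt (x : Sp d) (hx : dist x z < δ) (hxΩ : x ∈ Ω) : φ x < inner ℝ e x := by
    refine (hin x ?_).1 hxΩ
    rw [Metric.mem_ball]
    have := min_le_left r δ₀
    nlinarith
  have hdist (x : Sp d) (t : ℝ) (ht : 0 ≤ t) (hts : t ≤ s) (hx : dist x z < δ) :
      dist (x + t • e) z < r' := by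
    have : dist (x + t • e) z ≤ t + dist x z := by
      refine (dist_triangle _ x _).trans ?_
      rw [dist_eq_norm (x + t • e) x, add_sub_cancel_left, norm_smul, he, mul_one,
        Real.norm_of_nonneg ht]
    have : s + δ = δ * (3 + 2 * K) := by rw [hs]; ring
    linarith
  have hvert (x : Sp d) (hx : dist x z < δ) (hxΩ : x ∈ Ω) : segment ℝ x (x + s • e) ⊆ U := by
    rw [segment_eq_image']
    rintro _ ⟨t, ht, rfl⟩
    have h1 : x + t • (x + s • e - x) = x + (t * s) • e := by module
    simp only [h1]
    have hts0 : 0 ≤ t * s := mul_nonneg ht.1 hs0.le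
    refine hUin _ (hdist x _ hts0 (by nlinarith [ht.2]) hx) ?_
    rw [hφe, hinner]
    linarith [hφlt x hx hxΩ]
  have hhor : segment ℝ (y + s • e) (y' + s • e) ⊆ U := by
    rw [segment_eq_image']
    rintro _ ⟨t, ht, rfl⟩
    have h1 : y + s • e + t • (y' + s • e - (y + s • e)) = (y + t • (y' - y)) + s • e := by module
    simp only [h1]
    set q := y + t • (y' - y) with hq
    have hqz : dist q z < δ := by
      have hc := (convex_ball z δ).segment_subset (Metric.mem_ball.2 hyz) (Metric.mem_ball.2 hyz')
      apply hc
      rw [segment_eq_image']; exact ⟨t, ht, rfl⟩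
    refine hUin _ (hdist q s hs0.le le_rfl hqz) ?_
    rw [hφe, hinner]
    have hqy : dist q y ≤ 2 * δ := by
      have := dist_triangle q z y
      rw [dist_comm z y] at this; linarith
    have hL := hφ.dist_le_mul q y
    have h3 : φ q ≤ φ y + K * (2 * δ) := by
      have : φ q - φ y ≤ dist (φ q) (φ y) := le_abs_self _
      have : (K : ℝ) * dist q y ≤ K * (2 * δ) := mul_le_mul_of_nonneg_left hqy hK
      linarith
    have h4 : inner ℝ e y ≤ inner ℝ e q + 2 * δ := by
      have h5 : inner ℝ e (y - q) ≤ ‖e‖ * ‖y - q‖ := real_inner_le_norm _ _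
      rw [he, one_mul, ← dist_eq_norm, dist_comm, inner_sub_right] at h5
      linarith
    have h5 := hφlt y hyz hyΩ
    have : s = 2 * K * δ + 2 * δ := by rw [hs]; ring
    linarith
  have hex (x : Sp d) (hx : x ∈ U) : ∃ B ∈ 𝒯, x ∈ B.carrier := by
    obtain ⟨B, hB, hxB⟩ := mem_iUnion₂.1 (hUcov hx); exact ⟨B, hB, hxB⟩
  obtain ⟨A, hA, hyA⟩ := hex _ (hhor (left_mem_segment _ _ _))
  obtain ⟨A', hA', hyA'⟩ := hex _ (hhor (right_mem_segment _ _ _))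
  have c1 := facetChain_of_segment hfin hN hconf hUo hUcov hUstar (hvert y hyz hyΩ) hS hA hyS hyA
  have c2 := facetChain_of_segment hfin hN hconf hUo hUcov hUstar hhor hA hA' hyA hyA'
  have c3 := facetChain_of_segment hfin hN hconf hUo hUcov hUstar
    (by rw [segment_symm]; exact hvert y' hyz' hyΩ') hA' hS' hyA' hyS'
  exact (c1.trans c2).trans c3

/-! ### Conformity of uniform refinements -/

namespace TaggedSimplex

/-- A well-labelled conforming triangulation of a Lipschitz domain. -/
structure Triang (Ω : Set (Sp d)) (𝒯 : Set (TaggedSimplex d)) : Prop extends Matched 𝒯 where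
  pos : 1 ≤ d
  lip : IsLipschitzDomain Ω
  finite : 𝒯.Finite
  cover : ⋃ S ∈ 𝒯, S.carrier = closure Ω
  conf : ∀ S ∈ 𝒯, ∀ S' ∈ 𝒯, S.Conf S'

variable {Ω : Set (Sp d)} {𝒯 : Set (TaggedSimplex d)}

lemma Triang.adm_unif (h : Triang Ω 𝒯) {n c} (hc : c ∈ unif 𝒯 n) : c.Adm :=
  TaggedSimplex.adm_unif h.adm hc

lemma Triang.cover_unif (h : Triang Ω 𝒯) (n : ℕ) : ⋃ S ∈ unif 𝒯 n, S.carrier = closure Ω := by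
  rw [← h.cover]
  apply Subset.antisymm
  · intro x hx
    obtain ⟨c, hc, hxc⟩ := mem_iUnion₂.1 hx
    obtain ⟨S, hS, hcS⟩ := mem_unif_iff.1 hc
    exact mem_iUnion₂.2 ⟨S, hS, (h.adm S hS).unif_subset hcS hxc⟩
  · intro x hx
    obtain ⟨S, hS, hxS⟩ := mem_iUnion₂.1 hx
    obtain ⟨c, hc, hxc⟩ := exists_mem_unif h.adm hS hxS n
    exact mem_iUnion₂.2 ⟨c, hc, hxc⟩

/-- A simplex that contains the refinement edge of another one has the same refinement edge: the
equality propagates along a chain of facet neighbours around the midpoint of the edge. -/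
lemma Triang.ends_eq_of_conf (h : Triang Ω 𝒯) {n : ℕ}
    (hconf : ∀ S ∈ unif 𝒯 n, ∀ S' ∈ unif 𝒯 n, S.Conf S') {S S' : TaggedSimplex d}
    (hS : S ∈ unif 𝒯 n) (hS' : S' ∈ unif 𝒯 n) (hends : S.ends ⊆ S'.verts) : S'.ends = S.ends := by
  have hm : S.mid ∈ S.carrier := (isBary_midpoint (S.vert_mem _) (S.vert_mem _)).mem_convexHull
  have hm' : S.mid ∈ S'.carrier :=
    (isBary_midpoint (hends (Or.inl rfl)) (hends (Or.inr rfl))).mem_convexHull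
  have hchain := facetChain h.lip (finite_unif h.finite n)
    (fun A hA => (h.adm_unif hA).nondeg) hconf (h.cover_unif n) hS hS' hm hm'
  -- along the chain, all simplices contain the midpoint and hence the edge
  have key : ∀ B, Relation.ReflTransGen (FacetStep (unif 𝒯 n) S.mid) S B →
      B ∈ unif 𝒯 n ∧ B.ends = S.ends := by
    intro B hB
    induction hB with
    | refl => exact ⟨hS, rfl⟩
    | @tail A B _ hstep ih =>
      obtain ⟨hB, hmB, hcard⟩ := hstep
      refine ⟨hB, ?_⟩
      by_cases hAB : A = B
      · rw [← hAB]; exact ih.2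
      rw [← ih.2]
      refine h.toMatched.edgeOK_of_ne h.pos ih.1 hB hAB hcard ?_
      rw [ih.2]
      have hb := (hconf S hS B hB).isBary_right
        (isBary_midpoint (S.vert_mem 0) (S.vert_mem (Fin.last d))) hmB
      have hp := isBary_midpoint_pos (h.adm_unif hS).nondeg.wIndep (S.vert_mem 0)
        (S.vert_mem (Fin.last d)) (isBary_midpoint (S.vert_mem 0) (S.vert_mem (Fin.last d)))
      rintro v (rfl | rfl)
      · exact hb.supp _ hp.1
      · exact hb.supp _ hp.2
  exact (key S' hchain).2

/-- Uniform refinements of a well-labelled conforming triangulation are conforming. -/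
lemma Triang.conf_unif (h : Triang Ω 𝒯) (n : ℕ) :
    ∀ S ∈ unif 𝒯 n, ∀ S' ∈ unif 𝒯 n, S.Conf S' := by
  induction n with
  | zero => exact h.conf
  | succ n ih =>
    intro c hc c' hc'
    rw [unif_succ, mem_refineAll] at hc hc'
    obtain ⟨S, hS, hcS⟩ := hc
    obtain ⟨S', hS', hcS'⟩ := hc'
    exact (ih S hS S' hS').bisect (h.adm_unif hS) (h.adm_unif hS') hcS hcS'
      (fun he => (h.ends_eq_of_conf ih hS hS' he).symm)
      (fun he => (h.ends_eq_of_conf ih hS' hS he).symm)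

/-- Refinement edges in uniform refinements are compatible. -/
lemma Triang.ends_eq (h : Triang Ω 𝒯) {n : ℕ} {S S' : TaggedSimplex d}
    (hS : S ∈ unif 𝒯 n) (hS' : S' ∈ unif 𝒯 n) (hends : S.ends ⊆ S'.verts) : S'.ends = S.ends :=
  h.ends_eq_of_conf (h.conf_unif n) hS hS' hends

end TaggedSimplex

end

section
variable {d : ℕ}

/-! ### Time intervals -/

namespace TimeInterval

/-- Intervals with more than one point. -/
def Valid (I : TimeInterval) : Prop := I.left < I.right

lemma Valid.closure {I : TimeInterval} (h : I.Valid) : closure I.carrier = Icc I.left I.right := by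
  rw [carrier]
  split_ifs
  · exact isClosed_Icc.closure_eq
  · exact closure_Ico h.ne

lemma Ico_subset (I : TimeInterval) : Ico I.left I.right ⊆ I.carrier := by
  rw [carrier]; split_ifs
  · exact Ico_subset_Icc_self
  · exact Subset.rfl

lemma subset_Icc (I : TimeInterval) : I.carrier ⊆ Icc I.left I.right := by
  rw [carrier]; split_ifs
  · exact Subset.rfl
  · exact Ico_subset_Icc_self

lemma mem_carrier {I : TimeInterval} {t : ℝ} :
    t ∈ I.carrier ↔ I.left ≤ t ∧ (t < I.right ∨ (I.closed = true ∧ t = I.right)) ∧ t ≤ I.right := by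
  rw [carrier]
  split_ifs with h
  · simp only [mem_Icc, h, true_and]
    constructor
    · rintro ⟨h1, h2⟩; exact ⟨h1, h2.lt_or_eq, h2⟩
    · rintro ⟨h1, -, h2⟩; exact ⟨h1, h2⟩
  · simp only [mem_Ico, h]
    constructor
    · rintro ⟨h1, h2⟩; exact ⟨h1, by simpa using h2, h2.le⟩
    · rintro ⟨h1, h2, -⟩; exact ⟨h1, by simpa using h2⟩

lemma Valid.bisect {I J : TimeInterval} (h : I.Valid) (hJ : J ∈ I.bisect) : J.Valid := by
  rw [Valid] at h
  rcases hJ with rfl | rfl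
  · change I.left < (I.left + I.right) / 2; linarith
  · change (I.left + I.right) / 2 < I.right; linarith

lemma Valid.bisect_subset {I J : TimeInterval} (h : I.Valid) (hJ : J ∈ I.bisect) :
    J.carrier ⊆ I.carrier := by
  rw [Valid] at h
  intro t ht
  rw [mem_carrier] at ht ⊢
  rcases hJ with rfl | rfl
  · dsimp only at ht
    obtain ⟨h1, h2, h3⟩ := ht
    exact ⟨h1, Or.inl (by linarith), by linarith⟩
  · dsimp only at ht
    obtain ⟨h1, h2, h3⟩ := ht
    exact ⟨by linarith, h2, h3⟩

lemma exists_mem_bisect {I : TimeInterval} {t} (ht : t ∈ I.carrier) :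
    ∃ J ∈ I.bisect, t ∈ J.carrier := by
  rw [mem_carrier] at ht
  rcases lt_or_ge t ((I.left + I.right) / 2) with hlt | hge
  · exact ⟨_, Or.inl rfl, mem_carrier.2 ⟨ht.1, Or.inl hlt, hlt.le⟩⟩
  · exact ⟨_, Or.inr rfl, mem_carrier.2 ⟨hge, ht.2.1, ht.2.2⟩⟩

lemma bisect_disjoint {I J J' : TimeInterval} (hJ : J ∈ I.bisect)
    (hJ' : J' ∈ I.bisect) (hne : J ≠ J') : Disjoint J.carrier J'.carrier := by
  rw [Set.disjoint_left]
  intro t ht ht'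
  rw [mem_carrier] at ht ht'
  rcases hJ with rfl | rfl <;> rcases hJ' with rfl | rfl
  · exact hne rfl
  · dsimp only at ht ht'
    rcases ht.2.1 with h1 | h1
    · linarith [ht'.1]
    · simp at h1
  · dsimp only at ht ht'
    rcases ht'.2.1 with h1 | h1
    · linarith [ht.1]
    · simp at h1
  · exact hne rfl

lemma bisect_length {I J : TimeInterval} (hJ : J ∈ I.bisect) :
    J.right - J.left = (I.right - I.left) / 2 := by
  rcases hJ with rfl | rfl <;> (dsimp only; ring)

/-- The `m`-fold uniform bisection of a set of intervals. -/
def tunif (𝓘 : Set TimeInterval) (m : ℕ) : Set TimeInterval :=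
  {J | ∃ I ∈ 𝓘, J ∈ I.bisectIter m}

lemma mem_bisectIter_succ {I J : TimeInterval} {m : ℕ} :
    J ∈ I.bisectIter (m + 1) ↔ ∃ A ∈ I.bisectIter m, J ∈ A.bisect := by
  simp [bisectIter]

lemma mem_bisectIter_add {I J : TimeInterval} {m n : ℕ} :
    J ∈ I.bisectIter (m + n) ↔ ∃ A ∈ I.bisectIter m, J ∈ A.bisectIter n := by
  induction n generalizing J with
  | zero => simp [bisectIter]
  | succ n ih =>
    rw [← add_assoc, mem_bisectIter_succ]
    constructor
    · rintro ⟨A, hA, hJ⟩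
      obtain ⟨B, hB, hAB⟩ := ih.1 hA
      exact ⟨B, hB, mem_bisectIter_succ.2 ⟨A, hAB, hJ⟩⟩
    · rintro ⟨B, hB, hJ⟩
      obtain ⟨A, hA, hJ⟩ := mem_bisectIter_succ.1 hJ
      exact ⟨A, ih.2 ⟨B, hB, hA⟩, hJ⟩

lemma mem_tunif_add {𝓘 : Set TimeInterval} {J : TimeInterval} {m n : ℕ} :
    J ∈ tunif 𝓘 (m + n) ↔ ∃ A ∈ tunif 𝓘 m, J ∈ A.bisectIter n := by
  constructor
  · rintro ⟨I, hI, hJ⟩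
    obtain ⟨A, hA, hJ⟩ := mem_bisectIter_add.1 hJ
    exact ⟨A, ⟨I, hI, hA⟩, hJ⟩
  · rintro ⟨A, ⟨I, hI, hA⟩, hJ⟩
    exact ⟨I, hI, mem_bisectIter_add.2 ⟨A, hA, hJ⟩⟩

lemma finite_bisectIter (I : TimeInterval) (m : ℕ) : (I.bisectIter m).Finite := by
  induction m with
  | zero => exact finite_singleton _
  | succ m ih => exact ih.biUnion fun J _ => (finite_singleton _).insert _

lemma Valid.iter {I J : TimeInterval} (h : I.Valid) {m} (hJ : J ∈ I.bisectIter m) :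
    J.Valid ∧ J.carrier ⊆ I.carrier ∧ J.right - J.left = (I.right - I.left) / 2 ^ m := by
  induction m generalizing J with
  | zero => rw [bisectIter, mem_singleton_iff] at hJ; subst hJ; exact ⟨h, Subset.rfl, by simp⟩
  | succ m ih =>
    obtain ⟨A, hA, hJ⟩ := mem_bisectIter_succ.1 hJ
    obtain ⟨h1, h2, h3⟩ := ih hA
    refine ⟨h1.bisect hJ, (h1.bisect_subset hJ).trans h2, ?_⟩
    rw [bisect_length hJ, h3, pow_succ, div_div]

lemma exists_mem_iter {I : TimeInterval} {t} (ht : t ∈ I.carrier) (m) :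
    ∃ J ∈ I.bisectIter m, t ∈ J.carrier := by
  induction m with
  | zero => exact ⟨I, rfl, ht⟩
  | succ m ih =>
    obtain ⟨A, hA, htA⟩ := ih
    obtain ⟨J, hJ, htJ⟩ := exists_mem_bisect htA
    exact ⟨J, mem_bisectIter_succ.2 ⟨A, hA, hJ⟩, htJ⟩

lemma Valid.Icc_subset {I J : TimeInterval} (h : I.Valid) {m} (hJ : J ∈ I.bisectIter m) :
    Icc J.left J.right ⊆ Icc I.left I.right := by
  obtain ⟨h1, h2, -⟩ := h.iter hJ
  rw [← h1.closure, ← h.closure]; exact closure_mono h2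

/-- Nodes of an interval in a half of the interval are nodes of that half. -/
lemma node_bisect {I J : TimeInterval} {r : ℕ} (hr : 2 ≤ r) (hJ : J ∈ I.bisect) {t}
    (h : I.Valid) (ht : t ∈ timeNodes r I) (htJ : t ∈ Icc J.left J.right) : t ∈ timeNodes r J := by
  have hk : (0 : ℝ) < ((r - 1 : ℕ) : ℝ) := by
    rw [Nat.cast_pos]; omega
  rw [timeNodes, mem_ofPred_eq] at ht ⊢
  generalize r - 1 = k at *
  obtain ⟨n, hn, rfl⟩ := ht
  have hl : 0 < I.right - I.left := sub_pos.2 h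
  rcases hJ with rfl | rfl
  · refine ⟨2 * n, ?_, ?_⟩
    · have h1 := htJ.2
      dsimp only at h1
      have h2 : (n : ℝ) / k * (I.right - I.left) ≤ 1 / 2 * (I.right - I.left) := by linarith
      have h3 := le_of_mul_le_mul_right h2 hl
      rw [div_le_div_iff₀ hk two_pos] at h3
      have : n * 2 ≤ 1 * k := by exact_mod_cast h3
      omega
    · dsimp only; push_cast; ring
  · have h1 := htJ.1
    dsimp only at h1
    have h2 : 1 / 2 * (I.right - I.left) ≤ (n : ℝ) / k * (I.right - I.left) := by linarith
    have h3 := le_of_mul_le_mul_right h2 hl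
    rw [div_le_div_iff₀ two_pos hk] at h3
    have h4 : 1 * k ≤ n * 2 := by exact_mod_cast h3
    refine ⟨2 * n - k, by omega, ?_⟩
    dsimp only
    have hc : ((2 * n - k : ℕ) : ℝ) = 2 * n - k := by rw [Nat.cast_sub (by omega)]; push_cast; ring
    rw [hc]
    field_simp
    ring

lemma Valid.node_iter {I J : TimeInterval} {r : ℕ} (hr : 2 ≤ r) (h : I.Valid) {m}
    (hJ : J ∈ I.bisectIter m) {t} (ht : t ∈ timeNodes r I) (htJ : t ∈ Icc J.left J.right) :
    t ∈ timeNodes r J := by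
  induction m generalizing J with
  | zero => rw [bisectIter, mem_singleton_iff] at hJ; rwa [hJ]
  | succ m ih =>
    obtain ⟨A, hA, hJ⟩ := mem_bisectIter_succ.1 hJ
    have hA' := (h.iter hA).1
    have hs := (hA'.Icc_subset (m := 1) (J := J) (mem_bisectIter_succ.2 ⟨A, rfl, hJ⟩))
    exact node_bisect hr hJ hA' (ih hA (hs htJ)) htJ

lemma left_node (I : TimeInterval) (r : ℕ) : I.left ∈ timeNodes r I := ⟨0, by omega, by simp⟩

lemma right_node (I : TimeInterval) {r : ℕ} (hr : 2 ≤ r) : I.right ∈ timeNodes r I := by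
  refine ⟨r - 1, le_rfl, ?_⟩
  have hk : ((r - 1 : ℕ) : ℝ) ≠ 0 := by rw [Nat.cast_ne_zero]; omega
  rw [div_self hk]; ring

lemma timeNodes_subset (I : TimeInterval) (h : I.Valid) {r : ℕ} (hr : 2 ≤ r) :
    timeNodes r I ⊆ Icc I.left I.right := by
  rintro t ⟨n, hn, rfl⟩
  have hk : (0 : ℝ) < ((r - 1 : ℕ) : ℝ) := by rw [Nat.cast_pos]; omega
  have hl : 0 < I.right - I.left := sub_pos.2 h
  have h1 : (n : ℝ) / ((r - 1 : ℕ) : ℝ) ≤ 1 := by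
    rw [div_le_one hk]; exact_mod_cast hn
  have h0 : 0 ≤ (n : ℝ) / ((r - 1 : ℕ) : ℝ) := by positivity
  constructor <;> nlinarith

/-- Disjoint intervals touch in end points only. -/
lemma touch {I J : TimeInterval} (hI : I.Valid) (hJ : J.Valid) (hdis : Disjoint I.carrier J.carrier)
    {t : ℝ} (htI : t ∈ Icc I.left I.right) (htJ : t ∈ Icc J.left J.right) :
    (t = I.right ∧ t = J.left) ∨ (t = I.left ∧ t = J.right) := by
  rw [Valid] at hI hJ
  by_contra hcon
  push Not at hcon
  have : max I.left J.left < min I.right J.right := by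
    rw [max_lt_iff, lt_min_iff, lt_min_iff]
    refine ⟨⟨hI, ?_⟩, ?_, hJ⟩
    · refine lt_of_le_of_ne (htI.1.trans htJ.2) fun h => ?_
      exact hcon.2 (le_antisymm (h ▸ htJ.2) htI.1) (le_antisymm htJ.2 (h ▸ htI.1))
    · refine lt_of_le_of_ne (htJ.1.trans htI.2) fun h => ?_
      exact hcon.1 (le_antisymm htI.2 (h ▸ htJ.1)) (le_antisymm (h ▸ htI.2) htJ.1)
  have h1 : max I.left J.left ∈ I.carrier := I.Ico_subset ⟨le_max_left _ _, this.trans_le (min_le_left _ _)⟩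
  have h2 : max I.left J.left ∈ J.carrier := J.Ico_subset ⟨le_max_right _ _, this.trans_le (min_le_right _ _)⟩
  exact Set.disjoint_left.1 hdis h1 h2

lemma ncard_closure_inter {I J : TimeInterval} (hI : I.Valid) (hJ : J.Valid)
    (hdis : Disjoint I.carrier J.carrier) (hne : (closure I.carrier ∩ closure J.carrier).Nonempty) :
    (closure I.carrier ∩ closure J.carrier).ncard = 1 := by
  obtain ⟨t, ht⟩ := hne
  rw [ncard_eq_one]
  refine ⟨t, Subset.antisymm ?_ (singleton_subset_iff.2 ht)⟩
  rw [hI.closure, hJ.closure] at *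
  rintro u ⟨hu1, hu2⟩
  rw [Valid] at hI hJ
  rcases touch hI hJ hdis ht.1 ht.2 with ⟨h1, h2⟩ | ⟨h1, h2⟩ <;>
  rcases touch hI hJ hdis hu1 hu2 with ⟨h3, h4⟩ | ⟨h3, h4⟩ <;>
  simp only [mem_singleton_iff] <;> linarith

/-- A partition of `[0, T]` into time intervals. -/
structure Grid (T : ℝ) (𝓘 : Set TimeInterval) : Prop where
  finite : 𝓘.Finite
  valid : ∀ I ∈ 𝓘, I.Valid
  disj : ∀ I ∈ 𝓘, ∀ J ∈ 𝓘, I ≠ J → Disjoint I.carrier J.carrier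
  cover : ∀ t ∈ Icc 0 T, ∃ I ∈ 𝓘, t ∈ I.carrier
  sub : ∀ I ∈ 𝓘, I.carrier ⊆ Icc 0 T

lemma Grid.tunif_succ {T : ℝ} {𝓘 : Set TimeInterval} (h : Grid T 𝓘) :
    Grid T {J | ∃ I ∈ 𝓘, J ∈ I.bisect} := by
  refine ⟨?_, ?_, ?_, ?_, ?_⟩
  · have : {J | ∃ I ∈ 𝓘, J ∈ I.bisect} = ⋃ I ∈ 𝓘, I.bisect := by ext; simp
    rw [this]
    exact h.finite.biUnion fun J _ => (finite_singleton _).insert _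
  · rintro J ⟨I, hI, hJ⟩; exact (h.valid I hI).bisect hJ
  · rintro J ⟨I, hI, hJ⟩ J' ⟨I', hI', hJ'⟩ hne
    by_cases hII : I = I'
    · subst hII; exact bisect_disjoint hJ hJ' hne
    · exact (h.disj I hI I' hI' hII).mono ((h.valid I hI).bisect_subset hJ)
        ((h.valid I' hI').bisect_subset hJ')
  · intro t ht
    obtain ⟨I, hI, htI⟩ := h.cover t ht
    obtain ⟨J, hJ, htJ⟩ := exists_mem_bisect htI
    exact ⟨J, ⟨I, hI, hJ⟩, htJ⟩
  · rintro J ⟨I, hI, hJ⟩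
    exact ((h.valid I hI).bisect_subset hJ).trans (h.sub I hI)

lemma Grid.tunif {T : ℝ} {𝓘 : Set TimeInterval} (h : Grid T 𝓘) (m : ℕ) : Grid T (tunif 𝓘 m) := by
  induction m with
  | zero =>
    have : TimeInterval.tunif 𝓘 0 = 𝓘 := by ext; simp [TimeInterval.tunif, bisectIter]
    rwa [this]
  | succ m ih =>
    have : TimeInterval.tunif 𝓘 (m + 1) = {J | ∃ I ∈ TimeInterval.tunif 𝓘 m, J ∈ I.bisect} := by
      ext J
      rw [mem_tunif_add]
      simp [bisectIter]
    rw [this]; exact ih.tunif_succ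

/-- Intersecting intervals of uniform bisections are nested. -/
lemma Grid.mem_iter {T : ℝ} {𝓘 : Set TimeInterval} (h : Grid T 𝓘) {m n : ℕ} (hmn : m ≤ n)
    {I J : TimeInterval} (hI : I ∈ TimeInterval.tunif 𝓘 m) (hJ : J ∈ TimeInterval.tunif 𝓘 n)
    (hne : (I.carrier ∩ J.carrier).Nonempty) : J ∈ I.bisectIter (n - m) := by
  have hJ' := hJ
  rw [← Nat.add_sub_cancel' hmn] at hJ'
  obtain ⟨A, hA, hJA⟩ := mem_tunif_add.1 hJ'
  obtain ⟨t, htI, htJ⟩ := hne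
  have htA := (((h.tunif m).valid A hA).iter hJA).2.1 htJ
  have : A = I := by
    by_contra hne
    exact Set.disjoint_left.1 ((h.tunif m).disj A hA I hI hne) htA htI
  rwa [← this]

lemma Grid.volume_pos {T : ℝ} {𝓘 : Set TimeInterval} (h : Grid T 𝓘) {m n : ℕ}
    {I J : TimeInterval} (hI : I ∈ TimeInterval.tunif 𝓘 m) (hJ : J ∈ TimeInterval.tunif 𝓘 n)
    (hne : (I.carrier ∩ J.carrier).Nonempty) : 0 < volume (I.carrier ∩ J.carrier) := by
  have hv : ∀ {K : TimeInterval}, K.Valid → 0 < volume K.carrier := fun {K} hK => by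
    refine lt_of_lt_of_le ?_ (measure_mono K.Ico_subset)
    rw [Real.volume_Ico, ENNReal.ofReal_pos]; exact sub_pos.2 hK
  have hIv := (h.tunif m).valid I hI
  have hJv := (h.tunif n).valid J hJ
  rcases le_total m n with hmn | hmn
  · rw [inter_eq_right.2 (hIv.iter (h.mem_iter hmn hI hJ hne)).2.1]; exact hv hJv
  · rw [inter_eq_left.2 (hJv.iter (h.mem_iter hmn hJ hI (by rwa [inter_comm]))).2.1]; exact hv hIv

end TimeInterval

/-! ### Initial meshes -/

namespace TaggedSimplex

/-- Simplices meeting in a common face are conforming. -/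
lemma MeetInCommonFace.conf {S S' : TaggedSimplex d} (h : MeetInCommonFace S S') (hS : S.Nondeg)
    (hS' : S'.Nondeg) : S.Conf S' := by
  obtain ⟨A, B, -, -, hA, hB⟩ := h
  intro x w w' hw hw'
  have hx : x ∈ convexHull ℝ (S.vert '' A) := by
    rw [← hA]; exact ⟨mem_carrier_iff.2 ⟨w, hw⟩, mem_carrier_iff.2 ⟨w', hw'⟩⟩
  obtain ⟨u, hu⟩ := mem_convexHull_iff_isBary.1 hx
  have huS : IsBary S.verts x u := hu.mono fun v hv => image_subset_range _ _ (hu.supp v hv)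
  obtain rfl := hS.wIndep.isBary_unique hw huS
  -- the vertices of the common face of `S` are vertices of `S'`
  have hsub : S.vert '' A ⊆ S'.verts := by
    rintro _ ⟨k, hk, rfl⟩
    -- otherwise the coordinate of that vertex is less than `1` at all vertices of the face of `S'`,
    -- hence on all of the common face
    by_contra hcon
    have hcv : Convex ℝ {y | y ∈ S.carrier ∧ hS.coord k y < 1} := by
      apply S.convex_carrier.inter
      intro y hy z hz a b ha hb hab
      have hy' : hS.coord k y < 1 := hy
      have hz' : hS.coord k z < 1 := hz
      have : hS.coord k (a • y + b • z) = a * hS.coord k y + b * hS.coord k z := by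
        rw [Convex.combo_affine_apply hab]; simp
      change hS.coord k (a • y + b • z) < 1
      rw [this]
      rcases eq_or_lt_of_le ha with h0 | h0
      · have hb1 : b = 1 := by linarith
        rw [← h0, hb1]; linarith
      · have := mul_lt_mul_of_pos_left hy' h0
        have := mul_le_mul_of_nonneg_left hz'.le hb
        linarith
    have hBsub : S'.vert '' B ⊆ {y | y ∈ S.carrier ∧ hS.coord k y < 1} := by
      intro y hy
      have hyS : y ∈ S.carrier := by
        have : y ∈ S.carrier ∩ S'.carrier := by rw [hB]; exact subset_convexHull ℝ _ hy
        exact this.1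
      refine ⟨hyS, ?_⟩
      have h0 := hS.mem_carrier_iff_coord.1 hyS
      have hle : hS.coord k y ≤ 1 := by
        rw [← hS.sum_coord y]
        exact Finset.single_le_sum (f := fun k => hS.coord k y) (fun i _ => h0 i) (Finset.mem_univ k)
      refine lt_of_le_of_ne hle fun h1 => hcon ?_
      have hz : ∀ l, l ≠ k → hS.coord l y = 0 := by
        intro l hl
        have h2 := hS.sum_coord y
        rw [← Finset.add_sum_erase _ _ (Finset.mem_univ k), h1] at h2
        have h3 : ∑ i ∈ Finset.univ.erase k, hS.coord i y = 0 := by linarith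
        exact (Finset.sum_eq_zero_iff_of_nonneg (fun i _ => h0 i)).1 h3 l (by simp [hl])
      have h4 := hS.sum_coord_smul y
      rw [Finset.sum_eq_single k (fun l _ hl => by rw [hz l hl, zero_smul]) (by simp), h1, one_smul] at h4
      rw [h4]
      exact image_subset_range _ _ hy
    have : S.vert k ∈ convexHull ℝ (S'.vert '' B) := by
      rw [← hB, hA]; exact subset_convexHull ℝ _ ⟨k, hk, rfl⟩
    have h1 := (convexHull_min hBsub hcv this).2
    rw [hS.coord_vert, if_pos rfl] at h1
    exact lt_irrefl _ h1
  exact hS'.wIndep.isBary_unique (hu.mono fun v hv => hsub (hu.supp v hv)) hw'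

end TaggedSimplex

open TaggedSimplex TimeInterval

variable {T : ℝ} {Ω : Set (Sp d)}

lemma InitialMesh.triang (M : InitialMesh d T Ω) (hd : 1 ≤ d) (hΩ : IsLipschitzDomain Ω) :
    Triang Ω M.simplices := by
  obtain ⟨γ, hγ, hγS⟩ := M.uniform_type
  refine ⟨⟨fun S hS => ⟨hd, M.affineIndependent S hS, by rw [hγS S hS]; exact hγ⟩,
    fun S hS S' hS' => by rw [hγS S hS, hγS S' hS'], M.nonoverlapping, M.matching⟩, hd, hΩ,
    M.finite_simplices, M.iUnion_carrier, ?_⟩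
  intro S hS S' hS'
  by_cases h : S = S'
  · subst h; exact Nondeg.conf_self (M.affineIndependent S hS)
  · exact (M.conforming S hS S' hS' h).conf (M.affineIndependent S hS) (M.affineIndependent S' hS')

lemma InitialMesh.grid (M : InitialMesh d T Ω) (hT : 0 < T) : Grid T M.intervals := by
  have hmono := M.strictMono_t
  have hlt (i : Fin M.N) : M.t i.castSucc < M.t i.succ := hmono (Fin.castSucc_lt_succ)
  refine ⟨finite_range _, ?_, ?_, ?_, ?_⟩
  · rintro _ ⟨i, rfl⟩; exact hlt i
  · have key : ∀ i j : Fin M.N, i < j → Disjoint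
        (TimeInterval.mk (M.t i.castSucc) (M.t i.succ) (decide (i.val + 1 = M.N))).carrier
        (TimeInterval.mk (M.t j.castSucc) (M.t j.succ) (decide (j.val + 1 = M.N))).carrier := by
      intro i j hij
      rw [Set.disjoint_left]
      intro t ht ht'
      rw [mem_carrier] at ht ht'
      dsimp only at ht ht'
      have hi : ¬ (i.val + 1 = M.N) := by have := j.isLt; have : i.val < j.val := hij; omega
      have hle : M.t i.succ ≤ M.t j.castSucc := hmono.monotone (by
        rw [Fin.le_def]; simp; exact hij)
      rcases ht.2.1 with h | h
      · linarith [ht'.1]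
      · simp [hi] at h
    rintro _ ⟨i, rfl⟩ _ ⟨j, rfl⟩ hne
    rcases lt_trichotomy i j with h | h | h
    · exact key i j h
    · subst h; exact absurd rfl hne
    · exact (key j i h).symm
  · intro t ht
    have hNpos : 0 < M.N := by
      rcases Nat.eq_zero_or_pos M.N with h | h
      · exfalso
        have h1 := M.t_zero; have h2 := M.t_last
        have : Fin.last M.N = 0 := Fin.ext (by simp [h])
        rw [this, h1] at h2; linarith
      · exact h
    -- the last grid point below `t`
    obtain ⟨i, hi, hmax⟩ := Finset.exists_max_image (Finset.univ.filter fun i : Fin M.N => M.t i.castSucc ≤ t)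
      (fun i => i.val) ⟨⟨0, hNpos⟩, by
        simp only [Finset.mem_filter, Finset.mem_univ, true_and]
        have : (Fin.castSucc ⟨0, hNpos⟩ : Fin (M.N + 1)) = 0 := Fin.ext (by simp)
        rw [this, M.t_zero]; exact ht.1⟩
    simp only [Finset.mem_filter, Finset.mem_univ, true_and] at hi hmax
    refine ⟨_, ⟨i, rfl⟩, mem_carrier.2 ⟨hi, ?_⟩⟩
    dsimp only
    by_cases hl : i.val + 1 = M.N
    · have hlast : i.succ = Fin.last M.N := Fin.ext (by simp [hl])
      have : t ≤ M.t i.succ := by rw [hlast, M.t_last]; exact ht.2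
      refine ⟨?_, this⟩
      rcases this.lt_or_eq with h | h
      · exact Or.inl h
      · exact Or.inr ⟨by simp [hl], h⟩
    · have : t < M.t i.succ := by
        by_contra hge
        have h1 := hmax ⟨i.val + 1, by omega⟩ (by
          have : (Fin.castSucc ⟨i.val + 1, by omega⟩ : Fin (M.N + 1)) = i.succ := Fin.ext (by simp)
          rw [this]; exact not_lt.1 hge)
        dsimp only at h1; omega
      exact ⟨Or.inl this, this.le⟩
  · rintro _ ⟨i, rfl⟩ t ht
    have h1 := TimeInterval.subset_Icc _ ht
    dsimp only at h1
    constructor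
    · rw [← M.t_zero]; exact (hmono.monotone (Fin.zero_le _)).trans h1.1
    · rw [← M.t_last]; exact h1.2.trans (hmono.monotone (Fin.le_last _))

end

section
variable {d : ℕ}
open TaggedSimplex TimeInterval

/-! ### Graded partitions and patch refinement -/

/-- The number of temporal bisections of a prism of level `n`. -/
def timeLevel (s₁ s₂ : ℝ) (d n : ℕ) : ℕ := ⌈(n : ℝ) * s₂ / (s₁ * d)⌉₊

lemma timeLevel_zero (s₁ s₂ : ℝ) (d : ℕ) : timeLevel s₁ s₂ d 0 = 0 := by simp [timeLevel]

lemma timeLevel_mono {s₁ s₂ : ℝ} (h₁ : 0 < s₁) (h₂ : 0 < s₂) (d : ℕ) :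
    Monotone (timeLevel s₁ s₂ d) := by
  intro m n hmn
  apply Nat.ceil_mono
  have : (m : ℝ) ≤ n := by exact_mod_cast hmn
  gcongr

lemma timeLevel_add_le {s₁ s₂ : ℝ} (d m n : ℕ) :
    timeLevel s₁ s₂ d (m + n) ≤ timeLevel s₁ s₂ d m + timeLevel s₁ s₂ d n := by
  rw [timeLevel, timeLevel, timeLevel]
  refine le_trans (le_of_eq ?_) (Nat.ceil_add_le _ _)
  congr 1; push_cast; ring

/-- A simplex of a uniform refinement that overlaps a simplex of a coarser one descends from it. -/
lemma TaggedSimplex.Triang.nested {Ω : Set (Sp d)} {𝒯 : Set (TaggedSimplex d)} (h : Triang Ω 𝒯)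
    {m n : ℕ} (hmn : m ≤ n) {S S' : TaggedSimplex d} (hS : S ∈ unif 𝒯 m) (hS' : S' ∈ unif 𝒯 n)
    (hne : (interior S.carrier ∩ interior S'.carrier).Nonempty) : S' ∈ unif {S} (n - m) := by
  rw [← Nat.add_sub_cancel' hmn] at hS'
  obtain ⟨A, hA, hS'A⟩ := mem_unif_add.1 hS'
  have : S = A := by
    by_contra hSA
    have hd := h.nonOverlap.unif h.adm m S hS A hA hSA
    refine hne.not_disjoint (hd.mono_right ?_)
    exact interior_mono ((h.adm_unif hA).unif_subset hS'A)
  rwa [this]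

/-- The refinement edge of a simplex is not contained in a finer simplex. -/
lemma TaggedSimplex.Triang.level_le_of_ends {Ω : Set (Sp d)} {𝒯 : Set (TaggedSimplex d)}
    (h : Triang Ω 𝒯) {m n : ℕ} {S S' : TaggedSimplex d} (hS : S ∈ unif 𝒯 n) (hS' : S' ∈ unif 𝒯 m)
    (hends : S.ends ⊆ S'.carrier) : m ≤ n := by
  by_contra hlt
  push Not at hlt
  rw [← Nat.add_sub_cancel' hlt.le] at hS'
  obtain ⟨A, hA, hS'A⟩ := mem_unif_add.1 hS'
  obtain ⟨k, hk⟩ : ∃ k, m - n = k + 1 := ⟨m - n - 1, by omega⟩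
  rw [hk] at hS'A
  obtain ⟨C, hC, hS'C⟩ := mem_unif_succ_of_bisect.1 hS'A
  have hAA := h.adm_unif hA
  have hsub := (hAA.child hC).unif_subset hS'C
  have hE : A.ends = S.ends := by
    apply h.ends_eq hS hA
    intro v hv
    exact (h.conf_unif n S hS A hA).vert_mem (S.ends_subset hv)
      (hAA.child_subset hC (hsub (hends hv)))
  apply hAA.not_ends_subset_child hC
  exact ⟨hsub (hends (hE ▸ Or.inl rfl)), hsub (hends (hE ▸ Or.inr rfl))⟩

/-- Graded partitions into prisms descending from a given grid and triangulation: partitions that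
are conforming in every time slice, with level differences of at most one between temporal
neighbours, and also between spatial neighbours in dimension one. -/
structure Good (T : ℝ) (Ω : Set (Sp d)) (𝓘 : Set TimeInterval) (𝒯 : Set (TaggedSimplex d))
    (s₁ s₂ : ℝ) (P : Set (Prism d)) : Prop where
  grid : Grid T 𝓘
  triang : Triang Ω 𝒯
  pos₁ : 0 < s₁
  pos₂ : 0 < s₂
  finite : P.Finite
  time : ∀ E ∈ P, E.time ∈ tunif 𝓘 (timeLevel s₁ s₂ d E.level)
  space : ∀ E ∈ P, E.space ∈ unif 𝒯 E.level
  cover : ∀ t ∈ Icc 0 T, ∀ x ∈ closure Ω, ∃ E ∈ P, t ∈ E.time.carrier ∧ x ∈ E.space.carrier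
  disj : ∀ E ∈ P, ∀ E' ∈ P, E ≠ E' → (E.time.carrier ∩ E'.time.carrier).Nonempty →
    Disjoint (interior E.space.carrier) (interior E'.space.carrier)
  conf : ∀ E ∈ P, ∀ E' ∈ P, (E.time.carrier ∩ E'.time.carrier).Nonempty →
    E.space.Conf E'.space
  grad_space : d = 1 → ∀ E ∈ P, ∀ E' ∈ P, (E.time.carrier ∩ E'.time.carrier).Nonempty →
    (E.space.carrier ∩ E'.space.carrier).Nonempty → E.level ≤ E'.level + 1
  grad_time : ∀ E ∈ P, ∀ E' ∈ P, Disjoint E.time.carrier E'.time.carrier →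
    (closure E.time.carrier ∩ closure E'.time.carrier).Nonempty →
    (interior E.space.carrier ∩ interior E'.space.carrier).Nonempty → E.level ≤ E'.level + 1

lemma _root_.PrismMesh.Prism.ext' {E E' : Prism d} (h1 : E.time = E'.time) (h2 : E.space = E'.space)
    (h3 : E.level = E'.level) : E = E' := by
  cases E; cases E'; simp_all

namespace Good

variable {T : ℝ} {Ω : Set (Sp d)} {𝓘 : Set TimeInterval} {𝒯 : Set (TaggedSimplex d)} {s₁ s₂ : ℝ}
  {P : Set (Prism d)}

lemma adm (h : Good T Ω 𝓘 𝒯 s₁ s₂ P) {E} (hE : E ∈ P) : E.space.Adm :=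
  h.triang.adm_unif (h.space E hE)

lemma valid (h : Good T Ω 𝓘 𝒯 s₁ s₂ P) {E} (hE : E ∈ P) : E.time.Valid :=
  (h.grid.tunif _).valid _ (h.time E hE)

lemma levelMono (h : Good T Ω 𝓘 𝒯 s₁ s₂ P) : Monotone (timeLevel s₁ s₂ d) :=
  timeLevel_mono h.pos₁ h.pos₂ d

lemma ends_subset_of_refEdge {S : TaggedSimplex d} {A : Set (Sp d)} (h : S.refEdge ⊆ A) :
    S.ends ⊆ A := by
  rintro v (rfl | rfl)
  · exact h (left_mem_segment ℝ _ _)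
  · exact h (right_mem_segment ℝ _ _)

lemma one_le_dimension {S : TaggedSimplex d} (hS : S.Adm) {A : Set (Sp d)} (h : S.ends ⊆ A) :
    1 ≤ dimension A := by
  rw [Nat.one_le_iff_ne_zero, dimension]
  intro h0
  have h1 := Submodule.finrank_eq_zero.1 h0
  have h2 : S.vert 0 -ᵥ S.vert (Fin.last d) ∈ vectorSpan ℝ A :=
    vsub_mem_vectorSpan ℝ (h (Or.inl rfl)) (h (Or.inr rfl))
  rw [h1, Submodule.mem_bot, vsub_eq_zero_iff_eq] at h2
  exact hS.ends_ne h2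

/-- Temporal neighbours that are too coarse are necessary refinements. -/
lemma mem_necRefTime (h : Good T Ω 𝓘 𝒯 s₁ s₂ P) {E E'} (hE : E ∈ P) (hE' : E' ∈ P)
    (hl : E'.level + 1 = E.level) (hdis : Disjoint E.time.carrier E'.time.carrier)
    (hne : (closure E.time.carrier ∩ closure E'.time.carrier).Nonempty)
    (hov : (interior E.space.carrier ∩ interior E'.space.carrier).Nonempty) :
    E' ∈ necRefTime E P := by
  refine ⟨hE', ?_, ncard_closure_inter (h.valid hE) (h.valid hE') hdis hne,
    (dimension_inter_eq_iff h.triang.pos).2 hov, hl⟩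
  rintro rfl; omega

lemma not_overlap (h : Good T Ω 𝓘 𝒯 s₁ s₂ P) {E E'} (hE : E ∈ P) (hE' : E' ∈ P) (hne : E' ≠ E)
    (ht : (E.time.carrier ∩ E'.time.carrier).Nonempty) :
    dimension (E.space.carrier ∩ E'.space.carrier) ≤ d - 1 := by
  have h1 := dimension_le (E.space.carrier ∩ E'.space.carrier)
  have h2 : dimension (E.space.carrier ∩ E'.space.carrier) ≠ d := fun h2 =>
    ((dimension_inter_eq_iff h.triang.pos).1 h2).not_disjoint (h.disj E hE E' hE' hne.symm ht)
  omega

/-- Simplices containing the refinement edge are necessary refinements. -/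
lemma mem_necRefSpace_of_ends (h : Good T Ω 𝓘 𝒯 s₁ s₂ P) {E E'} (hE : E ∈ P) (hE' : E' ∈ P)
    (hne : E' ≠ E) (ht : (E.time.carrier ∩ E'.time.carrier).Nonempty)
    (hends : E.space.ends ⊆ E'.space.carrier) : E' ∈ necRefSpace E P := by
  have hsub : E.space.ends ⊆ E.space.carrier ∩ E'.space.carrier :=
    subset_inter (E.space.ends_subset.trans E.space.verts_subset_carrier) hends
  have h1 := one_le_dimension (h.adm hE) hsub
  have h2 := h.not_overlap hE hE' hne ht
  refine ⟨hE', hne, h.grid.volume_pos (h.time E hE) (h.time E' hE') ht, Or.inl ⟨?_, h1, h2, ?_⟩⟩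
  · omega
  · exact refEdge_subset_of_ends E'.space.convex_carrier hends

lemma mem_necRefSpace_one (h : Good T Ω 𝓘 𝒯 s₁ s₂ P) (hd : d = 1) {E E'} (hE : E ∈ P)
    (hE' : E' ∈ P) (hl : E'.level + 1 = E.level)
    (ht : (E.time.carrier ∩ E'.time.carrier).Nonempty)
    (hx : (E.space.carrier ∩ E'.space.carrier).Nonempty) : E' ∈ necRefSpace E P := by
  have hne : E' ≠ E := by rintro rfl; omega
  have h2 := h.not_overlap hE hE' hne ht
  refine ⟨hE', hne, h.grid.volume_pos (h.time E hE) (h.time E' hE') ht, Or.inr ⟨hd, ?_, hl⟩⟩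
  have h3 : vectorSpan ℝ (E.space.carrier ∩ E'.space.carrier) = ⊥ :=
    Submodule.finrank_eq_zero.1 (by rw [dimension] at h2; omega)
  rw [vectorSpan_eq_bot_iff_subsingleton] at h3
  obtain ⟨x, hx⟩ := hx
  rw [h3.eq_singleton_of_mem hx, ncard_singleton]

/-- Necessary refinements are not finer. -/
lemma level_le_of_mem_necRef (h : Good T Ω 𝓘 𝒯 s₁ s₂ P) {E E'} (hE : E ∈ P)
    (hE' : E' ∈ necRef E P) : E'.level ≤ E.level := by
  rcases hE' with ⟨-, -, -, -, hl⟩ | ⟨hE'P, -, -, ⟨-, -, -, hR⟩ | ⟨-, -, hl⟩⟩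
  · omega
  · exact h.triang.level_le_of_ends (h.space E hE) (h.space E' hE'P) (ends_subset_of_refEdge hR)
  · omega

end Good

/-- `c` is contained in the prism `e`. -/
def Inside (c e : Prism d) : Prop :=
  c.time.carrier ⊆ e.time.carrier ∧ c.space.carrier ⊆ e.space.carrier

lemma Inside.trans {a b c : Prism d} (h : Inside a b) (h' : Inside b c) : Inside a c :=
  ⟨h.1.trans h'.1, h.2.trans h'.2⟩

namespace Good

variable {T : ℝ} {Ω : Set (Sp d)} {𝓘 : Set TimeInterval} {𝒯 : Set (TaggedSimplex d)} {s₁ s₂ : ℝ}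
  {P : Set (Prism d)}

lemma inside (h : Good T Ω 𝓘 𝒯 s₁ s₂ P) {E c} (hE : E ∈ P) (hc : c ∈ E.atomicSplit s₁ s₂) :
    Inside c E :=
  ⟨((h.valid hE).iter hc.2.2).2.1, (h.adm hE).child_subset hc.2.1⟩

lemma finite_atomicSplit (E : Prism d) : (E.atomicSplit s₁ s₂).Finite := by
  have h1 : E.space.bisect.Finite := (finite_singleton _).insert _
  refine (((E.time.finite_bisectIter
    (timeLevel s₁ s₂ d (E.level + 1) - timeLevel s₁ s₂ d E.level)).prod h1).image
    (fun q => (⟨q.1, q.2, E.level + 1⟩ : Prism d))).subset ?_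
  intro c hc
  exact ⟨(c.time, c.space), ⟨hc.2.2, hc.2.1⟩, Prism.ext' rfl rfl hc.1.symm⟩

/-- The simultaneous atomic split of prisms of equal level preserves graded partitions if all
necessary refinements are carried out. -/
lemma splitAll (h : Good T Ω 𝓘 𝒯 s₁ s₂ P) {K : Set (Prism d)} (hK : K ⊆ P) {n : ℕ}
    (hn : ∀ E ∈ K, E.level = n) (hcl : ∀ E ∈ K, necRef E P ⊆ K) :
    Good T Ω 𝓘 𝒯 s₁ s₂ (splitAll s₁ s₂ P K) := by
  have hmem : ∀ {c}, c ∈ PrismMesh.splitAll s₁ s₂ P K ↔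
      (c ∈ P ∧ c ∉ K) ∨ ∃ E ∈ K, c ∈ E.atomicSplit s₁ s₂ := by
    intro c; simp [PrismMesh.splitAll]
  have htm : ∀ {E c E' c' : Prism d}, Inside c E → Inside c' E' →
      (c.time.carrier ∩ c'.time.carrier).Nonempty → (E.time.carrier ∩ E'.time.carrier).Nonempty :=
    fun hc hc' hne => hne.mono (inter_subset_inter hc.1 hc'.1)
  have hself : ∀ E : Prism d, Inside E E := fun E => ⟨Subset.rfl, Subset.rfl⟩
  have htime : ∀ E ∈ PrismMesh.splitAll s₁ s₂ P K,
      E.time ∈ TimeInterval.tunif 𝓘 (timeLevel s₁ s₂ d E.level) := by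
    intro c hc
    rcases hmem.1 hc with ⟨hc, -⟩ | ⟨E, hE, hc⟩
    · exact h.time c hc
    · rw [hc.1, ← Nat.add_sub_cancel' (h.levelMono (Nat.le_succ E.level))]
      exact mem_tunif_add.2 ⟨E.time, h.time E (hK hE), hc.2.2⟩
  have hspace : ∀ E ∈ PrismMesh.splitAll s₁ s₂ P K, E.space ∈ TaggedSimplex.unif 𝒯 E.level := by
    intro c hc
    rcases hmem.1 hc with ⟨hc, -⟩ | ⟨E, hE, hc⟩
    · exact h.space c hc
    · rw [hc.1, unif_succ]
      exact mem_refineAll.2 ⟨E.space, h.space E (hK hE), hc.2.1⟩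
  -- A split prism and a kept prism: the kept one is not a necessary refinement of the parent of the
  -- former. Two split prisms have the same level and belong to uniform refinements.
  have hmixConf : ∀ {E c c'}, E ∈ K → c ∈ E.atomicSplit s₁ s₂ → c' ∈ P → c' ∉ K →
      (c.time.carrier ∩ c'.time.carrier).Nonempty → c.space.Conf c'.space := by
    intro E c c' hE hc hc' hc'K hne
    have hne' := htm (h.inside (hK hE) hc) (hself c') hne
    refine (h.conf E (hK hE) c' hc' hne').bisect_left (h.adm (hK hE)) hc.2.1 fun hends => ?_
    exact hc'K (hcl E hE (Or.inr (h.mem_necRefSpace_of_ends (hK hE) hc'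
      (fun h => hc'K (h ▸ hE)) hne' (hends.trans c'.space.verts_subset_carrier))))
  have hmixDisj : ∀ {E c c'}, E ∈ K → c ∈ E.atomicSplit s₁ s₂ → c' ∈ P → c' ∉ K →
      (c.time.carrier ∩ c'.time.carrier).Nonempty →
      Disjoint (interior c.space.carrier) (interior c'.space.carrier) := by
    intro E c c' hE hc hc' hc'K hne
    have hin := h.inside (hK hE) hc
    exact (h.disj E (hK hE) c' hc' (fun h => hc'K (h ▸ hE)) (htm hin (hself c') hne)).mono_left
      (interior_mono hin.2)
  have hmixSpace : d = 1 → ∀ {E c c'}, E ∈ K → c ∈ E.atomicSplit s₁ s₂ → c' ∈ P → c' ∉ K →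
      (c.time.carrier ∩ c'.time.carrier).Nonempty →
      (c.space.carrier ∩ c'.space.carrier).Nonempty → c.level ≤ c'.level + 1 ∧
        c'.level ≤ c.level + 1 := by
    intro hd E c c' hE hc hc' hc'K hne hnx
    have hin := h.inside (hK hE) hc
    have hne' := htm hin (hself c') hne
    have hnx' := hnx.mono (inter_subset_inter_left c'.space.carrier hin.2)
    have h1 := h.grad_space hd E (hK hE) c' hc' hne' hnx'
    have h2 := h.grad_space hd c' hc' E (hK hE) (by rwa [inter_comm]) (by rwa [inter_comm])
    have h3 : c'.level + 1 ≠ E.level := fun hl =>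
      hc'K (hcl E hE (Or.inr (h.mem_necRefSpace_one hd (hK hE) hc' hl hne' hnx')))
    have h4 := hc.1
    omega
  have hmixTime : ∀ {E c c'}, E ∈ K → c ∈ E.atomicSplit s₁ s₂ → c' ∈ P → c' ∉ K →
      (closure c.time.carrier ∩ closure c'.time.carrier).Nonempty →
      (interior c.space.carrier ∩ interior c'.space.carrier).Nonempty →
      c.level ≤ c'.level + 1 ∧ c'.level ≤ c.level + 1 := by
    intro E c c' hE hc hc' hc'K hcl' hov
    have hin := h.inside (hK hE) hc
    have hov' := hov.mono (inter_subset_inter_left (interior c'.space.carrier) (interior_mono hin.2))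
    have hcl'' := hcl'.mono (inter_subset_inter_left (closure c'.time.carrier) (closure_mono hin.1))
    have hdis : Disjoint E.time.carrier c'.time.carrier := by
      by_contra hcon
      rw [not_disjoint_iff_nonempty_inter] at hcon
      exact hov'.not_disjoint (h.disj E (hK hE) c' hc' (fun h => hc'K (h ▸ hE)) hcon)
    have h1 := h.grad_time E (hK hE) c' hc' hdis hcl'' hov'
    have h2 := h.grad_time c' hc' E (hK hE) hdis.symm (by rwa [inter_comm]) (by rwa [inter_comm])
    have h3 : c'.level + 1 ≠ E.level := fun hl =>
      hc'K (hcl E hE (Or.inl (h.mem_necRefTime (hK hE) hc' hl hdis hcl'' hov')))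
    have h4 := hc.1
    omega
  refine ⟨h.grid, h.triang, h.pos₁, h.pos₂, ?_, htime, hspace, ?_, ?_, ?_, ?_, ?_⟩
  · exact (h.finite.subset sdiff_subset).union
      ((h.finite.subset hK).biUnion fun E _ => finite_atomicSplit E)
  · intro t ht x hx
    obtain ⟨E, hE, htE, hxE⟩ := h.cover t ht x hx
    by_cases hEK : E ∈ K
    · obtain ⟨J, hJ, htJ⟩ := exists_mem_iter htE
        (timeLevel s₁ s₂ d (E.level + 1) - timeLevel s₁ s₂ d E.level)
      obtain ⟨c, hc, hxc⟩ := (h.adm hE).mem_child hxE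
      exact ⟨⟨J, c, E.level + 1⟩, hmem.2 (Or.inr ⟨E, hEK, rfl, hc, hJ⟩), htJ, hxc⟩
    · exact ⟨E, hmem.2 (Or.inl ⟨hE, hEK⟩), htE, hxE⟩
  · intro c hc c' hc' hne ht
    rcases hmem.1 hc with ⟨hcP, hcK⟩ | ⟨E, hE, hcE⟩ <;>
    rcases hmem.1 hc' with ⟨hcP', hcK'⟩ | ⟨E', hE', hcE'⟩
    · exact h.disj c hcP c' hcP' hne ht
    · exact (hmixDisj hE' hcE' hcP hcK (by rwa [inter_comm])).symm
    · exact hmixDisj hE hcE hcP' hcK' ht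
    · have hlev : c.level = c'.level := by rw [hcE.1, hcE'.1, hn E hE, hn E' hE']
      have hteq : c.time = c'.time := by
        by_contra hne'
        have h1 := htime c hc
        have h2 := htime c' hc'
        rw [hlev] at h1
        exact ht.not_disjoint ((h.grid.tunif _).disj _ h1 _ h2 hne')
      have h1 := hspace c hc
      rw [hlev] at h1
      exact h.triang.nonOverlap.unif h.triang.adm _ _ h1 _ (hspace c' hc')
        fun hs => hne (Prism.ext' hteq hs hlev)
  · intro c hc c' hc' ht
    rcases hmem.1 hc with ⟨hcP, hcK⟩ | ⟨E, hE, hcE⟩ <;>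
    rcases hmem.1 hc' with ⟨hcP', hcK'⟩ | ⟨E', hE', hcE'⟩
    · exact h.conf c hcP c' hcP' ht
    · exact (hmixConf hE' hcE' hcP hcK (by rwa [inter_comm])).symm
    · exact hmixConf hE hcE hcP' hcK' ht
    · have hlev : c.level = c'.level := by rw [hcE.1, hcE'.1, hn E hE, hn E' hE']
      have h1 := hspace c hc
      rw [hlev] at h1
      exact h.triang.conf_unif _ _ h1 _ (hspace c' hc')
  · intro hd c hc c' hc' ht hx
    rcases hmem.1 hc with ⟨hcP, hcK⟩ | ⟨E, hE, hcE⟩ <;>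
    rcases hmem.1 hc' with ⟨hcP', hcK'⟩ | ⟨E', hE', hcE'⟩
    · exact h.grad_space hd c hcP c' hcP' ht hx
    · exact (hmixSpace hd hE' hcE' hcP hcK (by rwa [inter_comm]) (by rwa [inter_comm])).2
    · exact (hmixSpace hd hE hcE hcP' hcK' ht hx).1
    · rw [hcE.1, hcE'.1, hn E hE, hn E' hE']; omega
  · intro c hc c' hc' ht htc hx
    rcases hmem.1 hc with ⟨hcP, hcK⟩ | ⟨E, hE, hcE⟩ <;>
    rcases hmem.1 hc' with ⟨hcP', hcK'⟩ | ⟨E', hE', hcE'⟩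
    · exact h.grad_time c hcP c' hcP' ht htc hx
    · exact (hmixTime hE' hcE' hcP hcK (by rwa [inter_comm]) (by rwa [inter_comm])).2
    · exact (hmixTime hE hcE hcP' hcK' htc hx).1
    · rw [hcE.1, hcE'.1, hn E hE, hn E' hE']; omega

/-- A partition `P'` obtained from `P` by refining prisms of levels less than `n`. -/
def RefinesBelow (n : ℕ) (P P' : Set (Prism d)) : Prop :=
  (∀ E ∈ P, n ≤ E.level → E ∈ P') ∧
    ∀ c ∈ P', c ∉ P → c.level ≤ n ∧ ∃ e ∈ P, e.level < n ∧ Inside c e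

lemma RefinesBelow.trans {n : ℕ} {P P' P'' : Set (Prism d)} (h : RefinesBelow n P P')
    (h' : RefinesBelow n P' P'') : RefinesBelow n P P'' := by
  refine ⟨fun E hE hl => h'.1 E (h.1 E hE hl) hl, fun c hc hcP => ?_⟩
  by_cases hc' : c ∈ P'
  · exact h.2 c hc' hcP
  obtain ⟨hl, e, he, hle, hin⟩ := h'.2 c hc hc'
  refine ⟨hl, ?_⟩
  by_cases heP : e ∈ P
  · exact ⟨e, heP, hle, hin⟩
  · obtain ⟨-, e', he', hle', hin'⟩ := h.2 e he heP
    exact ⟨e', he', hle', hin.trans hin'⟩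

/-- Splitting a set of prisms of level `m < n` after a refinement below `m` is a refinement
below `n`. -/
lemma RefinesBelow.splitAll {m n : ℕ} (hmn : m < n) {P Q L : Set (Prism d)}
    (hQ : Good T Ω 𝓘 𝒯 s₁ s₂ Q) (h : RefinesBelow m P Q) (hL : L ⊆ Q)
    (hLm : ∀ E ∈ L, E.level = m) : RefinesBelow n P (PrismMesh.splitAll s₁ s₂ Q L) := by
  have hself : ∀ E : Prism d, Inside E E := fun E => ⟨Subset.rfl, Subset.rfl⟩
  refine ⟨fun E hE hl => Or.inl ⟨h.1 E hE (by omega), fun hEL => ?_⟩, ?_⟩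
  · have := hLm E hEL; omega
  · rintro c (⟨hcQ, -⟩ | hc) hcP
    · obtain ⟨h1, e, he, hle, hin⟩ := h.2 c hcQ hcP
      exact ⟨by omega, e, he, by omega, hin⟩
    · simp only [mem_iUnion, exists_prop] at hc
      obtain ⟨E, hE, hc⟩ := hc
      have hin := hQ.inside (hL hE) hc
      have hEm := hLm E hE
      refine ⟨by rw [hc.1]; omega, ?_⟩
      by_cases hEP : E ∈ P
      · exact ⟨E, hEP, by omega, hin⟩
      · obtain ⟨-, e, he, hle, hin'⟩ := h.2 E (hL hE) hEP
        exact ⟨e, he, by omega, hin.trans hin'⟩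

/-- Refinements below `n` create no new necessary refinements of prisms of level `n` all of whose
necessary refinements have level `n`. -/
lemma necRef_subset_of_refinesBelow {n : ℕ} {P' : Set (Prism d)} (h : Good T Ω 𝓘 𝒯 s₁ s₂ P)
    (hP' : RefinesBelow n P P') {E : Prism d} (hE : E ∈ P) (hn : E.level = n)
    (hN : ∀ X ∈ necRef E P, X.level = n) : necRef E P' ⊆ necRef E P := by
  intro X hX
  have hXP' : X ∈ P' := by rcases hX with hX | hX <;> exact hX.1
  by_cases hXP : X ∈ P
  · rcases hX with ⟨-, hX⟩ | ⟨-, hX⟩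
    · exact Or.inl ⟨hXP, hX⟩
    · exact Or.inr ⟨hXP, hX⟩
  -- a new element descends from some `e` of lower level, which would be a necessary refinement
  exfalso
  obtain ⟨-, e, he, hle, hin⟩ := hP'.2 X hXP' hXP
  have heE : e ≠ E := by rintro rfl; omega
  suffices e ∈ necRef E P by have := hN e this; omega
  have hmeet : 0 < volume (E.time.carrier ∩ X.time.carrier) →
      (E.time.carrier ∩ e.time.carrier).Nonempty := fun hv =>
    (nonempty_of_measure_ne_zero hv.ne').mono (inter_subset_inter_right _ hin.1)
  rcases hX with ⟨-, -, hc, hdim, hl⟩ | ⟨-, -, hv, ⟨-, -, -, hR⟩ | ⟨hd, hcard, hl⟩⟩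
  · have hov := ((dimension_inter_eq_iff h.triang.pos).1 hdim).mono
      (inter_subset_inter_right _ (interior_mono hin.2))
    have hcl : (closure E.time.carrier ∩ closure e.time.carrier).Nonempty :=
      (nonempty_of_ncard_ne_zero (by rw [hc]; exact one_ne_zero)).mono
        (inter_subset_inter_right _ (closure_mono hin.1))
    have hdis : Disjoint E.time.carrier e.time.carrier := by
      by_contra hcon
      rw [not_disjoint_iff_nonempty_inter] at hcon
      exact hov.not_disjoint (h.disj E hE e he heE.symm hcon)
    have := h.grad_time E hE e he hdis hcl hov
    exact Or.inl (h.mem_necRefTime hE he (by omega) hdis hcl hov)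
  · exact Or.inr (h.mem_necRefSpace_of_ends hE he heE (hmeet hv)
      ((ends_subset_of_refEdge hR).trans hin.2))
  · have hx : (E.space.carrier ∩ e.space.carrier).Nonempty :=
      (nonempty_of_ncard_ne_zero (by rw [hcard]; exact one_ne_zero)).mono
        (inter_subset_inter_right _ hin.2)
    have := h.grad_space hd E hE e he (hmeet hv) hx
    exact Or.inr (h.mem_necRefSpace_one hd hE he (by omega) (hmeet hv) hx)

/-- The invariants of the patch refinement: `K`, `F` and `G` consist of prisms of one level `n`, the
necessary refinements of the prisms of `K` are in `K ∪ F`, and the recursive calls concern prisms of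
levels less than `n`, so that they preserve these properties. In the end, the set to be split
contains all necessary refinements of its elements. -/
lemma patchRun {K F G P' K' : Set (Prism d)} (hrun : PatchRun s₁ s₂ P K F G P' K') :
    ∀ n, Good T Ω 𝓘 𝒯 s₁ s₂ P → K ∪ F ∪ G ⊆ P → (∀ E ∈ K ∪ F ∪ G, E.level = n) →
    (∀ E ∈ K, necRef E P ⊆ K ∪ F) →
    Good T Ω 𝓘 𝒯 s₁ s₂ P' ∧ K' ⊆ P' ∧ (∀ E ∈ K', E.level = n) ∧ (∀ E ∈ K', necRef E P' ⊆ K') ∧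
      RefinesBelow n P P' := by
  induction hrun with
  | done P K =>
    intro n h hsub hl hcl
    simp only [union_empty] at hsub hl hcl
    exact ⟨h, hsub, hl, hcl, fun E hE _ => hE, fun c hc hcP => absurd hc hcP⟩
  | next P K F G P' K' hF hG _ ih =>
    intro n h hsub hl hcl
    refine ih n h (by simpa using hsub) (by simpa using hl) ?_
    rintro E (hE | hE)
    · exact (hcl E hE).trans subset_union_left
    · intro X hX
      by_cases hXK : X ∈ K ∪ F
      · exact Or.inl hXK
      · exact Or.inr (hG E hE X ⟨hX, hXK⟩)
  | equal P K F G P' K' E' E'' hE' hE'' hlev _ ih =>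
    intro n h hsub hl hcl
    have hE''P : E'' ∈ P := by rcases hE''.1 with hX | hX <;> exact hX.1
    refine ih n h ?_ ?_ hcl
    · rintro X (hX | rfl | hX)
      · exact hsub (Or.inl hX)
      · exact hE''P
      · exact hsub (Or.inr hX)
    · rintro X (hX | rfl | hX)
      · exact hl X (Or.inl hX)
      · rw [← hlev]; exact hl E' (Or.inl (Or.inr hE'))
      · exact hl X (Or.inr hX)
  | coarser P K F G P' K' Q L E' E'' hE' hE'' hlev _ _ ih1 ih2 =>
    intro n h hsub hl hcl
    have hE''P : E'' ∈ P := by rcases hE''.1 with hX | hX <;> exact hX.1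
    have hE'n := hl E' (Or.inl (Or.inr hE'))
    have hlt : E''.level < n := by
      have := h.level_le_of_mem_necRef (hsub (Or.inl (Or.inr hE'))) hE''.1
      omega
    obtain ⟨hQ, hLQ, hLn, hLcl, hr⟩ := ih1 E''.level h (by simpa using hE''P) (by simp) (by simp)
    have hr' : RefinesBelow n P (PrismMesh.splitAll s₁ s₂ Q L) := hr.splitAll hlt hQ hLQ hLn
    obtain ⟨h1, h2, h3, h4, h5⟩ := ih2 n (hQ.splitAll hLQ hLn hLcl) (by
        rintro X (hX | hX | hX)
        · exact hr'.1 X (hsub (Or.inl hX)) (hl X (Or.inl hX)).ge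
        · exact hr'.1 X (hsub (Or.inr hX)) (hl X (Or.inr hX)).ge
        · rcases hX.2.2.1 with hX | hX <;> exact hX.1) (by
        rintro X (hX | hX | hX)
        · exact hl X (Or.inl hX)
        · exact hl X (Or.inr hX)
        · rw [hX.2.2.2, hE'n]) (by
        intro E hE
        have hE1 : E ∈ K ∪ F ∪ G := Or.inl (Or.inl hE)
        exact (h.necRef_subset_of_refinesBelow hr' (hsub hE1) (hl E hE1)
          fun X hX => hl X (Or.inl (hcl E hE hX))).trans (hcl E hE))
    exact ⟨h1, h2, h3, h4, hr'.trans h5⟩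

/-- Patch refinements of graded partitions are graded. -/
lemma patchRefine (h : Good T Ω 𝓘 𝒯 s₁ s₂ P) {E : Prism d} (hE : E ∈ P) {P' : Set (Prism d)}
    (hP' : PatchRefine s₁ s₂ P E P') : Good T Ω 𝓘 𝒯 s₁ s₂ P' := by
  obtain ⟨Q, K, hrun, rfl⟩ := hP'
  obtain ⟨h1, h2, h3, h4, -⟩ := patchRun hrun E.level h (by simpa using hE) (by simp) (by simp)
  exact h1.splitAll h2 h3 h4

/-- The initial partition is graded. -/
lemma prisms (M : InitialMesh d T Ω) (hd : 1 ≤ d) (hT : 0 < T) (hΩ : IsLipschitzDomain Ω)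
    (h₁ : 0 < s₁) (h₂ : 0 < s₂) : Good T Ω M.intervals M.simplices s₁ s₂ M.prisms := by
  have hg := M.grid hT
  have ht := M.triang hd hΩ
  have hteq : ∀ E ∈ M.prisms, ∀ E' ∈ M.prisms, (E.time.carrier ∩ E'.time.carrier).Nonempty →
      E.time = E'.time := by
    intro E hE E' hE' hne
    by_contra h
    exact hne.not_disjoint (hg.disj _ hE.1 _ hE'.1 h)
  refine ⟨hg, ht, h₁, h₂, ?_, ?_, ?_, ?_, ?_, ?_, ?_, ?_⟩
  · refine ((hg.finite.prod ht.finite).image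
      (fun q => (⟨q.1, q.2, 0⟩ : Prism d))).subset ?_
    intro E hE
    exact ⟨(E.time, E.space), ⟨hE.1, hE.2.1⟩, Prism.ext' rfl rfl hE.2.2.symm⟩
  · intro E hE
    rw [hE.2.2, timeLevel_zero]
    exact ⟨E.time, hE.1, rfl⟩
  · intro E hE
    rw [hE.2.2]; exact hE.2.1
  · intro t htT x hx
    obtain ⟨I, hI, htI⟩ := hg.cover t htT
    rw [← ht.cover] at hx
    simp only [mem_iUnion, exists_prop] at hx
    obtain ⟨S, hS, hxS⟩ := hx
    exact ⟨⟨I, S, 0⟩, ⟨hI, hS, rfl⟩, htI, hxS⟩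
  · intro E hE E' hE' hne hmeet
    exact ht.nonOverlap _ hE.2.1 _ hE'.2.1 fun hs =>
      hne (Prism.ext' (hteq E hE E' hE' hmeet) hs (hE.2.2.trans hE'.2.2.symm))
  · intro E hE E' hE' _
    exact ht.conf _ hE.2.1 _ hE'.2.1
  · intro _ E hE E' hE' _ _
    rw [hE.2.2]; omega
  · intro E hE E' hE' _ _ _
    rw [hE.2.2]; omega

/-- All partitions obtained from the initial one by patch refinements are graded. -/
lemma of_reachable (M : InitialMesh d T Ω) (hd : 1 ≤ d) (hT : 0 < T) (hΩ : IsLipschitzDomain Ω)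
    (h₁ : 0 < s₁) (h₂ : 0 < s₂) (h : Reachable s₁ s₂ M.prisms P) :
    Good T Ω M.intervals M.simplices s₁ s₂ P := by
  induction h with
  | refl => exact prisms M hd hT hΩ h₁ h₂
  | step P P' E _ hE h ih => exact ih.patchRefine hE h

end Good

end

section
variable {d : ℕ}
open TaggedSimplex TimeInterval

/-! ### Volumes and diameters under bisection -/

namespace TaggedSimplex

lemma volume_image_affine (f : Sp d →ᵃ[ℝ] Sp d) (A : Set (Sp d)) :
    volume (f '' A) = ENNReal.ofReal |LinearMap.det f.linear| * volume A := by
  have h1 : (f : Sp d → Sp d) = (fun y => y + f 0) ∘ f.linear := by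
    rw [f.decomp]; funext x; simp
  rw [h1, image_comp, image_add_right, measure_preimage_add_right,
    Measure.addHaar_image_linearMap]

lemma volume_carrier_ne_top (S : TaggedSimplex d) : volume S.carrier ≠ ⊤ :=
  S.isCompact_carrier.measure_lt_top.ne

lemma Nondeg.volume_pos {S : TaggedSimplex d} (h : S.Nondeg) : 0 < volume S.carrier :=
  Measure.measure_pos_of_nonempty_interior _ h.interior_nonempty

lemma Nondeg.volume_real_pos {S : TaggedSimplex d} (h : S.Nondeg) : 0 < volume.real S.carrier :=
  ENNReal.toReal_pos h.volume_pos.ne' S.volume_carrier_ne_top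

/-- Non-overlapping simplices meet in a null set. -/
lemma aedisjoint_of_interior {S S' : TaggedSimplex d}
    (h : Disjoint (interior S.carrier) (interior S'.carrier)) :
    AEDisjoint volume S.carrier S'.carrier := by
  have h1 : S.carrier ∩ S'.carrier ⊆ frontier S.carrier ∪ frontier S'.carrier := by
    rintro x ⟨hx, hx'⟩
    by_contra hcon
    rw [mem_union, not_or] at hcon
    rw [S.isClosed_carrier.frontier_eq, S'.isClosed_carrier.frontier_eq] at hcon
    simp only [mem_sdiff, hx, hx', true_and, not_not] at hcon
    exact Set.disjoint_left.1 h hcon.1 hcon.2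
  exact measure_mono_null h1 (measure_union_null (S.convex_carrier.addHaar_frontier volume)
    (S'.convex_carrier.addHaar_frontier volume))

/-- The children have equal volumes, being exchanged by the affine reflection that swaps the end
points of the refinement edge. -/
lemma Adm.volume_children {S : TaggedSimplex d} (h : S.Adm) :
    volume S.child₂.carrier = volume S.child₁.carrier := by
  set u : Sp d := S.vert (Fin.last d) - S.vert 0 with hu
  -- `f` swaps the end points of the refinement edge and fixes the other vertices
  set g : Sp d →ᵃ[ℝ] ℝ := h.nondeg.coord 0 - h.nondeg.coord (Fin.last d) with hg
  set f : Sp d →ᵃ[ℝ] Sp d := AffineMap.id ℝ (Sp d) +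
    (LinearMap.toSpanSingleton ℝ (Sp d) u).toAffineMap.comp g with hf
  have hfx : ∀ x, f x = x + (h.nondeg.coord 0 x - h.nondeg.coord (Fin.last d) x) • u := fun x => by
    simp [hf, hg, sub_smul]
  have h0l := zero_ne_last h.pos
  have hf0 : f (S.vert 0) = S.vert (Fin.last d) := by
    rw [hfx, h.nondeg.coord_vert, h.nondeg.coord_vert, if_pos rfl, if_neg h0l.symm, hu]; simp
  have hfl : f (S.vert (Fin.last d)) = S.vert 0 := by
    rw [hfx, h.nondeg.coord_vert, h.nondeg.coord_vert, if_pos rfl, if_neg h0l, hu]; simp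
  have hfk : ∀ k, k ≠ 0 → k ≠ Fin.last d → f (S.vert k) = S.vert k := fun k h1 h2 => by
    rw [hfx, h.nondeg.coord_vert, h.nondeg.coord_vert, if_neg h1.symm, if_neg h2.symm]; simp
  have hfm : f S.mid = S.mid := by
    rw [mid, AffineMap.map_midpoint, hf0, hfl, midpoint_comm]
  have hinv : f.comp f = AffineMap.id ℝ (Sp d) := by
    refine AffineMap.ext_on (s := S.verts) ?_ ?_
    · exact h.nondeg.affineSpan_eq
    · rintro _ ⟨k, rfl⟩
      by_cases h1 : k = 0
      · subst h1; simp [hf0, hfl]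
      by_cases h2 : k = Fin.last d
      · subst h2; simp [hf0, hfl]
      · simp [hfk k h1 h2]
  have hdet : |LinearMap.det f.linear| = 1 := by
    have h1 : LinearMap.det (f.linear ∘ₗ f.linear) = 1 := by
      have : f.linear ∘ₗ f.linear = (f.comp f).linear := rfl
      rw [this, hinv]; simp
    rw [LinearMap.det_comp] at h1
    rcases mul_self_eq_one_iff.1 h1 with h2 | h2 <;> simp [h2]
  have himg : f '' S.child₁.verts = S.child₂.verts := by
    rw [verts_child₁ h.nondeg h.pos, verts_child₂ h.nondeg h.pos h.type_lt, image_insert_eq, hfm]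
    congr 1
    ext y
    constructor
    · rintro ⟨_, ⟨⟨k, rfl⟩, hk⟩, rfl⟩
      by_cases h1 : k = 0
      · subst h1; rw [hf0]; exact ⟨S.vert_mem _, h.ends_ne.symm⟩
      have h2 : k ≠ Fin.last d := fun h => hk (h ▸ rfl)
      rw [hfk k h1 h2]
      exact ⟨S.vert_mem _, fun h' => h1 (h.nondeg.injective h')⟩
    · rintro ⟨⟨k, rfl⟩, hk⟩
      by_cases h2 : k = Fin.last d
      · subst h2; exact ⟨_, ⟨S.vert_mem 0, h.ends_ne⟩, hf0⟩
      have h1 : k ≠ 0 := fun h => hk (h ▸ rfl)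
      exact ⟨_, ⟨S.vert_mem k, fun h' => h2 (h.nondeg.injective h')⟩, hfk k h1 h2⟩
  have hcar : S.child₂.carrier = f '' S.child₁.carrier := by
    rw [carrier, carrier, AffineMap.image_convexHull]
    exact congrArg _ himg.symm
  rw [hcar, volume_image_affine, hdet]; simp

lemma Adm.volume_child {S c : TaggedSimplex d} (h : S.Adm) (hc : c ∈ S.bisect) :
    volume.real c.carrier = volume.real S.carrier / 2 := by
  have h1 : S.carrier = S.child₁.carrier ∪ S.child₂.carrier := by
    apply Subset.antisymm
    · intro x hx
      obtain ⟨c, hc | hc, hx⟩ := h.mem_child hx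
      · subst hc; exact Or.inl hx
      · rw [mem_singleton_iff] at hc; subst hc; exact Or.inr hx
    · exact union_subset (h.child_subset (Or.inl rfl)) (h.child_subset (Or.inr rfl))
  have h2 : volume S.carrier = volume S.child₁.carrier + volume S.child₁.carrier := by
    rw [h1, measure_union₀ S.child₂.isClosed_carrier.measurableSet.nullMeasurableSet
      (aedisjoint_of_interior h.disjoint_children), h.volume_children]
  have h3 : volume c.carrier = volume S.child₁.carrier := by
    rcases hc with rfl | rfl
    · rfl
    · exact h.volume_children
  rw [Measure.real, Measure.real, h2, h3, ENNReal.toReal_add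
    S.child₁.volume_carrier_ne_top S.child₁.volume_carrier_ne_top]
  ring

lemma Adm.volume_unif {S c : TaggedSimplex d} (h : S.Adm) {n : ℕ} (hc : c ∈ TaggedSimplex.unif {S} n) :
    volume.real c.carrier = volume.real S.carrier / 2 ^ n := by
  induction n generalizing c with
  | zero => rw [unif_zero, mem_singleton_iff] at hc; subst hc; simp
  | succ n ih =>
    rw [unif_succ] at hc
    obtain ⟨A, hA, hc⟩ := mem_refineAll.1 hc
    rw [(h.unif hA).volume_child hc, ih hA, pow_succ, div_div]

/-- The scale of a tagged simplex: `δ` bounds the edges of the path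
`x₀, x_{γ+1}, x_{γ+2}, …, x_d`, and `δ / 2` those of the path `(x₀ + x_d) / 2, x₁, …, x_γ`.
Bisection transforms these paths into each other, which is why the scale is halved by `d`
successive bisections. -/
structure Spread (S : TaggedSimplex d) (δ : ℝ) : Prop where
  first : ‖S.vert (Fin.ofNat (d + 1) (S.type + 1)) - S.vert 0‖ ≤ δ
  upper : ∀ k, S.type < k → k < d →
    ‖S.vert (Fin.ofNat (d + 1) (k + 1)) - S.vert (Fin.ofNat (d + 1) k)‖ ≤ δ
  start : 1 ≤ S.type → ‖S.vert (Fin.ofNat (d + 1) 1) - S.mid‖ ≤ δ / 2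
  lower : ∀ k, 1 ≤ k → k < S.type →
    ‖S.vert (Fin.ofNat (d + 1) (k + 1)) - S.vert (Fin.ofNat (d + 1) k)‖ ≤ δ / 2

lemma child₁_vert (S : TaggedSimplex d) {k : ℕ} (hk : k ≤ d) :
    S.child₁.vert (Fin.ofNat (d + 1) k) = if k = 0 then S.vert 0 else if k = 1 then S.mid
      else S.vert (Fin.ofNat (d + 1) (k - 1)) := by
  simp only [child₁, ofNat_val hk]; rfl

lemma child₂_vert (S : TaggedSimplex d) {k : ℕ} (hk : k ≤ d) :
    S.child₂.vert (Fin.ofNat (d + 1) k) = if k = 0 then S.vert (Fin.last d) else if k = 1 then S.mid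
      else if k ≤ S.type + 1 then S.vert (Fin.ofNat (d + 1) (k - 1))
      else S.vert (Fin.ofNat (d + 1) (d + S.type + 1 - k)) := by
  simp only [child₂, ofNat_val hk]; rfl

lemma ofNat_last : Fin.ofNat (d + 1) d = Fin.last d := Fin.ext (by simp [Fin.ofNat])

lemma norm_midpoint_sub_midpoint (a b c : Sp d) :
    ‖midpoint ℝ a b - midpoint ℝ a c‖ = ‖b - c‖ / 2 := by
  have : midpoint ℝ a b - midpoint ℝ a c = (2 : ℝ)⁻¹ • (b - c) := by
    simp only [midpoint_eq_smul_add, smul_add, smul_sub, invOf_eq_inv]; abel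
  rw [this, norm_smul]; norm_num; ring

/-- The scale is halved when the type returns to zero. -/
lemma Spread.child {S c : TaggedSimplex d} (h : S.Adm) {δ : ℝ} (hS : S.Spread δ)
    (hc : c ∈ S.bisect) : c.Spread (if S.type + 1 = d then δ / 2 else δ) := by
  have hd := h.pos
  have hm0 : ‖S.mid - S.vert 0‖ = ‖S.vert (Fin.last d) - S.vert 0‖ / 2 := by
    rw [mid, ← norm_midpoint_sub_midpoint (S.vert 0) (S.vert (Fin.last d)), midpoint_self]
  have hml : ‖S.mid - S.vert (Fin.last d)‖ = ‖S.vert (Fin.last d) - S.vert 0‖ / 2 := by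
    rw [mid, midpoint_comm, ← norm_neg (_ - S.vert 0), neg_sub,
      ← norm_midpoint_sub_midpoint (S.vert (Fin.last d)) (S.vert 0), midpoint_self]
  have htc := type_bisect hc
  have hlt := h.type_lt
  by_cases htd : S.type + 1 = d
  · -- the type returns to zero
    rw [if_pos htd]
    have ht0 : c.type = 0 := by rw [htc, htd, Nat.mod_self]
    have hfirst := hS.first
    rw [htd, ofNat_last] at hfirst
    refine ⟨?_, ?_, by omega, by omega⟩
    · rw [ht0]
      rcases hc with rfl | rfl
      · rw [child₁_vert S (by omega), child₁_vert_zero]; simp; linarith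
      · rw [child₂_vert S (by omega), child₂_vert_zero]; simp; linarith
    · intro k hk1 hk2
      have hkey : ‖S.vert (Fin.ofNat (d + 1) k) -
          if k = 1 then S.mid else S.vert (Fin.ofNat (d + 1) (k - 1))‖ ≤ δ / 2 := by
        by_cases h1 : k = 1
        · subst h1; rw [if_pos rfl]; exact hS.start (by omega)
        · rw [if_neg h1]
          have := hS.lower (k - 1) (by omega) (by omega)
          rwa [Nat.sub_add_cancel (by omega)] at this
      rcases hc with rfl | rfl
      · rw [child₁_vert S (by omega), child₁_vert S (by omega), if_neg (by omega),
          if_neg (by omega), if_neg (by omega : ¬ k = 0)]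
        exact hkey
      · rw [child₂_vert S (by omega), child₂_vert S (by omega), if_neg (by omega),
          if_neg (by omega), if_neg (by omega : ¬ k = 0), if_pos (by omega : k + 1 ≤ S.type + 1),
          if_pos (by omega : k ≤ S.type + 1)]
        exact hkey
  · rw [if_neg htd]
    have ht : c.type = S.type + 1 := by rw [htc, Nat.mod_eq_of_lt (by omega)]
    have hlow : ∀ k, 1 ≤ k → k < S.type + 1 → ‖S.vert (Fin.ofNat (d + 1) k) -
          if k = 1 then S.mid else S.vert (Fin.ofNat (d + 1) (k - 1))‖ ≤ δ / 2 := by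
      intro k hk1 hk2
      by_cases h1 : k = 1
      · subst h1; rw [if_pos rfl]; exact hS.start (by omega)
      · rw [if_neg h1]
        have := hS.lower (k - 1) (by omega) (by omega)
        rwa [Nat.sub_add_cancel (by omega)] at this
    rcases hc with rfl | rfl
    · refine ⟨?_, ?_, fun _ => ?_, ?_⟩
      · rw [ht, child₁_vert S (by omega), child₁_vert_zero, if_neg (by omega), if_neg (by omega)]
        exact hS.first
      · intro k hk1 hk2
        rw [ht] at hk1
        rw [child₁_vert S (by omega), child₁_vert S (by omega), if_neg (by omega),
          if_neg (by omega), if_neg (by omega), if_neg (by omega)]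
        have := hS.upper (k - 1) (by omega) (by omega)
        rwa [Nat.sub_add_cancel (by omega)] at this
      · have hlast : S.child₁.vert (Fin.last d) = S.vert (Fin.ofNat (d + 1) (d - 1)) := by
          rw [← ofNat_last, child₁_vert S le_rfl, if_neg (by omega), if_neg (by omega)]
        change ‖_ - midpoint ℝ (S.child₁.vert 0) (S.child₁.vert (Fin.last d))‖ ≤ _
        rw [child₁_vert S (by omega), child₁_vert_zero, hlast, if_neg (by omega), if_pos rfl,
          mid, norm_midpoint_sub_midpoint]
        have := hS.upper (d - 1) (by omega) (by omega)
        rw [Nat.sub_add_cancel (by omega), ofNat_last] at this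
        linarith
      · intro k hk1 hk2
        rw [ht] at hk2
        rw [child₁_vert S (by omega), child₁_vert S (by omega), if_neg (by omega),
          if_neg (by omega), if_neg (by omega : ¬ k = 0)]
        exact hlow k hk1 hk2
    · refine ⟨?_, ?_, fun _ => ?_, ?_⟩
      · rw [ht, child₂_vert S (by omega), child₂_vert_zero, if_neg (by omega), if_neg (by omega),
          if_neg (by omega), ← norm_neg, neg_sub]
        have := hS.upper (d - 1) (by omega) (by omega)
        rw [Nat.sub_add_cancel (by omega), ofNat_last] at this
        rwa [show d + S.type + 1 - (S.type + 1 + 1) = d - 1 by omega]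
      · intro k hk1 hk2
        rw [ht] at hk1
        rw [child₂_vert S (by omega), child₂_vert S (by omega), if_neg (by omega),
          if_neg (by omega), if_neg (by omega), if_neg (by omega), if_neg (by omega),
          if_neg (by omega), ← norm_neg, neg_sub]
        have := hS.upper (d + S.type + 1 - (k + 1)) (by omega) (by omega)
        rwa [show d + S.type + 1 - (k + 1) + 1 = d + S.type + 1 - k by omega] at this
      · have hlast : S.child₂.vert (Fin.last d) = S.vert (Fin.ofNat (d + 1) (S.type + 1)) := by
          rw [← ofNat_last, child₂_vert S le_rfl, if_neg (by omega), if_neg (by omega),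
            if_neg (by omega), show d + S.type + 1 - d = S.type + 1 by omega]
        change ‖_ - midpoint ℝ (S.child₂.vert 0) (S.child₂.vert (Fin.last d))‖ ≤ _
        rw [child₂_vert S (by omega), child₂_vert_zero, hlast, if_neg (by omega), if_pos rfl,
          mid, midpoint_comm, norm_midpoint_sub_midpoint, ← norm_neg, neg_sub]
        linarith [hS.first]
      · intro k hk1 hk2
        rw [ht] at hk2
        rw [child₂_vert S (by omega), child₂_vert S (by omega), if_neg (by omega),
          if_neg (by omega), if_neg (by omega : ¬ k = 0), if_pos (by omega : k + 1 ≤ S.type + 1),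
          if_pos (by omega : k ≤ S.type + 1)]
        exact hlow k hk1 hk2

/-- The scale is halved by every `d` successive bisections. -/
lemma Spread.unif {S c : TaggedSimplex d} (h : S.Adm) {δ : ℝ} (hS : S.Spread δ) {n : ℕ}
    (hc : c ∈ TaggedSimplex.unif {S} n) : c.Spread (δ / 2 ^ ((S.type + n) / d)) := by
  have hd := h.pos
  induction n generalizing c with
  | zero =>
    rw [unif_zero, mem_singleton_iff] at hc; subst hc
    rw [add_zero, Nat.div_eq_of_lt h.type_lt]; simpa using hS
  | succ n ih =>
    rw [unif_succ] at hc
    obtain ⟨A, hA, hc⟩ := mem_refineAll.1 hc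
    have h1 := (ih hA).child (h.unif hA) hc
    rw [type_unif h.type_lt hA] at h1
    have h2 : (S.type + n + 1) / d = (S.type + n) / d + if d ∣ S.type + n + 1 then 1 else 0 :=
      Nat.succ_div
    rw [← add_assoc, h2]
    have h3 : d ∣ S.type + n + 1 ↔ (S.type + n) % d + 1 = d := by
      have h4 := Nat.mod_lt (S.type + n) hd
      rw [Nat.dvd_iff_mod_eq_zero, Nat.add_mod]
      rcases Nat.lt_or_ge 1 d with h5 | h5
      · rw [Nat.mod_eq_of_lt h5]
        constructor
        · intro h6
          by_contra h7
          rw [Nat.mod_eq_of_lt (by omega)] at h6; omega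
        · intro h6; rw [h6, Nat.mod_self]
      · have : d = 1 := by omega
        subst this; simp [Nat.mod_one]
    by_cases h4 : d ∣ S.type + n + 1
    · rw [if_pos h4, pow_succ, ← div_div]; rwa [if_pos (h3.1 h4)] at h1
    · rw [if_neg h4, add_zero]; rwa [if_neg (fun h => h4 (h3.2 h))] at h1

/-- The scale bounds the diameter, all vertices being on the two paths. -/
lemma Spread.norm_sub_le {S : TaggedSimplex d} (h : S.Adm) {δ : ℝ} (hS : S.Spread δ) (k) :
    ‖S.vert k - S.vert 0‖ ≤ 2 * d * δ := by
  have hd := h.pos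
  have hδ : 0 ≤ δ := (norm_nonneg _).trans hS.first
  have hup : ∀ j, S.type + 1 + j ≤ d →
      ‖S.vert (Fin.ofNat (d + 1) (S.type + 1 + j)) - S.vert 0‖ ≤ (j + 1) * δ := by
    intro j
    induction j with
    | zero => intro _; simpa using hS.first
    | succ j ih =>
      intro hj
      have h1 := ih (by omega)
      have h2 := hS.upper (S.type + 1 + j) (by omega) (by omega)
      have h3 := norm_add_le (S.vert (Fin.ofNat (d + 1) (S.type + 1 + j + 1)) -
        S.vert (Fin.ofNat (d + 1) (S.type + 1 + j)))
        (S.vert (Fin.ofNat (d + 1) (S.type + 1 + j)) - S.vert 0)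
      rw [sub_add_sub_cancel] at h3
      rw [← add_assoc]; push_cast; linarith
  have hd' : (1 : ℝ) ≤ d := by exact_mod_cast hd
  have hlast : ‖S.vert (Fin.last d) - S.vert 0‖ ≤ d * δ := by
    have h1 := hup (d - (S.type + 1)) (by have := h.type_lt; omega)
    rw [Nat.add_sub_cancel' h.type_lt, ofNat_last] at h1
    refine h1.trans (mul_le_mul_of_nonneg_right ?_ hδ)
    have : d - (S.type + 1) + 1 ≤ d := by omega
    exact_mod_cast this
  have hlow : ∀ j, 1 + j ≤ S.type →
      ‖S.vert (Fin.ofNat (d + 1) (1 + j)) - S.mid‖ ≤ (j + 1) * δ := by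
    intro j
    induction j with
    | zero => intro h1; have := hS.start (by omega); push_cast; linarith
    | succ j ih =>
      intro hj
      have h1 := ih (by omega)
      have h2 := hS.lower (1 + j) (by omega) (by omega)
      have h3 := norm_add_le (S.vert (Fin.ofNat (d + 1) (1 + j + 1)) -
        S.vert (Fin.ofNat (d + 1) (1 + j))) (S.vert (Fin.ofNat (d + 1) (1 + j)) - S.mid)
      rw [sub_add_sub_cancel] at h3
      rw [← add_assoc]; push_cast; linarith
  have hk : k = Fin.ofNat (d + 1) k.val := Fin.ext (by rw [ofNat_val (by omega)])
  rcases Nat.eq_zero_or_pos k.val with h0 | h0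
  · have : k = 0 := Fin.ext (by simpa using h0)
    rw [this, sub_self, norm_zero]; positivity
  rcases Nat.lt_or_ge S.type k.val with h1 | h1
  · have h2 := hup (k.val - (S.type + 1)) (by omega)
    rw [Nat.add_sub_cancel' h1, ← hk] at h2
    refine h2.trans (mul_le_mul_of_nonneg_right ?_ hδ)
    have h3 : k.val - (S.type + 1) + 1 ≤ 2 * d := by omega
    exact_mod_cast h3
  · have h2 := hlow (k.val - 1) (by omega)
    rw [Nat.add_sub_cancel' h0, ← hk] at h2
    have hm0 : ‖S.mid - S.vert 0‖ = ‖S.vert (Fin.last d) - S.vert 0‖ / 2 := by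
      rw [mid, ← norm_midpoint_sub_midpoint (S.vert 0) (S.vert (Fin.last d)), midpoint_self]
    have h3 := norm_add_le (S.vert k - S.mid) (S.mid - S.vert 0)
    rw [sub_add_sub_cancel] at h3
    have h4 : ((k.val - 1 : ℕ) : ℝ) + 1 ≤ d := by
      have : k.val - 1 + 1 ≤ d := by omega
      exact_mod_cast this
    have h5 := mul_le_mul_of_nonneg_right h4 hδ
    have h6 : 0 ≤ d * δ := by positivity
    linarith

lemma isBounded_carrier (S : TaggedSimplex d) : Bornology.IsBounded S.carrier :=
  S.isCompact_carrier.isBounded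

lemma Adm.diam_pos {S : TaggedSimplex d} (h : S.Adm) : 0 < Metric.diam S.carrier := by
  have h1 := Metric.dist_le_diam_of_mem S.isBounded_carrier (S.vert_mem_carrier 0)
    (S.vert_mem_carrier (Fin.last d))
  exact (dist_pos.2 h.ends_ne).trans_le h1

/-- Descendants of a simplex are shape-regular. -/
lemma Adm.diam_unif {S c : TaggedSimplex d} (h : S.Adm) {n : ℕ} (hc : c ∈ TaggedSimplex.unif {S} n) :
    Metric.diam c.carrier ^ d ≤ (16 * d * Metric.diam S.carrier) ^ d / 2 ^ n := by
  have hd := h.pos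
  set D := Metric.diam S.carrier with hD
  have hD0 : 0 < D := h.diam_pos
  have hdist : ∀ {x y}, x ∈ S.carrier → y ∈ S.carrier → ‖x - y‖ ≤ D := fun hx hy => by
    rw [← dist_eq_norm]; exact Metric.dist_le_diam_of_mem S.isBounded_carrier hx hy
  have hv := S.vert_mem_carrier
  have hm : S.mid ∈ S.carrier := S.convex_carrier.midpoint_mem (hv _) (hv _)
  have hS : S.Spread (2 * D) :=
    ⟨(hdist (hv _) (hv _)).trans (by linarith), fun k _ _ => (hdist (hv _) (hv _)).trans (by linarith),
      fun _ => (hdist (hv _) hm).trans (by linarith),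
      fun k _ _ => (hdist (hv _) (hv _)).trans (by linarith)⟩
  have hcA := h.unif hc
  have hcS := hS.unif h hc
  set q := (S.type + n) / d with hq
  have h1 : c.carrier ⊆ Metric.closedBall (c.vert 0) (2 * d * (2 * D / 2 ^ q)) := by
    apply convexHull_min _ (convex_closedBall _ _)
    rintro _ ⟨k, rfl⟩
    rw [Metric.mem_closedBall, dist_eq_norm]
    exact hcS.norm_sub_le hcA k
  have h2 : Metric.diam c.carrier ≤ 8 * d * D / 2 ^ q := by
    refine (Metric.diam_mono h1 Metric.isBounded_closedBall).trans
      ((Metric.diam_closedBall (by positivity)).trans (le_of_eq (by ring)))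
  have h3 : (2 : ℝ) ^ n ≤ (2 * 2 ^ q) ^ d := by
    rw [← pow_succ', ← pow_mul]
    apply pow_le_pow_right₀ one_le_two
    have := Nat.lt_mul_div_succ (S.type + n) hd
    rw [← hq, mul_comm] at this
    omega
  calc Metric.diam c.carrier ^ d ≤ (8 * d * D / 2 ^ q) ^ d :=
        pow_le_pow_left₀ Metric.diam_nonneg h2 d
    _ = (16 * d * D) ^ d / (2 * 2 ^ q) ^ d := by rw [← div_pow]; congr 1; field_simp; ring
    _ ≤ _ := by gcongr

/-- A point belongs to a bounded number of non-overlapping shape-regular simplices. -/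
lemma card_le_of_shape {c : ℝ} (F : Finset (TaggedSimplex d)) (hd : 1 ≤ d) {v : Sp d}
    (hA : ∀ S ∈ F, S.Adm) (hv : ∀ S ∈ F, v ∈ S.carrier)
    (hdis : ∀ S ∈ F, ∀ S' ∈ F, S ≠ S' → Disjoint (interior S.carrier) (interior S'.carrier))
    (hsh : ∀ S ∈ F, c * Metric.diam S.carrier ^ d ≤ volume.real S.carrier) :
    F.card * c ≤ volume.real (Metric.closedBall (0 : Sp d) 1) := by
  rcases F.eq_empty_or_nonempty with rfl | hne
  · simp
  obtain ⟨S₀, hS₀, hmin⟩ := F.exists_min_image (fun S => Metric.diam S.carrier) hne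
  set l := Metric.diam S₀.carrier with hl
  have hl0 : 0 < l := (hA S₀ hS₀).diam_pos
  have : Nonempty (Fin d) := ⟨⟨0, hd⟩⟩
  -- copies of the simplices shrunk towards `v` to the diameter of the smallest one: they do not
  -- overlap, have volumes at least `c * l ^ d`, and fit into a ball of radius `l`
  let A : TaggedSimplex d → Set (Sp d) := fun S =>
    AffineMap.homothety v (l / Metric.diam S.carrier) '' S.carrier
  have hr : ∀ S ∈ F, 0 < l / Metric.diam S.carrier ∧ l / Metric.diam S.carrier ≤ 1 := fun S hS =>
    ⟨div_pos hl0 (hA S hS).diam_pos, (div_le_one (hA S hS).diam_pos).2 (hmin S hS)⟩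
  have hsub : ∀ S ∈ F, A S ⊆ S.carrier := by
    rintro S hS _ ⟨y, hy, rfl⟩
    rw [AffineMap.homothety_eq_lineMap]
    exact S.convex_carrier.segment_subset (hv S hS) hy
      (by rw [segment_eq_image_lineMap]; exact ⟨_, ⟨(hr S hS).1.le, (hr S hS).2⟩, rfl⟩)
  have hball : ∀ S ∈ F, A S ⊆ Metric.closedBall v l := by
    rintro S hS _ ⟨y, hy, rfl⟩
    rw [Metric.mem_closedBall, AffineMap.homothety_apply, dist_eq_norm]
    simp only [vsub_eq_sub, vadd_eq_add, add_sub_cancel_right]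
    rw [norm_smul, Real.norm_of_nonneg (hr S hS).1.le, ← dist_eq_norm]
    have := Metric.dist_le_diam_of_mem S.isBounded_carrier hy (hv S hS)
    calc _ ≤ l / Metric.diam S.carrier * Metric.diam S.carrier :=
          mul_le_mul_of_nonneg_left this (hr S hS).1.le
      _ = l := div_mul_cancel₀ _ (hA S hS).diam_pos.ne'
  have hmeas : ∀ S ∈ F, NullMeasurableSet (A S) volume := fun S _ =>
    ((S.isCompact_carrier.image (AffineMap.homothety_continuous _ _)).isClosed.measurableSet).nullMeasurableSet
  have hvol : ∀ S ∈ F, c * l ^ d ≤ volume.real (A S) := by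
    intro S hS
    have hD := (hA S hS).diam_pos
    rw [Measure.real, Measure.addHaar_image_homothety, ENNReal.toReal_mul, ENNReal.toReal_ofReal
      (abs_nonneg _), finrank_euclideanSpace, Fintype.card_fin, abs_of_nonneg
      (pow_nonneg (hr S hS).1.le _), div_pow, div_mul_eq_mul_div, le_div_iff₀ (by positivity)]
    calc _ = l ^ d * (c * Metric.diam S.carrier ^ d) := by ring
      _ ≤ _ := mul_le_mul_of_nonneg_left (hsh S hS) (by positivity)
  have hsum : ∑ S ∈ F, volume (A S) ≤ volume (Metric.closedBall v l) := by
    rw [← measure_biUnion_finset₀ (fun S hS S' hS' hne => ?_) hmeas]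
    · exact measure_mono (iUnion₂_subset hball)
    · exact (aedisjoint_of_interior (hdis S hS S' hS' hne)).mono (hsub S hS) (hsub S' hS')
  have hfin : volume (Metric.closedBall v l) ≠ ⊤ := measure_closedBall_lt_top.ne
  have hball1 : volume.real (Metric.closedBall v l) =
      l ^ d * volume.real (Metric.closedBall (0 : Sp d) 1) := by
    rw [Measure.real, Measure.addHaar_closedBall _ _ hl0.le, ENNReal.toReal_mul,
      ENNReal.toReal_ofReal (by positivity), finrank_euclideanSpace, Fintype.card_fin,
      ← Measure.addHaar_closedBall_eq_addHaar_ball volume (0 : Sp d) 1, Measure.real]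
  have h1 : ∑ S ∈ F, volume.real (A S) ≤ volume.real (Metric.closedBall v l) := by
    have := ENNReal.toReal_mono hfin hsum
    rwa [ENNReal.toReal_sum] at this
    intro S hS
    exact ((measure_mono (hball S hS)).trans_lt measure_closedBall_lt_top).ne
  have h2 := (Finset.card_nsmul_le_sum F _ _ hvol).trans h1
  rw [hball1, nsmul_eq_mul] at h2
  have h3 : l ^ d * (F.card * c) ≤ l ^ d * volume.real (Metric.closedBall (0 : Sp d) 1) := by
    linarith
  exact le_of_mul_le_mul_left h3 (by positivity)

end TaggedSimplex

end

section
variable {d : ℕ}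
open TaggedSimplex TimeInterval

/-! ### Levels and sizes of touching prisms -/

namespace Good

variable {T : ℝ} {Ω : Set (Sp d)} {𝓘 : Set TimeInterval} {𝒯 : Set (TaggedSimplex d)} {s₁ s₂ : ℝ}
  {P : Set (Prism d)}

lemma space_subset (h : Good T Ω 𝓘 𝒯 s₁ s₂ P) {E} (hE : E ∈ P) :
    E.space.carrier ⊆ closure Ω := by
  rw [← h.triang.cover_unif E.level]
  exact subset_biUnion_of_mem (u := fun S : TaggedSimplex d => S.carrier) (h.space E hE)

lemma eq_of_space_eq (h : Good T Ω 𝓘 𝒯 s₁ s₂ P) {E E'} (hE : E ∈ P) (hE' : E' ∈ P) {t : ℝ}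
    (ht : t ∈ E.time.carrier) (ht' : t ∈ E'.time.carrier) (hs : E.space = E'.space) : E = E' := by
  by_contra hne
  have := h.disj E hE E' hE' hne ⟨t, ht, ht'⟩
  rw [hs, disjoint_self] at this
  exact (h.adm hE').nondeg.interior_nonempty.ne_empty this

/-- Only one bisection of a simplex can preserve a facet of it: the first one produces a facet
containing the next refinement edge. -/
lemma level_le_of_facet (h : Good T Ω 𝓘 𝒯 s₁ s₂ P) {E E'} (hE : E ∈ P) (hE' : E' ∈ P)
    (ht : (E.time.carrier ∩ E'.time.carrier).Nonempty)
    (hW : d ≤ (E.space.verts ∩ E'.space.verts).ncard) : E'.level ≤ E.level + 1 := by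
  have hd := h.triang.pos
  obtain ⟨v, hv, hv'⟩ := nonempty_of_ncard_ne_zero (show (E.space.verts ∩ E'.space.verts).ncard ≠ 0
    by omega)
  rcases Nat.lt_or_ge 1 d with hd2 | hd2
  swap
  · exact h.grad_space (by omega) E' hE' E hE (by rwa [inter_comm])
      ⟨v, E'.space.verts_subset_carrier hv', E.space.verts_subset_carrier hv⟩
  by_contra hlt
  push Not at hlt
  have hE's := h.space E' hE'
  rw [← Nat.add_sub_cancel' (by omega : E.level ≤ E'.level)] at hE's
  obtain ⟨A, hA, hE'A⟩ := mem_unif_add.1 hE's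
  obtain ⟨k, hk⟩ : ∃ k, E'.level - E.level = k + 1 + 1 := ⟨E'.level - E.level - 2, by omega⟩
  rw [hk] at hE'A
  obtain ⟨C, hC, hE'C⟩ := mem_unif_succ_of_bisect.1 hE'A
  obtain ⟨D, hD, hE'D⟩ := mem_unif_succ_of_bisect.1 hE'C
  have hAA := h.triang.adm_unif hA
  have hCA := hAA.child hC
  have hDA := hCA.child hD
  set W := E.space.verts ∩ E'.space.verts
  have hWD : W ⊆ D.carrier :=
    inter_subset_right.trans (E'.space.verts_subset_carrier.trans (hDA.unif_subset hE'D))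
  have hWC := hWD.trans (hCA.child_subset hD)
  have hWA : W ⊆ A.verts := fun w hw =>
    (h.triang.conf_unif _ _ (h.space E hE) A hA).vert_mem hw.1 (hAA.child_subset hC (hWC hw))
  -- `C` retains all vertices of `A` but one end point of the refinement edge
  obtain ⟨e, he, hCv⟩ : ∃ e ∈ A.ends, C.verts = insert A.mid (A.verts \ {e}) := by
    rcases hC with rfl | rfl
    · exact ⟨_, Or.inr rfl, verts_child₁ hAA.nondeg hd⟩
    · exact ⟨_, Or.inl rfl, verts_child₂ hAA.nondeg hd hAA.type_lt⟩
  have heC : e ∉ C.carrier := by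
    intro heC
    have hends : A.ends ⊆ C.carrier := by
      intro a ha
      by_cases hae : a = e
      · rwa [hae]
      · exact C.verts_subset_carrier (by rw [hCv]; exact Or.inr ⟨A.ends_subset ha, hae⟩)
    exact hAA.not_ends_subset_child hC ⟨hends (Or.inl rfl), hends (Or.inr rfl)⟩
  have hWe : W = A.verts \ {e} := by
    apply eq_of_subset_of_ncard_le
    · exact fun w hw => ⟨hWA hw, fun h => heC (h ▸ hWC hw)⟩
    · rw [ncard_sdiff_singleton_of_mem (A.ends_subset he), hAA.nondeg.ncard_verts]; exact hW
    · exact A.finite_verts.sdiff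
  have hmid : C.vert (Fin.ofNat (d + 1) 1) = A.mid := by
    rcases hC with rfl | rfl
    · rw [child₁_vert A (by omega)]; simp
    · rw [child₂_vert A (by omega)]; simp
  have hkey : ∀ k : Fin (d + 1), k.val ≠ 1 → C.vert k ∈ D.carrier := by
    intro k hk
    apply hWD
    rw [hWe]
    have h1 : C.vert k ∈ insert A.mid (A.verts \ {e}) := hCv ▸ C.vert_mem k
    refine h1.resolve_left fun h2 => hk ?_
    rw [← hmid] at h2
    rw [hCA.nondeg.injective h2, ofNat_val (by omega)]
  exact hCA.not_ends_subset_child hD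
    ⟨hkey 0 (by simp), hkey (Fin.last d) (by simp; omega)⟩

/-- The simplices of a time slice, with the shape regularity constant `c` in the volume sense,
have bounded level differences at any point: levels change by at most one between facet neighbours,
so that all levels in between occur at the point, in distinct simplices. -/
lemma level_le_of_slice (h : Good T Ω 𝓘 𝒯 s₁ s₂ P) {c : ℝ}
    (hsh : ∀ E ∈ P, c * Metric.diam E.space.carrier ^ d ≤ volume.real E.space.carrier) {N : ℕ}
    (hN : volume.real (Metric.closedBall (0 : Sp d) 1) ≤ N * c) (hc : 0 < c) {E E'} (hE : E ∈ P)
    (hE' : E' ∈ P) {t : ℝ} (ht : t ∈ E.time.carrier) (ht' : t ∈ E'.time.carrier) {x : Sp d}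
    (hx : x ∈ E.space.carrier) (hx' : x ∈ E'.space.carrier) : E'.level ≤ E.level + N := by
  classical
  have hd := h.triang.pos
  set 𝒮 : Set (TaggedSimplex d) := Prism.space '' {A | A ∈ P ∧ t ∈ A.time.carrier}
  have hfin : 𝒮.Finite := (h.finite.subset fun A hA => hA.1).image _
  have htT : t ∈ Icc 0 T := (h.grid.tunif _).sub _ (h.time E hE) ht
  have hcov : ⋃ S ∈ 𝒮, S.carrier = closure Ω := by
    apply Subset.antisymm
    · refine iUnion₂_subset ?_
      rintro _ ⟨A, hA, rfl⟩
      exact h.space_subset hA.1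
    · intro y hy
      obtain ⟨A, hA, htA, hyA⟩ := h.cover t htT y hy
      exact mem_biUnion (mem_image_of_mem _ ⟨hA, htA⟩) hyA
  have hchain := facetChain h.triang.lip hfin (by rintro _ ⟨A, hA, rfl⟩; exact (h.adm hA.1).nondeg)
    (by
      rintro _ ⟨A, hA, rfl⟩ _ ⟨B, hB, rfl⟩
      exact h.conf A hA.1 B hB.1 ⟨t, hA.2, hB.2⟩) hcov (mem_image_of_mem _ ⟨hE, ht⟩)
    (mem_image_of_mem _ ⟨hE', ht'⟩) hx hx'
  -- all levels in between occur at `x`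
  have hint : ∀ S, Relation.ReflTransGen (FacetStep 𝒮 x) E.space S → ∀ B ∈ P, t ∈ B.time.carrier →
      B.space = S → ∀ k, E.level ≤ k → k ≤ B.level →
      ∃ A ∈ P, t ∈ A.time.carrier ∧ x ∈ A.space.carrier ∧ A.level = k := by
    intro S hS
    induction hS with
    | refl =>
      intro B hB htB hBS k hk1 hk2
      obtain rfl := h.eq_of_space_eq hB hE htB ht hBS
      exact ⟨B, hB, htB, hx, by omega⟩
    | tail hS1 hstep ih =>
      rename_i S1 S2
      intro B hB htB hBS k hk1 hk2
      have hS1' : S1 ∈ 𝒮 := by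
        rcases Relation.ReflTransGen.cases_tail hS1 with h1 | ⟨S0, -, h1⟩
        · rw [h1]; exact mem_image_of_mem _ ⟨hE, ht⟩
        · exact h1.1
      obtain ⟨A, hA, rfl⟩ := hS1'
      have hle := h.level_le_of_facet hA.1 hB ⟨t, hA.2, htB⟩ (hBS ▸ hstep.2.2)
      rcases Nat.lt_or_ge A.level k with h1 | h1
      · exact ⟨B, hB, htB, hBS ▸ hstep.2.1, by omega⟩
      · exact ih A hA.1 hA.2 rfl k hk1 h1
  by_contra hlt
  push Not at hlt
  have hex : ∀ k ∈ Finset.Icc E.level E'.level,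
      ∃ A ∈ P, t ∈ A.time.carrier ∧ x ∈ A.space.carrier ∧ A.level = k := by
    intro k hk
    rw [Finset.mem_Icc] at hk
    exact hint _ hchain E' hE' ht' rfl k hk.1 hk.2
  have : Nonempty (Prism d) := ⟨E⟩
  choose! A hAP hAt hAx hAl using hex
  have hinj : Set.InjOn (fun k => (A k).space) (Finset.Icc E.level E'.level : Finset ℕ) := by
    intro k hk l hl hkl
    have := h.eq_of_space_eq (hAP k hk) (hAP l hl) (hAt k hk) (hAt l hl) hkl
    rw [← hAl k hk, ← hAl l hl, this]
  have hcard := card_le_of_shape (c := c) ((Finset.Icc E.level E'.level).image fun k => (A k).space)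
    hd (v := x) (by
      intro S hS
      obtain ⟨k, hk, rfl⟩ := Finset.mem_image.1 hS
      exact h.adm (hAP k hk)) (by
      intro S hS
      obtain ⟨k, hk, rfl⟩ := Finset.mem_image.1 hS
      exact hAx k hk) (by
      intro S hS S' hS' hne
      obtain ⟨k, hk, rfl⟩ := Finset.mem_image.1 hS
      obtain ⟨l, hl, rfl⟩ := Finset.mem_image.1 hS'
      exact h.disj _ (hAP k hk) _ (hAP l hl) (fun h => hne (by rw [h])) ⟨t, hAt k hk, hAt l hl⟩) (by
      intro S hS
      obtain ⟨k, hk, rfl⟩ := Finset.mem_image.1 hS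
      exact hsh _ (hAP k hk))
  rw [Finset.card_image_of_injOn hinj, Nat.card_Icc] at hcard
  have h1 := le_of_mul_le_mul_right (hcard.trans hN) hc
  have h2 : E'.level + 1 - E.level ≤ N := by exact_mod_cast h1
  omega

/-- Shortly before `τ`, all time intervals in use have `τ` in their closures. -/
lemma eventually_slice (h : Good T Ω 𝓘 𝒯 s₁ s₂ P) (τ : ℝ) : ∀ᶠ t in nhdsWithin τ (Iio τ),
    ∀ A ∈ P, t ∈ A.time.carrier → τ ∈ closure A.time.carrier := by
  rw [Filter.eventually_all_finite h.finite]
  intro A hA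
  rw [(h.valid hA).closure]
  by_cases hlt : A.time.right < τ
  · filter_upwards [Ioo_mem_nhdsLT hlt] with t ht htA
    exact absurd ht.1 (not_lt.2 (A.time.subset_Icc htA).2)
  · filter_upwards [self_mem_nhdsWithin] with t ht htA
    exact ⟨(A.time.subset_Icc htA).1.trans (le_of_lt ht), not_lt.1 hlt⟩

/-- A time whose slice consists of prisms with a given time in their closures. -/
lemma exists_slice (h : Good T Ω 𝓘 𝒯 s₁ s₂ P) {E} (hE : E ∈ P) {τ : ℝ}
    (hτ : τ ∈ closure E.time.carrier) :
    ∃ t ∈ Icc 0 T, t ∈ E.time.carrier ∧ ∀ A ∈ P, t ∈ A.time.carrier → τ ∈ closure A.time.carrier := by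
  have hsub := (h.grid.tunif _).sub _ (h.time E hE)
  by_cases hτE : τ ∈ E.time.carrier
  · exact ⟨τ, hsub hτE, hτE, fun A _ hA => subset_closure hA⟩
  have hv := h.valid hE
  rw [hv.closure] at hτ
  have hτr : τ = E.time.right := by
    by_contra hne
    exact hτE (E.time.Ico_subset ⟨hτ.1, lt_of_le_of_ne hτ.2 hne⟩)
  have hlt : E.time.left < τ := by rw [hτr]; exact hv
  obtain ⟨t, ht1, ht2⟩ := ((h.eventually_slice τ).and (Ioo_mem_nhdsLT hlt)).exists
  have htE : t ∈ E.time.carrier := E.time.Ico_subset ⟨ht2.1.le, hτr ▸ ht2.2⟩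
  exact ⟨t, hsub htE, htE, ht1⟩

/-- Near any of its points, a simplex is overlapped by an element of the slice at any time. -/
lemma exists_overlap (h : Good T Ω 𝓘 𝒯 s₁ s₂ P) {S : TaggedSimplex d} (hS : S.Adm)
    (hsub : S.carrier ⊆ closure Ω) {t : ℝ} (ht : t ∈ Icc 0 T) {x : Sp d} (hx : x ∈ S.carrier) :
    ∃ A ∈ P, t ∈ A.time.carrier ∧ x ∈ A.space.carrier ∧
      (interior S.carrier ∩ interior A.space.carrier).Nonempty := by
  set F : Set (Prism d) := {A | A ∈ P ∧ x ∉ A.space.carrier}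
  have hF : F.Finite := h.finite.subset fun A hA => hA.1
  set U : Set (Sp d) := (⋃ A ∈ F, A.space.carrier)ᶜ
  have hU : IsOpen U := (hF.isClosed_biUnion fun A _ => A.space.isClosed_carrier).isOpen_compl
  have hxU : x ∈ U := by
    simp only [U, mem_compl_iff, mem_iUnion, not_exists]
    exact fun A hA => hA.2
  obtain ⟨y, hyU, hyS⟩ := hS.nondeg.inter_interior_nonempty hU hxU hx
  obtain ⟨A, hA, htA, hyA⟩ := h.cover t ht y (hsub (interior_subset hyS))
  have hxA : x ∈ A.space.carrier := by
    by_contra hxA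
    exact hyU (mem_biUnion (show A ∈ F from ⟨hA, hxA⟩) hyA)
  exact ⟨A, hA, htA, hxA, (h.adm hA).nondeg.inter_interior_nonempty isOpen_interior hyS hyA⟩

/-- Prisms over overlapping simplices whose time intervals touch or meet differ in level by at most
one. -/
lemma level_le_of_overlap (h : Good T Ω 𝓘 𝒯 s₁ s₂ P) {E E'} (hE : E ∈ P) (hE' : E' ∈ P)
    (hcl : (closure E.time.carrier ∩ closure E'.time.carrier).Nonempty)
    (hov : (interior E.space.carrier ∩ interior E'.space.carrier).Nonempty) :
    E.level ≤ E'.level + 1 := by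
  by_cases hEE : E = E'
  · subst hEE; omega
  refine h.grad_time E hE E' hE' ?_ hcl hov
  by_contra hcon
  rw [not_disjoint_iff_nonempty_inter] at hcon
  exact hov.not_disjoint (h.disj E hE E' hE' hEE hcon)

lemma closure_carrier (E : Prism d) :
    closure E.carrier = closure E.time.carrier ×ˢ E.space.carrier := by
  rw [Prism.carrier, closure_prod_eq, E.space.isClosed_carrier.closure_eq]

/-- Touching prisms have bounded level differences: pass from one prism to an element of its own
time slice that is a temporal neighbour of the other prism. -/
lemma level_le_of_touch (h : Good T Ω 𝓘 𝒯 s₁ s₂ P) {c : ℝ}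
    (hsh : ∀ E ∈ P, c * Metric.diam E.space.carrier ^ d ≤ volume.real E.space.carrier) {N : ℕ}
    (hN : volume.real (Metric.closedBall (0 : Sp d) 1) ≤ N * c) (hc : 0 < c) {E E'} (hE : E ∈ P)
    (hE' : E' ∈ P) (ht : (closure E.carrier ∩ closure E'.carrier).Nonempty) :
    E'.level ≤ E.level + (N + 1) := by
  obtain ⟨⟨τ, x⟩, h1, h2⟩ := ht
  rw [closure_carrier, mem_prod] at h1 h2
  obtain ⟨t, htT, htE, hτ⟩ := h.exists_slice hE h1.1
  obtain ⟨A, hA, htA, hxA, hov⟩ := h.exists_overlap (h.adm hE') (h.space_subset hE') htT h2.2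
  have h3 := h.level_le_of_overlap hE' hA ⟨τ, h2.1, hτ A hA htA⟩ hov
  have h4 := h.level_le_of_slice hsh hN hc hE hA htE htA h1.2 hxA
  omega

end Good

lemma TimeInterval.Valid.volume_real {I : TimeInterval} (h : I.Valid) :
    volume.real I.carrier = I.right - I.left := by
  rw [Valid] at h
  rw [Measure.real, TimeInterval.carrier]
  split_ifs
  · rw [Real.volume_Icc, ENNReal.toReal_ofReal (by linarith)]
  · rw [Real.volume_Ico, ENNReal.toReal_ofReal (by linarith)]

lemma volume_real_prism (E : Prism d) :
    volume.real E.carrier = volume.real E.time.carrier * volume.real E.space.carrier := by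
  rw [Measure.real, Prism.carrier, Measure.volume_eq_prod, Measure.prod_prod, ENNReal.toReal_mul]
  rfl

/-- Simplices are shape-regular in the sense of volumes if they are so in the sense of inradii. -/
lemma TaggedSimplex.Adm.volume_ge_of_inradius {S : TaggedSimplex d} (h : S.Adm) {κ : ℝ}
    (hκ : Metric.diam S.carrier / S.inradius ≤ κ) :
    0 < κ ∧ volume.real (Metric.closedBall (0 : Sp d) 1) / (2 * κ) ^ d * Metric.diam S.carrier ^ d ≤
      volume.real S.carrier := by
  have : Nonempty (Fin d) := ⟨⟨0, h.pos⟩⟩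
  have hD := h.diam_pos
  set R := {r : ℝ | 0 < r ∧ ∃ x, Metric.ball x r ⊆ S.carrier} with hR
  have hne : R.Nonempty := by
    obtain ⟨x, hx⟩ := h.nondeg.interior_nonempty
    obtain ⟨r, hr, hball⟩ := Metric.isOpen_iff.1 isOpen_interior x hx
    exact ⟨r, hr, x, hball.trans interior_subset⟩
  have hballvol : ∀ {r : ℝ} {x : Sp d}, 0 < r → Metric.ball x r ⊆ S.carrier →
      r ^ d * volume.real (Metric.closedBall (0 : Sp d) 1) ≤ volume.real S.carrier := by
    intro r x hr hsub
    have h1 := ENNReal.toReal_mono S.volume_carrier_ne_top (measure_mono (μ := volume) hsub)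
    rwa [Measure.addHaar_ball _ _ hr.le, ENNReal.toReal_mul, ENNReal.toReal_ofReal (by positivity),
      finrank_euclideanSpace, Fintype.card_fin,
      ← Measure.addHaar_closedBall_eq_addHaar_ball volume (0 : Sp d) 1] at h1
  have hB : 0 < volume.real (Metric.closedBall (0 : Sp d) 1) :=
    ENNReal.toReal_pos (Metric.measure_closedBall_pos volume _ one_pos).ne'
      measure_closedBall_lt_top.ne
  -- radii of balls in `S` are bounded, so that the supremum is not a junk value
  have hpos : 0 < S.inradius := by
    obtain ⟨r, hr⟩ := hne
    refine lt_of_lt_of_le hr.1 (le_csSup ?_ hr)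
    refine ⟨max 1 (volume.real S.carrier / volume.real (Metric.closedBall (0 : Sp d) 1)), ?_⟩
    rintro q ⟨hq, x, hx⟩
    rcases le_total q 1 with h1 | h1
    · exact h1.trans (le_max_left _ _)
    · refine le_trans ?_ (le_max_right _ _)
      rw [le_div_iff₀ hB]
      refine le_trans ?_ (hballvol hq hx)
      exact mul_le_mul_of_nonneg_right (le_self_pow₀ h1 (by have := h.pos; omega)) hB.le
  have hκ0 : 0 < κ := lt_of_lt_of_le (by positivity) hκ
  refine ⟨hκ0, ?_⟩
  rw [div_le_iff₀ hpos] at hκ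
  have hlt : Metric.diam S.carrier / (2 * κ) < sSup R := by
    rw [div_lt_iff₀ (by positivity)]
    change _ < S.inradius * _
    nlinarith [mul_pos hκ0 hpos]
  obtain ⟨r, ⟨hr, x, hx⟩, hlt⟩ := exists_lt_of_lt_csSup hne hlt
  refine le_trans ?_ (hballvol hr hx)
  calc _ = (Metric.diam S.carrier / (2 * κ)) ^ d * volume.real (Metric.closedBall (0 : Sp d) 1) := by
        rw [div_pow]; ring
    _ ≤ _ := by gcongr

lemma exists_eq_sInf_image {α : Type*} {A : Set α} (hA : A.Finite) (hne : A.Nonempty) (f : α → ℝ) :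
    ∃ a ∈ A, f a = sInf (f '' A) :=
  (hne.image f).csInf_mem (hA.image f)

lemma le_sSup_image {α : Type*} {A : Set α} (hA : A.Finite) (f : α → ℝ) {a : α} (ha : a ∈ A) :
    f a ≤ sSup (f '' A) := le_csSup (hA.image f).bddAbove (mem_image_of_mem f ha)

lemma sInf_image_le {α : Type*} {A : Set α} (hA : A.Finite) (f : α → ℝ) {a : α} (ha : a ∈ A) :
    sInf (f '' A) ≤ f a := csInf_le (hA.image f).bddBelow (mem_image_of_mem f ha)

lemma le_shapeConst {P : Set (Prism d)} (hP : P.Finite) {E : Prism d} (hE : E ∈ P) :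
    Metric.diam E.space.carrier / E.space.inradius ≤ shapeConst P :=
  le_sSup_image hP (fun E : Prism d => Metric.diam E.space.carrier / E.space.inradius) hE

lemma le_maxTime {P : Set (Prism d)} (hP : P.Finite) {E : Prism d} (hE : E ∈ P) :
    volume.real E.time.carrier ≤ maxTime P :=
  le_sSup_image hP (fun E : Prism d => volume.real E.time.carrier) hE

lemma minTime_le {P : Set (Prism d)} (hP : P.Finite) {E : Prism d} (hE : E ∈ P) :
    minTime P ≤ volume.real E.time.carrier :=
  sInf_image_le hP (fun E : Prism d => volume.real E.time.carrier) hE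

lemma le_maxSpace {P : Set (Prism d)} (hP : P.Finite) {E : Prism d} (hE : E ∈ P) :
    volume.real E.space.carrier ≤ maxSpace P :=
  le_sSup_image hP (fun E : Prism d => volume.real E.space.carrier) hE

lemma minSpace_le {P : Set (Prism d)} (hP : P.Finite) {E : Prism d} (hE : E ∈ P) :
    minSpace P ≤ volume.real E.space.carrier :=
  sInf_image_le hP (fun E : Prism d => volume.real E.space.carrier) hE

/-- Touching prisms have comparable volumes. -/
theorem exists_volume_const (hd : 1 ≤ d) (s₁ s₂ : ℝ) (hs₁ : 0 < s₁) (hs₂ : 0 < s₂)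
    (κ μ₁ μ₂ μ₃ μ₄ : ℝ) :
    ∃ C : ℝ, 1 ≤ C ∧ ∀ (T : ℝ) (Ω : Set (Sp d)), 0 < T → IsLipschitzDomain Ω →
      ∀ M : InitialMesh d T Ω, shapeConst M.prisms = κ →
        maxTime M.prisms = μ₁ → minTime M.prisms = μ₂ →
        maxSpace M.prisms = μ₃ → minSpace M.prisms = μ₄ →
      ∀ P : Set (Prism d), Reachable s₁ s₂ M.prisms P → ∀ E ∈ P, ∀ E' ∈ P,
        (closure E.carrier ∩ closure E'.carrier).Nonempty →
        volume.real E.carrier ≤ C * volume.real E'.carrier := by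
  have hB : 0 < volume.real (Metric.closedBall (0 : Sp d) 1) :=
    ENNReal.toReal_pos (Metric.measure_closedBall_pos volume _ one_pos).ne'
      measure_closedBall_lt_top.ne
  obtain ⟨B, hBdef⟩ : ∃ B, B = volume.real (Metric.closedBall (0 : Sp d) 1) := ⟨_, rfl⟩
  rw [← hBdef] at hB
  -- `c` is the shape regularity constant of all descendants, `N + 1` bounds the level differences,
  -- and `q` the differences of the numbers of bisections in space and time
  obtain ⟨c, hcdef⟩ : ∃ c : ℝ, c = B / (2 * κ) ^ d / (16 * d) ^ d := ⟨_, rfl⟩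
  obtain ⟨N, hNdef⟩ : ∃ N : ℕ, B / c ≤ N := ⟨_, Nat.le_ceil _⟩
  obtain ⟨q, hqdef⟩ : ∃ q : ℕ, q = N + 1 + timeLevel s₁ s₂ d (N + 1) := ⟨_, rfl⟩
  refine ⟨max 1 (μ₁ * μ₃ / (μ₂ * μ₄) * 2 ^ q), le_max_left _ _, ?_⟩
  intro T Ω hT hΩ M h0 h1 h2 h3 h4 P hP E hE E' hE' hne
  have hG := Good.of_reachable M hd hT hΩ hs₁ hs₂ hP
  have hG0 := Good.prisms M hd hT hΩ hs₁ hs₂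
  have hdR : (1 : ℝ) ≤ d := by exact_mod_cast hd
  -- constants of the initial prisms
  obtain ⟨I₀, hI₀, -⟩ := hG.grid.cover 0 ⟨le_rfl, hT.le⟩
  obtain ⟨S₀, hS₀, -⟩ := mem_unif_iff.1 (hG.space E hE)
  have hsp : ∀ S ∈ M.simplices, (⟨I₀, S, 0⟩ : Prism d) ∈ M.prisms := fun S hS => ⟨hI₀, hS, rfl⟩
  have htm : ∀ I ∈ M.intervals, (⟨I, S₀, 0⟩ : Prism d) ∈ M.prisms := fun I hI => ⟨hI, hS₀, rfl⟩
  have hκ : ∀ S ∈ M.simplices, Metric.diam S.carrier / S.inradius ≤ κ := fun S hS =>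
    (le_shapeConst hG0.finite (hsp S hS)).trans h0.le
  have hμ₁ : ∀ I ∈ M.intervals, I.right - I.left ≤ μ₁ := fun I hI => by
    rw [← (hG.grid.valid I hI).volume_real]
    exact (le_maxTime hG0.finite (htm I hI)).trans h1.le
  have hμ₂ : ∀ I ∈ M.intervals, μ₂ ≤ I.right - I.left := fun I hI => by
    rw [← (hG.grid.valid I hI).volume_real]
    exact h2.ge.trans (minTime_le hG0.finite (htm I hI))
  have hμ₃ : ∀ S ∈ M.simplices, volume.real S.carrier ≤ μ₃ := fun S hS =>
    (le_maxSpace hG0.finite (hsp S hS)).trans h3.le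
  have hμ₄ : ∀ S ∈ M.simplices, μ₄ ≤ volume.real S.carrier := fun S hS =>
    h4.ge.trans (minSpace_le hG0.finite (hsp S hS))
  have hμ₂0 : 0 < μ₂ := by
    obtain ⟨A, hA, hAe⟩ := exists_eq_sInf_image hG0.finite ⟨_, hsp S₀ hS₀⟩
      (fun E : Prism d => volume.real E.time.carrier)
    rw [← h2, minTime, ← hAe]
    rw [(hG0.valid hA).volume_real]; exact sub_pos.2 (hG0.valid hA)
  have hμ₄0 : 0 < μ₄ := by
    obtain ⟨A, hA, hAe⟩ := exists_eq_sInf_image hG0.finite ⟨_, hsp S₀ hS₀⟩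
      (fun E : Prism d => volume.real E.space.carrier)
    rw [← h4, minSpace, ← hAe]
    exact (hG0.adm hA).nondeg.volume_real_pos
  have hκ0 : 0 < κ := ((hG.triang.adm S₀ hS₀).volume_ge_of_inradius (hκ S₀ hS₀)).1
  have hc : 0 < c := by rw [hcdef]; positivity
  -- level differences
  have hsh : ∀ A ∈ P, c * Metric.diam A.space.carrier ^ d ≤ volume.real A.space.carrier := by
    intro A hA
    obtain ⟨S, hS, hAS⟩ := mem_unif_iff.1 (hG.space A hA)
    have hSA := hG.triang.adm S hS
    have h5 := (hSA.volume_ge_of_inradius (hκ S hS)).2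
    rw [← hBdef] at h5
    rw [hSA.volume_unif hAS]
    calc _ ≤ c * ((16 * d * Metric.diam S.carrier) ^ d / 2 ^ A.level) :=
          mul_le_mul_of_nonneg_left (hSA.diam_unif hAS) hc.le
      _ = B / (2 * κ) ^ d * Metric.diam S.carrier ^ d / 2 ^ A.level := by
          rw [hcdef, mul_pow (16 * (d : ℝ))]; field_simp
      _ ≤ _ := by gcongr
  have hNc : B ≤ N * c := by
    rwa [← div_le_iff₀ hc]
  have hlev := hG.level_le_of_touch hsh (hBdef ▸ hNc) hc hE hE' hne
  have htl : timeLevel s₁ s₂ d E'.level ≤ timeLevel s₁ s₂ d E.level + timeLevel s₁ s₂ d (N + 1) :=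
    (hG.levelMono hlev).trans (timeLevel_add_le d _ _)
  -- volumes
  obtain ⟨S, hS, hES⟩ := mem_unif_iff.1 (hG.space E hE)
  obtain ⟨S', hS', hES'⟩ := mem_unif_iff.1 (hG.space E' hE')
  obtain ⟨I, hI, hEI⟩ := hG.time E hE
  obtain ⟨I', hI', hEI'⟩ := hG.time E' hE'
  rw [volume_real_prism, volume_real_prism, (hG.valid hE).volume_real, (hG.valid hE').volume_real,
    ((hG.grid.valid I hI).iter hEI).2.2, ((hG.grid.valid I' hI').iter hEI').2.2,
    (hG.triang.adm S hS).volume_unif hES, (hG.triang.adm S' hS').volume_unif hES']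
  generalize timeLevel s₁ s₂ d E.level = m at *
  generalize timeLevel s₁ s₂ d E'.level = m' at *
  have hμ₁0 : 0 ≤ μ₁ := hμ₂0.le.trans ((hμ₂ I hI).trans (hμ₁ I hI))
  have hμ₃0 : 0 ≤ μ₃ := hμ₄0.le.trans ((hμ₄ S hS).trans (hμ₃ S hS))
  have hpow : (2 : ℝ) ^ (m' + E'.level) ≤ 2 ^ q * 2 ^ (m + E.level) := by
    rw [← pow_add]; exact pow_le_pow_right₀ one_le_two (by omega)
  have hS0 : 0 ≤ volume.real S.carrier := measureReal_nonneg
  have hlow : 0 ≤ (I'.right - I'.left) / 2 ^ m' * (volume.real S'.carrier / 2 ^ E'.level) := by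
    have := hμ₂0.le.trans (hμ₂ I' hI'); positivity
  refine le_trans ?_ (mul_le_mul_of_nonneg_right (le_max_right _ _) hlow)
  calc (I.right - I.left) / 2 ^ m * (volume.real S.carrier / 2 ^ E.level)
      ≤ μ₁ / 2 ^ m * (μ₃ / 2 ^ E.level) := by
        have := hμ₁ I hI; have := hμ₃ S hS; gcongr
    _ = μ₁ * μ₃ / 2 ^ (m + E.level) := by rw [pow_add]; field_simp
    _ ≤ μ₁ * μ₃ * 2 ^ q / 2 ^ (m' + E'.level) := by
        rw [div_le_div_iff₀ (by positivity) (by positivity), mul_assoc (μ₁ * μ₃)]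
        exact mul_le_mul_of_nonneg_left hpow (by positivity)
    _ = μ₁ * μ₃ / (μ₂ * μ₄) * 2 ^ q * (μ₂ / 2 ^ m' * (μ₄ / 2 ^ E'.level)) := by
        rw [pow_add]; field_simp
    _ ≤ _ := by
        have hl := hμ₂ I' hI'
        have hl' := hμ₄ S' hS'
        have h0 : 0 ≤ I'.right - I'.left := hμ₂0.le.trans hl
        gcongr

end

section
variable {d : ℕ}
open TaggedSimplex TimeInterval

/-! ### Lagrange bases of anisotropic polynomials -/

/-- The binomial coefficient `y` over `n` for a real number `y`. -/
def realChoose (n : ℕ) (y : ℝ) : ℝ := ∏ j ∈ Finset.range n, (y - j) / (j + 1)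

lemma realChoose_self (n : ℕ) : realChoose n n = 1 := by
  rw [realChoose, Finset.prod_div_distrib, div_eq_one_iff_eq
    (Finset.prod_ne_zero_iff.2 fun j _ => by positivity),
    ← Finset.prod_range_reflect (fun j : ℕ => (j : ℝ) + 1)]
  apply Finset.prod_congr rfl
  intro j hj
  rw [Finset.mem_range] at hj
  rw [show n - 1 - j = n - (j + 1) by omega, Nat.cast_sub hj]; push_cast; ring

lemma realChoose_of_lt {n m : ℕ} (h : m < n) : realChoose n m = 0 :=
  Finset.prod_eq_zero (Finset.mem_range.2 h) (by simp)

lemma realChoose_zero {n : ℕ} (h : n ≠ 0) : realChoose n 0 = 0 := by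
  simpa using realChoose_of_lt (Nat.pos_of_ne_zero h)

lemma continuous_realChoose (n : ℕ) : Continuous (realChoose n) := by
  unfold realChoose; fun_prop

lemma exists_polynomial_realChoose (n : ℕ) (α β : ℝ) :
    ∃ a : Polynomial ℝ, a.natDegree ≤ n ∧ ∀ t, a.eval t = realChoose n (α * t + β) := by
  refine ⟨∏ j ∈ Finset.range n, (Polynomial.C (α / (j + 1)) * Polynomial.X +
    Polynomial.C ((β - j) / (j + 1))), ?_, fun t => ?_⟩
  · refine (Polynomial.natDegree_prod_le _ _).trans ?_
    calc _ ≤ ∑ _j ∈ Finset.range n, 1 := Finset.sum_le_sum fun j _ => Polynomial.natDegree_linear_le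
      _ = n := by simp
  · rw [Polynomial.eval_prod, realChoose]
    apply Finset.prod_congr rfl
    intro j _
    simp only [Polynomial.eval_add, Polynomial.eval_mul, Polynomial.eval_C, Polynomial.eval_X]
    ring

lemma affine_eq_sum (g : Sp d →ᵃ[ℝ] ℝ) (x : Sp d) :
    g x = g 0 + ∑ k, x k * g.linear (EuclideanSpace.single k 1) := by
  have h1 : x = ∑ k, x k • EuclideanSpace.single k (1 : ℝ) := by
    ext i
    simp [Finset.sum_apply, Pi.single_apply]
  have h2 : g x = g.linear x + g 0 := by
    have := congrFun g.decomp x; simpa using this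
  rw [h2, add_comm]
  conv_lhs => rw [h1, map_sum]
  simp

lemma exists_mvPolynomial_realChoose (n : ℕ) (c : ℝ) (g : Sp d →ᵃ[ℝ] ℝ) :
    ∃ b : MvPolynomial (Fin d) ℝ, b.totalDegree ≤ n ∧
      ∀ x : Sp d, MvPolynomial.eval (fun k => x k) b = realChoose n (c * g x) := by
  refine ⟨∏ j ∈ Finset.range n, (MvPolynomial.C ((c * g 0 - j) / (j + 1)) +
    ∑ k, MvPolynomial.C (c * g.linear (EuclideanSpace.single k 1) / (j + 1)) * MvPolynomial.X k),
    ?_, fun x => ?_⟩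
  · refine (MvPolynomial.totalDegree_finsetProd _ _).trans ?_
    calc _ ≤ ∑ _j ∈ Finset.range n, 1 := Finset.sum_le_sum fun j _ => ?_
      _ = n := by simp
    refine (MvPolynomial.totalDegree_add _ _).trans (max_le (by simp) ?_)
    refine (MvPolynomial.totalDegree_finsetSum _ _).trans (Finset.sup_le fun k _ => ?_)
    refine (MvPolynomial.totalDegree_mul _ _).trans ?_
    simp
  · rw [MvPolynomial.eval_prod, realChoose]
    apply Finset.prod_congr rfl
    intro j _
    rw [affine_eq_sum g x]
    simp only [map_add, map_sum, map_mul, MvPolynomial.eval_C, MvPolynomial.eval_X]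
    rw [mul_add, Finset.mul_sum, add_sub_right_comm, add_div, Finset.sum_div]
    congr 1
    apply Finset.sum_congr rfl
    intro k _; ring

lemma mul_mem_anisoPoly {r₁ r₂ : ℕ} {a : Polynomial ℝ} {b : MvPolynomial (Fin d) ℝ}
    (ha : a.natDegree < r₁) (hb : b.totalDegree < r₂) :
    (fun z : Pt d => a.eval z.1 * MvPolynomial.eval (fun k => z.2 k) b) ∈ anisoPoly d r₁ r₂ := by
  have : (fun z : Pt d => a.eval z.1 * MvPolynomial.eval (fun k => z.2 k) b) =
      ∑ i ∈ Finset.range r₁, ∑ α ∈ b.support, (a.coeff i * b.coeff α) •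
        fun z : Pt d => z.1 ^ i * ∏ k, z.2 k ^ α k := by
    funext z
    rw [Polynomial.eval_eq_sum_range' ha, MvPolynomial.eval_eq', Finset.sum_mul_sum,
      Finset.sum_apply]
    apply Finset.sum_congr rfl
    intro i _
    rw [Finset.sum_apply]
    apply Finset.sum_congr rfl
    intro α _
    simp only [Pi.smul_apply, smul_eq_mul]; ring
  rw [this]
  refine Submodule.sum_mem _ fun i hi => Submodule.sum_mem _ fun α hα => Submodule.smul_mem _ _ ?_
  refine Submodule.subset_span ⟨i, α, Finset.mem_range.1 hi, ?_, rfl⟩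
  have := MvPolynomial.le_totalDegree hα
  rw [Finsupp.sum_fintype _ _ (fun _ => rfl)] at this
  omega

/-- The indices of the Lagrange nodes of a prism: a temporal index and the barycentric
coordinates of the spatial part, in multiples of `1 / (r₂ - 1)`. -/
def nodeIdx (d r₁ r₂ : ℕ) : Finset (ℕ × (Fin (d + 1) → ℕ)) :=
  Finset.range r₁ ×ˢ Finset.piAntidiag Finset.univ (r₂ - 1)

lemma mem_nodeIdx {r₁ r₂ : ℕ} {j : ℕ × (Fin (d + 1) → ℕ)} :
    j ∈ nodeIdx d r₁ r₂ ↔ j.1 < r₁ ∧ ∑ k, j.2 k = r₂ - 1 := by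
  simp [nodeIdx]

/-- The Lagrange basis in terms of the relative time and the barycentric coordinates. -/
def refBasis (r₁ r₂ : ℕ) (j : ℕ × (Fin (d + 1) → ℕ)) (p : ℝ × (Fin (d + 1) → ℝ)) : ℝ :=
  realChoose (r₁ - 1 - j.1) ((r₁ - 1 : ℕ) * (1 - p.1)) * realChoose j.1 ((r₁ - 1 : ℕ) * p.1) *
    ∏ i, realChoose (j.2 i) ((r₂ - 1 : ℕ) * p.2 i)

/-- Relative time and barycentric coordinates of a node. -/
def refNode (r₁ r₂ : ℕ) (j : ℕ × (Fin (d + 1) → ℕ)) : ℝ × (Fin (d + 1) → ℝ) :=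
  ((j.1 : ℝ) / (r₁ - 1 : ℕ), fun i => (j.2 i : ℝ) / (r₂ - 1 : ℕ))

/-- The node of a prism with a given index. -/
def nodePt (r₁ r₂ : ℕ) (E : Prism d) (j : ℕ × (Fin (d + 1) → ℕ)) : Pt d :=
  (E.time.left + (j.1 : ℝ) / (r₁ - 1 : ℕ) * (E.time.right - E.time.left),
    ∑ k, ((j.2 k : ℝ) / (r₂ - 1 : ℕ)) • E.space.vert k)

lemma continuous_refBasis (r₁ r₂ : ℕ) (j : ℕ × (Fin (d + 1) → ℕ)) :
    Continuous (refBasis r₁ r₂ j) := by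
  have := continuous_realChoose
  unfold refBasis; fun_prop

lemma nodes_eq (r₁ r₂ : ℕ) (hr₁ : 2 ≤ r₁) (E : Prism d) :
    nodes r₁ r₂ E = nodePt r₁ r₂ E '' (nodeIdx d r₁ r₂ : Set _) := by
  ext z
  constructor
  · rintro ⟨⟨n, hn, h1⟩, ⟨α, hα, h2⟩⟩
    exact ⟨(n, α), Finset.mem_coe.2 (mem_nodeIdx.2 ⟨by dsimp only; omega, hα⟩),
      Prod.ext h1.symm h2.symm⟩
  · rintro ⟨j, hj, rfl⟩
    obtain ⟨h1, h2⟩ := mem_nodeIdx.1 (Finset.mem_coe.1 hj)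
    exact ⟨⟨j.1, by omega, rfl⟩, ⟨j.2, h2, rfl⟩⟩

lemma refBasis_refNode {r₁ r₂ : ℕ} (hr₁ : 2 ≤ r₁) (hr₂ : 2 ≤ r₂) {j l : ℕ × (Fin (d + 1) → ℕ)}
    (hj : j ∈ nodeIdx d r₁ r₂) (hl : l ∈ nodeIdx d r₁ r₂) :
    refBasis r₁ r₂ j (refNode r₁ r₂ l) = if j = l then 1 else 0 := by
  obtain ⟨hj1, hj2⟩ := mem_nodeIdx.1 hj
  obtain ⟨hl1, hl2⟩ := mem_nodeIdx.1 hl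
  have hk₁ : ((r₁ - 1 : ℕ) : ℝ) ≠ 0 := by rw [Nat.cast_ne_zero]; omega
  have hk₂ : ((r₂ - 1 : ℕ) : ℝ) ≠ 0 := by rw [Nat.cast_ne_zero]; omega
  have e1 : ((r₁ - 1 : ℕ) : ℝ) * (1 - (l.1 : ℝ) / (r₁ - 1 : ℕ)) = ((r₁ - 1 - l.1 : ℕ) : ℝ) := by
    rw [Nat.cast_sub (by omega : l.1 ≤ r₁ - 1), mul_sub, mul_div_cancel₀ _ hk₁, mul_one]
  rw [refBasis, refNode]
  simp only [mul_div_cancel₀ _ hk₁, mul_div_cancel₀ _ hk₂, e1]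
  split_ifs with hjl
  · subst hjl
    simp [realChoose_self]
  · by_cases h1 : l.1 < j.1
    · rw [realChoose_of_lt h1]; simp
    by_cases h2 : j.1 < l.1
    · rw [realChoose_of_lt (show r₁ - 1 - l.1 < r₁ - 1 - j.1 by omega)]; simp
    have h3 : ∃ i, l.2 i < j.2 i := by
      by_contra hcon
      push Not at hcon
      apply hjl
      refine Prod.ext (by omega) (funext fun i => ?_)
      have := (Finset.sum_eq_sum_iff_of_le fun i _ => hcon i).1 (hj2.trans hl2.symm)
      exact this i (Finset.mem_univ i)
    obtain ⟨i, hi⟩ := h3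
    rw [Finset.prod_eq_zero (Finset.mem_univ i) (realChoose_of_lt hi), mul_zero]

namespace Prism

/-- Prisms with a non-degenerate time interval and simplex. -/
structure Proper (E : Prism d) : Prop where
  valid : E.time.Valid
  nondeg : E.space.Nondeg

variable {E : Prism d}

/-- Relative time and barycentric coordinates. -/
def Proper.refCoord (h : E.Proper) (z : Pt d) : ℝ × (Fin (d + 1) → ℝ) :=
  ((z.1 - E.time.left) / (E.time.right - E.time.left), fun i => h.nondeg.coord i z.2)

lemma Proper.length_pos (h : E.Proper) : 0 < E.time.right - E.time.left := sub_pos.2 h.valid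

lemma Proper.refCoord_nodePt (h : E.Proper) {r₁ r₂ : ℕ} (hr₂ : 2 ≤ r₂)
    {j : ℕ × (Fin (d + 1) → ℕ)} (hj : j ∈ nodeIdx d r₁ r₂) :
    h.refCoord (nodePt r₁ r₂ E j) = refNode r₁ r₂ j := by
  have hk₂ : ((r₂ - 1 : ℕ) : ℝ) ≠ 0 := by rw [Nat.cast_ne_zero]; omega
  have hl := h.length_pos.ne'
  refine Prod.ext ?_ (funext fun i => ?_)
  · simp only [refCoord, nodePt, refNode]; field_simp; ring
  · have hw := h.nondeg.isBary_weight (l := fun k => (j.2 k : ℝ) / (r₂ - 1 : ℕ))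
      (fun k => by positivity) (by
        rw [← Finset.sum_div, ← Nat.cast_sum, (mem_nodeIdx.1 hj).2, div_self hk₂])
    have := h.nondeg.weight_eq_coord hw i
    rw [h.nondeg.weight_apply] at this
    exact this.symm

lemma Proper.basis_mem (h : E.Proper) {r₁ r₂ : ℕ} (hr₂ : 2 ≤ r₂)
    {j : ℕ × (Fin (d + 1) → ℕ)} (hj : j ∈ nodeIdx d r₁ r₂) :
    (fun z => refBasis r₁ r₂ j (h.refCoord z)) ∈ anisoPoly d r₁ r₂ := by
  obtain ⟨hj1, hj2⟩ := mem_nodeIdx.1 hj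
  have hl := h.length_pos.ne'
  set k : ℝ := ((r₁ - 1 : ℕ) : ℝ)
  obtain ⟨a₁, ha₁, hae₁⟩ := exists_polynomial_realChoose (r₁ - 1 - j.1)
    (-k / (E.time.right - E.time.left)) (k * E.time.right / (E.time.right - E.time.left))
  obtain ⟨a₂, ha₂, hae₂⟩ := exists_polynomial_realChoose j.1
    (k / (E.time.right - E.time.left)) (-k * E.time.left / (E.time.right - E.time.left))
  choose b hb hbe using fun i => exists_mvPolynomial_realChoose (j.2 i) ((r₂ - 1 : ℕ) : ℝ)
    (h.nondeg.coord i)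
  have hm := mul_mem_anisoPoly (r₁ := r₁) (r₂ := r₂) (a := a₁ * a₂) (b := ∏ i, b i)
    ((Polynomial.natDegree_mul_le).trans_lt (by omega))
    ((MvPolynomial.totalDegree_finsetProd _ _).trans_lt
      (lt_of_le_of_lt (Finset.sum_le_sum fun i _ => hb i) (by omega)))
  convert! hm using 1
  funext z
  rw [Polynomial.eval_mul, hae₁, hae₂, MvPolynomial.eval_prod, refBasis, refCoord]
  simp only [hbe]
  congr 3
  · simp only [k]; field_simp; ring
  · simp only [k]; field_simp; ring

end Prism

instance (r₁ r₂ : ℕ) : FiniteDimensional ℝ (anisoPoly d r₁ r₂) := by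
  apply FiniteDimensional.span_of_finite
  have : {m : Pt d → ℝ | ∃ (i : ℕ) (α : Fin d → ℕ), i < r₁ ∧ ∑ k, α k < r₂ ∧
      m = fun z => z.1 ^ i * ∏ k, z.2 k ^ α k} ⊆
      (fun q : ℕ × (Fin d → ℕ) => fun z : Pt d => z.1 ^ q.1 * ∏ k, z.2 k ^ q.2 k) ''
        ((Finset.range r₁ ×ˢ Fintype.piFinset fun _ : Fin d => Finset.range r₂ : Finset _) : Set _) := by
    rintro m ⟨i, α, hi, hα, rfl⟩
    refine ⟨(i, α), ?_, rfl⟩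
    simp only [Finset.coe_product, mem_prod, Finset.mem_coe, Finset.mem_range, Fintype.mem_piFinset]
    exact ⟨hi, fun k => (Finset.single_le_sum (fun _ _ => Nat.zero_le _)
      (Finset.mem_univ k)).trans_lt hα⟩
  exact (Set.Finite.image _ (Finset.finite_toSet _)).subset this

lemma finrank_anisoPoly_le (r₁ r₂ : ℕ) :
    Module.finrank ℝ (anisoPoly d r₁ r₂) ≤ (nodeIdx d r₁ r₂).card := by
  classical
  -- a monomial for every node
  let f : ℕ × (Fin (d + 1) → ℕ) → Pt d → ℝ :=
    fun j z => z.1 ^ j.1 * ∏ k, z.2 k ^ j.2 (Fin.succ k)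
  have hsub : anisoPoly d r₁ r₂ ≤ Submodule.span ℝ ((nodeIdx d r₁ r₂).image f : Set (Pt d → ℝ)) := by
    refine Submodule.span_mono ?_
    rintro m ⟨i, α, hi, hα, rfl⟩
    rw [Finset.coe_image]
    refine ⟨(i, Fin.cons (r₂ - 1 - ∑ k, α k) α), ?_, ?_⟩
    · rw [Finset.mem_coe, mem_nodeIdx]
      refine ⟨hi, ?_⟩
      simp only [Fin.sum_univ_succ, Fin.cons_zero, Fin.cons_succ]
      omega
    · simp [f]
  refine (Submodule.finrank_mono hsub).trans ?_
  exact (finrank_span_finset_le_card _).trans Finset.card_image_le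

namespace Prism

variable {E : Prism d}

/-- Anisotropic polynomials are determined by their nodal values. -/
lemma Proper.expansion (h : E.Proper) {r₁ r₂ : ℕ} (hr₁ : 2 ≤ r₁) (hr₂ : 2 ≤ r₂) {q : Pt d → ℝ}
    (hq : q ∈ anisoPoly d r₁ r₂) (z : Pt d) :
    q z = ∑ j ∈ nodeIdx d r₁ r₂, q (nodePt r₁ r₂ E j) * refBasis r₁ r₂ j (h.refCoord z) := by
  classical
  let b : nodeIdx d r₁ r₂ → Pt d → ℝ := fun j z => refBasis r₁ r₂ j (h.refCoord z)
  have hbn : ∀ j l : nodeIdx d r₁ r₂, b j (nodePt r₁ r₂ E l) = if j = l then 1 else 0 := by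
    intro j l
    simp only [b]
    rw [h.refCoord_nodePt hr₂ l.2, refBasis_refNode hr₁ hr₂ j.2 l.2]
    simp only [Subtype.ext_iff]
  have hcomb : ∀ (c : nodeIdx d r₁ r₂ → ℝ) (l : nodeIdx d r₁ r₂), (∑ j, c j • b j) (nodePt r₁ r₂ E l) = c l := by
    intro c l
    rw [Finset.sum_apply]
    simp [hbn]
  have hli : LinearIndependent ℝ b := by
    rw [Fintype.linearIndependent_iff]
    intro c hc l
    rw [← hcomb c l, hc]; rfl
  have hspan : Submodule.span ℝ (range b) = anisoPoly d r₁ r₂ := by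
    apply Submodule.eq_of_le_of_finrank_le
    · rw [Submodule.span_le]
      rintro _ ⟨j, rfl⟩
      exact h.basis_mem hr₂ j.2
    · rw [finrank_span_eq_card hli, Fintype.card_coe]
      exact finrank_anisoPoly_le r₁ r₂
  rw [← hspan, Submodule.mem_span_range_iff_exists_fun] at hq
  obtain ⟨c, rfl⟩ := hq
  rw [Finset.sum_apply, ← Finset.sum_coe_sort (nodeIdx d r₁ r₂) fun j =>
    (∑ i, c i • b i) (nodePt r₁ r₂ E j) * refBasis r₁ r₂ j (h.refCoord z)]
  apply Finset.sum_congr rfl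
  intro j _
  rw [hcomb]; rfl

lemma Proper.eq_of_nodes (h : E.Proper) {r₁ r₂ : ℕ} (hr₁ : 2 ≤ r₁) (hr₂ : 2 ≤ r₂)
    {q q' : Pt d → ℝ} (hq : q ∈ anisoPoly d r₁ r₂) (hq' : q' ∈ anisoPoly d r₁ r₂)
    (hn : ∀ ν ∈ nodes r₁ r₂ E, q ν = q' ν) : q = q' := by
  funext z
  rw [h.expansion hr₁ hr₂ hq, h.expansion hr₁ hr₂ hq']
  apply Finset.sum_congr rfl
  intro j hj
  rw [hn _ (by rw [nodes_eq r₁ r₂ hr₁]; exact ⟨j, hj, rfl⟩)]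

/-- Nodal values can be prescribed. -/
lemma Proper.exists_nodes (h : E.Proper) {r₁ r₂ : ℕ} (hr₁ : 2 ≤ r₁) (hr₂ : 2 ≤ r₂) (v : Pt d → ℝ) :
    ∃ q ∈ anisoPoly d r₁ r₂, ∀ ν ∈ nodes r₁ r₂ E, q ν = v ν := by
  classical
  refine ⟨∑ j ∈ nodeIdx d r₁ r₂, v (nodePt r₁ r₂ E j) • fun z => refBasis r₁ r₂ j (h.refCoord z),
    Submodule.sum_mem _ fun j hj => Submodule.smul_mem _ _ (h.basis_mem hr₂ hj), ?_⟩
  rw [nodes_eq r₁ r₂ hr₁]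
  rintro _ ⟨l, hl, rfl⟩
  rw [Finset.sum_apply, Finset.sum_eq_single l]
  · simp only [Pi.smul_apply, smul_eq_mul]
    rw [h.refCoord_nodePt hr₂ hl, refBasis_refNode hr₁ hr₂ hl hl, if_pos rfl, mul_one]
  · intro j hj hjl
    simp only [Pi.smul_apply, smul_eq_mul]
    rw [h.refCoord_nodePt hr₂ hl, refBasis_refNode hr₁ hr₂ hj hl, if_neg hjl, mul_zero]
  · exact fun h => absurd hl h

lemma Proper.closure_carrier (h : E.Proper) :
    closure E.carrier = Icc E.time.left E.time.right ×ˢ E.space.carrier := by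
  rw [Prism.carrier, closure_prod_eq, E.space.isClosed_carrier.closure_eq, h.valid.closure]

lemma Proper.nodes_subset (h : E.Proper) {r₁ r₂ : ℕ} (hr₁ : 2 ≤ r₁) (hr₂ : 2 ≤ r₂) :
    nodes r₁ r₂ E ⊆ closure E.carrier := by
  rw [h.closure_carrier]
  exact prod_mono (timeNodes_subset _ h.valid hr₁) (spaceNodes_subset h.nondeg hr₂)

/-- The unit cube, which contains the reference coordinates of the points of a prism. -/
def _root_.PrismMesh.refCube (d : ℕ) : Set (ℝ × (Fin (d + 1) → ℝ)) :=
  Icc 0 1 ×ˢ Set.pi univ fun _ => Icc 0 1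

lemma Proper.refCoord_mem (h : E.Proper) {z : Pt d} (hz : z ∈ closure E.carrier) :
    h.refCoord z ∈ refCube d := by
  rw [h.closure_carrier] at hz
  have hl := h.length_pos
  refine ⟨⟨div_nonneg (sub_nonneg.2 hz.1.1) hl.le, (div_le_one hl).2 (by linarith [hz.1.2])⟩, ?_⟩
  intro i _
  have h0 := h.nondeg.mem_carrier_iff_coord.1 hz.2
  refine ⟨h0 i, ?_⟩
  rw [← h.nondeg.sum_coord z.2]
  exact Finset.single_le_sum (f := fun k => h.nondeg.coord k z.2) (fun k _ => h0 k)
    (Finset.mem_univ i)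

end Prism

lemma isCompact_refCube (d : ℕ) : IsCompact (refCube d) :=
  isCompact_Icc.prod (isCompact_univ_pi fun _ => isCompact_Icc)

/-- Bounds for the Lagrange basis that are uniform in the prism. -/
lemma exists_refBasis_bound (d r₁ r₂ : ℕ) :
    ∃ Λ : ℝ, 1 ≤ Λ ∧ ∀ p ∈ refCube d, ∑ j ∈ nodeIdx d r₁ r₂, |refBasis r₁ r₂ j p| ≤ Λ := by
  obtain ⟨Λ, hΛ⟩ := (isCompact_refCube d).exists_bound_of_continuousOn
    (f := fun p => ∑ j ∈ nodeIdx d r₁ r₂, |refBasis r₁ r₂ j p|)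
    (continuous_finsetSum _ fun j _ => (continuous_refBasis r₁ r₂ j).abs).continuousOn
  refine ⟨max 1 Λ, le_max_left _ _, fun p hp => le_trans ?_ (le_max_right _ _)⟩
  exact (le_abs_self _).trans (hΛ p hp)

end

section
variable {d : ℕ}
open TaggedSimplex TimeInterval

/-! ### Nodes on faces -/

namespace Prism

/-- The node `ν` of the prism `E` lies on the minimal face containing `z` (and in the same fibre
if a component of `z` is a node), as is the case if the Lagrange polynomial of `ν` does not vanish
at `z`. -/
structure NodeFace (r₁ r₂ : ℕ) (E : Prism d) (z ν : Pt d) : Prop where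
  mem : ν ∈ nodes r₁ r₂ E
  time : z.1 ∈ timeNodes r₁ E.time → ν.1 = z.1
  space : z.2 ∈ spaceNodes r₂ E.space → ν.2 = z.2
  supp : ∀ w u, IsBary E.space.verts z.2 w → IsBary E.space.verts ν.2 u → ∀ v, u v ≠ 0 → w v ≠ 0

variable {E : Prism d} {r₁ r₂ : ℕ}

/-- Only nodes on the minimal face contribute to the value of a polynomial at `z`: the Lagrange
polynomials of all other nodes vanish there. -/
lemma Proper.nodeFace (h : E.Proper) (hr₁ : 2 ≤ r₁) (hr₂ : 2 ≤ r₂) {j : ℕ × (Fin (d + 1) → ℕ)}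
    (hj : j ∈ nodeIdx d r₁ r₂) {z : Pt d} (hz : refBasis r₁ r₂ j (h.refCoord z) ≠ 0) :
    NodeFace r₁ r₂ E z (nodePt r₁ r₂ E j) := by
  have hk₁ : ((r₁ - 1 : ℕ) : ℝ) ≠ 0 := by rw [Nat.cast_ne_zero]; omega
  have hk₂ : ((r₂ - 1 : ℕ) : ℝ) ≠ 0 := by rw [Nat.cast_ne_zero]; omega
  have hl := h.length_pos.ne'
  obtain ⟨hj1, hj2⟩ := mem_nodeIdx.1 hj
  have hmem : nodePt r₁ r₂ E j ∈ nodes r₁ r₂ E := by rw [nodes_eq r₁ r₂ hr₁]; exact ⟨j, hj, rfl⟩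
  rw [refBasis, mul_ne_zero_iff, mul_ne_zero_iff, Finset.prod_ne_zero_iff] at hz
  obtain ⟨⟨hz1, hz2⟩, hz3⟩ := hz
  -- the nodal coordinates of `ν`
  have hcoord : ∀ i, h.nondeg.coord i (nodePt r₁ r₂ E j).2 = (j.2 i : ℝ) / (r₂ - 1 : ℕ) := fun i =>
    congrFun (congrArg Prod.snd (h.refCoord_nodePt hr₂ hj)) i
  refine ⟨hmem, ?_, ?_, ?_⟩
  · rintro ⟨n, hn, ht⟩
    have hs : (h.refCoord z).1 = (n : ℝ) / (r₁ - 1 : ℕ) := by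
      simp only [refCoord]; rw [ht]; field_simp; ring
    have e1 : ((r₁ - 1 : ℕ) : ℝ) * (1 - (n : ℝ) / (r₁ - 1 : ℕ)) = ((r₁ - 1 - n : ℕ) : ℝ) := by
      rw [Nat.cast_sub hn, mul_sub, mul_div_cancel₀ _ hk₁, mul_one]
    rw [hs, e1] at hz1
    rw [hs, mul_div_cancel₀ _ hk₁] at hz2
    have h1 : ¬ n < j.1 := fun h => hz2 (realChoose_of_lt h)
    have h2 : ¬ (r₁ - 1 - n < r₁ - 1 - j.1) := fun h => hz1 (realChoose_of_lt h)
    have h3 : j.1 = n := by omega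
    rw [ht]; simp only [nodePt, h3]
  · rintro ⟨β, hβ, hx⟩
    have hw := h.nondeg.isBary_weight (l := fun k => (β k : ℝ) / (r₂ - 1 : ℕ))
      (fun k => by positivity) (by
        rw [← Finset.sum_div, ← Nat.cast_sum, hβ, div_self hk₂])
    have hc : ∀ i, h.nondeg.coord i z.2 = (β i : ℝ) / (r₂ - 1 : ℕ) := fun i => by
      rw [hx, ← h.nondeg.weight_eq_coord hw i, h.nondeg.weight_apply]
    have h1 : ∀ i ∈ Finset.univ, j.2 i ≤ β i := by
      intro i hi
      by_contra hlt
      refine hz3 i hi ?_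
      simp only [refCoord]
      rw [hc, mul_div_cancel₀ _ hk₂]; exact realChoose_of_lt (not_le.1 hlt)
    have h2 := (Finset.sum_eq_sum_iff_of_le h1).1 (hj2.trans hβ.symm)
    rw [hx]; simp only [nodePt]
    exact Finset.sum_congr rfl fun k hk => by rw [h2 k hk]
  · intro w u hw hu v hv h0
    obtain ⟨i, rfl⟩ := hu.supp v hv
    rw [h.nondeg.weight_eq_coord hw i] at h0
    rw [h.nondeg.weight_eq_coord hu i, hcoord] at hv
    refine hz3 i (Finset.mem_univ i) ?_
    simp only [refCoord]
    rw [h0, mul_zero]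
    exact realChoose_zero fun h' => hv (by rw [h']; simp)

/-- The values of a polynomial on a face are determined by the nodes of the face. -/
lemma Proper.eq_of_nodeFace (h : E.Proper) (hr₁ : 2 ≤ r₁) (hr₂ : 2 ≤ r₂) {q q' : Pt d → ℝ}
    (hq : q ∈ anisoPoly d r₁ r₂) (hq' : q' ∈ anisoPoly d r₁ r₂) {z : Pt d}
    (hn : ∀ ν, NodeFace r₁ r₂ E z ν → q ν = q' ν) : q z = q' z := by
  rw [h.expansion hr₁ hr₂ hq, h.expansion hr₁ hr₂ hq']
  apply Finset.sum_congr rfl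
  intro j hj
  by_cases h0 : refBasis r₁ r₂ j (h.refCoord z) = 0
  · rw [h0, mul_zero, mul_zero]
  · rw [hn _ (h.nodeFace hr₁ hr₂ hj h0)]

lemma Proper.abs_le_of_nodeFace (h : E.Proper) (hr₁ : 2 ≤ r₁) (hr₂ : 2 ≤ r₂) {Λ : ℝ}
    (hΛ : ∀ p ∈ refCube d, ∑ j ∈ nodeIdx d r₁ r₂, |refBasis r₁ r₂ j p| ≤ Λ) {q : Pt d → ℝ}
    (hq : q ∈ anisoPoly d r₁ r₂) {z : Pt d} (hz : z ∈ closure E.carrier) {M : ℝ} (hM : 0 ≤ M)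
    (hn : ∀ ν, NodeFace r₁ r₂ E z ν → |q ν| ≤ M) : |q z| ≤ Λ * M := by
  rw [h.expansion hr₁ hr₂ hq]
  refine (Finset.abs_sum_le_sum_abs _ _).trans ?_
  calc _ ≤ ∑ j ∈ nodeIdx d r₁ r₂, |refBasis r₁ r₂ j (h.refCoord z)| * M := by
        apply Finset.sum_le_sum
        intro j hj
        rw [abs_mul, mul_comm]
        by_cases h0 : refBasis r₁ r₂ j (h.refCoord z) = 0
        · rw [h0]; simp
        · exact mul_le_mul_of_nonneg_left (hn _ (h.nodeFace hr₁ hr₂ hj h0)) (abs_nonneg _)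
    _ ≤ Λ * M := by
        rw [← Finset.sum_mul]
        exact mul_le_mul_of_nonneg_right (hΛ _ (h.refCoord_mem hz)) hM

end Prism

namespace TaggedSimplex

lemma Adm.node_unif {S c : TaggedSimplex d} (hS : S.Adm) {n : ℕ} (hc : c ∈ TaggedSimplex.unif {S} n)
    {r : ℕ} (hr : 2 ≤ r) {x} (hx : x ∈ spaceNodes r S) (hxc : x ∈ c.carrier) :
    x ∈ spaceNodes r c := by
  induction n generalizing c with
  | zero => rw [unif_zero, mem_singleton_iff] at hc; rwa [hc]
  | succ n ih =>
    rw [unif_succ] at hc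
    obtain ⟨A, hA, hc⟩ := mem_refineAll.1 hc
    have hAA := hS.unif hA
    exact hAA.node_child hc hr (ih hA (hAA.child_subset hc hxc)) hxc

variable {Ω : Set (Sp d)} {𝒯 : Set (TaggedSimplex d)}

lemma Triang.exists_descendant (h : Triang Ω 𝒯) {m n : ℕ} (hmn : m ≤ n) {S : TaggedSimplex d}
    (hS : S ∈ unif 𝒯 m) {x} (hx : x ∈ S.carrier) :
    ∃ c ∈ unif {S} (n - m), c ∈ unif 𝒯 n ∧ x ∈ c.carrier := by
  obtain ⟨c, hc, hxc⟩ := exists_mem_unif (𝒯 := {S}) (by simpa using h.adm_unif hS)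
    (mem_singleton S) hx (n - m)
  refine ⟨c, hc, ?_, hxc⟩
  have := mem_unif_add.2 ⟨S, hS, hc⟩
  rwa [Nat.add_sub_cancel' hmn] at this

/-- Nodes of a coarse simplex are nodes of the finer simplices containing them. -/
lemma Triang.node (h : Triang Ω 𝒯) {m n : ℕ} (hmn : m ≤ n) {S S' : TaggedSimplex d}
    (hS : S ∈ unif 𝒯 m) (hS' : S' ∈ unif 𝒯 n) {r : ℕ} (hr : 2 ≤ r) {x}
    (hx : x ∈ spaceNodes r S) (hx' : x ∈ S'.carrier) : x ∈ spaceNodes r S' := by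
  have hA := h.adm_unif hS
  obtain ⟨c, hc, hcn, hxc⟩ := h.exists_descendant hmn hS (spaceNodes_subset hA.nondeg hr hx)
  exact (h.conf_unif n c hcn S' hS').node (hA.unif hc).nondeg (h.adm_unif hS').nondeg hr
    (hA.node_unif hc hr hx hxc) hx'

/-- The minimal face of a fine simplex containing a point of a coarse simplex is contained in the
coarse simplex. -/
lemma Triang.face_subset (h : Triang Ω 𝒯) {m n : ℕ} (hmn : m ≤ n) {S S' : TaggedSimplex d}
    (hS : S ∈ unif 𝒯 m) (hS' : S' ∈ unif 𝒯 n) {x y w u} (hx : x ∈ S.carrier)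
    (hw : IsBary S'.verts x w) (hu : IsBary S'.verts y u) (hwu : ∀ v, u v ≠ 0 → w v ≠ 0) :
    y ∈ S.carrier := by
  obtain ⟨c, hc, hcn, hxc⟩ := h.exists_descendant hmn hS hx
  have hwc := (h.conf_unif n S' hS' c hcn).isBary_right hw hxc
  exact (h.adm_unif hS).unif_subset hc
    (mem_carrier_iff.2 ⟨u, hu.mono fun v hv => hwc.supp v (hwu v hv)⟩)

end TaggedSimplex

/-- Nodes of a coarse interval are nodes of the finer intervals containing them. -/
lemma TimeInterval.Grid.node {T : ℝ} {𝓘 : Set TimeInterval} (h : Grid T 𝓘) {m n : ℕ} (hmn : m ≤ n)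
    {I J : TimeInterval} (hI : I ∈ TimeInterval.tunif 𝓘 m) (hJ : J ∈ TimeInterval.tunif 𝓘 n)
    {r : ℕ} (hr : 2 ≤ r) {t} (ht : t ∈ timeNodes r I) (htJ : t ∈ Icc J.left J.right) :
    t ∈ timeNodes r J := by
  have hIv := (h.tunif m).valid I hI
  have hJv := (h.tunif n).valid J hJ
  by_cases hdis : Disjoint I.carrier J.carrier
  · rcases touch hIv hJv hdis (timeNodes_subset I hIv hr ht) htJ with ⟨-, rfl⟩ | ⟨-, rfl⟩
    · exact J.left_node r
    · exact J.right_node hr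
  · rw [not_disjoint_iff_nonempty_inter] at hdis
    exact hIv.node_iter hr (h.mem_iter hmn hI hJ hdis) ht htJ

namespace Good

variable {T : ℝ} {Ω : Set (Sp d)} {𝓘 : Set TimeInterval} {𝒯 : Set (TaggedSimplex d)} {s₁ s₂ : ℝ}
  {P : Set (Prism d)} {r₁ r₂ : ℕ}

lemma proper (h : Good T Ω 𝓘 𝒯 s₁ s₂ P) {E} (hE : E ∈ P) : E.Proper :=
  ⟨h.valid hE, (h.adm hE).nondeg⟩

lemma time_node (h : Good T Ω 𝓘 𝒯 s₁ s₂ P) (hr₁ : 2 ≤ r₁) {E E'} (hE : E ∈ P) (hE' : E' ∈ P)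
    (hl : E.level ≤ E'.level) {t} (ht : t ∈ timeNodes r₁ E.time)
    (ht' : t ∈ closure E'.time.carrier) : t ∈ timeNodes r₁ E'.time :=
  h.grid.node (h.levelMono hl) (h.time E hE) (h.time E' hE') hr₁ ht ((h.valid hE').closure ▸ ht')

lemma space_node (h : Good T Ω 𝓘 𝒯 s₁ s₂ P) (hr₂ : 2 ≤ r₂) {E E'} (hE : E ∈ P) (hE' : E' ∈ P)
    (hl : E.level ≤ E'.level) {x} (hx : x ∈ spaceNodes r₂ E.space) (hx' : x ∈ E'.space.carrier) :
    x ∈ spaceNodes r₂ E'.space :=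
  h.triang.node hl (h.space E hE) (h.space E' hE') hr₂ hx hx'

lemma node_of_level_le (h : Good T Ω 𝓘 𝒯 s₁ s₂ P) (hr₁ : 2 ≤ r₁) (hr₂ : 2 ≤ r₂) {E E'}
    (hE : E ∈ P) (hE' : E' ∈ P) (hl : E.level ≤ E'.level) {ν : Pt d} (hν : ν ∈ nodes r₁ r₂ E)
    (hν' : ν ∈ closure E'.carrier) : ν ∈ nodes r₁ r₂ E' := by
  rw [closure_carrier] at hν'
  exact ⟨h.time_node hr₁ hE hE' hl hν.1 hν'.1, h.space_node hr₂ hE hE' hl hν.2 hν'.2⟩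

/-- The face of a fine prism through a point of a coarse prism is contained in the latter. -/
lemma nodeFace_mem (h : Good T Ω 𝓘 𝒯 s₁ s₂ P) (hr₁ : 2 ≤ r₁) (hr₂ : 2 ≤ r₂) {E E'} (hE : E ∈ P)
    (hE' : E' ∈ P) (hl : E'.level ≤ E.level) {z ν : Pt d} (hz : z ∈ closure E.carrier)
    (hz' : z ∈ closure E'.carrier) (hν : E.NodeFace r₁ r₂ z ν) : ν ∈ closure E'.carrier := by
  have hp := h.proper hE
  have hν1 := hp.nodes_subset hr₁ hr₂ hν.mem
  rw [closure_carrier] at hz hz' hν1 ⊢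
  refine ⟨?_, ?_⟩
  · by_cases hdis : Disjoint E.time.carrier E'.time.carrier
    · have hz1 := hz.1
      have hz1' := hz'.1
      rw [hp.valid.closure] at hz1
      rw [(h.valid hE').closure] at hz1'
      have hnode : z.1 ∈ timeNodes r₁ E.time := by
        rcases touch hp.valid (h.valid hE') hdis hz1 hz1' with ⟨h1, -⟩ | ⟨h1, -⟩
        · rw [h1]; exact E.time.right_node hr₁
        · rw [h1]; exact E.time.left_node r₁
      rw [hν.time hnode]; exact hz'.1
    · rw [not_disjoint_iff_nonempty_inter, inter_comm] at hdis
      have := h.grid.mem_iter (h.levelMono hl) (h.time E' hE') (h.time E hE) hdis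
      exact closure_mono ((h.valid hE').iter this).2.1 hν1.1
  · obtain ⟨w, hw⟩ := mem_carrier_iff.1 hz.2
    obtain ⟨u, hu⟩ := mem_carrier_iff.1 hν1.2
    exact h.triang.face_subset hl (h.space E' hE') (h.space E hE) hz'.2 hw hu (hν.supp w u hw hu)

lemma closure_subset (h : Good T Ω 𝓘 𝒯 s₁ s₂ P) {E} (hE : E ∈ P) :
    closure E.carrier ⊆ spaceTimeCyl T Ω := by
  rw [closure_carrier, spaceTimeCyl]
  refine prod_mono ?_ (h.space_subset hE)
  exact closure_minimal ((h.grid.tunif _).sub _ (h.time E hE)) isClosed_Icc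

lemma exists_mem (h : Good T Ω 𝓘 𝒯 s₁ s₂ P) {z : Pt d} (hz : z ∈ spaceTimeCyl T Ω) :
    ∃ E ∈ P, z ∈ E.carrier := by
  obtain ⟨E, hE, h1, h2⟩ := h.cover z.1 hz.1 z.2 hz.2
  exact ⟨E, hE, h1, h2⟩

lemma finite_freeNodes (h : Good T Ω 𝓘 𝒯 s₁ s₂ P) (hr₁ : 2 ≤ r₁) :
    (freeNodes r₁ r₂ P).Finite := by
  refine (h.finite.biUnion fun E _ => ?_).subset sdiff_subset
  rw [nodes_eq r₁ r₂ hr₁]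
  exact (Finset.finite_toSet _).image _

lemma free_mem_nodes {ν : Pt d} (hν : ν ∈ freeNodes r₁ r₂ P) {E} (hE : E ∈ P)
    (hνE : ν ∈ closure E.carrier) : ν ∈ nodes r₁ r₂ E := by
  by_contra hcon
  exact hν.2 ⟨E, hE, hνE, hcon⟩

/-- Locally polynomial interpolants of prescribed values at the free nodes, continuous across the
prisms of levels less than `n`: the values at hanging nodes are inherited from coarser prisms. -/
lemma exists_pieces (h : Good T Ω 𝓘 𝒯 s₁ s₂ P) (hr₁ : 2 ≤ r₁) (hr₂ : 2 ≤ r₂) (c : Pt d → ℝ)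
    (n : ℕ) : ∃ q : Prism d → Pt d → ℝ, (∀ E, q E ∈ anisoPoly d r₁ r₂) ∧
      (∀ E ∈ P, E.level < n → ∀ ν ∈ freeNodes r₁ r₂ P, ν ∈ closure E.carrier → q E ν = c ν) ∧
      ∀ E ∈ P, E.level < n → ∀ E' ∈ P, E'.level < n → ∀ z ∈ closure E.carrier,
        z ∈ closure E'.carrier → q E z = q E' z := by
  classical
  induction n with
  | zero => exact ⟨fun _ => 0, fun _ => Submodule.zero_mem _, by simp, by simp⟩
  | succ n ih =>
    obtain ⟨q, hq, hqc, hqq⟩ := ih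
    let v : Pt d → ℝ := fun ν => if ν ∈ freeNodes r₁ r₂ P then c ν else
      if h0 : ∃ E₀ ∈ P, E₀.level < n ∧ ν ∈ closure E₀.carrier then q h0.choose ν else 0
    -- inherited values are well defined
    have hv : ∀ ν, ν ∉ freeNodes r₁ r₂ P → ∀ E ∈ P, E.level < n → ν ∈ closure E.carrier →
        v ν = q E ν := by
      intro ν hν E hE hl hνE
      have h0 : ∃ E₀ ∈ P, E₀.level < n ∧ ν ∈ closure E₀.carrier := ⟨E, hE, hl, hνE⟩
      simp only [v, if_neg hν, dif_pos h0]
      exact hqq _ h0.choose_spec.1 h0.choose_spec.2.1 E hE hl ν h0.choose_spec.2.2 hνE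
    have hex : ∀ E : Prism d, ∃ g ∈ anisoPoly d r₁ r₂, E ∈ P → ∀ ν ∈ nodes r₁ r₂ E, g ν = v ν := by
      intro E
      by_cases hE : E ∈ P
      · obtain ⟨g, hg, hgv⟩ := (h.proper hE).exists_nodes hr₁ hr₂ v
        exact ⟨g, hg, fun _ => hgv⟩
      · exact ⟨0, Submodule.zero_mem _, fun h => absurd h hE⟩
    choose g hg hgv using hex
    let q' : Prism d → Pt d → ℝ := fun E => if E.level < n then q E else g E
    have hlt : ∀ E, E.level < n → q' E = q E := fun E hl => if_pos hl
    have hge : ∀ E, ¬ E.level < n → q' E = g E := fun E hl => if_neg hl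
    have hq' : ∀ E, q' E ∈ anisoPoly d r₁ r₂ := fun E => by
      by_cases hl : E.level < n
      · rw [hlt E hl]; exact hq E
      · rw [hge E hl]; exact hg E
    have hstep : ∀ E ∈ P, E.level = n → ∀ E' ∈ P, E'.level < n + 1 → ∀ z ∈ closure E.carrier,
        z ∈ closure E'.carrier → q' E z = q' E' z := by
      intro E hE hEn E' hE' hl z hz hz'
      refine (h.proper hE).eq_of_nodeFace hr₁ hr₂ (hq' E) (hq' E') fun ν hν => ?_
      have hνE' := h.nodeFace_mem hr₁ hr₂ hE hE' (by omega) hz hz' hν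
      rw [hge E (by omega), hgv E hE ν hν.mem]
      by_cases hE'n : E'.level < n
      · rw [hlt E' hE'n]
        by_cases hfree : ν ∈ freeNodes r₁ r₂ P
        · rw [hqc E' hE' hE'n ν hfree hνE']; exact if_pos hfree
        · exact hv ν hfree E' hE' hE'n hνE'
      · rw [hge E' hE'n]
        exact (hgv E' hE' ν (h.node_of_level_le hr₁ hr₂ hE hE' (by omega) hν.mem hνE')).symm
    refine ⟨q', hq', ?_, ?_⟩
    · intro E hE hl ν hν hνE
      by_cases hEn : E.level < n
      · rw [hlt E hEn]; exact hqc E hE hEn ν hν hνE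
      · rw [hge E hEn, hgv E hE ν (free_mem_nodes hν hE hνE)]; exact if_pos hν
    · intro E hE hl E' hE' hl' z hz hz'
      by_cases hEn : E.level < n
      · by_cases hE'n : E'.level < n
        · rw [hlt E hEn, hlt E' hE'n]; exact hqq E hE hEn E' hE' hE'n z hz hz'
        · exact (hstep E' hE' (by omega) E hE hl z hz' hz).symm
      · exact hstep E hE (by omega) E' hE' hl' z hz hz'

lemma _root_.PrismMesh.continuous_of_mem_anisoPoly {q : Pt d → ℝ} (hq : q ∈ anisoPoly d r₁ r₂) :
    Continuous q := by
  induction hq using Submodule.span_induction with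
  | mem q h => obtain ⟨i, α, -, -, rfl⟩ := h; fun_prop
  | zero => exact continuous_zero
  | add p q _ _ hp hq => exact hp.add hq
  | smul c q _ hq => exact hq.const_smul c

/-- Values at the free nodes can be prescribed for continuous finite elements. -/
lemma exists_feSpace (h : Good T Ω 𝓘 𝒯 s₁ s₂ P) (hr₁ : 2 ≤ r₁) (hr₂ : 2 ≤ r₂) (c : Pt d → ℝ) :
    ∃ F ∈ feSpace (spaceTimeCyl T Ω) P r₁ r₂, ∀ ν ∈ freeNodes r₁ r₂ P, F ν = c ν := by
  classical
  obtain ⟨n, hn⟩ : ∃ n, ∀ E ∈ P, E.level < n := by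
    obtain ⟨n, hn⟩ := (h.finite.image Prism.level).bddAbove
    exact ⟨n + 1, fun E hE => Nat.lt_succ_of_le (hn (mem_image_of_mem _ hE))⟩
  obtain ⟨q, hq, hqc, hqq⟩ := h.exists_pieces hr₁ hr₂ c n
  let F : Pt d → ℝ := fun z => if h0 : ∃ E ∈ P, z ∈ closure E.carrier then q h0.choose z else 0
  have hF : ∀ E ∈ P, EqOn F (q E) (closure E.carrier) := by
    intro E hE z hz
    have h0 : ∃ E ∈ P, z ∈ closure E.carrier := ⟨E, hE, hz⟩
    simp only [F, dif_pos h0]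
    exact hqq _ h0.choose_spec.1 (hn _ h0.choose_spec.1) E hE (hn E hE) z h0.choose_spec.2 hz
  refine ⟨F, ⟨?_, fun E hE => ⟨q E, hq E, (hF E hE).mono subset_closure⟩⟩, ?_⟩
  · have hcov : spaceTimeCyl T Ω ⊆ ⋃ E : P, closure E.1.carrier := fun z hz => by
      obtain ⟨E, hE, hzE⟩ := h.exists_mem hz
      exact mem_iUnion.2 ⟨⟨E, hE⟩, subset_closure hzE⟩
    have := h.finite.to_subtype
    refine ContinuousOn.mono ?_ hcov
    refine (locallyFinite_of_finite _).continuousOn_iUnion (fun _ => isClosed_closure) fun E => ?_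
    exact (continuous_of_mem_anisoPoly (hq E.1)).continuousOn.congr (hF E.1 E.2)
  · intro ν hν
    obtain ⟨E, hE, hνE⟩ := mem_iUnion₂.1 hν.1
    have hcl := (h.proper hE).nodes_subset hr₁ hr₂ hνE
    rw [hF E hE hcl]
    exact hqc E hE (hn E hE) ν hν hcl

open Classical in
lemma nodalBasis_spec (h : Good T Ω 𝓘 𝒯 s₁ s₂ P) (hr₁ : 2 ≤ r₁) (hr₂ : 2 ≤ r₂) (ν : Pt d) :
    nodalBasis (spaceTimeCyl T Ω) P r₁ r₂ ν ∈ feSpace (spaceTimeCyl T Ω) P r₁ r₂ ∧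
      ∀ ν' ∈ freeNodes r₁ r₂ P,
        nodalBasis (spaceTimeCyl T Ω) P r₁ r₂ ν ν' = if ν' = ν then 1 else 0 := by
  obtain ⟨F, hF, hFc⟩ := h.exists_feSpace hr₁ hr₂ fun ν' => if ν' = ν then 1 else 0
  exact Classical.epsilon_spec (p := fun φ => φ ∈ feSpace (spaceTimeCyl T Ω) P r₁ r₂ ∧
    ∀ ν' ∈ freeNodes r₁ r₂ P, φ ν' = if ν' = ν then 1 else 0) ⟨F, hF, hFc⟩

/-- A finite element coincides with a polynomial on the closure of each prism. -/
lemma feSpace_eqOn_closure (h : Good T Ω 𝓘 𝒯 s₁ s₂ P) {F : Pt d → ℝ}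
    (hF : F ∈ feSpace (spaceTimeCyl T Ω) P r₁ r₂) {E} (hE : E ∈ P) :
    ∃ q ∈ anisoPoly d r₁ r₂, EqOn F q (closure E.carrier) := by
  obtain ⟨q, hq, hFq⟩ := hF.2 E hE
  exact ⟨q, hq, hFq.of_subset_closure (hF.1.mono (h.closure_subset hE))
    (continuous_of_mem_anisoPoly hq).continuousOn subset_closure Subset.rfl⟩

end Good

end

section
variable {d : ℕ}
open TaggedSimplex TimeInterval

/-! ### Hanging nodes -/

namespace Good

variable {T : ℝ} {Ω : Set (Sp d)} {𝓘 : Set TimeInterval} {𝒯 : Set (TaggedSimplex d)} {s₁ s₂ : ℝ}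
  {P : Set (Prism d)} {r₁ r₂ : ℕ}

/-- Two prisms at a time `τ` on the same side of a third one have a common slice near `τ`. -/
lemma exists_common_slice (h : Good T Ω 𝓘 𝒯 s₁ s₂ P) {A B C} (hA : A ∈ P) (hB : B ∈ P) (hC : C ∈ P)
    {τ : ℝ} (hτA : τ ∈ closure A.time.carrier) (hτB : τ ∈ closure B.time.carrier)
    (hτC : τ ∈ closure C.time.carrier) (hAC : Disjoint A.time.carrier C.time.carrier)
    (hBC : Disjoint B.time.carrier C.time.carrier) :
    ∃ t ∈ Icc 0 T, t ∈ A.time.carrier ∧ t ∈ B.time.carrier ∧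
      ∀ D ∈ P, t ∈ D.time.carrier → τ ∈ closure D.time.carrier := by
  have hvA := h.valid hA
  have hvB := h.valid hB
  have hvC := h.valid hC
  have hsub := (h.grid.tunif _).sub _ (h.time A hA)
  rw [hvA.closure] at hτA
  rw [hvB.closure] at hτB
  rw [hvC.closure] at hτC
  have h1 := touch hvA hvC hAC hτA hτC
  have h2 := touch hvB hvC hBC hτB hτC
  rw [Valid] at hvA hvB hvC
  rcases h1 with ⟨h1, h1'⟩ | ⟨h1, h1'⟩ <;> rcases h2 with ⟨h2, h2'⟩ | ⟨h2, h2'⟩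
  · obtain ⟨t, ⟨ht1, ht2⟩, ht3⟩ := (((h.eventually_slice τ).and
      (Ioo_mem_nhdsLT (h1 ▸ hvA : A.time.left < τ))).and
      (Ioo_mem_nhdsLT (h2 ▸ hvB : B.time.left < τ))).exists
    have htA : t ∈ A.time.carrier := A.time.Ico_subset ⟨ht2.1.le, h1 ▸ ht2.2⟩
    exact ⟨t, hsub htA, htA, B.time.Ico_subset ⟨ht3.1.le, h2 ▸ ht3.2⟩, ht1⟩
  · linarith
  · linarith
  · have htA : τ ∈ A.time.carrier := A.time.Ico_subset ⟨h1.ge, by linarith⟩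
    exact ⟨τ, hsub htA, htA, B.time.Ico_subset ⟨h2.ge, by linarith⟩,
      fun D _ hD => subset_closure hD⟩

/-- A node of the simplices of a slice that is not a node of a touching simplex is in the interior
of a face containing the refinement edge of the latter. -/
lemma ends_pos_of_not_node (h : Good T Ω 𝓘 𝒯 s₁ s₂ P) (hr₂ : 2 ≤ r₂) {τ t : ℝ} {x : Sp d}
    (ht : t ∈ Icc 0 T) (hτ : ∀ A ∈ P, t ∈ A.time.carrier → τ ∈ closure A.time.carrier)
    (hx : ∀ A ∈ P, t ∈ A.time.carrier → x ∈ A.space.carrier → x ∈ spaceNodes r₂ A.space)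
    {B} (hB : B ∈ P) (hτB : τ ∈ closure B.time.carrier) (hxB : x ∈ B.space.carrier)
    (hxB' : x ∉ spaceNodes r₂ B.space) {w} (hw : IsBary B.space.verts x w) :
    ∀ v ∈ B.space.ends, w v ≠ 0 := by
  obtain ⟨A, hA, htA, hxA, hov⟩ := h.exists_overlap (h.adm hB) (h.space_subset hB) ht hxB
  have h1 := h.level_le_of_overlap hA hB ⟨τ, hτ A hA htA, hτB⟩ (by rwa [inter_comm])
  have h2 : ¬ A.level ≤ B.level := fun hle =>
    hxB' (h.space_node hr₂ hA hB hle (hx A hA htA hxA) hxB)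
  have h3 := h.triang.nested (by omega) (h.space B hB) (h.space A hA) hov
  rw [show A.level - B.level = 1 by omega, unif_succ, unif_zero, refineAll_singleton] at h3
  have h4 := (h.adm hB).ends_pos_of_new_node h3 hr₂ (hx A hA htA hxA) hxB' hw
  rintro v (rfl | rfl)
  · exact h4.1
  · exact h4.2

/-- If a node of a prism `A` is not a node of a temporally touching prism `B`, all prisms on the
side of `A` that contain it have one level more than `B`. -/
lemma level_eq_of_not_node (h : Good T Ω 𝓘 𝒯 s₁ s₂ P) (hr₂ : 2 ≤ r₂) {τ t : ℝ} {x : Sp d}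
    (ht : t ∈ Icc 0 T) (hτ : ∀ A ∈ P, t ∈ A.time.carrier → τ ∈ closure A.time.carrier)
    {A B} (hA : A ∈ P) (htA : t ∈ A.time.carrier) (hxA : x ∈ spaceNodes r₂ A.space)
    (hB : B ∈ P) (hτB : τ ∈ closure B.time.carrier) (hxB : x ∈ B.space.carrier)
    (hxB' : x ∉ spaceNodes r₂ B.space) {C} (hC : C ∈ P) (htC : t ∈ C.time.carrier)
    (hxC : x ∈ C.space.carrier) : C.level = B.level + 1 := by
  have hx : ∀ A ∈ P, t ∈ A.time.carrier → x ∈ A.space.carrier → x ∈ spaceNodes r₂ A.space :=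
    fun C hC htC hxC => (h.conf A hA C hC ⟨t, htA, htC⟩).node (h.adm hA).nondeg (h.adm hC).nondeg
      hr₂ hxA hxC
  obtain ⟨t', ht', htB', hτ'⟩ := h.exists_slice hB hτB
  obtain ⟨D, hD, htD, hxD, hov⟩ := h.exists_overlap (h.adm hC) (h.space_subset hC) ht' hxC
  have hBD := h.conf B hB D hD ⟨t', htB', htD⟩
  have hxD' : x ∉ spaceNodes r₂ D.space := fun hxD' =>
    hxB' (hBD.symm.node (h.adm hD).nondeg (h.adm hB).nondeg hr₂ hxD' hxB)
  have h1 := h.level_le_of_overlap hC hD ⟨τ, hτ C hC htC, hτ' D hD htD⟩ hov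
  have h2 : ¬ C.level ≤ D.level := fun hle =>
    hxD' (h.space_node hr₂ hC hD hle (hx C hC htC hxC) hxD)
  -- `B` and `D` contain each other's refinement edges
  obtain ⟨w, hw⟩ := mem_carrier_iff.1 hxB
  have hwD := hBD.isBary_right hw hxD
  have h3 := h.ends_pos_of_not_node hr₂ ht hτ hx hB hτB hxB hxB' hw
  have h4 := h.ends_pos_of_not_node hr₂ ht hτ hx hD (hτ' D hD htD) hxD hxD' hwD
  have h5 := h.triang.level_le_of_ends (h.space B hB) (h.space D hD)
    fun v hv => D.space.verts_subset_carrier (hwD.supp v (h3 v hv))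
  have h6 := h.triang.level_le_of_ends (h.space D hD) (h.space B hB)
    fun v hv => B.space.verts_subset_carrier (hw.supp v (h4 v hv))
  omega

/-- Time intervals that only touch have a common end point, which is a node. -/
lemma meet_of_not_timeNode (h : Good T Ω 𝓘 𝒯 s₁ s₂ P) (hr₁ : 2 ≤ r₁) {A B} (hA : A ∈ P)
    (hB : B ∈ P) {t : ℝ} (htA : t ∈ closure A.time.carrier) (htB : t ∈ closure B.time.carrier)
    (ht : t ∉ timeNodes r₁ B.time) : (A.time.carrier ∩ B.time.carrier).Nonempty := by
  by_contra hcon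
  rw [← not_disjoint_iff_nonempty_inter, not_not] at hcon
  rw [(h.valid hA).closure] at htA
  rw [(h.valid hB).closure] at htB
  rcases touch (h.valid hA) (h.valid hB) hcon htA htB with ⟨-, h1⟩ | ⟨-, h1⟩
  · exact ht (h1 ▸ B.time.left_node r₁)
  · exact ht (h1 ▸ B.time.right_node hr₁)

lemma mem_freeNodes {A : Prism d} (hA : A ∈ P) {ν : Pt d} (hν : ν ∈ nodes r₁ r₂ A)
    (hall : ∀ B ∈ P, ν ∈ closure B.carrier → ν ∈ nodes r₁ r₂ B) : ν ∈ freeNodes r₁ r₂ P :=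
  ⟨mem_iUnion₂.2 ⟨A, hA, hν⟩, fun ⟨B, hB, h1, h2⟩ => h2 (hall B hB h1)⟩

/-- A node in the interior of a longer time interval, without being a temporal node there, belongs
to a fibre of a prism all of whose temporal nodes are free. -/
lemma exists_free_fibre (h : Good T Ω 𝓘 𝒯 s₁ s₂ P) (hr₁ : 2 ≤ r₁) (hr₂ : 2 ≤ r₂) {E} (hE : E ∈ P)
    {t : ℝ} {x : Sp d} (hν : (t, x) ∈ nodes r₁ r₂ E)
    (hex : ∃ B ∈ P, (t, x) ∈ closure B.carrier ∧ t ∉ timeNodes r₁ B.time) :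
    ∃ A ∈ P, (t, x) ∈ closure A.carrier ∧ x ∈ spaceNodes r₂ A.space ∧
      ∀ s ∈ timeNodes r₁ A.time, (s, x) ∈ freeNodes r₁ r₂ P := by
  have hνE := (h.proper hE).nodes_subset hr₁ hr₂ hν
  -- among the prisms with `t` in the interior of a time interval, but not as a node, take the
  -- coarsest one
  obtain ⟨A, ⟨hA, hνA, htA⟩, hmin⟩ := Set.exists_min_image
    {B | B ∈ P ∧ (t, x) ∈ closure B.carrier ∧ t ∉ timeNodes r₁ B.time} Prism.level
    (h.finite.subset fun B hB => hB.1) hex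
  rw [closure_carrier] at hνA hνE
  have hEA := h.meet_of_not_timeNode hr₁ hE hA hνE.1 hνA.1 htA
  have hxA : x ∈ spaceNodes r₂ A.space := (h.conf E hE A hA hEA).node (h.adm hE).nondeg
    (h.adm hA).nondeg hr₂ hν.2 hνA.2
  refine ⟨A, hA, by rw [closure_carrier]; exact hνA, hxA, fun s hs => mem_freeNodes hA ⟨hs, hxA⟩ ?_⟩
  intro B hB hsB
  rw [closure_carrier] at hsB
  have hsA : s ∈ closure A.time.carrier := by
    rw [(h.valid hA).closure]; exact timeNodes_subset _ (h.valid hA) hr₁ hs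
  by_cases hdis : Disjoint A.time.carrier B.time.carrier
  · -- temporal neighbours: otherwise all prisms at the fibre would have the time interval of `A`
    have hsB' : s ∈ timeNodes r₁ B.time := by
      by_contra hcon
      exact (h.meet_of_not_timeNode hr₁ hA hB hsA hsB.1 hcon).not_disjoint hdis
    refine ⟨hsB', ?_⟩
    by_contra hxB
    obtain ⟨t₁, ht₁, ht₁A, hslice⟩ := h.exists_slice hA hsA
    have hlev : ∀ {C}, C ∈ P → t₁ ∈ C.time.carrier → x ∈ C.space.carrier → C.level = B.level + 1 :=
      fun hC htC hxC => h.level_eq_of_not_node hr₂ ht₁ hslice hA ht₁A hxA hB hsB.1 hsB.2 hxB hC htC hxC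
    obtain ⟨C, hC, htC, hxC, hov⟩ := h.exists_overlap (h.adm hE) (h.space_subset hE) ht₁ hνE.2
    have hCA : C.level = A.level := by rw [hlev hC htC hxC, hlev hA ht₁A hνA.2]
    have htime : C.time = A.time := by
      by_contra hne
      have h1 := h.time C hC
      rw [hCA] at h1
      exact Set.disjoint_left.1 ((h.grid.tunif _).disj _ h1 _ (h.time A hA) hne) htC ht₁A
    have hEC : E = C := by
      by_contra hne
      exact hov.not_disjoint (h.disj E hE C hC hne (by rwa [htime]))
    exact htA (htime ▸ hEC ▸ hν.1)
  · rw [not_disjoint_iff_nonempty_inter] at hdis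
    refine ⟨?_, (h.conf A hA B hB hdis).node (h.adm hA).nondeg (h.adm hB).nondeg hr₂ hxA hsB.2⟩
    by_contra hsB'
    have hlt : ¬ A.level ≤ B.level := fun hle => hsB' (h.time_node hr₁ hA hB hle hs hsB.1)
    have hsub := ((h.valid hB).iter (h.grid.mem_iter (h.levelMono (by omega : B.level ≤ A.level))
      (h.time B hB) (h.time A hA) (by rwa [inter_comm]))).2.1
    have htB : t ∉ timeNodes r₁ B.time := fun htB =>
      htA (h.time_node hr₁ hB hA (by omega) htB hνA.1)
    exact hlt (hmin B ⟨hB, by rw [closure_carrier]; exact ⟨closure_mono hsub hνA.1, hsB.2⟩, htB⟩)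

/-- A hanging node that is a temporal node of all prisms containing it lies in a prism `A` whose
nodes at this time are free or subject to `exists_free_fibre`, the latter only if `d ≠ 1`. -/
lemma exists_free_slice (h : Good T Ω 𝓘 𝒯 s₁ s₂ P) (hr₁ : 2 ≤ r₁) (hr₂ : 2 ≤ r₂) {E} (hE : E ∈ P)
    {t : ℝ} {x : Sp d} (hν : (t, x) ∈ nodes r₁ r₂ E) (hnf : (t, x) ∉ freeNodes r₁ r₂ P)
    (hall : ∀ B ∈ P, (t, x) ∈ closure B.carrier → t ∈ timeNodes r₁ B.time) :
    ∃ A ∈ P, (t, x) ∈ closure A.carrier ∧ t ∈ timeNodes r₁ A.time ∧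
      ∀ y ∈ spaceNodes r₂ A.space, (t, y) ∈ freeNodes r₁ r₂ P ∨
        (d ≠ 1 ∧ ∃ B ∈ P, (t, y) ∈ closure B.carrier ∧ t ∉ timeNodes r₁ B.time) := by
  have hνE := (h.proper hE).nodes_subset hr₁ hr₂ hν
  obtain ⟨A, hA, hνA, hnA⟩ : ∃ A ∈ P, (t, x) ∈ closure A.carrier ∧ (t, x) ∉ nodes r₁ r₂ A := by
    by_contra hcon
    push Not at hcon
    exact hnf (mem_freeNodes hE hν hcon)
  have htA := hall A hA hνA
  refine ⟨A, hA, hνA, htA, fun y hy => ?_⟩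
  rw [closure_carrier] at hνA hνE
  have hxA : x ∉ spaceNodes r₂ A.space := fun hx => hnA ⟨htA, hx⟩
  have hEA : Disjoint E.time.carrier A.time.carrier := by
    by_contra hcon
    rw [not_disjoint_iff_nonempty_inter] at hcon
    exact hxA ((h.conf E hE A hA hcon).node (h.adm hE).nondeg (h.adm hA).nondeg hr₂ hν.2 hνA.2)
  have hyA : y ∈ A.space.carrier := spaceNodes_subset (h.adm hA).nondeg hr₂ hy
  -- no prism of the slice of `E` that overlaps `A` at `y` can be as coarse as `A`, as it would
  -- contain `x`
  have hkey : ∀ {t₁ : ℝ}, t₁ ∈ Icc 0 T → t₁ ∈ E.time.carrier →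
      (∀ D ∈ P, t₁ ∈ D.time.carrier → t ∈ closure D.time.carrier) →
      ∃ C ∈ P, t₁ ∈ C.time.carrier ∧ y ∈ C.space.carrier ∧ A.level < C.level := by
    intro t₁ ht₁ ht₁E hslice
    obtain ⟨C, hC, htC, hyC, hov⟩ := h.exists_overlap (h.adm hA) (h.space_subset hA) ht₁ hyA
    refine ⟨C, hC, htC, hyC, ?_⟩
    by_contra hle
    push Not at hle
    have h1 := h.triang.nested hle (h.space C hC) (h.space A hA) (by rwa [inter_comm])
    have h2 := h.level_eq_of_not_node hr₂ ht₁ hslice hE ht₁E hν.2 hA hνA.1 hνA.2 hxA hC htC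
      ((h.adm hC).unif_subset h1 hνA.2)
    omega
  by_cases hfree : (t, y) ∈ freeNodes r₁ r₂ P
  · exact Or.inl hfree
  right
  have hhang : ∃ B ∈ P, (t, y) ∈ closure B.carrier ∧ t ∉ timeNodes r₁ B.time := by
    by_contra hcon
    push Not at hcon
    refine hfree (mem_freeNodes hA ⟨htA, hy⟩ fun B hB hyB => ⟨hcon B hB hyB, ?_⟩)
    by_contra hyB'
    rw [closure_carrier] at hyB
    have hBA : Disjoint B.time.carrier A.time.carrier := by
      by_contra hcon
      rw [not_disjoint_iff_nonempty_inter] at hcon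
      exact hyB' ((h.conf B hB A hA hcon).symm.node (h.adm hA).nondeg (h.adm hB).nondeg hr₂ hy hyB.2)
    obtain ⟨t₁, ht₁, ht₁E, ht₁B, hslice⟩ :=
      h.exists_common_slice hE hB hA hνE.1 hyB.1 hνA.1 hEA hBA
    obtain ⟨C, hC, htC, hyC, hlt⟩ := hkey ht₁ ht₁E hslice
    exact hyB' ((h.conf C hC B hB ⟨t₁, htC, ht₁B⟩).node (h.adm hC).nondeg (h.adm hB).nondeg hr₂
      (h.space_node hr₂ hA hC hlt.le hy hyC) hyB.2)
  refine ⟨fun hd => ?_, hhang⟩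
  -- in dimension one, a prism with `t` in the interior of its time interval is too coarse
  obtain ⟨B, hB, hyB, htB⟩ := hhang
  rw [closure_carrier] at hyB
  have hlt : ¬ A.level ≤ B.level := fun hle => htB (h.time_node hr₁ hA hB hle htA hyB.1)
  have hEB := h.meet_of_not_timeNode hr₁ hE hB hνE.1 hyB.1 htB
  have hlt' : ¬ E.level < B.level := by
    intro hle
    obtain ⟨t₁, ht₁, ht₁E, hslice⟩ := h.exists_slice hE hνE.1
    have := h.level_eq_of_not_node hr₂ ht₁ hslice hE ht₁E hν.2 hA hνA.1 hνA.2 hxA hE ht₁E hνE.2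
    omega
  have hsub := ((h.valid hB).iter (h.grid.mem_iter (h.levelMono (not_lt.1 hlt'))
      (h.time B hB) (h.time E hE) (by rwa [inter_comm]))).2.1
  obtain ⟨t₁, ht₁, ht₁E, hslice⟩ := h.exists_slice hE hνE.1
  obtain ⟨C, hC, htC, hyC, hltC⟩ := hkey ht₁ ht₁E hslice
  have := h.grad_space hd C hC B hB ⟨t₁, htC, hsub ht₁E⟩ ⟨y, hyC, hyB.2⟩
  omega

lemma mem_nbhd_succ {E A B : Prism d} {j : ℕ} (hA : A ∈ nbhd P E j) (hB : B ∈ P) {z : Pt d}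
    (hzA : z ∈ closure A.carrier) (hzB : z ∈ closure B.carrier) : B ∈ nbhd P E (j + 1) :=
  ⟨hB, A, hA, z, hzA, hzB⟩

/-- Finite elements are bounded by their values at free nodes nearby. Up to three interpolations, on
`E` itself, on a prism of the time slice, and on a prism whose fibre consists of free nodes, lead
from `z` to free nodes. Each costs a factor `Λ`; the last two move to a touching prism, and only one
of them is needed for `d = 1`. -/
lemma abs_le_of_freeNodes (h : Good T Ω 𝓘 𝒯 s₁ s₂ P) (hr₁ : 2 ≤ r₁) (hr₂ : 2 ≤ r₂) {Λ : ℝ}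
    (hΛ1 : 1 ≤ Λ)
    (hΛ : ∀ p ∈ refCube d, ∑ j ∈ nodeIdx d r₁ r₂, |refBasis r₁ r₂ j p| ≤ Λ) {F : Pt d → ℝ}
    (hF : F ∈ feSpace (spaceTimeCyl T Ω) P r₁ r₂) {E} (hE : E ∈ P) {M : ℝ} (hM : 0 ≤ M)
    (hfree : ∀ ν ∈ freeNodes r₁ r₂ P, (∃ A ∈ nbhd P E (nbhdDegree d - 1), ν ∈ closure A.carrier) →
      |F ν| ≤ M) {z : Pt d} (hz : z ∈ closure E.carrier) : |F z| ≤ Λ * (Λ * (Λ * M)) := by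
  have hmul : ∀ {a : ℝ}, 0 ≤ a → a ≤ Λ * a := fun ha => le_mul_of_one_le_left ha hΛ1
  have hM1 : M ≤ Λ * M := hmul hM
  have hM2 : Λ * M ≤ Λ * (Λ * M) := hmul (hM.trans hM1)
  -- the local bound
  have hloc : ∀ {A}, A ∈ P → ∀ {z}, z ∈ closure A.carrier → ∀ {m}, 0 ≤ m →
      (∀ ν, A.NodeFace r₁ r₂ z ν → |F ν| ≤ m) → |F z| ≤ Λ * m := by
    intro A hA z hz m hm hn
    obtain ⟨q, hq, hFq⟩ := h.feSpace_eqOn_closure hF hA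
    rw [hFq hz]
    refine (h.proper hA).abs_le_of_nodeFace hr₁ hr₂ hΛ hq hz hm fun ν hν => ?_
    rw [← hFq ((h.proper hA).nodes_subset hr₁ hr₂ hν.mem)]
    exact hn ν hν
  have hE0 : E ∈ nbhd P E 0 := rfl
  have hself : ∀ {A j}, A ∈ P → A ∈ nbhd P E j → A ∈ nbhd P E (j + 1) := fun {A j} hA hAj => by
    have hne : (closure A.carrier).Nonempty := by
      rw [closure_carrier, (h.valid hA).closure]
      exact ⟨(A.time.left, A.space.vert 0), ⟨le_rfl, le_of_lt (h.valid hA)⟩,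
        A.space.vert_mem_carrier 0⟩
    obtain ⟨z, hz⟩ := hne
    exact mem_nbhd_succ hAj hA hz hz
  have hd := h.triang.pos
  obtain ⟨k, hk⟩ : ∃ k, nbhdDegree d - 1 = k + 1 ∧ (d ≠ 1 → k = 1) := by
    by_cases hd1 : d = 1
    · exact ⟨0, by simp [nbhdDegree, hd1], fun h => absurd hd1 h⟩
    · exact ⟨1, by simp [nbhdDegree, hd1], fun _ => rfl⟩
  have hmono : ∀ {A}, A ∈ P → A ∈ nbhd P E 1 → A ∈ nbhd P E (k + 1) := fun {A} hA hA1 => by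
    by_cases hd1 : d = 1
    · have : k = 0 := by have := hk.1; simp [nbhdDegree, hd1] at this; omega
      rwa [this]
    · rw [hk.2 hd1]; exact hself hA hA1
  rw [hk.1] at hfree
  -- nodes in the interior of a longer time interval
  have hfibre : ∀ {A}, A ∈ P → A ∈ nbhd P E k → ∀ {t x}, (t, x) ∈ nodes r₁ r₂ A →
      (∃ B ∈ P, (t, x) ∈ closure B.carrier ∧ t ∉ timeNodes r₁ B.time) → |F (t, x)| ≤ Λ * M := by
    intro A hA hAk t x hν hex
    obtain ⟨B, hB, hνB, hxB, hBfree⟩ := h.exists_free_fibre hr₁ hr₂ hA hν hex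
    refine hloc hB hνB hM fun ν hν' => ?_
    have h1 := hν'.space hxB
    refine hfree ν ?_ ⟨B, mem_nbhd_succ hAk hB ((h.proper hA).nodes_subset hr₁ hr₂ hν) hνB,
      (h.proper hB).nodes_subset hr₁ hr₂ hν'.mem⟩
    have h2 := hBfree ν.1 hν'.mem.1
    have h3 : ν = (ν.1, x) := Prod.ext rfl h1
    rw [h3]
    exact h2
  have hE1 : E ∈ nbhd P E 1 := hself hE hE0
  have hEk : E ∈ nbhd P E k := by
    by_cases hd1 : d = 1
    · have : k = 0 := by have := hk.1; simp [nbhdDegree, hd1] at this; omega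
      rw [this]; exact hE0
    · rw [hk.2 hd1]; exact hE1
  refine hloc hE hz (hM.trans (hM1.trans hM2)) fun ν hν => ?_
  obtain ⟨t, x⟩ := ν
  have hcl := (h.proper hE).nodes_subset hr₁ hr₂ hν.mem
  by_cases hex : ∃ B ∈ P, (t, x) ∈ closure B.carrier ∧ t ∉ timeNodes r₁ B.time
  · exact (hfibre hE hEk hν.mem hex).trans hM2
  push Not at hex
  by_cases hfr : (t, x) ∈ freeNodes r₁ r₂ P
  · exact (hfree _ hfr ⟨E, hmono hE hE1, hcl⟩).trans (hM1.trans hM2)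
  obtain ⟨A, hA, hνA, htA, hAfree⟩ := h.exists_free_slice hr₁ hr₂ hE hν.mem hfr hex
  refine hloc hA hνA (hM.trans hM1) fun ν hν' => ?_
  obtain ⟨s, y⟩ := ν
  obtain rfl : s = t := hν'.time htA
  have hA1 : A ∈ nbhd P E 1 := mem_nbhd_succ hE0 hA hcl hνA
  rcases hAfree y hν'.mem.2 with h1 | ⟨hd1, h1⟩
  · exact (hfree _ h1 ⟨A, hmono hA hA1, (h.proper hA).nodes_subset hr₁ hr₂ hν'.mem⟩).trans hM1
  · exact hfibre hA (by rw [hk.2 hd1]; exact hA1) hν'.mem h1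

end Good

end

section
variable {d : ℕ}
open TaggedSimplex TimeInterval

/-! ### Norms of polynomials on a prism -/

/-- Shrinking a prism towards one of its points by a suitable factor `η`, the same for all prisms,
changes the Lagrange basis but little. -/
lemma exists_refBasis_modulus (d r₁ r₂ : ℕ) :
    ∃ η : ℝ, 0 < η ∧ η < 1 ∧ ∀ p ∈ refCube d, ∀ p' ∈ refCube d,
      ∑ j ∈ nodeIdx d r₁ r₂,
        |refBasis r₁ r₂ j (AffineMap.lineMap p p' η) - refBasis r₁ r₂ j p| < 1 / 2 := by
  have hcont : Continuous fun x : ℝ × ((ℝ × (Fin (d + 1) → ℝ)) × (ℝ × (Fin (d + 1) → ℝ))) =>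
      ∑ j ∈ nodeIdx d r₁ r₂,
        |refBasis r₁ r₂ j (AffineMap.lineMap x.2.1 x.2.2 x.1) - refBasis r₁ r₂ j x.2.1| := by
    refine continuous_finsetSum _ fun j _ => ?_
    simp only [AffineMap.lineMap_apply_module]
    have := continuous_refBasis r₁ r₂ j
    fun_prop
  have hev := ((isCompact_refCube d).prod (isCompact_refCube d)).eventually_forall_of_forall_eventually
    (x₀ := (0 : ℝ)) (P := fun η p => ∑ j ∈ nodeIdx d r₁ r₂,
      |refBasis r₁ r₂ j (AffineMap.lineMap p.1 p.2 η) - refBasis r₁ r₂ j p.1| < 1 / 2)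
    fun p _ => hcont.continuousAt.eventually_lt continuousAt_const (by simp)
  obtain ⟨η, h1, h2, h3⟩ := ((hev.filter_mono (nhdsWithin_le_nhds (s := Ioi 0))).and
    (Ioo_mem_nhdsGT (zero_lt_one' ℝ))).exists
  exact ⟨η, h2, h3, fun p hp p' hp' => h1 (p, p') ⟨hp, hp'⟩⟩

instance : (volume : Measure (Pt d)).IsAddHaarMeasure :=
  inferInstanceAs ((volume : Measure ℝ).prod (volume : Measure (Sp d))).IsAddHaarMeasure

namespace Prism
variable {E : Prism d} {r₁ r₂ : ℕ}

lemma convex_carrier (E : Prism d) : Convex ℝ E.carrier := by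
  refine Convex.prod ?_ (convex_convexHull ℝ _)
  unfold TimeInterval.carrier
  split_ifs
  · exact convex_Icc _ _
  · exact convex_Ico _ _

lemma Proper.isCompact_closure (h : E.Proper) : IsCompact (closure E.carrier) := by
  rw [h.closure_carrier]
  exact isCompact_Icc.prod E.space.isCompact_carrier

lemma Proper.volume_ne_top (h : E.Proper) : volume E.carrier ≠ ⊤ :=
  ((measure_mono subset_closure).trans_lt h.isCompact_closure.measure_lt_top).ne

lemma volume_interior (E : Prism d) : volume (interior E.carrier) = volume E.carrier :=
  measure_interior_of_null_frontier (E.convex_carrier.addHaar_frontier volume)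

lemma nullMeasurableSet_carrier (E : Prism d) : NullMeasurableSet E.carrier volume :=
  E.convex_carrier.nullMeasurableSet volume

lemma Proper.volume_ne_zero (h : E.Proper) : volume E.carrier ≠ 0 := by
  rw [carrier, Measure.volume_eq_prod, Measure.prod_prod, mul_ne_zero_iff]
  refine ⟨?_, h.nondeg.volume_pos.ne'⟩
  refine (lt_of_lt_of_le ?_ (measure_mono E.time.Ico_subset)).ne'
  rw [Real.volume_Ico, ENNReal.ofReal_pos]
  exact h.length_pos

lemma Proper.refCoord_homothety (h : E.Proper) (ν y : Pt d) (η : ℝ) :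
    h.refCoord (AffineMap.homothety ν η y) =
      AffineMap.lineMap (h.refCoord ν) (h.refCoord y) η := by
  have hl := h.length_pos.ne'
  rw [AffineMap.homothety_eq_lineMap]
  refine Prod.ext ?_ (funext fun i => ?_)
  · simp only [refCoord, AffineMap.lineMap_apply_module, Prod.fst_add, Prod.smul_fst, smul_eq_mul]
    field_simp
    ring
  · have := (h.nondeg.coord i).apply_lineMap ν.2 y.2 η
    simp only [refCoord]
    rw [AffineMap.lineMap_apply_module] at this ⊢
    simpa [AffineMap.lineMap_apply_module] using this

end Prism

/-- All norms of polynomials on a prism are equivalent, uniformly in the prism. The reason is that a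
polynomial is at least half its largest nodal value on a fixed fraction of the prism near that node.
This covers `ρ < 1`, where `L_ρ` is not normed, and `ρ = ∞`, where the exponents are `0`. -/
theorem exists_norm_bound (d r₁ r₂ : ℕ) (hr₁ : 2 ≤ r₁) (hr₂ : 2 ≤ r₂) {ρ : ℝ≥0∞} (hρ : ρ ≠ 0) :
    ∃ C : ℝ≥0∞, C ≠ ⊤ ∧ ∀ E : Prism d, E.Proper → ∀ q ∈ anisoPoly d r₁ r₂,
      ∀ z ∈ closure E.carrier, ‖q z‖ₑ * volume E.carrier ^ (1 / ρ.toReal) ≤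
        C * eLpNorm q ρ (volume.restrict E.carrier) := by
  obtain ⟨Λ, hΛ1, hΛ⟩ := exists_refBasis_bound d r₁ r₂
  obtain ⟨η, hη0, hη1, hη⟩ := exists_refBasis_modulus d r₁ r₂
  obtain ⟨a, ha⟩ : ∃ a, a = ENNReal.ofReal |η ^ Module.finrank ℝ (Pt d)| := ⟨_, rfl⟩
  have ha0 : a ≠ 0 := by rw [ha]; simp [hη0.ne']
  have hat : a ≠ ⊤ := by rw [ha]; exact ENNReal.ofReal_ne_top
  have hA0 : a ^ (1 / ρ.toReal) ≠ 0 := (ENNReal.rpow_pos (pos_iff_ne_zero.2 ha0) hat).ne'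
  have hAt : a ^ (1 / ρ.toReal) ≠ ⊤ := ENNReal.rpow_ne_top_of_nonneg (by positivity) hat
  refine ⟨ENNReal.ofReal (2 * Λ) * (a ^ (1 / ρ.toReal))⁻¹,
    ENNReal.mul_ne_top ENNReal.ofReal_ne_top (ENNReal.inv_ne_top.2 hA0), ?_⟩
  intro E h q hq z hz
  have hne : (nodeIdx d r₁ r₂).Nonempty :=
    ⟨(0, Pi.single 0 (r₂ - 1)), by rw [mem_nodeIdx]; exact ⟨by omega, by simp⟩⟩
  -- the node at which the polynomial is largest
  obtain ⟨j, hj, hmax⟩ := (nodeIdx d r₁ r₂).exists_max_image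
    (fun j => |q (nodePt r₁ r₂ E j)|) hne
  obtain ⟨ν, hν⟩ : ∃ ν, ν = nodePt r₁ r₂ E j := ⟨_, rfl⟩
  rw [← hν] at hmax
  have hνE : ν ∈ closure E.carrier := by
    refine h.nodes_subset hr₁ hr₂ ?_
    rw [nodes_eq r₁ r₂ hr₁, hν]
    exact mem_image_of_mem _ hj
  have hqz : |q z| ≤ Λ * |q ν| := by
    rw [h.expansion hr₁ hr₂ hq z]
    calc |∑ j ∈ nodeIdx d r₁ r₂, q (nodePt r₁ r₂ E j) * refBasis r₁ r₂ j (h.refCoord z)|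
        ≤ ∑ j ∈ nodeIdx d r₁ r₂, |q ν| * |refBasis r₁ r₂ j (h.refCoord z)| := by
          refine (Finset.abs_sum_le_sum_abs _ _).trans (Finset.sum_le_sum fun i hi => ?_)
          rw [abs_mul]
          exact mul_le_mul_of_nonneg_right (hmax i hi) (abs_nonneg _)
      _ ≤ Λ * |q ν| := by
          rw [← Finset.mul_sum, mul_comm]
          exact mul_le_mul_of_nonneg_right (hΛ _ (h.refCoord_mem hz)) (abs_nonneg _)
  -- the prism shrunk towards `ν`, where the polynomial stays close to its value at `ν`
  obtain ⟨H, hH⟩ : ∃ H, H = AffineMap.homothety ν η '' interior E.carrier := ⟨_, rfl⟩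
  have hHsub : H ⊆ interior E.carrier := by
    rw [hH]
    rintro _ ⟨y, hy, rfl⟩
    rw [AffineMap.homothety_eq_lineMap, AffineMap.lineMap_apply_module]
    exact E.convex_carrier.combo_closure_interior_mem_interior hνE hy (by linarith) hη0 (by ring)
  have hHo : IsOpen H := by
    rw [hH]
    exact AffineMap.homothety_isOpenMap ν η hη0.ne' _ isOpen_interior
  have hHvol : volume H = a * volume E.carrier := by
    rw [hH, Measure.addHaar_image_homothety, E.volume_interior, ha]
  have hlow : ∀ w ∈ H, |q ν| / 2 ≤ |q w| := by
    intro w hw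
    rw [hH] at hw
    obtain ⟨y, hy, rfl⟩ := hw
    have hdiff : |q ν - q (AffineMap.homothety ν η y)| ≤ |q ν| * (1 / 2) := by
      rw [abs_sub_comm, h.expansion hr₁ hr₂ hq (AffineMap.homothety ν η y)]
      nth_rewrite 1 [h.expansion hr₁ hr₂ hq ν]
      rw [← Finset.sum_sub_distrib, h.refCoord_homothety]
      calc _ ≤ ∑ j ∈ nodeIdx d r₁ r₂, |q ν| * |refBasis r₁ r₂ j
              (AffineMap.lineMap (h.refCoord ν) (h.refCoord y) η) -
                refBasis r₁ r₂ j (h.refCoord ν)| := by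
            refine (Finset.abs_sum_le_sum_abs _ _).trans (Finset.sum_le_sum fun i hi => ?_)
            rw [← mul_sub, abs_mul]
            exact mul_le_mul_of_nonneg_right (hmax i hi) (abs_nonneg _)
        _ ≤ |q ν| * (1 / 2) := by
            rw [← Finset.mul_sum]
            exact mul_le_mul_of_nonneg_left (hη _ (h.refCoord_mem hνE) _
              (h.refCoord_mem (subset_closure (interior_subset hy)))).le (abs_nonneg _)
    have := abs_sub_abs_le_abs_sub (q ν) (q (AffineMap.homothety ν η y))
    linarith
  have hnorm : ENNReal.ofReal (|q ν| / 2) * (a * volume E.carrier) ^ (1 / ρ.toReal) ≤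
      eLpNorm q ρ (volume.restrict E.carrier) := by
    have hmu : volume.restrict E.carrier H = a * volume E.carrier := by
      rw [Measure.restrict_apply hHo.measurableSet,
        inter_eq_left.2 (hHsub.trans interior_subset), hHvol]
    have hmu0 : volume.restrict E.carrier H ≠ 0 := by
      rw [hmu]; exact mul_ne_zero ha0 h.volume_ne_zero
    calc _ = eLpNorm (H.indicator fun _ => |q ν| / 2) ρ (volume.restrict E.carrier) := by
          rw [eLpNorm_indicator_const' hHo.measurableSet hmu0 hρ, hmu, Real.enorm_eq_ofReal (by positivity)]
      _ ≤ _ := by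
          refine eLpNorm_mono fun w => ?_
          by_cases hw : w ∈ H
          · rw [indicator_of_mem hw, Real.norm_eq_abs, abs_of_nonneg (by positivity)]
            exact hlow w hw
          · rw [indicator_of_notMem hw, norm_zero]
            exact norm_nonneg _
  calc ‖q z‖ₑ * volume E.carrier ^ (1 / ρ.toReal)
      ≤ ENNReal.ofReal (2 * Λ) * ENNReal.ofReal (|q ν| / 2) * volume E.carrier ^ (1 / ρ.toReal) := by
        gcongr
        rw [← ENNReal.ofReal_mul (by positivity), ← ofReal_norm, Real.norm_eq_abs]
        exact ENNReal.ofReal_le_ofReal (by linarith)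
    _ = ENNReal.ofReal (2 * Λ) * (a ^ (1 / ρ.toReal))⁻¹ *
        (ENNReal.ofReal (|q ν| / 2) * (a * volume E.carrier) ^ (1 / ρ.toReal)) := by
        rw [ENNReal.mul_rpow_of_nonneg _ _ (by positivity)]
        have := ENNReal.inv_mul_cancel hA0 hAt
        calc _ = ENNReal.ofReal (2 * Λ) * ENNReal.ofReal (|q ν| / 2) *
              volume E.carrier ^ (1 / ρ.toReal) *
              ((a ^ (1 / ρ.toReal))⁻¹ * a ^ (1 / ρ.toReal)) := by rw [this, mul_one]
          _ = _ := by ring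
    _ ≤ _ := by gcongr

/-! ### The dual basis -/

namespace Prism
variable {E : Prism d} {r₁ r₂ : ℕ}

lemma Proper.integrable (h : E.Proper) {u : Pt d → ℝ} (hu : Continuous u) :
    IntegrableOn u E.carrier :=
  (hu.continuousOn.integrableOn_compact h.isCompact_closure).mono_set subset_closure

/-- Evaluation at a point is represented by a polynomial, as the Gram form of the polynomials on a
prism is positive definite. -/
lemma Proper.exists_dual (h : E.Proper) (hr₁ : 2 ≤ r₁) (hr₂ : 2 ≤ r₂) (ν : Pt d) :
    ∃ ζ ∈ anisoPoly d r₁ r₂, ∀ q ∈ anisoPoly d r₁ r₂, ∫ z in E.carrier, q z * ζ z = q ν := by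
  have hint : ∀ q ζ : anisoPoly d r₁ r₂, IntegrableOn (fun z => q.1 z * ζ.1 z) E.carrier :=
    fun q ζ => h.integrable ((continuous_of_mem_anisoPoly q.2).mul (continuous_of_mem_anisoPoly ζ.2))
  let Φ : anisoPoly d r₁ r₂ →ₗ[ℝ] Module.Dual ℝ (anisoPoly d r₁ r₂) :=
    LinearMap.mk₂ ℝ (fun ζ q => ∫ z in E.carrier, q.1 z * ζ.1 z)
      (fun ζ ζ' q => by
        rw [← integral_add (hint _ _) (hint _ _)]
        exact integral_congr_ae (.of_forall fun z => mul_add _ _ _))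
      (fun c ζ q => by
        rw [smul_eq_mul, ← integral_const_mul]
        exact integral_congr_ae (.of_forall fun z => by simp; ring))
      (fun ζ q q' => by
        rw [← integral_add (hint _ _) (hint _ _)]
        exact integral_congr_ae (.of_forall fun z => add_mul _ _ _))
      (fun c ζ q => by
        rw [smul_eq_mul, ← integral_const_mul]
        exact integral_congr_ae (.of_forall fun z => by simp; ring))
  have hinj : Function.Injective Φ := by
    rw [injective_iff_map_eq_zero]
    intro q hq
    have h0 : ∫ z in E.carrier, q.1 z * q.1 z = 0 := by
      have := LinearMap.congr_fun hq q
      simpa [Φ] using this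
    rw [integral_eq_zero_iff_of_nonneg (fun z => mul_self_nonneg _) (hint q q)] at h0
    obtain ⟨C, -, hC⟩ := exists_norm_bound d r₁ r₂ hr₁ hr₂ (ρ := 1) one_ne_zero
    have h1 : eLpNorm q.1 1 (volume.restrict E.carrier) = 0 := by
      rw [eLpNorm_congr_ae (h0.mono fun z hz => by simpa using hz : q.1 =ᵐ[_] 0), eLpNorm_zero]
    refine Subtype.ext (h.eq_of_nodes hr₁ hr₂ q.2 (Submodule.zero_mem _) fun ν hν => ?_)
    have := hC E h q q.2 ν (h.nodes_subset hr₁ hr₂ hν)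
    rw [h1, mul_zero, nonpos_iff_eq_zero, mul_eq_zero] at this
    rcases this with h2 | h2
    · simpa using h2
    · simp [h.volume_ne_zero] at h2
  have hsurj : Function.Surjective Φ :=
    (LinearMap.injective_iff_surjective_of_finrank_eq_finrank
      Subspace.dual_finrank_eq.symm).1 hinj
  obtain ⟨ζ, hζ⟩ := hsurj
    { toFun := fun q => q.1 ν, map_add' := fun _ _ => rfl, map_smul' := fun _ _ => rfl }
  exact ⟨ζ, ζ.2, fun q hq => LinearMap.congr_fun hζ ⟨q, hq⟩⟩

open Classical in
lemma Proper.lagrangePoly_spec (h : E.Proper) (hr₁ : 2 ≤ r₁) (hr₂ : 2 ≤ r₂) (ν : Pt d) :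
    lagrangePoly r₁ r₂ E ν ∈ anisoPoly d r₁ r₂ ∧
      ∀ ν' ∈ nodes r₁ r₂ E, lagrangePoly r₁ r₂ E ν ν' = if ν' = ν then 1 else 0 := by
  obtain ⟨b, hb, hb'⟩ := h.exists_nodes hr₁ hr₂ fun ν' => if ν' = ν then 1 else 0
  unfold lagrangePoly
  exact Classical.epsilon_spec (p := fun b => b ∈ anisoPoly d r₁ r₂ ∧
    ∀ ν' ∈ nodes r₁ r₂ E, b ν' = if ν' = ν then 1 else 0) ⟨b, hb, hb'⟩

/-- Testing with the dual polynomial evaluates polynomials at the node. -/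
lemma Proper.integral_mul_dualPoly (h : E.Proper) (hr₁ : 2 ≤ r₁) (hr₂ : 2 ≤ r₂) {ν : Pt d}
    (hν : ν ∈ nodes r₁ r₂ E) {q : Pt d → ℝ} (hq : q ∈ anisoPoly d r₁ r₂) :
    ∫ z in E.carrier, q z * dualPoly r₁ r₂ E ν z = q ν := by
  classical
  obtain ⟨ζ, hζ, hζ'⟩ := h.exists_dual hr₁ hr₂ ν
  obtain ⟨h1, h2⟩ : dualPoly r₁ r₂ E ν ∈ anisoPoly d r₁ r₂ ∧ ∀ ν' ∈ nodes r₁ r₂ E,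
      ∫ z in E.carrier, lagrangePoly r₁ r₂ E ν' z * dualPoly r₁ r₂ E ν z =
        if ν' = ν then 1 else 0 := by
    unfold dualPoly
    refine Classical.epsilon_spec (p := fun ζ => ζ ∈ anisoPoly d r₁ r₂ ∧ ∀ ν' ∈ nodes r₁ r₂ E,
      ∫ z in E.carrier, lagrangePoly r₁ r₂ E ν' z * ζ z = if ν' = ν then 1 else 0)
      ⟨ζ, hζ, fun ν' hν' => ?_⟩
    rw [hζ' _ (h.lagrangePoly_spec hr₁ hr₂ ν').1, (h.lagrangePoly_spec hr₁ hr₂ ν').2 ν hν]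
    simp only [eq_comm]
  have hfin : (nodes r₁ r₂ E).Finite := by
    rw [nodes_eq r₁ r₂ hr₁]
    exact (Finset.finite_toSet _).image _
  have hexp : q = fun z => ∑ ν' ∈ hfin.toFinset, q ν' * lagrangePoly r₁ r₂ E ν' z := by
    refine h.eq_of_nodes hr₁ hr₂ hq ?_ fun x hx => ?_
    · have : (∑ ν' ∈ hfin.toFinset, q ν' • lagrangePoly r₁ r₂ E ν') ∈ anisoPoly d r₁ r₂ :=
        Submodule.sum_mem _ fun ν' _ =>
          Submodule.smul_mem _ _ (h.lagrangePoly_spec hr₁ hr₂ ν').1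
      convert this using 1
      ext z
      simp
    · rw [Finset.sum_eq_single x]
      · rw [(h.lagrangePoly_spec hr₁ hr₂ x).2 x hx, if_pos rfl, mul_one]
      · intro y _ hyx
        rw [(h.lagrangePoly_spec hr₁ hr₂ y).2 x hx, if_neg hyx.symm, mul_zero]
      · exact fun hcon => absurd (hfin.mem_toFinset.2 hx) hcon
  have hc := continuous_of_mem_anisoPoly h1
  calc ∫ z in E.carrier, q z * dualPoly r₁ r₂ E ν z
      = ∫ z in E.carrier, ∑ ν' ∈ hfin.toFinset,
          q ν' * (lagrangePoly r₁ r₂ E ν' z * dualPoly r₁ r₂ E ν z) := by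
        refine integral_congr_ae (.of_forall fun z => ?_)
        have := congrFun hexp z
        simp only at this ⊢
        rw [this, Finset.sum_mul]
        exact Finset.sum_congr rfl fun _ _ => mul_assoc _ _ _
    _ = ∑ ν' ∈ hfin.toFinset, q ν' * if ν' = ν then 1 else 0 := by
        rw [integral_finsetSum]
        · refine Finset.sum_congr rfl fun ν' hν' => ?_
          rw [integral_const_mul, h2 ν' (hfin.mem_toFinset.1 hν')]
        · intro ν' _
          exact h.integrable (((continuous_of_mem_anisoPoly
            (h.lagrangePoly_spec hr₁ hr₂ ν').1).mul hc).const_mul _)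
    _ = q ν := by
        simp [hν]

end Prism

end

section
variable {d : ℕ}
open TaggedSimplex TimeInterval

/-! ### The quasi-interpolant at the free nodes -/

namespace Good
variable {T : ℝ} {Ω : Set (Sp d)} {𝓘 : Set TimeInterval} {𝒯 : Set (TaggedSimplex d)} {s₁ s₂ : ℝ}
  {P : Set (Prism d)} {r₁ r₂ : ℕ}

/-- Almost everywhere on a prism, only this prism contributes to a piecewise defined function. -/
lemma finsum_indicator_ae (h : Good T Ω 𝓘 𝒯 s₁ s₂ P) (b : Prism d → Pt d → ℝ) {J} (hJ : J ∈ P) :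
    (fun z => ∑ᶠ E ∈ P, E.carrier.indicator (b E) z) =ᵐ[volume.restrict J.carrier] b J := by
  have hnull : volume (⋃ A ∈ P, frontier A.carrier) = 0 :=
    (measure_biUnion_null_iff h.finite.countable).2 fun A _ =>
      A.convex_carrier.addHaar_frontier volume
  have hae : ∀ᵐ z ∂volume.restrict J.carrier, z ∉ ⋃ A ∈ P, frontier A.carrier :=
    ae_restrict_of_ae (measure_eq_zero_iff_ae_notMem.1 hnull)
  filter_upwards [hae, ae_restrict_mem₀ J.nullMeasurableSet_carrier] with z hz hzJ
  have hint : ∀ A ∈ P, z ∈ A.carrier → z.2 ∈ interior A.space.carrier := by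
    intro A hA hzA
    have : z ∈ interior A.carrier := by
      by_contra hcon
      exact hz (mem_biUnion hA ⟨subset_closure hzA, hcon⟩)
    rw [Prism.carrier, interior_prod_eq] at this
    exact this.2
  rw [finsum_mem_eq_finite_toFinset_sum _ h.finite, Finset.sum_eq_single J]
  · exact indicator_of_mem hzJ _
  · intro A hA hAJ
    have hA' := h.finite.mem_toFinset.1 hA
    refine indicator_of_notMem (fun hzA => ?_) _
    exact disjoint_left.1 (h.disj A hA' J hJ hAJ ⟨z.1, hzA.1, hzJ.1⟩) (hint A hA' hzA)
      (hint J hJ hzJ)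
  · exact fun hcon => absurd (h.finite.mem_toFinset.2 hJ) hcon

lemma sum_mem_feSpace {D : Set (Pt d)} {ι : Type*} (s : Finset ι) (c : ι → ℝ) {φ : ι → Pt d → ℝ}
    (hφ : ∀ i ∈ s, φ i ∈ feSpace D P r₁ r₂) :
    (fun z => ∑ i ∈ s, c i * φ i z) ∈ feSpace D P r₁ r₂ := by
  classical
  refine ⟨continuousOn_finsetSum _ fun i hi => continuousOn_const.mul (hφ i hi).1,
    fun E hE => ?_⟩
  have hex : ∀ i, ∃ q ∈ anisoPoly d r₁ r₂, i ∈ s → EqOn (φ i) q E.carrier := by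
    intro i
    by_cases hi : i ∈ s
    · obtain ⟨q, hq, hq'⟩ := (hφ i hi).2 E hE
      exact ⟨q, hq, fun _ => hq'⟩
    · exact ⟨0, Submodule.zero_mem _, fun hcon => absurd hcon hi⟩
  choose q hq hq' using hex
  refine ⟨∑ i ∈ s, c i • q i, Submodule.sum_mem _ fun i _ => Submodule.smul_mem _ _ (hq i),
    fun z hz => ?_⟩
  simp only [Finset.sum_apply, Pi.smul_apply, smul_eq_mul]
  exact Finset.sum_congr rfl fun i hi => by rw [hq' i hi hz]

lemma sub_mem_feSpace {D : Set (Pt d)} {F q : Pt d → ℝ} (hF : F ∈ feSpace D P r₁ r₂)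
    (hq : q ∈ anisoPoly d r₁ r₂) : (fun z => F z - q z) ∈ feSpace D P r₁ r₂ := by
  refine ⟨hF.1.sub (continuous_of_mem_anisoPoly hq).continuousOn, fun E hE => ?_⟩
  obtain ⟨q', hq', hFq⟩ := hF.2 E hE
  exact ⟨q' - q, Submodule.sub_mem _ hq' hq, fun z hz => by simp [hFq hz]⟩

/-- The projection of a piecewise polynomial function is the finite element that takes over its
values on the assigned prisms at the free nodes. -/
lemma projQ_spec (h : Good T Ω 𝓘 𝒯 s₁ s₂ P) (hr₁ : 2 ≤ r₁) (hr₂ : 2 ≤ r₂) {J : Pt d → Prism d}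
    (hJ : ∀ ν ∈ freeNodes r₁ r₂ P, J ν ∈ P ∧ ν ∈ closure (J ν).carrier)
    {b : Prism d → Pt d → ℝ} (hb : ∀ E ∈ P, b E ∈ anisoPoly d r₁ r₂) {g : Pt d → ℝ}
    (hg : g = projQ (spaceTimeCyl T Ω) P r₁ r₂ J fun z => ∑ᶠ E ∈ P, E.carrier.indicator (b E) z) :
    g ∈ feSpace (spaceTimeCyl T Ω) P r₁ r₂ ∧ ∀ ν ∈ freeNodes r₁ r₂ P, g ν = b (J ν) ν := by
  have hfin := h.finite_freeNodes (r₂ := r₂) hr₁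
  have hval : ∀ ν ∈ freeNodes r₁ r₂ P, ∫ w in (J ν).carrier,
      (∑ᶠ E ∈ P, E.carrier.indicator (b E) w) * dualPoly r₁ r₂ (J ν) ν w = b (J ν) ν := by
    intro ν hν
    obtain ⟨h1, h2⟩ := hJ ν hν
    rw [← (h.proper h1).integral_mul_dualPoly hr₁ hr₂ (free_mem_nodes hν h1 h2) (hb _ h1)]
    exact integral_congr_ae ((h.finsum_indicator_ae b h1).mono fun z hz => by
      simp only at hz ⊢; rw [hz])
  have hsum : g = fun z => ∑ ν ∈ hfin.toFinset,
      b (J ν) ν * nodalBasis (spaceTimeCyl T Ω) P r₁ r₂ ν z := by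
    rw [hg]
    funext z
    rw [projQ, finsum_mem_eq_finite_toFinset_sum _ hfin]
    exact Finset.sum_congr rfl fun ν hν => by rw [hval ν (hfin.mem_toFinset.1 hν)]
  refine ⟨?_, fun ν hν => ?_⟩
  · rw [hsum]
    exact sum_mem_feSpace _ (fun ν => b (J ν) ν) fun ν _ => (h.nodalBasis_spec hr₁ hr₂ ν).1
  · rw [hsum]
    simp only
    rw [Finset.sum_eq_single ν]
    · rw [(h.nodalBasis_spec hr₁ hr₂ ν).2 ν hν, if_pos rfl, mul_one]
    · intro y _ hy
      rw [(h.nodalBasis_spec hr₁ hr₂ y).2 ν hν, if_neg hy.symm, mul_zero]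
    · exact fun hcon => absurd (hfin.mem_toFinset.2 hν) hcon

end Good

/-! ### Best approximations -/

open Filter Topology in
/-- Best approximations by polynomials exist: the polynomials of a minimizing sequence are bounded
at the nodes. -/
lemma Prism.Proper.exists_isBestApprox {E : Prism d} (h : E.Proper) {r₁ r₂ : ℕ} (hr₁ : 2 ≤ r₁)
    (hr₂ : 2 ≤ r₂) {ρ : ℝ≥0∞} (hρ : ρ ≠ 0) {f : Pt d → ℝ}
    (hf : MemLp f ρ (volume.restrict E.carrier)) :
    ∃ q, IsBestApprox r₁ r₂ ρ E.carrier f q := by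
  obtain ⟨m, hm⟩ : ∃ m, m = bestError r₁ r₂ ρ E.carrier f := ⟨_, rfl⟩
  have hmf : m ≤ eLpNorm f ρ (volume.restrict E.carrier) := by
    rw [hm]
    refine (iInf₂_le 0 (Submodule.zero_mem _)).trans (le_of_eq ?_)
    simp
  have hmt : m ≠ ⊤ := (hmf.trans_lt hf.2).ne
  have hseq : ∀ n : ℕ, ∃ q ∈ anisoPoly d r₁ r₂,
      eLpNorm (fun z => f z - q z) ρ (volume.restrict E.carrier) < m + ((n : ℝ≥0∞) + 1)⁻¹ := by
    intro n
    have hlt : m < m + ((n : ℝ≥0∞) + 1)⁻¹ :=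
      ENNReal.lt_add_right hmt (ENNReal.inv_ne_zero.2 (by finiteness))
    nth_rewrite 1 [hm] at hlt
    simp only [bestError, iInf_lt_iff] at hlt
    obtain ⟨q, hq, hlt⟩ := hlt
    exact ⟨q, hq, hlt⟩
  choose q hq hqlt using hseq
  have hqm : ∀ n, AEStronglyMeasurable (q n) (volume.restrict E.carrier) := fun n =>
    (continuous_of_mem_anisoPoly (hq n)).aestronglyMeasurable
  obtain ⟨C, hC, hCq⟩ := exists_norm_bound d r₁ r₂ hr₁ hr₂ hρ
  obtain ⟨V, hV⟩ : ∃ V, V = volume E.carrier ^ (1 / ρ.toReal) := ⟨_, rfl⟩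
  have hV0 : V ≠ 0 := by
    rw [hV]
    exact (ENNReal.rpow_pos (pos_iff_ne_zero.2 h.volume_ne_zero) h.volume_ne_top).ne'
  obtain ⟨R, hR⟩ : ∃ R, R = C * (ENNReal.LpAddConst ρ * (eLpNorm f ρ (volume.restrict E.carrier) + (m + 1))) :=
    ⟨_, rfl⟩
  have hRt : R ≠ ⊤ := by
    have h1 := hf.2.ne
    have h2 := (ENNReal.LpAddConst_lt_top ρ).ne
    rw [hR]
    finiteness
  have hbound : ∀ n, ∀ z ∈ closure E.carrier, ‖q n z‖ ≤ (R / V).toReal := by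
    intro n z hz
    have h1 : eLpNorm (q n) ρ (volume.restrict E.carrier) ≤
        ENNReal.LpAddConst ρ * (eLpNorm f ρ (volume.restrict E.carrier) + (m + 1)) := by
      have h2 := eLpNorm_sub_le' (p := ρ) hf.1 (hf.1.sub (hqm n))
      rw [sub_sub_cancel] at h2
      refine h2.trans ?_
      gcongr
      refine (hqlt n).le.trans ?_
      gcongr
      exact ENNReal.inv_le_one.2 (by simp)
    have h2 : ‖q n z‖ₑ ≤ R / V := by
      rw [ENNReal.le_div_iff_mul_le (Or.inl hV0) (Or.inr hRt), hV, hR]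
      exact (hCq E h (q n) (hq n) z hz).trans (by gcongr)
    rw [← toReal_enorm]
    exact ENNReal.toReal_mono (ENNReal.div_ne_top hRt hV0) h2
  -- the values at the nodes converge for a subsequence
  obtain ⟨x, -, φ, hφ, hx⟩ := tendsto_subseq_of_bounded
    (s := Metric.closedBall (0 : nodeIdx d r₁ r₂ → ℝ) (R / V).toReal)
    Metric.isBounded_closedBall (x := fun n j => q n (nodePt r₁ r₂ E j.1)) fun n => by
      rw [mem_closedBall_zero_iff, pi_norm_le_iff_of_nonneg ENNReal.toReal_nonneg]
      intro j
      refine hbound n _ (h.nodes_subset hr₁ hr₂ ?_)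
      rw [nodes_eq r₁ r₂ hr₁]
      exact mem_image_of_mem _ j.2
  obtain ⟨q₀, hq₀⟩ : ∃ q₀ : Pt d → ℝ, q₀ = ∑ j : nodeIdx d r₁ r₂,
      x j • fun z => refBasis r₁ r₂ j.1 (h.refCoord z) := ⟨_, rfl⟩
  have hq₀m : q₀ ∈ anisoPoly d r₁ r₂ := by
    rw [hq₀]
    exact Submodule.sum_mem _ fun j _ => Submodule.smul_mem _ _ (h.basis_mem hr₂ j.2)
  have hlim : ∀ z, Tendsto (fun n => f z - q (φ n) z) atTop (𝓝 (f z - q₀ z)) := by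
    intro z
    refine tendsto_const_nhds.sub ?_
    have h1 : ∀ n, q (φ n) z = ∑ j : nodeIdx d r₁ r₂, q (φ n) (nodePt r₁ r₂ E j.1) *
        refBasis r₁ r₂ j.1 (h.refCoord z) := fun n => by
      rw [h.expansion hr₁ hr₂ (hq (φ n)) z]
      exact (Finset.sum_coe_sort (nodeIdx d r₁ r₂) fun j => q (φ n) (nodePt r₁ r₂ E j) *
        refBasis r₁ r₂ j (h.refCoord z)).symm
    simp only [h1, hq₀, Finset.sum_apply, Pi.smul_apply, smul_eq_mul]
    exact tendsto_finsetSum _ fun j _ => ((tendsto_pi_nhds.1 hx) j).mul_const _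
  refine ⟨q₀, hq₀m, le_antisymm ?_ (iInf₂_le q₀ hq₀m)⟩
  rw [← hm]
  refine (Lp.eLpNorm_lim_le_liminf_eLpNorm (fun n => hf.1.sub (hqm (φ n))) _
    (.of_forall hlim)).trans ?_
  have h1 : Tendsto (fun n => m + (((φ n : ℕ) : ℝ≥0∞) + 1)⁻¹) atTop (𝓝 m) := by
    have h2 : Tendsto (fun n : ℕ => ((n : ℝ≥0∞) + 1)⁻¹) atTop (𝓝 0) := by
      have := (tendsto_add_atTop_iff_nat 1).2 ENNReal.tendsto_inv_nat_nhds_zero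
      simpa using this
    simpa using tendsto_const_nhds.add (h2.comp hφ.tendsto_atTop)
  rw [← h1.liminf_eq]
  exact liminf_le_liminf (.of_forall fun n => (hqlt (φ n)).le)

end

section
variable {d : ℕ}
open TaggedSimplex TimeInterval

/-! ### The error estimate -/

lemma nbhd_subset {P : Set (Prism d)} {E : Prism d} (hE : E ∈ P) : ∀ j, nbhd P E j ⊆ P
  | 0 => singleton_subset_iff.2 hE
  | _ + 1 => fun _ hA => hA.1

/-- Each step to a touching prism changes the volume by the factor `c` at most. -/
lemma volume_le_of_mem_nbhd {P : Set (Prism d)} {E : Prism d} (hE : E ∈ P) {c : ℝ≥0∞}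
    (hc : ∀ A ∈ P, ∀ B ∈ P, (closure A.carrier ∩ closure B.carrier).Nonempty →
      volume A.carrier ≤ c * volume B.carrier) :
    ∀ (j : ℕ), ∀ A ∈ nbhd P E j, volume E.carrier ≤ c ^ j * volume A.carrier
  | 0 => fun A hA => by rw [mem_singleton_iff.1 hA, pow_zero, one_mul]
  | j + 1 => fun A ⟨hA, B, hB, hBA⟩ => by
    calc volume E.carrier ≤ c ^ j * volume B.carrier := volume_le_of_mem_nbhd hE hc j B hB
      _ ≤ c ^ j * (c * volume A.carrier) := by
        gcongr
        exact hc B (nbhd_subset hE j hB) A hA hBA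
      _ = _ := by ring

namespace Good
variable {T : ℝ} {Ω : Set (Sp d)} {𝓘 : Set TimeInterval} {𝒯 : Set (TaggedSimplex d)} {s₁ s₂ : ℝ}
  {P : Set (Prism d)} {r₁ r₂ : ℕ}

lemma memLp_carrier (h : Good T Ω 𝓘 𝒯 s₁ s₂ P) {ρ : ℝ≥0∞} {f : Pt d → ℝ}
    (hf : MemLp f ρ (volume.restrict (spaceTimeCyl T Ω))) {E} (hE : E ∈ P) :
    MemLp f ρ (volume.restrict E.carrier) :=
  hf.mono_measure (Measure.restrict_mono (subset_closure.trans (h.closure_subset hE)) le_rfl)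

/-- Assigned prisms and best approximations can be chosen. -/
lemma exists_isQuasiInterpolant (h : Good T Ω 𝓘 𝒯 s₁ s₂ P) (hr₁ : 2 ≤ r₁) (hr₂ : 2 ≤ r₂)
    {ρ : ℝ≥0∞} (hρ : ρ ≠ 0) {f : Pt d → ℝ}
    (hf : MemLp f ρ (volume.restrict (spaceTimeCyl T Ω))) :
    ∃ g, IsQuasiInterpolant (spaceTimeCyl T Ω) P r₁ r₂ ρ f g := by
  have hJ : ∀ ν : Pt d, ∃ A : Prism d, ν ∈ freeNodes r₁ r₂ P → A ∈ P ∧ ν ∈ closure A.carrier := by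
    intro ν
    by_cases hν : ν ∈ freeNodes r₁ r₂ P
    · obtain ⟨A, hA, hνA⟩ := mem_iUnion₂.1 hν.1
      exact ⟨A, fun _ => ⟨hA, (h.proper hA).nodes_subset hr₁ hr₂ hνA⟩⟩
    · exact ⟨⟨⟨0, 0, false⟩, ⟨0, 0⟩, 0⟩, fun hcon => absurd hcon hν⟩
  have hb : ∀ E : Prism d, ∃ b, E ∈ P → IsBestApprox r₁ r₂ ρ E.carrier f b := by
    intro E
    by_cases hE : E ∈ P
    · obtain ⟨b, hb⟩ := (h.proper hE).exists_isBestApprox hr₁ hr₂ hρ (h.memLp_carrier hf hE)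
      exact ⟨b, fun _ => hb⟩
    · exact ⟨0, fun hcon => absurd hcon hE⟩
  choose J hJ using hJ
  choose b hb using hb
  exact ⟨_, J, b, hJ, hb, rfl⟩

/-- The values of a best approximation at a point of the prism differ from those of any other
polynomial by no more than the error of the latter, scaled by the volume of the prism. -/
lemma enorm_sub_mul_le_of_isBestApprox (h : Good T Ω 𝓘 𝒯 s₁ s₂ P) {p ρ : ℝ≥0∞} (hρp : ρ ≤ p)
    {f : Pt d → ℝ} (hf : MemLp f ρ (volume.restrict (spaceTimeCyl T Ω))) {C : ℝ≥0∞} {J}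
    (hJ : J ∈ P) (hC : ∀ q ∈ anisoPoly d r₁ r₂, ∀ z ∈ closure J.carrier,
      ‖q z‖ₑ * volume J.carrier ^ (1 / ρ.toReal) ≤ C * eLpNorm q ρ (volume.restrict J.carrier))
    {b q : Pt d → ℝ} (hb : IsBestApprox r₁ r₂ ρ J.carrier f b) (hq : q ∈ anisoPoly d r₁ r₂)
    {z : Pt d} (hz : z ∈ closure J.carrier) :
    ‖b z - q z‖ₑ * volume J.carrier ^ (1 / p.toReal) ≤
      C * (ENNReal.LpAddConst ρ * 2) *
        eLpNorm (fun z => f z - q z) p (volume.restrict J.carrier) := by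
  have hpr := h.proper hJ
  have hfJ := h.memLp_carrier hf hJ
  have hmq := (continuous_of_mem_anisoPoly hq).aestronglyMeasurable
    (μ := volume.restrict J.carrier)
  have hmb := (continuous_of_mem_anisoPoly hb.1).aestronglyMeasurable
    (μ := volume.restrict J.carrier)
  obtain ⟨Y, hY⟩ : ∃ Y, Y = eLpNorm (fun z => f z - q z) p (volume.restrict J.carrier) := ⟨_, rfl⟩
  obtain ⟨a, ha⟩ : ∃ a, a = 1 / ρ.toReal := ⟨_, rfl⟩
  obtain ⟨a', ha'⟩ : ∃ a', a' = 1 / p.toReal := ⟨_, rfl⟩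
  obtain ⟨V, hV⟩ : ∃ V, V = volume J.carrier := ⟨_, rfl⟩
  have hV0 : V ≠ 0 := by rw [hV]; exact hpr.volume_ne_zero
  have hVt : V ≠ ⊤ := by rw [hV]; exact hpr.volume_ne_top
  have h1 : eLpNorm (fun z => f z - q z) ρ (volume.restrict J.carrier) ≤ Y * V ^ (a - a') := by
    rw [hY, ha, ha', hV]
    have := eLpNorm_le_eLpNorm_mul_rpow_measure_univ hρp (hfJ.1.sub hmq)
    rwa [Measure.restrict_apply_univ] at this
  have h2 : eLpNorm (fun z => f z - b z) ρ (volume.restrict J.carrier) ≤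
      eLpNorm (fun z => f z - q z) ρ (volume.restrict J.carrier) := by
    rw [hb.2]
    exact iInf₂_le q hq
  have h3 : eLpNorm (b - q) ρ (volume.restrict J.carrier) ≤
      ENNReal.LpAddConst ρ * 2 * (Y * V ^ (a - a')) := by
    have := eLpNorm_sub_le' (p := ρ) (hfJ.1.sub hmq) (hfJ.1.sub hmb)
    rw [sub_sub_sub_cancel_left] at this
    refine this.trans ?_
    rw [mul_assoc]
    gcongr
    rw [two_mul]
    exact add_le_add h1 (h2.trans h1)
  have h4 := hC (b - q) (Submodule.sub_mem _ hb.1 hq) z hz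
  rw [← hV, ← ha, Pi.sub_apply] at h4
  rw [← hV, ← ha', ← hY]
  have hW0 : V ^ (a - a') ≠ 0 := (ENNReal.rpow_pos (pos_iff_ne_zero.2 hV0) hVt).ne'
  have hWt : V ^ (a - a') ≠ ⊤ := ENNReal.rpow_ne_top_of_ne_zero hV0 hVt
  rw [← ENNReal.mul_le_mul_iff_left hW0 hWt, mul_assoc, ← ENNReal.rpow_add _ _ hV0 hVt,
    add_sub_cancel]
  calc _ ≤ _ := h4
    _ ≤ C * (ENNReal.LpAddConst ρ * 2 * (Y * V ^ (a - a'))) := by gcongr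
    _ = _ := by ring

/-- The error of the quasi-interpolant on a prism, compared with that of a single polynomial on its
neighbourhood. -/
lemma eLpNorm_sub_le_of_isQuasiInterpolant (h : Good T Ω 𝓘 𝒯 s₁ s₂ P) (hr₁ : 2 ≤ r₁)
    (hr₂ : 2 ≤ r₂) {p ρ : ℝ≥0∞} (hρp : ρ ≤ p) {Λ : ℝ} (hΛ1 : 1 ≤ Λ)
    (hΛ : ∀ p ∈ refCube d, ∑ j ∈ nodeIdx d r₁ r₂, |refBasis r₁ r₂ j p| ≤ Λ) {C c : ℝ≥0∞}
    (hC : ∀ J : Prism d, J.Proper → ∀ q ∈ anisoPoly d r₁ r₂, ∀ z ∈ closure J.carrier,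
      ‖q z‖ₑ * volume J.carrier ^ (1 / ρ.toReal) ≤ C * eLpNorm q ρ (volume.restrict J.carrier))
    (hCt : C ≠ ⊤) (hct : c ≠ ⊤)
    (hc : ∀ A ∈ P, ∀ B ∈ P, (closure A.carrier ∩ closure B.carrier).Nonempty →
      volume A.carrier ≤ c * volume B.carrier) {f g : Pt d → ℝ}
    (hf : MemLp f ρ (volume.restrict (spaceTimeCyl T Ω)))
    (hg : IsQuasiInterpolant (spaceTimeCyl T Ω) P r₁ r₂ ρ f g) {q : Pt d → ℝ}
    (hq : q ∈ anisoPoly d r₁ r₂) {E} (hE : E ∈ P) :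
    eLpNorm (fun z => f z - g z) p (volume.restrict E.carrier) ≤
      (ENNReal.LpAddConst p * (1 + ENNReal.ofReal (Λ * (Λ * Λ)) *
        ((c ^ nbhdDegree d) ^ (1 / p.toReal) * (C * (ENNReal.LpAddConst ρ * 2)))) + 1) *
        eLpNorm (fun z => f z - q z) p (volume.restrict (nbhdRegion P E (nbhdDegree d))) := by
  obtain ⟨J, b, hJ, hb, hgdef⟩ := hg
  obtain ⟨hgV, hgν⟩ := h.projQ_spec hr₁ hr₂ hJ (fun A hA => (hb A hA).1) hgdef
  obtain ⟨X, hX⟩ : ∃ X, X = eLpNorm (fun z => f z - q z) p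
    (volume.restrict (nbhdRegion P E (nbhdDegree d))) := ⟨_, rfl⟩
  obtain ⟨K, hK⟩ : ∃ K, K = (c ^ nbhdDegree d) ^ (1 / p.toReal) * (C * (ENNReal.LpAddConst ρ * 2)) :=
    ⟨_, rfl⟩
  rw [← hX, ← hK]
  -- the added `1` makes the constant nonzero, which settles the case of infinite error
  by_cases hXt : X = ⊤
  · rw [hXt, ENNReal.mul_top (by simp)]
    exact le_top
  have hpE := h.proper hE
  have hdeg : nbhdDegree d - 1 + 1 = nbhdDegree d := by
    unfold nbhdDegree; split_ifs <;> rfl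
  have hXA : ∀ A ∈ nbhd P E (nbhdDegree d),
      eLpNorm (fun z => f z - q z) p (volume.restrict A.carrier) ≤ X := by
    intro A hA
    rw [hX]
    exact eLpNorm_mono_measure _ (Measure.restrict_mono (subset_biUnion_of_mem
      (u := fun A : Prism d => A.carrier) hA) le_rfl)
  obtain ⟨W, hW⟩ : ∃ W, W = volume E.carrier ^ (1 / p.toReal) := ⟨_, rfl⟩
  have hW0 : W ≠ 0 := by
    rw [hW]
    exact (ENNReal.rpow_pos (pos_iff_ne_zero.2 hpE.volume_ne_zero) hpE.volume_ne_top).ne'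
  have hWt : W ≠ ⊤ := by
    rw [hW]
    exact ENNReal.rpow_ne_top_of_nonneg (by positivity) hpE.volume_ne_top
  have hKt : K ≠ ⊤ := by
    rw [hK]
    exact ENNReal.mul_ne_top (ENNReal.rpow_ne_top_of_nonneg (by positivity)
      (ENNReal.pow_ne_top hct)) (ENNReal.mul_ne_top hCt
        (ENNReal.mul_ne_top (ENNReal.LpAddConst_lt_top ρ).ne (by simp)))
  have hKXt : K * X / W ≠ ⊤ := ENNReal.div_ne_top (ENNReal.mul_ne_top hKt hXt) hW0
  -- the difference of the quasi-interpolant and the polynomial at the free nodes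
  have hfree : ∀ ν ∈ freeNodes r₁ r₂ P,
      (∃ A ∈ nbhd P E (nbhdDegree d - 1), ν ∈ closure A.carrier) →
      |g ν - q ν| ≤ (K * X / W).toReal := by
    rintro ν hν ⟨A, hA, hνA⟩
    obtain ⟨hJP, hJν⟩ := hJ ν hν
    have hJE : J ν ∈ nbhd P E (nbhdDegree d) := by
      rw [← hdeg]
      exact ⟨hJP, A, hA, ν, hνA, hJν⟩
    rw [← Real.norm_eq_abs, ← toReal_enorm]
    refine ENNReal.toReal_mono hKXt ?_
    rw [ENNReal.le_div_iff_mul_le (Or.inl hW0) (Or.inl hWt), hgν ν hν, hK, hW]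
    have h1 := h.enorm_sub_mul_le_of_isBestApprox hρp hf hJP (hC _ (h.proper hJP)) (hb _ hJP) hq hJν
    calc ‖b (J ν) ν - q ν‖ₑ * volume E.carrier ^ (1 / p.toReal)
        ≤ ‖b (J ν) ν - q ν‖ₑ *
          ((c ^ nbhdDegree d) ^ (1 / p.toReal) * volume (J ν).carrier ^ (1 / p.toReal)) := by
          rw [← ENNReal.mul_rpow_of_nonneg _ _ (by positivity)]
          gcongr
          exact volume_le_of_mem_nbhd hE hc _ _ hJE
      _ = (c ^ nbhdDegree d) ^ (1 / p.toReal) *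
          (‖b (J ν) ν - q ν‖ₑ * volume (J ν).carrier ^ (1 / p.toReal)) := by ring
      _ ≤ (c ^ nbhdDegree d) ^ (1 / p.toReal) * (C * (ENNReal.LpAddConst ρ * 2) * X) := by
          exact mul_le_mul_right (h1.trans (mul_le_mul_right (hXA _ hJE) _)) _
      _ = _ := by ring
  have hbd : ∀ z ∈ closure E.carrier, |g z - q z| ≤ Λ * (Λ * (Λ * (K * X / W).toReal)) :=
    fun z hz => h.abs_le_of_freeNodes hr₁ hr₂ hΛ1 hΛ (sub_mem_feSpace hgV hq) hE
      ENNReal.toReal_nonneg hfree hz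
  have hnorm : eLpNorm (fun z => g z - q z) p (volume.restrict E.carrier) ≤
      ENNReal.ofReal (Λ * (Λ * Λ)) * K * X := by
    have h1 : ∀ᵐ z ∂volume.restrict E.carrier, ‖g z - q z‖ ≤ Λ * (Λ * (Λ * (K * X / W).toReal)) := by
      filter_upwards [ae_restrict_mem₀ E.nullMeasurableSet_carrier] with z hz
      exact hbd z (subset_closure hz)
    refine (eLpNorm_le_of_ae_bound h1).trans (le_of_eq ?_)
    rw [Measure.restrict_apply_univ, ← one_div, ← hW,
      show Λ * (Λ * (Λ * (K * X / W).toReal)) = Λ * (Λ * Λ) * (K * X / W).toReal by ring,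
      ENNReal.ofReal_mul (by positivity), ENNReal.ofReal_toReal hKXt, mul_left_comm,
      ENNReal.mul_div_cancel hW0 hWt, mul_assoc]
  have hfE := h.memLp_carrier hf hE
  have hmq := (continuous_of_mem_anisoPoly hq).aestronglyMeasurable
    (μ := volume.restrict E.carrier)
  have hmg : AEStronglyMeasurable g (volume.restrict E.carrier) := by
    obtain ⟨q', hq', hgq⟩ := hgV.2 E hE
    refine (continuous_of_mem_anisoPoly hq').aestronglyMeasurable.congr ?_
    filter_upwards [ae_restrict_mem₀ E.nullMeasurableSet_carrier] with z hz
    exact (hgq hz).symm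
  have hEE : E ∈ nbhd P E (nbhdDegree d) := by
    have hstep : ∀ j, E ∈ nbhd P E j := by
      intro j
      induction j with
      | zero => exact mem_singleton E
      | succ j ih =>
        have hne : (closure E.carrier).Nonempty :=
          (nonempty_of_measure_ne_zero hpE.volume_ne_zero).closure
        exact ⟨hE, E, ih, by rwa [inter_self]⟩
    exact hstep _
  have htri := eLpNorm_sub_le' (p := p) (hfE.1.sub hmq) (hmg.sub hmq)
  rw [sub_sub_sub_cancel_right] at htri
  calc eLpNorm (fun z => f z - g z) p (volume.restrict E.carrier)
      ≤ ENNReal.LpAddConst p * (X + ENNReal.ofReal (Λ * (Λ * Λ)) * K * X) :=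
        htri.trans (by gcongr; exacts [hXA E hEE, hnorm])
    _ = ENNReal.LpAddConst p * (1 + ENNReal.ofReal (Λ * (Λ * Λ)) * K) * X := by ring
    _ ≤ _ := by gcongr; exact le_self_add

end Good

end

end PrismMesh

end

theorem mainTheorem7 (d : ℕ) (hd : 1 ≤ d) (p ρ : ℝ≥0∞) (hρ : 0 < ρ) (hρp : ρ ≤ p)
    (s₁ s₂ : ℝ) (hs₁ : 0 < s₁) (hs₂ : 0 < s₂) (r₁ r₂ : ℕ) (hr₁ : 2 ≤ r₁) (hr₂ : 2 ≤ r₂)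
    (κ μ₁ μ₂ μ₃ μ₄ : ℝ) :
    ∃ C : ℝ≥0, ∀ (T : ℝ) (Ω : Set (Sp d)), 0 < T → IsLipschitzDomain Ω →
      ∀ M : InitialMesh d T Ω, shapeConst M.prisms = κ →
        maxTime M.prisms = μ₁ → minTime M.prisms = μ₂ →
        maxSpace M.prisms = μ₃ → minSpace M.prisms = μ₄ →
      ∀ P : Set (Prism d), Reachable s₁ s₂ M.prisms P →
      ∀ f : Pt d → ℝ, MemLp f ρ (volume.restrict (spaceTimeCyl T Ω)) →
        (∃ g, IsQuasiInterpolant (spaceTimeCyl T Ω) P r₁ r₂ ρ f g) ∧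
        ∀ g, IsQuasiInterpolant (spaceTimeCyl T Ω) P r₁ r₂ ρ f g →
          g ∈ feSpace (spaceTimeCyl T Ω) P r₁ r₂ ∧
          ∀ E ∈ P, eLpNorm (fun z => f z - g z) p (volume.restrict E.carrier) ≤
            (C : ℝ≥0∞) * bestError r₁ r₂ p (nbhdRegion P E (nbhdDegree d)) f := by
  obtain ⟨Λ, hΛ1, hΛ⟩ := exists_refBasis_bound d r₁ r₂
  obtain ⟨C, hCt, hC⟩ := exists_norm_bound d r₁ r₂ hr₁ hr₂ hρ.ne'
  obtain ⟨c, -, hc⟩ := exists_volume_const hd s₁ s₂ hs₁ hs₂ κ μ₁ μ₂ μ₃ μ₄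
  obtain ⟨K, hK⟩ : ∃ K, K = ENNReal.LpAddConst p * (1 + ENNReal.ofReal (Λ * (Λ * Λ)) *
      ((ENNReal.ofReal c ^ nbhdDegree d) ^ (1 / p.toReal) *
        (C * (ENNReal.LpAddConst ρ * 2)))) + 1 := ⟨_, rfl⟩
  have hKt : K ≠ ⊤ := by
    have h1 := (ENNReal.LpAddConst_lt_top p).ne
    have h2 := (ENNReal.LpAddConst_lt_top ρ).ne
    have h3 : (ENNReal.ofReal c ^ nbhdDegree d) ^ (1 / p.toReal) ≠ ⊤ :=
      ENNReal.rpow_ne_top_of_nonneg (by positivity) (ENNReal.pow_ne_top ENNReal.ofReal_ne_top)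
    rw [hK]
    finiteness
  have hK0 : K ≠ 0 := by rw [hK]; simp
  refine ⟨K.toNNReal, fun T Ω hT hΩ M hκ h₁ h₂ h₃ h₄ P hP f hf => ?_⟩
  have h := Good.of_reachable M hd hT hΩ hs₁ hs₂ hP
  refine ⟨h.exists_isQuasiInterpolant hr₁ hr₂ hρ.ne' hf, fun g hg => ⟨?_, fun E hE => ?_⟩⟩
  · obtain ⟨J, b, hJ, hb, hgdef⟩ := hg
    exact (h.projQ_spec hr₁ hr₂ hJ (fun A hA => (hb A hA).1) hgdef).1
  rw [ENNReal.coe_toNNReal hKt]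
  have hvol : ∀ A ∈ P, ∀ B ∈ P, (closure A.carrier ∩ closure B.carrier).Nonempty →
      volume A.carrier ≤ ENNReal.ofReal c * volume B.carrier := by
    intro A hA B hB hAB
    have h5 := hc T Ω hT hΩ M hκ h₁ h₂ h₃ h₄ P hP A hA B hB hAB
    rw [← ENNReal.ofReal_toReal (h.proper hA).volume_ne_top,
      ← ENNReal.ofReal_toReal (h.proper hB).volume_ne_top, ← ENNReal.ofReal_mul' ENNReal.toReal_nonneg]
    exact ENNReal.ofReal_le_ofReal h5
  -- divide by the constant, to pass to the infimum over all polynomials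
  rw [mul_comm, ← ENNReal.div_le_iff_le_mul (Or.inl hK0) (Or.inl hKt)]
  refine le_iInf₂ fun q hq => ?_
  rw [ENNReal.div_le_iff_le_mul (Or.inl hK0) (Or.inl hKt), mul_comm, hK]
  exact h.eLpNorm_sub_le_of_isQuasiInterpolant hr₁ hr₂ hρp hΛ1 hΛ hC hCt ENNReal.ofReal_ne_top
    hvol hf hg hq hE
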